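/- Throughout, $k$ is an algebraically closed field of characteristic $0$ and all algebras and vector spaces are finite dimensional over $k$; $\otimes=\otimes_k$. **Definitions.** A Lie-Yamaguti algebra (LY-algebra) is a vector space $\mathfrak m$ with a bilinear product $x\cdot y$ and a trilinear product $[x,y,z]$ such that, with $\sum_{(x,y,z)}$ denoting cyclic sums: $x\cdot x=0$; $[x,x,y]=0$; $\sum_{(x,y,z)}([x,y,z]+(x\cdot y)\cdot z)=0$; $\sum_{(x,y,z)}[x\cdot y,z,t]=0$; $[x,y,u\cdot v]=[x,y,u]\cdot v+u\cdot[x,y,v]$; $[x,y,[u,v,w]]=[[x,y,u],v,w]+[u,[x,y,v],w]+[u,v,[x,y,w]]$. Its inner derivation algebra $D(\mathfrak m,\mathfrak m)$ is the Lie algebra spanned by the maps $D(x,y)=[x,y,-]$, and its standard enveloping Lie algebra is $\mathfrak g(\mathfrak m)=D(\mathfrak m,\mathfrak m)\oplus\mathfrak m$, where $D(\mathfrak m,\mathfrak m)$ has the commutator bracket, $[d,z]=d(z)$ and $[z,t]=D(z,t)+z\cdot t$. The LY-algebra $\mathfrak m$ is irreducible if it is an irreducible $D(\mathfrak m,\mathfrak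 m)$-module, and an irreducible one is of non-simple type if $D(\mathfrak m,\mathfrak m)$ is not simple. A Lie algebra is classical if it is isomorphic to $\mathfrak{sl}_n(k)$ ($n\ge2$), $\mathfrak{so}_n(k)$ ($n\ge 3$) or $\mathfrak{sp}_{2n}(k)$ ($n\ge1$). For an $\epsilon$-symmetric bilinear form $\varphi$ on $V$ ($\epsilon=\pm1$) put $\varphi_{v,w}=\varphi(v,-)w-\epsilon\varphi(w,-)v$; let $\mathfrak{so}(V)$, resp. $\mathfrak{sp}(V)$, be the Lie algebra of $\varphi$-skew endomorphisms if $\epsilon=1$, resp. $\epsilon=-1$; let $\mathfrak{sym}(V,\varphi)$ be the Jordan algebra of $\varphi$-symmetric endomorphisms with product $\frac12(fg+gf)$, and $\mathfrak{sym}_0(V,\varphi)$ its subspace of trace zero elements. Let $Q=\mathrm{Mat}_2(k)$ be the split quaternion algebra with involution $\bar q=\mathrm{tr}(q)1-q$, and let $H_n(k)$, $H_n(Q)$ be the Jordan algebras of symmetric $n\times n$ matrices over $k$ and of hermitian $n\times n$ matrices over $Q$, with product $\frac12(xy+yx)$. Given unital algebras $X,Y$ with normalized traces $t$ ($t(1)=1$),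 trace zero subspaces $X_0,Y_0$, products $x*x'=xx'-t(xx')1$ on $X_0$ and similarly $y\star y'$ on $Y_0$, and derivations $D_{x,x'}$ of $X$ ($x,x'\in X_0$) and $d_{y,y'}$ of $Y$ ($y,y'\in Y_0$), the Tits construction is $\mathcal T(X,Y)=D_{X_0,X_0}\oplus(X_0\otimes Y_0)\oplus d_{Y_0,Y_0}$, with commuting subalgebras $D_{X_0,X_0}=\mathrm{span}\{D_{x,x'}\}$ and $d_{Y_0,Y_0}=\mathrm{span}\{d_{y,y'}\}$ acting naturally on $X_0\otimes Y_0$ and $[x\otimes y,x'\otimes y']=t(yy')D_{x,x'}+(x*x')\otimes(y\star y')+t(xx')d_{y,y'}$. When this is a Lie algebra, the LY-algebra inside $\mathcal T(X,Y)$ is $X_0\otimes Y_0$ with products $u\cdot v$ and $[u,v,w]=[[u,v]_{\mathfrak h},w]$, where $u\cdot v$ and $[u,v]_{\mathfrak h}$ are the components of $[u,v]$ in $X_0\otimes Y_0$ and in $\mathfrak h=D_{X_0,X_0}\oplus d_{Y_0,Y_0}$. The following ingredients are used: for an $\epsilon$-symmetric form $\varphi$ on $V$, the Jordan algebra ($\epsilon=1$)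 or Jordan superalgebra with even part $k1$ and odd part $V$ ($\epsilon=-1$) $\mathcal J(V)=k1\oplus V$ with $(\alpha1+v)(\beta1+w)=(\alpha\beta+\varphi(v,w))1+\alpha w+\beta v$, $t(\alpha1+v)=\alpha$, $D_{v,w}=\varphi_{v,w}$ on $V$ and $D_{v,w}(1)=0$; the algebra $Q$ with $t=\frac12\mathrm{tr}$ and $D_{a,b}=\frac14[[a,b],-]$; the Jordan algebras $H_n(k)$ with $t(x)=\frac1n\sum_i x_{ii}$ and $H_n(Q)$ with $t(x)=\frac1n\sum_i\frac12\mathrm{tr}(x_{ii})$, both with $d_{x,y}=[R_x,R_y]$, where $R_x$ is multiplication by $x$. **Theorem.** Let $(\mathfrak m,x\cdot y,[x,y,z])$ be an irreducible LY-algebra of non-simple type whose standard enveloping Lie algebra is simple and classical. Then, up to isomorphism of LY-algebras, one of the following holds. (i) $\mathfrak m=\mathfrak{sl}(V_1)\otimes\mathfrak{sl}(V_2)$ for vector spaces $V_1,V_2$ of dimensions $n_1,n_2$ with $2\le n_1\le n_2$, $(n_1,n_2)\ne(2,2)$, and $$(a\otimes f)\cdot(b\otimes g)=\tfrac12[a,b]\otimes\bigl(fg+gf-\tfrac2{n_2}\mathrm{tr}(fg)1\bigr)+\bigl(ab+ba-\tfrac2{n_1}\mathrm{tr}(ab)1\bigr)\otimes\tfrac12[f,g],$$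 $$[a\otimes f,b\otimes g,c\otimes h]=[[a,b],c]\otimes\tfrac1{n_2}\mathrm{tr}(fg)h+\tfrac1{n_1}\mathrm{tr}(ab)c\otimes[[f,g],h].$$ There is an isomorphism $\mathfrak g(\mathfrak m)\cong\mathfrak{sl}(V_1\otimes V_2)$ which sends $a\otimes f\in\mathfrak m$ to the endomorphism $a\otimes f$ and restricts to an isomorphism of $D(\mathfrak m,\mathfrak m)$ with $\mathfrak{sl}(V_1)\oplus\mathfrak{sl}(V_2)$, where $(a,f)$ corresponds to $a\otimes1+1\otimes f$. (ii) $\mathfrak m=V_1\otimes V_2$ for vector spaces $V_i$ with nondegenerate symmetric bilinear forms $\varphi_i$, $3\le\dim V_1\le\dim V_2$, with $x\cdot y=0$ and $$[x_1\otimes x_2,y_1\otimes y_2,z_1\otimes z_2]=\varphi_2(x_2,y_2)\,(\varphi_1)_{x_1,y_1}(z_1)\otimes z_2+\varphi_1(x_1,y_1)\,z_1\otimes(\varphi_2)_{x_2,y_2}(z_2).$$ Alternatively, $\mathfrak m$ is the LY-algebra inside the Lie algebra $\mathcal T(\mathcal J(V_1),\mathcal J(V_2))$. With $\varphi=\varphi_1\perp\varphi_2$,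 there is an isomorphism $\mathfrak g(\mathfrak m)\cong\mathfrak{so}(V_1\oplus V_2)$ which sends $x_1\otimes x_2\in\mathfrak m$ to $\varphi_{x_1,x_2}$ and $D(\mathfrak m,\mathfrak m)$ onto $\mathfrak{so}(V_1)\oplus\mathfrak{so}(V_2)$. (iii) The same as (ii), with nondegenerate skew-symmetric forms $\varphi_i$, $2\le\dim V_1\le\dim V_2$, Jordan superalgebras $\mathcal J(V_i)$, and $\mathfrak{sp}(V_1\oplus V_2)$, $\mathfrak{sp}(V_1)\oplus\mathfrak{sp}(V_2)$ in place of $\mathfrak{so}(V_1\oplus V_2)$, $\mathfrak{so}(V_1)\oplus\mathfrak{so}(V_2)$. (iv) $\mathfrak m=\mathfrak{sp}(V_1)\otimes\mathcal J_0$, where $V_1$ is two-dimensional with a nonzero skew-symmetric bilinear form $\varphi_1$, $\mathcal J=\mathfrak{sym}(V_2,\varphi_2)\cong H_n(k)$ with $\varphi_2$ nondegenerate symmetric, $\dim V_2=n\ge3$, $\mathcal J_0=\mathfrak{sym}_0(V_2,\varphi_2)$, and, with $N=\dim V_2$, $$(a\otimes f)\cdot(b\otimes g)=\tfrac12[a,b]\otimes\bigl(fg+gf-\tfrac2{N}\mathrm{tr}(fg)1\bigr),$$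 $$[a\otimes f,b\otimes g,c\otimes h]=\tfrac1N\mathrm{tr}(fg)[[a,b],c]\otimes h+\tfrac12\mathrm{tr}(ab)c\otimes[[f,g],h].$$ Alternatively, $\mathfrak m$ is the LY-algebra inside the Lie algebra $\mathcal T(Q,H_n(k))$. With $\varphi=\varphi_1\otimes\varphi_2$, there is an isomorphism $\mathfrak g(\mathfrak m)\cong\mathfrak{sp}(V_1\otimes V_2)\cong\mathfrak{sp}_{2n}(k)$ which sends $a\otimes f\in\mathfrak m$ to the endomorphism $a\otimes f$ and restricts to an isomorphism of $D(\mathfrak m,\mathfrak m)$ with $\mathfrak{sp}(V_1)\oplus\mathfrak{so}(V_2)$, where $(a,f)$ corresponds to $a\otimes1+1\otimes f$. (v) The same as (iv), with $\mathcal J=\mathfrak{sym}(V_2,\varphi_2)\cong H_n(Q)$, $\varphi_2$ nondegenerate skew-symmetric, $N=\dim V_2=2n$, $n\ge3$; $\mathfrak m$ is the LY-algebra inside $\mathcal T(Q,H_n(Q))$, $\mathfrak g(\mathfrak m)\cong\mathfrak{so}(V_1\otimes V_2)\cong\mathfrak{so}_{4n}(k)$ and $D(\mathfrak m,\mathfrak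 m)\cong\mathfrak{sp}(V_1)\oplus\mathfrak{sp}(V_2)$. -/

import Mathlib

open scoped TensorProduct

attribute [local instance 100] LieRing.ofAssociativeRing

/-! ### Lie-Yamaguti algebras -/

/-- A Lie-Yamaguti algebra structure on the `k`-vector space `m`: a binary product `x · y` (`mul`)
and a ternary product `[x, y, z]` (`tri`) satisfying the usual axioms. -/
structure LieYamaguti (k : Type*) (m : Type*) [Field k] [AddCommGroup m] [Module k m] where
  /-- the binary product -/
  mul : m →ₗ[k] m →ₗ[k] m
  /-- the ternary product -/
  tri : m →ₗ[k] m →ₗ[k] m →ₗ[k] m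
  mul_self : ∀ x, mul x x = 0
  tri_self : ∀ x y, tri x x y = 0
  cyclic_tri : ∀ x y z, (tri x y z + mul (mul x y) z) + (tri y z x + mul (mul y z) x)
    + (tri z x y + mul (mul z x) y) = 0
  cyclic_mul : ∀ x y z t, tri (mul x y) z t + tri (mul y z) x t + tri (mul z x) y t = 0
  tri_mul : ∀ x y u v, tri x y (mul u v) = mul (tri x y u) v + mul u (tri x y v)
  tri_tri : ∀ x y u v w, tri x y (tri u v w)
    = tri (tri x y u) v w + tri u (tri x y v) w + tri u v (tri x y w)

namespace LieYamaguti

variable {k : Type*} {m : Type*} [Field k] [AddCommGroup m] [Module k m]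

lemma mul_swap (L : LieYamaguti k m) (x y : m) : L.mul x y = - L.mul y x := by
  have h := L.mul_self (x + y)
  simp only [map_add, LinearMap.add_apply, L.mul_self, zero_add, add_zero] at h
  exact eq_neg_of_add_eq_zero_right h

lemma tri_swap (L : LieYamaguti k m) (x y : m) : L.tri x y = - L.tri y x := by
  ext z
  have h := L.tri_self (x + y) z
  simp only [map_add, LinearMap.add_apply, L.tri_self, zero_add, add_zero] at h
  exact eq_neg_of_add_eq_zero_right h

/-- The Lie algebra `D(m, m)` of inner derivations: the linear span of the maps
`D(x, y) = [x, y, -]`, with the commutator. -/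
def innerDer (L : LieYamaguti k m) : LieSubalgebra k (Module.End k m) where
  toSubmodule := Submodule.span k {d | ∃ x y, d = L.tri x y}
  lie_mem' := by
    intro a b ha hb
    change a ∈ Submodule.span k {d | ∃ x y, d = L.tri x y} at ha
    change b ∈ Submodule.span k {d | ∃ x y, d = L.tri x y} at hb
    change ⁅a, b⁆ ∈ Submodule.span k {d | ∃ x y, d = L.tri x y}
    induction ha using Submodule.span_induction with
    | zero => simp
    | add u v _ _ hu hv => rw [add_lie]; exact add_mem hu hv
    | smul c u _ hu => rw [smul_lie]; exact Submodule.smul_mem _ _ hu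
    | mem u hu =>
      obtain ⟨x, y, rfl⟩ := hu
      induction hb using Submodule.span_induction with
      | zero => simp
      | add u v _ _ hu hv => rw [lie_add]; exact add_mem hu hv
      | smul c u _ hu => rw [lie_smul]; exact Submodule.smul_mem _ _ hu
      | mem u hu =>
        obtain ⟨z, t, rfl⟩ := hu
        have h : ⁅L.tri x y, L.tri z t⁆ = L.tri (L.tri x y z) t + L.tri z (L.tri x y t) := by
          ext w
          simp only [Ring.lie_def, LinearMap.sub_apply, Module.End.mul_apply, LinearMap.add_apply,
            L.tri_tri x y z t w]
          abel
        rw [h]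
        exact add_mem (Submodule.subset_span ⟨_, _, rfl⟩) (Submodule.subset_span ⟨_, _, rfl⟩)

/-- The inner derivation `D(x, y) = [x, y, -]`. -/
def der (L : LieYamaguti k m) (x y : m) : L.innerDer :=
  ⟨L.tri x y, Submodule.subset_span ⟨x, y, rfl⟩⟩

lemma innerDer_mul (L : LieYamaguti k m) (d : L.innerDer) (u v : m) :
    d.1 (L.mul u v) = L.mul (d.1 u) v + L.mul u (d.1 v) := by
  obtain ⟨d, hd⟩ := d
  change d ∈ Submodule.span k {d | ∃ x y, d = L.tri x y} at hd
  change d (L.mul u v) = L.mul (d u) v + L.mul u (d v)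
  induction hd using Submodule.span_induction with
  | zero => simp
  | add a b _ _ ha hb => simp only [LinearMap.add_apply, map_add, ha, hb]; abel
  | smul c a _ ha => simp only [LinearMap.smul_apply, map_smul, ha, smul_add]
  | mem a ha => obtain ⟨x, y, rfl⟩ := ha; exact L.tri_mul x y u v

lemma innerDer_tri (L : LieYamaguti k m) (d : L.innerDer) (u v w : m) :
    d.1 (L.tri u v w) = L.tri (d.1 u) v w + L.tri u (d.1 v) w + L.tri u v (d.1 w) := by
  obtain ⟨d, hd⟩ := d
  change d ∈ Submodule.span k {d | ∃ x y, d = L.tri x y} at hd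
  change d (L.tri u v w) = L.tri (d u) v w + L.tri u (d v) w + L.tri u v (d w)
  induction hd using Submodule.span_induction with
  | zero => simp
  | add a b _ _ ha hb => simp only [LinearMap.add_apply, map_add, ha, hb]; abel
  | smul c a _ ha => simp only [LinearMap.smul_apply, map_smul, ha, smul_add]
  | mem a ha => obtain ⟨x, y, rfl⟩ := ha; exact L.tri_tri x y u v w

/-- The underlying space `D(m, m) ⊕ m` of the standard enveloping Lie algebra `g(m)`. -/
structure Envelope (L : LieYamaguti k m) where
  /-- the component in `D(m, m)` -/
  fst : L.innerDer
  /-- the component in `m` -/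
  snd : m

namespace Envelope

/-- `g(m)` is `D(m, m) × m` as a vector space. -/
def equivProd (L : LieYamaguti k m) : L.Envelope ≃ L.innerDer × m where
  toFun a := (a.1, a.2)
  invFun p := ⟨p.1, p.2⟩
  left_inv _ := rfl
  right_inv _ := rfl

instance (L : LieYamaguti k m) : AddCommGroup L.Envelope := (equivProd L).addCommGroup

instance (L : LieYamaguti k m) : Module k L.Envelope := (equivProd L).module k

/-- The bracket of `g(m) = D(m, m) ⊕ m`: the commutator on `D(m, m)`, the natural action
`[d, z] = d(z)`, and `[z, t] = D(z, t) + z · t`. -/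
instance (L : LieYamaguti k m) : Bracket L.Envelope L.Envelope where
  bracket a b := ⟨⁅a.1, b.1⁆ + L.der a.2 b.2, a.1.1 b.2 - b.1.1 a.2 + L.mul a.2 b.2⟩

lemma ext' {L : LieYamaguti k m} {a b : L.Envelope} (h₁ : ∀ z, a.1.1 z = b.1.1 z)
    (h₂ : a.2 = b.2) : a = b := by
  obtain ⟨a₁, a₂⟩ := a
  obtain ⟨b₁, b₂⟩ := b
  obtain rfl : a₁ = b₁ := Subtype.ext (LinearMap.ext h₁)
  obtain rfl : a₂ = b₂ := h₂
  rfl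

lemma lie_fst_apply {L : LieYamaguti k m} (a b : L.Envelope) (z : m) :
    (⁅a, b⁆ : L.Envelope).1.1 z = a.1.1 (b.1.1 z) - b.1.1 (a.1.1 z) + L.tri a.2 b.2 z := rfl

lemma lie_snd {L : LieYamaguti k m} (a b : L.Envelope) :
    (⁅a, b⁆ : L.Envelope).2 = a.1.1 b.2 - b.1.1 a.2 + L.mul a.2 b.2 := rfl

lemma add_fst_apply {L : LieYamaguti k m} (a b : L.Envelope) (z : m) :
    (a + b : L.Envelope).1.1 z = a.1.1 z + b.1.1 z := rfl

lemma add_snd {L : LieYamaguti k m} (a b : L.Envelope) : (a + b : L.Envelope).2 = a.2 + b.2 := rfl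

lemma smul_fst_apply {L : LieYamaguti k m} (c : k) (a : L.Envelope) (z : m) :
    (c • a : L.Envelope).1.1 z = c • a.1.1 z := rfl

lemma smul_snd {L : LieYamaguti k m} (c : k) (a : L.Envelope) :
    (c • a : L.Envelope).2 = c • a.2 := rfl

instance (L : LieYamaguti k m) : LieRing L.Envelope where
  add_lie a b c := by
    refine ext' (fun z => ?_) ?_
    · simp only [lie_fst_apply, add_fst_apply, add_snd, map_add, LinearMap.add_apply]; abel
    · simp only [lie_snd, add_fst_apply, add_snd, map_add, LinearMap.add_apply]; abel
  lie_add a b c := by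
    refine ext' (fun z => ?_) ?_
    · simp only [lie_fst_apply, add_fst_apply, add_snd, map_add, LinearMap.add_apply]; abel
    · simp only [lie_snd, add_fst_apply, add_snd, map_add]; abel
  lie_self a := by
    refine ext' (fun z => ?_) ?_
    · rw [lie_fst_apply, L.tri_self]; simp only [sub_self, add_zero]; rfl
    · rw [lie_snd, L.mul_self]; simp only [sub_self, add_zero]; rfl
  leibniz_lie a b c := by
    refine ext' (fun z => ?_) ?_
    · have h := L.cyclic_mul a.2 b.2 c.2 z
      have e1 : L.tri (L.mul b.2 c.2) a.2 z = - L.tri a.2 (L.mul b.2 c.2) z := by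
        rw [L.tri_swap]; rfl
      have e2 : L.tri (L.mul c.2 a.2) b.2 z = L.tri b.2 (L.mul a.2 c.2) z := by
        rw [L.mul_swap c.2 a.2, L.tri_swap, map_neg, neg_neg]
      rw [e1, e2] at h
      have h' : L.tri a.2 (L.mul b.2 c.2) z
          = L.tri (L.mul a.2 b.2) c.2 z + L.tri b.2 (L.mul a.2 c.2) z := by
        rw [← sub_eq_zero, ← neg_eq_zero, ← h]; abel
      simp only [lie_fst_apply, lie_snd, add_fst_apply, map_add, map_sub, LinearMap.add_apply,
        LinearMap.sub_apply, innerDer_tri, h', L.tri_swap (c.1.1 a.2) b.2, LinearMap.neg_apply]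
      abel
    · have h := L.cyclic_tri a.2 b.2 c.2
      rw [L.mul_swap (L.mul b.2 c.2) a.2, L.mul_swap c.2 a.2, map_neg, LinearMap.neg_apply,
        L.mul_swap (L.mul a.2 c.2) b.2, L.tri_swap c.2 a.2] at h
      simp only [LinearMap.neg_apply, neg_neg] at h
      have h' : L.mul a.2 (L.mul b.2 c.2)
          = L.tri a.2 b.2 c.2 + L.tri b.2 c.2 a.2 - L.tri a.2 c.2 b.2
            + L.mul (L.mul a.2 b.2) c.2 + L.mul b.2 (L.mul a.2 c.2) := by
        rw [← sub_eq_zero, ← neg_eq_zero, ← h]; abel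
      simp only [lie_fst_apply, lie_snd, add_snd, map_add, map_sub, LinearMap.add_apply,
        LinearMap.sub_apply, innerDer_mul, h', L.mul_swap (c.1.1 a.2) b.2]
      abel

instance (L : LieYamaguti k m) : LieAlgebra k L.Envelope where
  lie_smul c a b := by
    refine ext' (fun z => ?_) ?_
    · simp only [lie_fst_apply, smul_fst_apply, smul_snd, map_smul, LinearMap.smul_apply,
        smul_add, smul_sub]
    · simp only [lie_snd, smul_fst_apply, smul_snd, map_smul, smul_add, smul_sub]

end Envelope

/-- The inclusion `D(m, m) ⊆ g(m)`. -/
def ofDer (L : LieYamaguti k m) (d : L.innerDer) : L.Envelope := ⟨d, 0⟩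

/-- The inclusion `m ⊆ g(m)`. -/
def ofVec (L : LieYamaguti k m) (x : m) : L.Envelope := ⟨0, x⟩

/-- `m` is an irreducible `D(m, m)`-module. -/
def IsIrreducible (L : LieYamaguti k m) : Prop := LieModule.IsIrreducible k L.innerDer m

/-- Non-simple type: the inner derivation algebra `D(m, m)` is not simple. -/
def IsNonSimpleType (L : LieYamaguti k m) : Prop := ¬ LieAlgebra.IsSimple k L.innerDer

end LieYamaguti

/-- A classical Lie algebra: one isomorphic to `sl_n(k)` (`n ≥ 2`), `so_n(k)` (`n ≥ 3`) or
`sp_{2n}(k)` (`n ≥ 1`). -/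
def IsClassicalLie (k : Type*) (g : Type*) [Field k] [LieRing g] [LieAlgebra k g] : Prop :=
  (∃ n : ℕ, 2 ≤ n ∧ Nonempty (g ≃ₗ⁅k⁆ LieAlgebra.SpecialLinear.sl (Fin n) k)) ∨
  (∃ n : ℕ, 3 ≤ n ∧ Nonempty (g ≃ₗ⁅k⁆ LieAlgebra.Orthogonal.so (Fin n) k)) ∨
  (∃ n : ℕ, 1 ≤ n ∧ Nonempty (g ≃ₗ⁅k⁆ LieAlgebra.Symplectic.sp (Fin n) k))

/-! ### Linear Lie algebras and spaces of symmetric maps -/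

section Linear

variable {k : Type*} {V W : Type*} [Field k] [AddCommGroup V] [Module k V]
  [AddCommGroup W] [Module k W]

/-- `sl(V)`: the endomorphisms of trace zero. -/
noncomputable def slEnd (k V : Type*) [Field k] [AddCommGroup V] [Module k V] :
    LieSubalgebra k (Module.End k V) where
  toSubmodule := LinearMap.ker (LinearMap.trace k V)
  lie_mem' := by
    intro f g _ _
    exact LinearMap.trace_lie f g

/-- The map `fg + gf - (2/n) tr(fg) 1`, where `n = dim V`. -/
noncomputable def jordanTraceless (f g : Module.End k V) : Module.End k V :=
  f * g + g * f - (2 / (Module.finrank k V : k) * LinearMap.trace k V (f * g)) • 1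

lemma trace_jordanTraceless [CharZero k] [FiniteDimensional k V] (f g : Module.End k V) :
    LinearMap.trace k V (jordanTraceless f g) = 0 := by
  by_cases h : Module.finrank k V = 0
  · have hs : Subsingleton V := Module.finrank_zero_iff.mp h
    have : jordanTraceless f g = 0 := LinearMap.ext fun v => Subsingleton.elim _ _
    rw [this, map_zero]
  · have h' : (Module.finrank k V : k) ≠ 0 := Nat.cast_ne_zero.mpr h
    simp only [jordanTraceless, map_sub, map_add, map_smul, LinearMap.trace_one, smul_eq_mul,
      LinearMap.trace_mul_comm k g f]
    field_simp
    ring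

/-- `fg + gf - (2/n) tr(fg) 1` as an element of `sl(V)`. -/
noncomputable def slJordan [CharZero k] [FiniteDimensional k V] (f g : slEnd k V) : slEnd k V :=
  ⟨jordanTraceless f.1 g.1, trace_jordanTraceless f.1 g.1⟩

/-- `ε`-symmetry of a bilinear form: symmetric for `ε = 1`, skew-symmetric for `ε = -1`. -/
def IsEpsSymm (ε : k) (φ : LinearMap.BilinForm k V) : Prop := ∀ v w, φ v w = ε * φ w v

/-- The map `φ_{v,w} = φ(v, -) w - ε φ(w, -) v`. -/
def phiMap (ε : k) (φ : LinearMap.BilinForm k V) (v w : V) : Module.End k V :=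
  (φ v).smulRight w - ε • (φ w).smulRight v

lemma phiMap_apply (ε : k) (φ : LinearMap.BilinForm k V) (v w z : V) :
    phiMap ε φ v w z = φ v z • w - (ε * φ w z) • v := by
  simp [phiMap, smul_smul]

/-- The orthogonal sum `φ₁ ⊥ φ₂` on `V ⊕ W`. -/
def orthSum (φ₁ : LinearMap.BilinForm k V) (φ₂ : LinearMap.BilinForm k W) :
    LinearMap.BilinForm k (V × W) :=
  φ₁.compl₁₂ (LinearMap.fst k V W) (LinearMap.fst k V W)
    + φ₂.compl₁₂ (LinearMap.snd k V W) (LinearMap.snd k V W)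

/-- `sym(V, φ)`: the endomorphisms with `φ(f v, w) = φ(v, f w)`. -/
def symEnd (φ : LinearMap.BilinForm k V) : Submodule k (Module.End k V) where
  carrier := {f | ∀ v w, φ (f v) w = φ v (f w)}
  zero_mem' := by intro v w; simp
  add_mem' := by intro f g hf hg v w; simp [hf v w, hg v w]
  smul_mem' := by intro c f hf v w; simp [hf v w]

/-- `sym₀(V, φ)`: the elements of `sym(V, φ)` of trace zero. -/
noncomputable def symZero (φ : LinearMap.BilinForm k V) : Submodule k (Module.End k V) :=
  symEnd φ ⊓ LinearMap.ker (LinearMap.trace k V)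

/-- `fg + gf - (2/n) tr(fg) 1` as an element of `sym₀(V, φ)`. -/
noncomputable def symJordan [CharZero k] [FiniteDimensional k V] {φ : LinearMap.BilinForm k V}
    (f g : symZero φ) : symZero φ :=
  ⟨jordanTraceless f.1 g.1, by
    refine ⟨fun v w => ?_, trace_jordanTraceless f.1 g.1⟩
    have hf : ∀ v w, φ (f.1 v) w = φ v (f.1 w) := f.2.1
    have hg : ∀ v w, φ (g.1 v) w = φ v (g.1 w) := g.2.1
    simp only [jordanTraceless, LinearMap.sub_apply, LinearMap.add_apply, Module.End.mul_apply,
      LinearMap.smul_apply, Module.End.one_apply, map_sub, map_add, map_smul, hf, hg, smul_eq_mul]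
    ring⟩

/-- `[[f, g], h]` as an element of `sym₀(V, φ)`. -/
noncomputable def symTriple {φ : LinearMap.BilinForm k V} (f g h : symZero φ) : symZero φ :=
  ⟨⁅⁅f.1, g.1⁆, h.1⁆, by
    refine ⟨fun v w => ?_, LinearMap.trace_lie _ _⟩
    have hf : ∀ v w, φ (f.1 v) w = φ v (f.1 w) := f.2.1
    have hg : ∀ v w, φ (g.1 v) w = φ v (g.1 w) := g.2.1
    have hh : ∀ v w, φ (h.1 v) w = φ v (h.1 w) := h.2.1
    simp only [Ring.lie_def, LinearMap.sub_apply, Module.End.mul_apply, map_sub, hf, hg, hh]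
    ring⟩

end Linear

/-! ### The products of the classical examples -/

namespace LieYamaguti

variable {k : Type*} {m : Type*} [Field k] [AddCommGroup m] [Module k m]
variable {V₁ V₂ : Type*} [AddCommGroup V₁] [Module k V₁] [AddCommGroup V₂] [Module k V₂]

/-- Under the linear isomorphism `e : sl(V₁) ⊗ sl(V₂) ≃ m`, the products of `m` are
`(a ⊗ f) · (b ⊗ g) = ½[a,b] ⊗ (fg + gf - (2/n₂)tr(fg)1) + (ab + ba - (2/n₁)tr(ab)1) ⊗ ½[f,g]` and
`[a ⊗ f, b ⊗ g, c ⊗ h] = [[a,b],c] ⊗ (1/n₂)tr(fg)h + (1/n₁)tr(ab)c ⊗ [[f,g],h]`,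
where `nᵢ = dim Vᵢ`. -/
def HasProductsSl [CharZero k] [FiniteDimensional k V₁] [FiniteDimensional k V₂]
    (L : LieYamaguti k m) (e : (slEnd k V₁ ⊗[k] slEnd k V₂) ≃ₗ[k] m) : Prop :=
  (∀ (a b : slEnd k V₁) (f g : slEnd k V₂),
    L.mul (e (a ⊗ₜ f)) (e (b ⊗ₜ g))
      = e (((1 / 2 : k) • ⁅a, b⁆) ⊗ₜ slJordan f g + slJordan a b ⊗ₜ ((1 / 2 : k) • ⁅f, g⁆))) ∧
  (∀ (a b c : slEnd k V₁) (f g h : slEnd k V₂),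
    L.tri (e (a ⊗ₜ f)) (e (b ⊗ₜ g)) (e (c ⊗ₜ h))
      = e (⁅⁅a, b⁆, c⁆ ⊗ₜ
            ((1 / (Module.finrank k V₂ : k) * LinearMap.trace k V₂ (f.1 * g.1)) • h)
          + ((1 / (Module.finrank k V₁ : k) * LinearMap.trace k V₁ (a.1 * b.1)) • c) ⊗ₜ
            ⁅⁅f, g⁆, h⁆))

/-- Under the linear isomorphism `e : V₁ ⊗ V₂ ≃ m`, the binary product of `m` is trivial and
`[x₁ ⊗ x₂, y₁ ⊗ y₂, z₁ ⊗ z₂] = φ₂(x₂,y₂) (φ₁)_{x₁,y₁}(z₁) ⊗ z₂ + φ₁(x₁,y₁) z₁ ⊗ (φ₂)_{x₂,y₂}(z₂)`,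
for `ε`-symmetric forms `φ₁`, `φ₂`. -/
def HasProductsForms (L : LieYamaguti k m) (ε : k) (φ₁ : LinearMap.BilinForm k V₁)
    (φ₂ : LinearMap.BilinForm k V₂) (e : (V₁ ⊗[k] V₂) ≃ₗ[k] m) : Prop :=
  (∀ x y, L.mul x y = 0) ∧
  (∀ (x₁ y₁ z₁ : V₁) (x₂ y₂ z₂ : V₂),
    L.tri (e (x₁ ⊗ₜ x₂)) (e (y₁ ⊗ₜ y₂)) (e (z₁ ⊗ₜ z₂))
      = e (φ₂ x₂ y₂ • (phiMap ε φ₁ x₁ y₁ z₁ ⊗ₜ z₂) + φ₁ x₁ y₁ • (z₁ ⊗ₜ phiMap ε φ₂ x₂ y₂ z₂)))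

/-- Under the linear isomorphism `e : sp(V₁, φ₁) ⊗ sym₀(V₂, φ₂) ≃ m`, the products of `m` are
`(a ⊗ f) · (b ⊗ g) = ½[a,b] ⊗ (fg + gf - (2/n)tr(fg)1)` and
`[a ⊗ f, b ⊗ g, c ⊗ h] = (1/n)tr(fg)[[a,b],c] ⊗ h + ½tr(ab)c ⊗ [[f,g],h]`, where `n = dim V₂`. -/
def HasProductsSpSym [CharZero k] [FiniteDimensional k V₂] (L : LieYamaguti k m)
    (φ₁ : LinearMap.BilinForm k V₁) (φ₂ : LinearMap.BilinForm k V₂)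
    (e : (skewAdjointLieSubalgebra φ₁ ⊗[k] symZero φ₂) ≃ₗ[k] m) : Prop :=
  (∀ (a b : skewAdjointLieSubalgebra φ₁) (f g : symZero φ₂),
    L.mul (e (a ⊗ₜ f)) (e (b ⊗ₜ g)) = e (((1 / 2 : k) • ⁅a, b⁆) ⊗ₜ symJordan f g)) ∧
  (∀ (a b c : skewAdjointLieSubalgebra φ₁) (f g h : symZero φ₂),
    L.tri (e (a ⊗ₜ f)) (e (b ⊗ₜ g)) (e (c ⊗ₜ h))
      = e ((1 / (Module.finrank k V₂ : k) * LinearMap.trace k V₂ (f.1 * g.1)) • (⁅⁅a, b⁆, c⁆ ⊗ₜ h)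
          + (1 / 2 * LinearMap.trace k V₁ (a.1 * b.1)) • (c ⊗ₜ symTriple f g h)))

end LieYamaguti

/-! ### The generalized Tits construction -/

/-- An ingredient of the generalized Tits construction: a unital algebra `X` with a normalized
trace `t` and a bilinear map `D : X₀ × X₀ → Der(X)` on `X₀ = ker t`, with `D_{x,y}` leaving `X₀`
invariant and `[E, D_{x,y}] = D_{E(x),y} + D_{x,E(y)}` for `E ∈ D_{X₀,X₀}`. For `ε = 1`, the form
`t(xy)` is symmetric and `D` is skew-symmetric; for `ε = -1` (which arises from superalgebras with
even part `k1` and odd part `X₀`) the form `t(xy)` on `X₀` is skew-symmetric and `D` is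
symmetric. -/
structure TitsIngredient (k : Type*) [Field k] (ε : k) (X : Type*) [AddCommGroup X]
    [Module k X] where
  /-- the multiplication of `X` -/
  mul : X →ₗ[k] X →ₗ[k] X
  /-- the unit of `X` -/
  one : X
  /-- the normalized trace -/
  t : X →ₗ[k] k
  /-- the map `D` -/
  D : LinearMap.ker t →ₗ[k] LinearMap.ker t →ₗ[k] Module.End k X
  one_mul : ∀ x, mul one x = x
  mul_one : ∀ x, mul x one = x
  t_one : t one = 1
  t_comm : ∀ x y, t x = 0 → t y = 0 → t (mul x y) = ε * t (mul y x)
  t_assoc : ∀ x y z, t (mul (mul x y) z) = t (mul x (mul y z))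
  D_comm : ∀ x y, D x y = - ε • D y x
  D_der : ∀ x y a b, D x y (mul a b) = mul (D x y a) b + mul a (D x y b)
  D_mem : ∀ x y (z : LinearMap.ker t), D x y z ∈ LinearMap.ker t
  D_lie : ∀ u v x y, ⁅D u v, D x y⁆ = D ⟨D u v x, D_mem u v x⟩ y + D x ⟨D u v y, D_mem u v y⟩

namespace TitsIngredient

variable {k : Type*} [Field k] {ε : k} {X : Type*} [AddCommGroup X] [Module k X]

/-- The space `X₀` of elements of trace zero. -/
abbrev Zero (A : TitsIngredient k ε X) : Submodule k X := LinearMap.ker A.t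

/-- The Lie algebra `D_{X₀,X₀}` spanned by the derivations `D_{x,y}`. -/
def inner (A : TitsIngredient k ε X) : LieSubalgebra k (Module.End k X) where
  toSubmodule := Submodule.span k {d | ∃ x y, d = A.D x y}
  lie_mem' := by
    intro a b ha hb
    change a ∈ Submodule.span k {d | ∃ x y, d = A.D x y} at ha
    change b ∈ Submodule.span k {d | ∃ x y, d = A.D x y} at hb
    change ⁅a, b⁆ ∈ Submodule.span k {d | ∃ x y, d = A.D x y}
    induction ha using Submodule.span_induction with
    | zero => simp
    | add u v _ _ hu hv => rw [add_lie]; exact add_mem hu hv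
    | smul c u _ hu => rw [smul_lie]; exact Submodule.smul_mem _ _ hu
    | mem u hu =>
      obtain ⟨x, y, rfl⟩ := hu
      induction hb using Submodule.span_induction with
      | zero => simp
      | add u v _ _ hu hv => rw [lie_add]; exact add_mem hu hv
      | smul c u _ hu => rw [lie_smul]; exact Submodule.smul_mem _ _ hu
      | mem u hu =>
        obtain ⟨z, t, rfl⟩ := hu
        rw [A.D_lie]
        exact add_mem (Submodule.subset_span ⟨_, _, rfl⟩) (Submodule.subset_span ⟨_, _, rfl⟩)

lemma inner_mem (A : TitsIngredient k ε X) (d : A.inner) (x : A.Zero) : d.1 x ∈ A.Zero := by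
  obtain ⟨d, hd⟩ := d
  change d ∈ Submodule.span k {d | ∃ x y, d = A.D x y} at hd
  change d x ∈ A.Zero
  induction hd using Submodule.span_induction with
  | zero => exact zero_mem _
  | add a b _ _ ha hb => exact add_mem ha hb
  | smul c a _ ha => exact Submodule.smul_mem _ _ ha
  | mem a ha => obtain ⟨u, v, rfl⟩ := ha; exact A.D_mem u v x

/-- The action of an element of `D_{X₀,X₀}` on `X₀`. -/
def act (A : TitsIngredient k ε X) (d : A.inner) : Module.End k A.Zero :=
  d.1.restrict fun x hx => A.inner_mem d ⟨x, hx⟩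

/-- `D` as a bilinear map `X₀ × X₀ → D_{X₀,X₀}`. -/
def DInner (A : TitsIngredient k ε X) : A.Zero →ₗ[k] A.Zero →ₗ[k] A.inner :=
  LinearMap.mk₂ k (fun x y => ⟨A.D x y, Submodule.subset_span ⟨x, y, rfl⟩⟩)
    (fun x x' y => by ext; simp) (fun c x y => by ext; simp)
    (fun x y y' => by ext; simp) (fun c x y => by ext; simp)

/-- The bilinear form `t(xy)` on `X₀`. -/
def form (A : TitsIngredient k ε X) : A.Zero →ₗ[k] A.Zero →ₗ[k] k :=
  (A.mul.compl₁₂ A.Zero.subtype A.Zero.subtype).compr₂ A.t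

/-- The multiplication `x * y = xy - t(xy)1` on `X₀`. -/
def star (A : TitsIngredient k ε X) : A.Zero →ₗ[k] A.Zero →ₗ[k] A.Zero :=
  LinearMap.mk₂ k (fun x y => ⟨A.mul x y - A.t (A.mul x y) • A.one, by simp [A.t_one]⟩)
    (fun x x' y => by ext; simp only [Submodule.coe_add, map_add, LinearMap.add_apply]; module)
    (fun c x y => by
      ext; simp only [Submodule.coe_smul, map_smul, LinearMap.smul_apply, smul_eq_mul]; module)
    (fun x y y' => by ext; simp only [Submodule.coe_add, map_add]; module)
    (fun c x y => by ext; simp only [Submodule.coe_smul, map_smul, smul_eq_mul]; module)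

end TitsIngredient

section Tits

variable {k : Type*} [Field k] {ε : k} {X Y : Type*} [AddCommGroup X] [Module k X]
  [AddCommGroup Y] [Module k Y]

/-- The space `T(X, Y) = D_{X₀,X₀} ⊕ (X₀ ⊗ Y₀) ⊕ d_{Y₀,Y₀}`. -/
abbrev TitsSpace (A : TitsIngredient k ε X) (B : TitsIngredient k ε Y) : Type _ :=
  A.inner × (A.Zero ⊗[k] B.Zero) × B.inner

/-- The multiplication of `T(X, Y)`: `D_{X₀,X₀}` and `d_{Y₀,Y₀}` are commuting subalgebras,
`[D, x ⊗ y] = D(x) ⊗ y`, `[d, x ⊗ y] = x ⊗ d(y)`, and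
`[x ⊗ y, x' ⊗ y'] = t(yy') D_{x,x'} + (x * x') ⊗ (y ⋆ y') + t(xx') d_{y,y'}`. -/
noncomputable def titsBracket (A : TitsIngredient k ε X) (B : TitsIngredient k ε Y)
    (p q : TitsSpace A B) : TitsSpace A B :=
  (⁅p.1, q.1⁆ + TensorProduct.rid k A.inner (TensorProduct.map₂ A.DInner B.form p.2.1 q.2.1),
   ((A.act p.1).rTensor B.Zero q.2.1 + (B.act p.2.2).lTensor A.Zero q.2.1)
    - ((A.act q.1).rTensor B.Zero p.2.1 + (B.act q.2.2).lTensor A.Zero p.2.1)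
    + TensorProduct.map₂ A.star B.star p.2.1 q.2.1,
   ⁅p.2.2, q.2.2⁆ + TensorProduct.lid k B.inner (TensorProduct.map₂ A.form B.DInner p.2.1 q.2.1))

/-- `T(X, Y)` is a Lie algebra. -/
def TitsIsLie (A : TitsIngredient k ε X) (B : TitsIngredient k ε Y) : Prop :=
  (∀ p, titsBracket A B p p = 0) ∧
  (∀ p q r, titsBracket A B p (titsBracket A B q r)
    = titsBracket A B (titsBracket A B p q) r + titsBracket A B q (titsBracket A B p r))

/-- The binary product of the LY-algebra `X₀ ⊗ Y₀` inside `T(X, Y)`: the projection to `X₀ ⊗ Y₀` of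
the bracket, relative to `T(X, Y) = (D_{X₀,X₀} ⊕ d_{Y₀,Y₀}) ⊕ (X₀ ⊗ Y₀)`. -/
noncomputable def titsMul (A : TitsIngredient k ε X) (B : TitsIngredient k ε Y)
    (u v : A.Zero ⊗[k] B.Zero) : A.Zero ⊗[k] B.Zero :=
  (titsBracket A B (0, u, 0) (0, v, 0)).2.1

/-- The ternary product of the LY-algebra `X₀ ⊗ Y₀` inside `T(X, Y)`: the bracket of the component of
`[u, v]` in `D_{X₀,X₀} ⊕ d_{Y₀,Y₀}` with `w`. -/
noncomputable def titsTri (A : TitsIngredient k ε X) (B : TitsIngredient k ε Y)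
    (u v w : A.Zero ⊗[k] B.Zero) : A.Zero ⊗[k] B.Zero :=
  (titsBracket A B ((titsBracket A B (0, u, 0) (0, v, 0)).1, 0,
    (titsBracket A B (0, u, 0) (0, v, 0)).2.2) (0, w, 0)).2.1

/-- `T(X, Y)` is a Lie algebra and the LY-algebra `m` is isomorphic to the LY-algebra inside it. -/
def LieYamaguti.IsInsideTits {m : Type*} [AddCommGroup m] [Module k m] (L : LieYamaguti k m)
    (A : TitsIngredient k ε X) (B : TitsIngredient k ε Y) : Prop :=
  TitsIsLie A B ∧ ∃ e : (A.Zero ⊗[k] B.Zero) ≃ₗ[k] m,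
    (∀ u v, L.mul (e u) (e v) = e (titsMul A B u v)) ∧
    (∀ u v w, L.tri (e u) (e v) (e w) = e (titsTri A B u v w))

end Tits

/-! ### The ingredients used -/

section Ingredients

variable {k : Type*} [Field k]

/-- The Jordan algebra (`ε = 1`) or Jordan superalgebra (`ε = -1`, with odd part `V`)
`J(V, φ) = k1 ⊕ V` of an `ε`-symmetric bilinear form:
`(α1 + v)(β1 + w) = (αβ + φ(v,w))1 + (αw + βv)`, `t(α1 + v) = α`, and `D_{v,w} = φ_{v,w}`. -/
def jordanOfForm {V : Type*} [AddCommGroup V] [Module k V] (ε : k) (hε : ε * ε = 1)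
    (φ : LinearMap.BilinForm k V) (hφ : IsEpsSymm ε φ) : TitsIngredient k ε (k × V) where
  mul := LinearMap.mk₂ k (fun p q => (p.1 * q.1 + φ p.2 q.2, p.1 • q.2 + q.1 • p.2))
    (fun p p' q => by
      ext <;> simp only [Prod.fst_add, Prod.snd_add, map_add, LinearMap.add_apply]
      · ring
      · module)
    (fun c p q => by
      ext <;> simp only [Prod.smul_fst, Prod.smul_snd, map_smul, LinearMap.smul_apply, smul_eq_mul]
      · ring
      · module)
    (fun p q q' => by
      ext <;> simp only [Prod.fst_add, Prod.snd_add, map_add]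
      · ring
      · module)
    (fun c p q => by
      ext <;> simp only [Prod.smul_fst, Prod.smul_snd, map_smul, smul_eq_mul]
      · ring
      · module)
  one := (1, 0)
  t := LinearMap.fst k k V
  D := LinearMap.mk₂ k
    (fun x y => LinearMap.inr k k V ∘ₗ phiMap ε φ x.1.2 y.1.2 ∘ₗ LinearMap.snd k k V)
    (fun x x' y => by
      refine LinearMap.ext fun z => Prod.ext ?_ ?_
      · simp
      · simp [phiMap]; module)
    (fun c x y => by
      refine LinearMap.ext fun z => Prod.ext ?_ ?_
      · simp
      · simp [phiMap]; module)
    (fun x y y' => by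
      refine LinearMap.ext fun z => Prod.ext ?_ ?_
      · simp
      · simp [phiMap]; module)
    (fun c x y => by
      refine LinearMap.ext fun z => Prod.ext ?_ ?_
      · simp
      · simp [phiMap]; module)
  one_mul := by intro x; ext <;> simp
  mul_one := by intro x; ext <;> simp
  t_one := rfl
  t_comm := by
    intro x y hx hy
    simp only [LinearMap.fst_apply] at hx hy
    simp [hx, hy, hφ x.2 y.2]
  t_assoc := by
    intro x y z
    simp
    ring
  D_comm := by
    intro x y
    refine LinearMap.ext fun z => Prod.ext ?_ ?_
    · simp
    · change phiMap ε φ x.1.2 y.1.2 z.2 = (-ε) • phiMap ε φ y.1.2 x.1.2 z.2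
      rw [phiMap_apply, phiMap_apply, smul_sub, smul_smul, smul_smul, ← mul_assoc, neg_mul ε ε, hε]
      module
  D_der := by
    intro x y a b
    refine Prod.ext ?_ ?_
    · change (0 : k) = (0 * b.1 + φ (phiMap ε φ x.1.2 y.1.2 a.2) b.2)
        + (a.1 * 0 + φ a.2 (phiMap ε φ x.1.2 y.1.2 b.2))
      rw [phiMap_apply, phiMap_apply]
      simp only [map_sub, map_smul, LinearMap.sub_apply, LinearMap.smul_apply, smul_eq_mul]
      rw [hφ a.2 x.1.2, hφ a.2 y.1.2]
      linear_combination (φ x.1.2 a.2 * φ y.1.2 b.2) * hε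
    · change phiMap ε φ x.1.2 y.1.2 (a.1 • b.2 + b.1 • a.2)
        = ((0 : k) • b.2 + b.1 • phiMap ε φ x.1.2 y.1.2 a.2)
          + (a.1 • phiMap ε φ x.1.2 y.1.2 b.2 + (0 : k) • a.2)
      rw [map_add, map_smul, map_smul]
      module
  D_mem := by
    intro x y z
    simp
  D_lie := by
    intro u v x y
    refine LinearMap.ext fun z => Prod.ext ?_ ?_
    · simp [Ring.lie_def]
    · change phiMap ε φ u.1.2 v.1.2 (phiMap ε φ x.1.2 y.1.2 z.2)
          - phiMap ε φ x.1.2 y.1.2 (phiMap ε φ u.1.2 v.1.2 z.2)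
        = phiMap ε φ (phiMap ε φ u.1.2 v.1.2 x.1.2) y.1.2 z.2
          + phiMap ε φ x.1.2 (phiMap ε φ u.1.2 v.1.2 y.1.2) z.2
      simp only [phiMap_apply, map_sub, map_smul, LinearMap.sub_apply, LinearMap.smul_apply,
        smul_eq_mul]
      rw [hφ x.1.2 u.1.2, hφ x.1.2 v.1.2, hφ y.1.2 u.1.2, hφ y.1.2 v.1.2]
      linear_combination (norm := module) hε • ((φ v.1.2 z.2 * φ u.1.2 x.1.2) • y.1.2)
        - hε • ((ε * φ v.1.2 z.2 * φ u.1.2 y.1.2) • x.1.2)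

/-- The Jordan algebra of a subspace `S` of an associative algebra `A` that contains `1` and is
closed under `xy + yx`, with product `x • y = ½(xy + yx)`, with the normalized trace given by the
restriction of a trace `τ` of `A`, and with `d_{x,y} = [R_x, R_y]`. -/
noncomputable def specialJordan [CharZero k] {A : Type*} [Ring A] [Algebra k A]
    (S : Submodule k A) (h1 : (1 : A) ∈ S) (hS : ∀ x ∈ S, ∀ y ∈ S, x * y + y * x ∈ S)
    (τ : A →ₗ[k] k) (hτ : ∀ x y, τ (x * y) = τ (y * x)) (hτ1 : τ 1 = 1) :
    TitsIngredient k 1 S :=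
  let M : S →ₗ[k] S →ₗ[k] S := LinearMap.mk₂ k
    (fun x y => ⟨(1 / 2 : k) • (x.1 * y.1 + y.1 * x.1),
      S.smul_mem _ (hS x.1 x.2 y.1 y.2)⟩)
    (fun x x' y => by ext; simp only [Submodule.coe_add, add_mul, mul_add]; module)
    (fun c x y => by
      ext; simp only [Submodule.coe_smul, smul_mul_assoc, mul_smul_comm]; module)
    (fun x y y' => by ext; simp only [Submodule.coe_add, add_mul, mul_add]; module)
    (fun c x y => by
      ext; simp only [Submodule.coe_smul, smul_mul_assoc, mul_smul_comm]; module)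
  have hM : ∀ x y : S, (M x y : A) = (1 / 2 : k) • (x.1 * y.1 + y.1 * x.1) := fun _ _ => rfl
  have hD : ∀ x y z : S, ((⁅M.flip x, M.flip y⁆ : Module.End k S) z : A)
      = (1 / 4 : k) • ((x.1 * y.1 - y.1 * x.1) * z.1 - z.1 * (x.1 * y.1 - y.1 * x.1)) := by
    intro x y z
    simp only [Ring.lie_def, LinearMap.sub_apply, Module.End.mul_apply, LinearMap.flip_apply,
      Submodule.coe_sub, hM, smul_mul_assoc, mul_smul_comm, mul_add, add_mul, mul_sub, sub_mul,
      ← mul_assoc]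
    module
  { mul := M
    one := ⟨1, h1⟩
    t := τ ∘ₗ S.subtype
    D := LinearMap.mk₂ k (fun x y => ⁅M.flip x.1, M.flip y.1⁆)
      (fun x x' y => by simp only [Submodule.coe_add, map_add, add_lie])
      (fun c x y => by
        refine LinearMap.ext fun z => Subtype.ext ?_
        change _ = c • ((⁅M.flip x.1, M.flip y.1⁆ : Module.End k S) z : A)
        simp only [Submodule.coe_smul, hD, smul_mul_assoc, mul_smul_comm, sub_mul, mul_sub]
        module)
      (fun x y y' => by simp only [Submodule.coe_add, map_add, lie_add])
      (fun c x y => by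
        refine LinearMap.ext fun z => Subtype.ext ?_
        change _ = c • ((⁅M.flip x.1, M.flip y.1⁆ : Module.End k S) z : A)
        simp only [Submodule.coe_smul, hD, smul_mul_assoc, mul_smul_comm, sub_mul, mul_sub]
        module)
    one_mul := by
      intro x
      ext
      rw [hM, one_mul, mul_one]
      module
    mul_one := by
      intro x
      ext
      rw [hM, one_mul, mul_one]
      module
    t_one := hτ1
    t_comm := by
      intro x y _ _
      simp only [LinearMap.comp_apply, Submodule.subtype_apply, hM, one_mul, add_comm]
    t_assoc := by
      intro x y z
      simp only [LinearMap.comp_apply, Submodule.subtype_apply, hM, map_smul, map_add, mul_add,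
        add_mul, smul_mul_assoc, mul_smul_comm, smul_add, smul_eq_mul]
      rw [hτ z.1 (x.1 * y.1), hτ z.1 (y.1 * x.1), hτ x.1 (y.1 * z.1), hτ x.1 (z.1 * y.1)]
      have e1 : τ (y.1 * z.1 * x.1) = τ (x.1 * y.1 * z.1) := by rw [mul_assoc x.1, hτ x.1]
      have e2 : τ (z.1 * y.1 * x.1) = τ (y.1 * x.1 * z.1) := by rw [mul_assoc z.1, hτ z.1]
      rw [e1, e2]
    D_comm := by
      intro x y
      simp only [LinearMap.mk₂_apply]
      rw [← lie_skew]
      exact (neg_one_smul k _).symm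
    D_der := by
      intro x y a b
      ext
      simp only [LinearMap.mk₂_apply, hD, hM, Submodule.coe_add, smul_mul_assoc, mul_smul_comm,
        mul_add, add_mul, mul_sub, sub_mul, ← mul_assoc]
      module
    D_mem := by
      intro x y z
      simp only [LinearMap.mem_ker, LinearMap.comp_apply, Submodule.subtype_apply,
        LinearMap.mk₂_apply, hD, map_smul, map_sub]
      rw [hτ z.1.1, sub_self, smul_zero]
    D_lie := by
      intro u v x y
      refine LinearMap.ext fun z => Subtype.ext ?_
      simp only [LinearMap.mk₂_apply, LinearMap.add_apply, Submodule.coe_add, hD]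
      rw [Ring.lie_def]
      simp only [LinearMap.sub_apply, Module.End.mul_apply, Submodule.coe_sub, hD, smul_mul_assoc,
        mul_smul_comm, mul_sub, sub_mul, ← mul_assoc, smul_sub]
      module }

/-- The split quaternion algebra `Q = Mat₂(k)`, with `t = ½ tr` and `D_{a,b} = ¼[[a,b], -]`
(the associators in `¼([[a,b],c] + 3(a,c,b))` vanish). -/
noncomputable def quaternions (k : Type*) [Field k] [CharZero k] :
    TitsIngredient k 1 (Matrix (Fin 2) (Fin 2) k) where
  mul := LinearMap.mul k (Matrix (Fin 2) (Fin 2) k)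
  one := 1
  t := (1 / 2 : k) • Matrix.traceLinearMap (Fin 2) k k
  D := LinearMap.mk₂ k
    (fun a b => (1 / 4 : k) • (LinearMap.mulLeft k (a.1 * b.1 - b.1 * a.1)
      - LinearMap.mulRight k (a.1 * b.1 - b.1 * a.1)))
    (fun a a' b => by
      ext1 c; simp [add_mul, mul_add, sub_mul, mul_sub]; module)
    (fun c a b => by
      ext1 c; simp [sub_mul, mul_sub]; module)
    (fun a b b' => by
      ext1 c; simp [add_mul, mul_add, sub_mul, mul_sub]; module)
    (fun c a b => by
      ext1 c; simp [sub_mul, mul_sub]; module)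
  one_mul := by intro x; simp
  mul_one := by intro x; simp
  t_one := by simp [Matrix.trace_one]
  t_comm := by
    intro x y _ _
    simp [Matrix.trace_mul_comm x y]
  t_assoc := by
    intro x y z
    simp [mul_assoc]
  D_comm := by
    intro x y
    ext1 c
    simp [sub_mul, mul_sub]
    module
  D_der := by
    intro x y a b
    simp [sub_mul, mul_sub, mul_assoc]
    module
  D_mem := by
    intro x y z
    simp [Matrix.trace_mul_comm z.1]
  D_lie := by
    intro u v x y
    refine LinearMap.ext fun z => ?_
    simp [Ring.lie_def, sub_mul, mul_sub, mul_assoc]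
    module

/-- The space of symmetric `n × n` matrices over `k`. -/
def symMatrices (k : Type*) [Field k] (n : ℕ) : Submodule k (Matrix (Fin n) (Fin n) k) where
  carrier := {x | ∀ i j, x j i = x i j}
  zero_mem' := by intro i j; rfl
  add_mem' := by intro x y hx hy i j; simp [hx i j, hy i j]
  smul_mem' := by intro c x hx i j; simp [hx i j]

/-- The Jordan algebra `H_n(k)` of symmetric `n × n` matrices, with `t(x) = (1/n) tr(x)`. -/
noncomputable def hermitianK (k : Type*) [Field k] [CharZero k] (n : ℕ) (hn : n ≠ 0) :
    TitsIngredient k 1 (symMatrices k n) :=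
  specialJordan _
    (by intro i j; simp [Matrix.one_apply, eq_comm])
    (by
      intro x hx y hy i j
      have hx' : ∀ i j, x j i = x i j := hx
      have hy' : ∀ i j, y j i = y i j := hy
      simp only [Matrix.add_apply, Matrix.mul_apply]
      rw [add_comm]
      congr 1
      · exact Finset.sum_congr rfl fun l _ => by rw [hx' i l, hy' l j, mul_comm]
      · exact Finset.sum_congr rfl fun l _ => by rw [hx' l j, hy' i l, mul_comm])
    ((1 / (n : k)) • Matrix.traceLinearMap (Fin n) k k)
    (by intro x y; simp [Matrix.trace_mul_comm x y])
    (by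
      have : (n : k) ≠ 0 := Nat.cast_ne_zero.mpr hn
      simp [Matrix.trace_one, this])

/-- The canonical involution `q ↦ tr(q)1 - q` of the split quaternion algebra. -/
def quatConj (q : Matrix (Fin 2) (Fin 2) k) : Matrix (Fin 2) (Fin 2) k :=
  Matrix.trace q • 1 - q

lemma quatConj_eq_adjugate (q : Matrix (Fin 2) (Fin 2) k) : quatConj q = q.adjugate := by
  rw [Matrix.adjugate_fin_two]
  ext i j
  fin_cases i <;> fin_cases j <;> simp [quatConj, Matrix.trace_fin_two]

lemma quatConj_mul (p q : Matrix (Fin 2) (Fin 2) k) :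
    quatConj (p * q) = quatConj q * quatConj p := by
  simp only [quatConj_eq_adjugate, Matrix.adjugate_mul_distrib]

lemma quatConj_add (p q : Matrix (Fin 2) (Fin 2) k) :
    quatConj (p + q) = quatConj p + quatConj q := by
  simp only [quatConj, Matrix.trace_add]; module

lemma quatConj_smul (c : k) (q : Matrix (Fin 2) (Fin 2) k) :
    quatConj (c • q) = c • quatConj q := by
  simp only [quatConj, Matrix.trace_smul, smul_eq_mul]; module

lemma quatConj_sum {ι : Type*} (s : Finset ι) (f : ι → Matrix (Fin 2) (Fin 2) k) :
    quatConj (∑ i ∈ s, f i) = ∑ i ∈ s, quatConj (f i) := by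
  simp only [quatConj, Matrix.trace_sum, Finset.sum_smul, Finset.sum_sub_distrib]

/-- The space of hermitian `n × n` matrices over the split quaternion algebra `Q`: those with
`x_{ji}` conjugate to `x_{ij}`. -/
def hermMatricesQ (k : Type*) [Field k] (n : ℕ) :
    Submodule k (Matrix (Fin n) (Fin n) (Matrix (Fin 2) (Fin 2) k)) where
  carrier := {x | ∀ i j, x j i = quatConj (x i j)}
  zero_mem' := by intro i j; simp [quatConj]
  add_mem' := by
    intro x y hx hy i j
    simp only [Matrix.add_apply, quatConj_add, hx i j, hy i j]
  smul_mem' := by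
    intro c x hx i j
    simp only [Matrix.smul_apply, quatConj_smul, hx i j]

/-- The Jordan algebra `H_n(Q)` of hermitian `n × n` matrices over the split quaternion algebra `Q`,
with `t(x) = (1/n) ∑ᵢ ½tr(x_{ii})`. -/
noncomputable def hermitianQ (k : Type*) [Field k] [CharZero k] (n : ℕ) (hn : n ≠ 0) :
    TitsIngredient k 1 (hermMatricesQ k n) :=
  specialJordan _
    (by
      intro i j
      by_cases h : i = j
      · subst h
        simp only [Matrix.one_apply_eq, quatConj, Matrix.trace_one, Fintype.card_fin]
        push_cast
        module
      · rw [Matrix.one_apply_ne h, Matrix.one_apply_ne (Ne.symm h)]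
        simp [quatConj])
    (by
      intro x hx y hy i j
      have hx' : ∀ i j, x j i = quatConj (x i j) := hx
      have hy' : ∀ i j, y j i = quatConj (y i j) := hy
      simp only [Matrix.add_apply, Matrix.mul_apply, quatConj_add, quatConj_sum, quatConj_mul]
      rw [add_comm]
      congr 1
      · exact Finset.sum_congr rfl fun l _ => by rw [hx' i l, hy' l j]
      · exact Finset.sum_congr rfl fun l _ => by rw [hx' l j, hy' i l])
    ((1 / (n : k)) • ∑ i, (1 / 2 : k) •
      (Matrix.traceLinearMap (Fin 2) k k ∘ₗ Matrix.entryLinearMap k _ i i))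
    (by
      intro x y
      simp only [LinearMap.smul_apply, LinearMap.sum_apply, LinearMap.comp_apply,
        Matrix.entryLinearMap_apply, Matrix.traceLinearMap_apply, Matrix.mul_apply,
        Matrix.trace_sum, Finset.smul_sum]
      rw [Finset.sum_comm]
      exact Finset.sum_congr rfl fun i _ => Finset.sum_congr rfl fun j _ => by
        rw [Matrix.trace_mul_comm])
    (by
      have : (n : k) ≠ 0 := Nat.cast_ne_zero.mpr hn
      simp [Matrix.trace_one, this])

/-- The Jordan algebra `J` is isomorphic to the Jordan algebra `sym(V, φ)` with the product
`½(fg + gf)`. -/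
def IsJordanSym {X V : Type*} [AddCommGroup X] [Module k X] [AddCommGroup V] [Module k V]
    (J : TitsIngredient k 1 X) (φ : LinearMap.BilinForm k V) : Prop :=
  ∃ j : X ≃ₗ[k] symEnd φ, ∀ x y,
    (j (J.mul x y)).1 = (1 / 2 : k) • ((j x).1 * (j y).1 + (j y).1 * (j x).1)

end Ingredients

/-! Write D for D(m, m) and g for g(m) = D ⊕ m.

Structure of D. The action of D on m is faithful and irreducible, so the radical of D is central and
the centre acts by scalars. A scalar t that is a derivation of the triple product satisfies t[x,y,w]
= 3t[x,y,w], so a nonzero t forces D = 0; hence the centre vanishes (`center_eq_bot`) and D is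
semisimple. As D is not simple, D = I ⊕ J with nonzero commuting ideals (`exists_ideals`). Two
consequences carry the proof. First, a D-stable subspace of g contains m or meets it trivially
(`vec_dichotomy`), so one that contains D is D or g. Second, because I and J are nonzero and meet in
0, m is the only D-stable complement of D in g (`ofVec_mem_of_complement`). So once g is realized by
matrices and D is located there, any explicit invariant complement is m, and both products are read
off from commutators.

Irreducible natural module. Let g be sl(V), so(V) or sp(V) and suppose that D is irreducible on V.
Burnside's theorem gives V = V₁ ⊗ V₂ with I acting on V₁ and J on V₂
(`exists_tensor_decomposition`), so D consists of maps a ⊗ 1 + 1 ⊗ f. For sl(V) the dichotomy gives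
D = sl(V₁) ⊕ sl(V₂), with complement sl(V₁) ⊗ sl(V₂). If there is an invariant form, it factors as
φ₁ ⊗ φ₂ by Schur's lemma (`exists_forms_of_invariant`), and its skew maps are skew ⊗ sym + sym ⊗
skew. The dichotomy, applied to D + skew ⊗ sym, shows that one factor has only scalar symmetric maps
(`scalar_or_scalar`); in dimension at least 2 this means a symplectic plane
(`eq_neg_one_of_symEnd_le`). What remains is sp(V₁) ⊗ sym₀(V₂).

Reducible natural module. D is then the full stabilizer of a proper subspace. In sl(V) such a
stabilizer contains a nonzero abelian ideal, which D cannot have (`irreducible_of_sl`). For so(V)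
and sp(V) the same argument, in two steps, excludes isotropic subspaces (`eq_bot_of_isotropic`), so
V = W ⊥ W^⊥, D is the algebra of block diagonal skew maps, and m = W ⊗ W^⊥ consists of the
off-diagonal ones (`conclusion_of_reducible`).

Small dimensions. Spaces of maps whose anticommutators are scalars are quadratic spaces on which the
double commutator is φ_{f,g}(h) up to a constant. So sl₂ ⊗ sl₂, and sp₂ ⊗ sym₀ of a four-dimensional
symplectic space, are orthogonal sums again (`hasProductsForms_of_anticomm`). In an orthogonal sum,
a plane would give a central so₂ in D, and a line gives D = so(V'), whose non-simplicity leads to a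
tensor product of two symplectic planes (`formsConclusion_of_quadric`).

Tits constructions. A surjective multiplicative map from g onto T(X, Y) transports the Lie
identities, so that T(X, Y) is a Lie algebra containing m as prescribed (`isInsideTits_of`). -/

set_option linter.unusedVariables false
set_option linter.unusedSectionVars false

/-! ### General facts on irreducible LY-algebras -/

namespace LieYamaguti

variable {k : Type*} {m : Type*} [Field k] [AddCommGroup m] [Module k m]

/-- The inclusion `D(m, m) ⊆ g(m)` as a linear map. -/
def ofDerₗ (L : LieYamaguti k m) : L.innerDer →ₗ[k] L.Envelope where
  toFun := L.ofDer
  map_add' x y := Envelope.ext' (fun _ => rfl) (add_zero (0 : m)).symm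
  map_smul' c x := Envelope.ext' (fun _ => rfl) (smul_zero c : c • (0 : m) = 0).symm

/-- The inclusion `m ⊆ g(m)` as a linear map. -/
def ofVecₗ (L : LieYamaguti k m) : m →ₗ[k] L.Envelope where
  toFun := L.ofVec
  map_add' x y := Envelope.ext' (fun z => (add_zero (0 : m)).symm) rfl
  map_smul' c x := Envelope.ext' (fun z => (smul_zero c : c • (0 : m) = 0).symm) rfl

@[simp] lemma ofDerₗ_apply (L : LieYamaguti k m) (d : L.innerDer) : L.ofDerₗ d = L.ofDer d := rfl

@[simp] lemma ofVecₗ_apply (L : LieYamaguti k m) (x : m) : L.ofVecₗ x = L.ofVec x := rfl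

lemma ofDer_add_ofVec (L : LieYamaguti k m) (z : L.Envelope) :
    L.ofDer z.1 + L.ofVec z.2 = z :=
  Envelope.ext' (fun _ => add_zero _) (zero_add _)

lemma ofDer_inj (L : LieYamaguti k m) {a b : L.innerDer} (h : L.ofDer a = L.ofDer b) : a = b :=
  congrArg Envelope.fst h

lemma ofVec_inj (L : LieYamaguti k m) {a b : m} (h : L.ofVec a = L.ofVec b) : a = b :=
  congrArg Envelope.snd h

lemma lie_ofDer_ofDer (L : LieYamaguti k m) (a b : L.innerDer) :
    ⁅L.ofDer a, L.ofDer b⁆ = L.ofDer ⁅a, b⁆ := by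
  refine Envelope.ext' (fun z => ?_) ?_
  · rw [Envelope.lie_fst_apply]
    change a.1 (b.1 z) - b.1 (a.1 z) + L.tri 0 0 z = a.1 (b.1 z) - b.1 (a.1 z)
    simp
  · rw [Envelope.lie_snd]
    change a.1 0 - b.1 0 + L.mul 0 0 = 0
    simp

lemma lie_ofDer_ofVec (L : LieYamaguti k m) (a : L.innerDer) (x : m) :
    ⁅L.ofDer a, L.ofVec x⁆ = L.ofVec (a.1 x) := by
  refine Envelope.ext' (fun z => ?_) ?_
  · rw [Envelope.lie_fst_apply]
    change a.1 0 - 0 + L.tri 0 x z = 0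
    simp
  · rw [Envelope.lie_snd]
    change a.1 x - 0 + L.mul 0 x = a.1 x
    simp

lemma lie_ofVec_ofVec (L : LieYamaguti k m) (x y : m) :
    ⁅L.ofVec x, L.ofVec y⁆ = L.ofDer (L.der x y) + L.ofVec (L.mul x y) := by
  refine Envelope.ext' (fun z => ?_) ?_
  · rw [Envelope.lie_fst_apply]
    change 0 - 0 + L.tri x y z = L.tri x y z + 0
    simp
  · rw [Envelope.lie_snd]
    change 0 - 0 + L.mul x y = 0 + L.mul x y
    simp

/-- A linear map on `D(m, m)` vanishes if it does on the `D(x, y)`. -/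
lemma innerDer_induction (L : LieYamaguti k m) {p : L.innerDer → Prop}
    (h0 : p 0) (hadd : ∀ a b, p a → p b → p (a + b)) (hsmul : ∀ (c : k) a, p a → p (c • a))
    (hder : ∀ x y, p (L.der x y)) (d : L.innerDer) : p d := by
  obtain ⟨d, hd⟩ := d
  have hd' : d ∈ Submodule.span k {d | ∃ x y, d = L.tri x y} := hd
  induction hd' using Submodule.span_induction with
  | zero => exact h0
  | add a b ha hb iha ihb => exact hadd ⟨a, ha⟩ ⟨b, hb⟩ (iha ha) (ihb hb)
  | smul c a ha iha => exact hsmul c ⟨a, ha⟩ (iha ha)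
  | mem a ha => obtain ⟨x, y, rfl⟩ := ha; exact hder x y

/-- A nonzero `D(m, m)`-stable subspace of an irreducible LY-algebra is everything. -/
lemma eq_top_of_stable (L : LieYamaguti k m) (hirr : L.IsIrreducible) (S : Submodule k m)
    (hS : ∀ d : L.innerDer, ∀ x ∈ S, d.1 x ∈ S) {x : m} (hx : x ∈ S) (hx0 : x ≠ 0) : S = ⊤ := by
  have : IsSimpleOrder (LieSubmodule k L.innerDer m) := hirr
  let N : LieSubmodule k L.innerDer m := { S with lie_mem := fun {d y} hy => hS d y hy }
  rcases eq_bot_or_eq_top N with h | h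
  · have : x ∈ N := hx
    rw [h] at this
    exact (hx0 (by simpa using this)).elim
  · refine Submodule.eq_top_iff'.mpr fun y => ?_
    have : y ∈ N := by rw [h]; trivial
    exact this

lemma nontrivial_of_isIrreducible (L : LieYamaguti k m) (hirr : L.IsIrreducible) :
    Nontrivial m := by
  have : IsSimpleOrder (LieSubmodule k L.innerDer m) := hirr
  exact LieModule.nontrivial_of_isIrreducible k L.innerDer m

/-- A subspace of `g(m)` stable under `D(m, m)` contains `m` or meets it trivially. -/
lemma vec_dichotomy (L : LieYamaguti k m) (hirr : L.IsIrreducible) (S : Submodule k L.Envelope)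
    (hS : ∀ d : L.innerDer, ∀ s ∈ S, ⁅L.ofDer d, s⁆ ∈ S) :
    (∀ x, L.ofVec x ∈ S) ∨ (∀ x, L.ofVec x ∈ S → x = 0) := by
  by_cases h : ∀ x, L.ofVec x ∈ S → x = 0
  · exact Or.inr h
  · push Not at h
    obtain ⟨x, hx, hx0⟩ := h
    left
    have := L.eq_top_of_stable hirr (S.comap L.ofVecₗ) (fun d y hy => by
      have := hS d _ hy
      rwa [ofVecₗ_apply, lie_ofDer_ofVec] at this) (x := x) hx hx0
    intro y
    have hy : y ∈ S.comap L.ofVecₗ := by rw [this]; trivial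
    exact hy

instance (L : LieYamaguti k m) : LieModule.IsFaithful k L.innerDer m :=
  ⟨fun a b h => Subtype.ext (LinearMap.ext fun x => LinearMap.congr_fun h x)⟩

variable [IsAlgClosed k] [CharZero k] [FiniteDimensional k m]

/-- A central element acts by a scalar t, and it is a derivation of the triple product: t[x,y,w] =
3t[x,y,w]. If t ≠ 0, the triple product vanishes, and then so does D(m, m). -/
lemma center_eq_bot (L : LieYamaguti k m) (hirr : L.IsIrreducible) :
    LieAlgebra.center k L.innerDer = ⊥ := by
  have : IsSimpleOrder (LieSubmodule k L.innerDer m) := hirr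
  rw [LieSubmodule.eq_bot_iff]
  intro z hz
  obtain ⟨-, h⟩ := LieAlgebra.hasCentralRadical_and_of_isIrreducible_of_isFaithful k L.innerDer m
  obtain ⟨t, ht⟩ := Submodule.mem_span_singleton.mp ((h z).mp hz)
  have hz' : ∀ x, z.1 x = t • x := fun x => (LinearMap.congr_fun ht x).symm
  by_cases ht0 : t = 0
  · exact Subtype.ext (LinearMap.ext fun x => by rw [hz' x, ht0, zero_smul]; rfl)
  · have htri : ∀ x y w, L.tri x y w = 0 := by
      intro x y w
      have h1 := L.innerDer_tri z x y w
      simp only [hz', map_smul, LinearMap.smul_apply] at h1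
      have h2 : (2 * t) • L.tri x y w = 0 := by
        linear_combination (norm := module) -h1
      exact (smul_eq_zero.mp h2).resolve_left (by simp [ht0])
    have : ∀ d : L.innerDer, d = 0 := by
      refine L.innerDer_induction rfl ?_ ?_ ?_
      · rintro a b rfl rfl; simp
      · rintro c a rfl; simp
      · intro x y; exact Subtype.ext (LinearMap.ext fun w => htri x y w)
    exact this z

/-- A Lie algebra with a faithful irreducible module has central radical, and here the centre is
zero. -/
lemma hasTrivialRadical (L : LieYamaguti k m) (hirr : L.IsIrreducible) :
    LieAlgebra.HasTrivialRadical k L.innerDer := by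
  have : IsSimpleOrder (LieSubmodule k L.innerDer m) := hirr
  obtain ⟨h, -⟩ := LieAlgebra.hasCentralRadical_and_of_isIrreducible_of_isFaithful k L.innerDer m
  rw [LieAlgebra.hasTrivialRadical_iff, h.radical_eq_center, L.center_eq_bot hirr]

lemma eq_zero_of_central (L : LieYamaguti k m) (hirr : L.IsIrreducible) (z : L.innerDer)
    (hz : ∀ d : L.innerDer, ⁅d, z⁆ = 0) : z = 0 := by
  have : z ∈ LieAlgebra.center k L.innerDer := (LieModule.mem_maxTrivSubmodule k _ _ z).mpr hz
  rw [L.center_eq_bot hirr] at this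
  simpa using this

/-- `D(m, m)` has no nonzero abelian ideals. -/
lemma eq_zero_of_mem_abelian_ideal (L : LieYamaguti k m) (hirr : L.IsIrreducible)
    (N : Submodule k L.innerDer) (hN : ∀ d : L.innerDer, ∀ a ∈ N, ⁅d, a⁆ ∈ N)
    (hab : ∀ a ∈ N, ∀ b ∈ N, ⁅a, b⁆ = 0) (a : L.innerDer) (ha : a ∈ N) : a = 0 := by
  have := L.hasTrivialRadical hirr
  let I : LieIdeal k L.innerDer := { N with lie_mem := fun {d y} hy => hN d y hy }
  have hI : IsLieAbelian I := ⟨fun x y => Subtype.ext (hab x.1 x.2 y.1 y.2)⟩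
  have : I = ⊥ := LieAlgebra.HasTrivialRadical.eq_bot_of_isSolvable I
  have ha' : a ∈ I := ha
  rw [this] at ha'
  simpa using ha'

/-- The inner derivation algebra of an irreducible LY-algebra of non-simple type with simple
enveloping algebra is the direct sum of two nonzero commuting ideals. -/
lemma exists_ideals (L : LieYamaguti k m) (hirr : L.IsIrreducible) (hns : L.IsNonSimpleType)
    (hsimple : LieAlgebra.IsSimple k L.Envelope) :
    ∃ I J : LieIdeal k L.innerDer, (∃ a ∈ I, a ≠ 0) ∧ (∃ b ∈ J, b ≠ 0) ∧
      (∀ a ∈ I, ∀ b ∈ J, ⁅a, b⁆ = 0) ∧ (∀ a ∈ I, a ∈ J → a = 0) ∧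
      (∀ d, ∃ a ∈ I, ∃ b ∈ J, d = a + b) := by
  have := L.hasTrivialRadical hirr
  -- If D is abelian, it is central and hence zero. Every line in m is then stable, so m is a line,
  -- the alternating binary product vanishes as well, and g(m) is abelian.
  have hnab : ¬ IsLieAbelian L.innerDer := by
    intro hab
    have h0 : ∀ d : L.innerDer, d = 0 := fun d =>
      L.eq_zero_of_central hirr d fun d' => trivial_lie_zero _ _ _ _
    have htri : ∀ x y z, L.tri x y z = 0 := fun x y z =>
      LinearMap.congr_fun (congrArg Subtype.val (h0 (L.der x y))) z
    have := L.nontrivial_of_isIrreducible hirr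
    obtain ⟨x, hx⟩ := exists_ne (0 : m)
    have hspan := L.eq_top_of_stable hirr (Submodule.span k {x})
      (fun d y _ => by rw [h0 d]; exact zero_mem _) (Submodule.mem_span_singleton_self x) hx
    have hmul : ∀ y z, L.mul y z = 0 := by
      intro y z
      have hy : y ∈ Submodule.span k {x} := by rw [hspan]; trivial
      have hz : z ∈ Submodule.span k {x} := by rw [hspan]; trivial
      obtain ⟨c, rfl⟩ := Submodule.mem_span_singleton.mp hy
      obtain ⟨c', rfl⟩ := Submodule.mem_span_singleton.mp hz
      simp [L.mul_self]
    refine hsimple.non_abelian ⟨fun a b => Envelope.ext' (fun z => ?_) ?_⟩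
    · rw [Envelope.lie_fst_apply, h0 a.1, h0 b.1, htri]
      simp; rfl
    · rw [Envelope.lie_snd, h0 a.1, h0 b.1, hmul]
      simp; rfl
  obtain ⟨I, hI⟩ : ∃ I : LieIdeal k L.innerDer, ¬ (I = ⊥ ∨ I = ⊤) := by
    by_contra h
    push Not at h
    exact hns ⟨fun I => by have := h I; tauto, hnab⟩
  push Not at hI
  -- In a semisimple algebra the Killing orthogonal of an ideal is a complementary ideal. The two
  -- commute because their bracket lies in both.
  have hc := LieIdeal.isCompl_killingCompl I
  have hinf : ∀ a ∈ I, a ∈ LieIdeal.killingCompl k L.innerDer I → a = 0 := by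
    intro a ha hb
    have : a ∈ I ⊓ LieIdeal.killingCompl k L.innerDer I := ⟨ha, hb⟩
    rw [hc.inf_eq_bot] at this
    simpa using this
  refine ⟨I, LieIdeal.killingCompl k L.innerDer I, ?_, ?_, ?_, hinf, ?_⟩
  · by_contra h
    push Not at h
    exact hI.1 ((LieSubmodule.eq_bot_iff _).mpr h)
  · by_contra h
    push Not at h
    have h0 := (LieSubmodule.eq_bot_iff _).mpr h
    have := hc.sup_eq_top
    rw [h0, sup_bot_eq] at this
    exact hI.2 this
  · intro a ha b hb
    refine hinf _ ?_ (lie_mem_right k _ _ a b hb)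
    exact lie_mem_left k _ _ a b ha
  · intro d
    have : d ∈ I ⊔ LieIdeal.killingCompl k L.innerDer I := by rw [hc.sup_eq_top]; trivial
    obtain ⟨a, ha, b, hb, rfl⟩ := (LieSubmodule.mem_sup _ _ _).mp this
    exact ⟨a, ha, b, hb, rfl⟩

/-- Any `D(m, m)`-stable complement of `D(m, m)` in `g(m)` contains `m`, if `D(m, m)` is a direct
sum of two nonzero commuting ideals. -/
lemma ofVec_mem_of_complement (L : LieYamaguti k m) (hirr : L.IsIrreducible)
    (hns : L.IsNonSimpleType) (hsimple : LieAlgebra.IsSimple k L.Envelope)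
    (M : Submodule k L.Envelope) (hM : ∀ d : L.innerDer, ∀ s ∈ M, ⁅L.ofDer d, s⁆ ∈ M)
    (hdisj : ∀ d, L.ofDer d ∈ M → d = 0) (hsup : ∀ x, ∃ d, L.ofVec x - L.ofDer d ∈ M) (x : m) :
    L.ofVec x ∈ M := by
  obtain ⟨I, J, ⟨a, haI, ha⟩, ⟨b, hbJ, hb⟩, -, hinf, -⟩ := L.exists_ideals hirr hns hsimple
  -- The vectors x that are congruent to an element of K modulo M form a stable subspace. It is
  -- nonzero: if x - d ∈ M and a ∈ K, then a(x) - [a, d] ∈ M with [a, d] ∈ K. By irreducibility it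
  -- is all of m.
  have key : ∀ (K : LieIdeal k L.innerDer), (∃ a ∈ K, a ≠ 0) →
      ∀ x, ∃ d ∈ K, L.ofVec x - L.ofDer d ∈ M := by
    rintro K ⟨a, haK, ha⟩
    let A : Submodule k m :=
      { carrier := {x | ∃ d ∈ K, L.ofVec x - L.ofDer d ∈ M}
        zero_mem' := ⟨0, zero_mem _, by
          rw [← ofVecₗ_apply, ← ofDerₗ_apply, map_zero, map_zero, sub_zero]; exact zero_mem _⟩
        add_mem' := by
          rintro x y ⟨d, hd, h⟩ ⟨d', hd', h'⟩
          refine ⟨d + d', add_mem hd hd', ?_⟩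
          have := add_mem h h'
          rw [← ofVecₗ_apply, ← ofDerₗ_apply] at this ⊢
          rw [← ofVecₗ_apply, ← ofDerₗ_apply] at this
          rw [map_add, map_add]
          convert this using 1
          abel
        smul_mem' := by
          rintro c x ⟨d, hd, h⟩
          refine ⟨c • d, K.smul_mem c hd, ?_⟩
          have := M.smul_mem c h
          rw [← ofVecₗ_apply, ← ofDerₗ_apply] at this ⊢
          rwa [map_smul, map_smul, ← smul_sub] }
    have hlie : ∀ e d : L.innerDer, ∀ x, L.ofVec x - L.ofDer d ∈ M →
        L.ofVec (e.1 x) - L.ofDer ⁅e, d⁆ ∈ M := by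
      intro e d x h
      have := hM e _ h
      rwa [lie_sub, lie_ofDer_ofVec, lie_ofDer_ofDer] at this
    have hax : ∃ x, a.1 x ≠ 0 := by
      by_contra h
      push Not at h
      exact ha (Subtype.ext (LinearMap.ext h))
    obtain ⟨x, hx⟩ := hax
    have hA : A = ⊤ := by
      refine L.eq_top_of_stable hirr A ?_ (x := a.1 x) ?_ hx
      · rintro e y ⟨d, hd, h⟩
        exact ⟨⁅e, d⁆, lie_mem_right k _ _ e d hd, hlie e d y h⟩
      · obtain ⟨d, hd⟩ := hsup x
        exact ⟨⁅a, d⁆, lie_mem_left k _ _ a d haK, hlie a d x hd⟩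
    intro y
    have hy : y ∈ A := by rw [hA]; trivial
    exact hy
  -- As M meets D trivially, the element of D congruent to x modulo M is unique. It therefore lies
  -- in both I and J, and vanishes.
  obtain ⟨d, hd, h⟩ := key I ⟨a, haI, ha⟩ x
  obtain ⟨d', hd', h'⟩ := key J ⟨b, hbJ, hb⟩ x
  have h2 : L.ofDer (d - d') ∈ M := by
    have := sub_mem h' h
    rw [← ofDerₗ_apply, map_sub, ofDerₗ_apply, ofDerₗ_apply]
    convert this using 1
    abel
  have h3 := sub_eq_zero.mp (hdisj _ h2)
  have h4 : d = 0 := hinf d hd (h3 ▸ hd')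
  rw [h4, ← ofDerₗ_apply, map_zero, sub_zero] at h
  exact h

end LieYamaguti

/-! ### Linear algebra of `ε`-symmetric forms and of tensor products -/

section FormLemmas

variable {k : Type*} [Field k] {V W : Type*} [AddCommGroup V] [Module k V]
  [AddCommGroup W] [Module k W]

lemma mem_skewAdjoint_iff {φ : LinearMap.BilinForm k V} {f : Module.End k V} :
    f ∈ skewAdjointLieSubalgebra φ ↔ ∀ v w, φ (f v) w = - φ v (f w) := by
  have : f ∈ skewAdjointLieSubalgebra φ ↔ LinearMap.IsAdjointPair φ φ f (-f : Module.End k V) :=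
    LinearMap.mem_skewAdjointSubmodule f
  rw [this]
  simp [LinearMap.IsAdjointPair]

lemma mem_symEnd_iff {φ : LinearMap.BilinForm k V} {f : Module.End k V} :
    f ∈ symEnd φ ↔ ∀ v w, φ (f v) w = φ v (f w) := Iff.rfl

lemma nondegenerate_of_left {ε : k} {φ : LinearMap.BilinForm k V} (h : IsEpsSymm ε φ)
    (hn : ∀ v, (∀ w, φ v w = 0) → v = 0) : φ.Nondegenerate := by
  have h1 : LinearMap.SeparatingLeft φ := hn
  refine ⟨h1, fun w hw => hn w fun v => ?_⟩
  rw [h w v, hw v, mul_zero]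

lemma IsEpsSymm.isRefl {ε : k} {φ : LinearMap.BilinForm k V} (h : IsEpsSymm ε φ) : φ.IsRefl := by
  intro v w hvw
  rw [h w v, hvw, mul_zero]

lemma eq_zero_of_nondegenerate {φ : LinearMap.BilinForm k V} (hn : φ.Nondegenerate) {v : V}
    (h : ∀ w, φ v w = 0) : v = 0 := hn.1 v h

lemma eq_of_nondegenerate {φ : LinearMap.BilinForm k V} (hn : φ.Nondegenerate) {v v' : V}
    (h : ∀ w, φ v w = φ v' w) : v = v' :=
  sub_eq_zero.mp (eq_zero_of_nondegenerate hn fun w => by simp [h w])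

lemma exists_form_eq_one {φ : LinearMap.BilinForm k V} (hn : φ.Nondegenerate) {v : V}
    (hv : v ≠ 0) : ∃ w, φ v w = 1 := by
  by_contra h
  push Not at h
  refine hv (eq_zero_of_nondegenerate hn fun w => ?_)
  by_contra hw
  exact h ((φ v w)⁻¹ • w) (by simp [hw])

lemma exists_form_eq_one' {φ : LinearMap.BilinForm k V} (hn : φ.Nondegenerate) {v : V}
    (hv : v ≠ 0) : ∃ w, φ w v = 1 := by
  by_contra h
  push Not at h
  refine hv (hn.2 v fun w => ?_)
  by_contra hw
  exact h ((φ w v)⁻¹ • w) (by simp [hw])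

/-- `φ_{v,w}` as a bilinear map in `(v, w)`. -/
def phiMapₗ (ε : k) (φ : LinearMap.BilinForm k V) : V →ₗ[k] V →ₗ[k] Module.End k V :=
  LinearMap.mk₂ k (phiMap ε φ)
    (fun v v' w => LinearMap.ext fun z => by
      simp only [phiMap_apply, map_add, LinearMap.add_apply]; module)
    (fun c v w => LinearMap.ext fun z => by
      simp only [phiMap_apply, map_smul, LinearMap.smul_apply, smul_eq_mul]; module)
    (fun v w w' => LinearMap.ext fun z => by
      simp only [phiMap_apply, map_add, LinearMap.add_apply]; module)
    (fun c v w => LinearMap.ext fun z => by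
      simp only [phiMap_apply, map_smul, LinearMap.smul_apply, smul_eq_mul]; module)

variable {ε : k} {φ : LinearMap.BilinForm k V}

lemma phiMap_mem (hε : ε * ε = 1) (hφ : IsEpsSymm ε φ) (v w : V) :
    phiMap ε φ v w ∈ skewAdjointLieSubalgebra φ := by
  rw [mem_skewAdjoint_iff]
  intro x y
  simp only [phiMap_apply, map_sub, map_smul, LinearMap.sub_apply, LinearMap.smul_apply,
    smul_eq_mul]
  rw [hφ x w, hφ x v]
  linear_combination (-φ v x * φ w y) * hε

lemma phiMap_swap (hε : ε * ε = 1) (v w : V) : phiMap ε φ w v = -ε • phiMap ε φ v w := by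
  refine LinearMap.ext fun z => ?_
  simp only [phiMap_apply, LinearMap.smul_apply]
  linear_combination (norm := module) (-hε) • (φ w z • v)

lemma lie_phiMap {f : Module.End k V} (hf : f ∈ skewAdjointLieSubalgebra φ) (v w : V) :
    ⁅f, phiMap ε φ v w⁆ = phiMap ε φ (f v) w + phiMap ε φ v (f w) := by
  rw [mem_skewAdjoint_iff] at hf
  refine LinearMap.ext fun z => ?_
  simp only [Ring.lie_def, LinearMap.sub_apply, Module.End.mul_apply, LinearMap.add_apply,
    phiMap_apply, map_sub, map_smul, hf]
  module

lemma trace_smulRight [FiniteDimensional k V] (l : V →ₗ[k] k) (v : V) :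
    LinearMap.trace k V (l.smulRight v) = l v := by
  have := LinearMap.trace_eq_contract_apply (R := k) (M := V) (l ⊗ₜ[k] v)
  rw [contractLeft_apply] at this
  rw [← this]
  congr 1

lemma trace_phiMap [FiniteDimensional k V] (hφ : IsEpsSymm ε φ) (v w : V) :
    LinearMap.trace k V (phiMap ε φ v w) = 0 := by
  rw [phiMap, map_sub, map_smul, trace_smulRight, trace_smulRight, hφ v w, smul_eq_mul, sub_self]

variable [FiniteDimensional k V] [CharZero k]

/-- The `φ_{v,w}` span the `φ`-skew maps. -/
lemma mem_span_phiMap (hε : ε * ε = 1) (hφ : IsEpsSymm ε φ) (hn : φ.Nondegenerate)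
    {f : Module.End k V} (hf : f ∈ skewAdjointLieSubalgebra φ) :
    f ∈ Submodule.span k {d | ∃ v w, d = phiMap ε φ v w} := by
  classical
  rw [mem_skewAdjoint_iff] at hf
  let b := Module.finBasis k V
  let b' := φ.dualBasis hn b
  have hb : ∀ i j, φ (b' i) (b j) = if j = i then 1 else 0 := fun i j =>
    LinearMap.BilinForm.apply_dualBasis_left hn b i j
  -- With φ(b'ᵢ, bⱼ) = δᵢⱼ, the first terms of the φ_{b'ᵢ, f(bᵢ)} add up to f by expansion in b. By
  -- skewness of f, the second terms add up to -f by expansion in b', and they enter with a minus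
  -- sign.
  have key : (2 : k) • f = ∑ i, phiMap ε φ (b' i) (f (b i)) := by
    have h1 : ∀ z, ∑ i, φ (b' i) z • f (b i) = f z := by
      intro z
      conv_rhs => rw [← b.sum_repr z, map_sum]
      refine Finset.sum_congr rfl fun i _ => ?_
      rw [map_smul]
      congr 1
      conv_lhs => rw [← b.sum_repr z, map_sum]
      simp [hb]
    have h2 : ∀ z, ∑ i, (ε * φ (f (b i)) z) • b' i = - f z := by
      intro z
      refine b'.ext_elem (fun i => ?_) 
      rw [map_sum, map_neg]
      simp only [map_smul, Finsupp.finsetSum_apply, Finsupp.smul_apply, Module.Basis.repr_self,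
        Finsupp.neg_apply]
      rw [Finset.sum_eq_single i]
      · have : b'.repr (f z) i = φ (f z) (b i) :=
          LinearMap.BilinForm.dualBasis_repr_apply hn b (f z) i
        rw [this, hφ (f z) (b i), hf]
        simp
      · intro j _ hj
        simp [Finsupp.single_eq_of_ne hj.symm]
      · simp
    refine LinearMap.ext fun z => ?_
    rw [LinearMap.sum_apply]
    simp only [phiMap_apply, Finset.sum_sub_distrib, h1, h2, LinearMap.smul_apply]
    module
  have : f = (1 / 2 : k) • ∑ i, phiMap ε φ (b' i) (f (b i)) := by
    rw [← key, smul_smul]; norm_num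
  rw [this]
  exact Submodule.smul_mem _ _ (Submodule.sum_mem _ fun i _ => Submodule.subset_span ⟨_, _, rfl⟩)

lemma trace_eq_zero_of_skew (hε : ε * ε = 1) (hφ : IsEpsSymm ε φ) (hn : φ.Nondegenerate)
    {f : Module.End k V} (hf : f ∈ skewAdjointLieSubalgebra φ) : LinearMap.trace k V f = 0 := by
  have := mem_span_phiMap hε hφ hn hf
  clear hf
  induction this using Submodule.span_induction with
  | zero => simp
  | add a b _ _ ha hb => rw [map_add, ha, hb, add_zero]
  | smul c a _ ha => rw [map_smul, ha, smul_zero]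
  | mem a ha => obtain ⟨v, w, rfl⟩ := ha; exact trace_phiMap hφ v w

end FormLemmas

/-! ### Endomorphisms of a tensor product and their partial contractions -/

section TensorEnd

variable {k : Type*} [Field k] {V W : Type*} [AddCommGroup V] [Module k V]
  [AddCommGroup W] [Module k W]

/-- The map `(a, f) ↦ a ⊗ 1 + 1 ⊗ f`. -/
noncomputable def kronSum (k V W : Type*) [Field k] [AddCommGroup V] [Module k V]
    [AddCommGroup W] [Module k W] :
    (Module.End k V × Module.End k W) →ₗ[k] Module.End k (V ⊗[k] W) :=
  (TensorProduct.mapBilinear (.id k) V W V W).flip LinearMap.id ∘ₗ LinearMap.fst k _ _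
    + TensorProduct.mapBilinear (.id k) V W V W LinearMap.id ∘ₗ LinearMap.snd k _ _

lemma kronSum_apply (a : Module.End k V) (f : Module.End k W) :
    kronSum k V W (a, f)
      = TensorProduct.map a LinearMap.id + TensorProduct.map LinearMap.id f := rfl

lemma kronSum_tmul (a : Module.End k V) (f : Module.End k W) (v : V) (w : W) :
    kronSum k V W (a, f) (v ⊗ₜ w) = a v ⊗ₜ w + v ⊗ₜ f w := rfl

lemma lie_kronSum_kronSum (a b : Module.End k V) (f g : Module.End k W) :
    ⁅kronSum k V W (a, f), kronSum k V W (b, g)⁆ = kronSum k V W (⁅a, b⁆, ⁅f, g⁆) := by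
  refine TensorProduct.ext' fun v w => ?_
  simp only [Ring.lie_def, LinearMap.sub_apply, Module.End.mul_apply, kronSum_tmul, map_add,
    TensorProduct.sub_tmul, TensorProduct.tmul_sub]
  abel

lemma lie_kronSum_map (a b : Module.End k V) (f g : Module.End k W) :
    ⁅kronSum k V W (a, f), TensorProduct.map b g⁆
      = TensorProduct.map ⁅a, b⁆ g + TensorProduct.map b ⁅f, g⁆ := by
  refine TensorProduct.ext' fun v w => ?_
  simp only [Ring.lie_def, LinearMap.sub_apply, LinearMap.add_apply, Module.End.mul_apply,
    kronSum_tmul, TensorProduct.map_tmul, TensorProduct.sub_tmul, TensorProduct.tmul_sub]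
  abel

/-- `End V ⊗ End W ≃ End (V ⊗ W)`. -/
noncomputable def endTensor (k V W : Type*) [Field k] [AddCommGroup V] [Module k V]
    [AddCommGroup W] [Module k W] [FiniteDimensional k V] [FiniteDimensional k W] :
    Module.End k V ⊗[k] Module.End k W ≃ₗ[k] Module.End k (V ⊗[k] W) :=
  homTensorHomEquiv k V W V W

variable [FiniteDimensional k V] [FiniteDimensional k W]

@[simp] lemma endTensor_tmul (a : Module.End k V) (f : Module.End k W) :
    endTensor k V W (a ⊗ₜ f) = TensorProduct.map a f := by
  simp [endTensor]

/-- `End (V ⊗ W)` is spanned by the `a ⊗ f`. -/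
lemma endTensor_induction {p : Module.End k (V ⊗[k] W) → Prop} (h0 : p 0)
    (hadd : ∀ x y, p x → p y → p (x + y)) (hmap : ∀ a f, p (TensorProduct.map a f))
    (x : Module.End k (V ⊗[k] W)) : p x := by
  obtain ⟨u, rfl⟩ := (endTensor k V W).surjective x
  induction u with
  | zero => simpa using h0
  | tmul a f => simpa using hmap a f
  | add u v hu hv => rw [map_add]; exact hadd _ _ hu hv

/-- Apply a linear form to the second factor of `End (V ⊗ W) = End V ⊗ End W`. -/
noncomputable def contractSnd (l : Module.End k W →ₗ[k] k) :
    Module.End k (V ⊗[k] W) →ₗ[k] Module.End k V :=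
  (TensorProduct.rid k _).toLinearMap ∘ₗ l.lTensor _ ∘ₗ (endTensor k V W).symm.toLinearMap

/-- Apply a linear form to the first factor of `End (V ⊗ W) = End V ⊗ End W`. -/
noncomputable def contractFst (l : Module.End k V →ₗ[k] k) :
    Module.End k (V ⊗[k] W) →ₗ[k] Module.End k W :=
  (TensorProduct.lid k _).toLinearMap ∘ₗ l.rTensor _ ∘ₗ (endTensor k V W).symm.toLinearMap

@[simp] lemma contractSnd_map (l : Module.End k W →ₗ[k] k) (a : Module.End k V)
    (f : Module.End k W) : contractSnd l (TensorProduct.map a f) = l f • a := by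
  simp [contractSnd, ← endTensor_tmul]

@[simp] lemma contractFst_map (l : Module.End k V →ₗ[k] k) (a : Module.End k V)
    (f : Module.End k W) : contractFst l (TensorProduct.map a f) = l a • f := by
  simp [contractFst, ← endTensor_tmul]

lemma trace_one' (k V : Type*) [Field k] [AddCommGroup V] [Module k V] [FiniteDimensional k V] :
    LinearMap.trace k V LinearMap.id = (Module.finrank k V : k) := LinearMap.trace_one k V

/-- The partial trace over `W` of a ⊗ 1 + 1 ⊗ f is (dim W) a when tr f = 0, and symmetrically for
`V`. Without the trace conditions the kernel contains the pairs (c, -c) of scalars. -/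
lemma kronSum_eq_zero [CharZero k] [Nontrivial V] [Nontrivial W] {a : Module.End k V}
    {f : Module.End k W} (ha : LinearMap.trace k V a = 0) (hf : LinearMap.trace k W f = 0)
    (h : kronSum k V W (a, f) = 0) : a = 0 ∧ f = 0 := by
  have hV : (Module.finrank k V : k) ≠ 0 := Nat.cast_ne_zero.mpr Module.finrank_pos.ne'
  have hW : (Module.finrank k W : k) ≠ 0 := Nat.cast_ne_zero.mpr Module.finrank_pos.ne'
  constructor
  · have := congrArg (contractSnd (LinearMap.trace k W)) h
    rw [kronSum_apply, map_add, contractSnd_map, contractSnd_map, hf, zero_smul, add_zero,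
      map_zero, trace_one'] at this
    exact (smul_eq_zero.mp this).resolve_left hW
  · have := congrArg (contractFst (LinearMap.trace k V)) h
    rw [kronSum_apply, map_add, contractFst_map, contractFst_map, ha, zero_smul, zero_add,
      map_zero, trace_one'] at this
    exact (smul_eq_zero.mp this).resolve_left hV

end TensorEnd

/-! ### Recognizing LY-algebras inside Tits constructions -/

lemma TitsIngredient.act_zero {k : Type*} [Field k] {ε : k} {X : Type*} [AddCommGroup X]
    [Module k X] (A : TitsIngredient k ε X) : A.act 0 = 0 := rfl

namespace LieYamaguti

variable {k : Type*} {m : Type*} [Field k] [AddCommGroup m] [Module k m]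
variable {ε : k} {X Y : Type*} [AddCommGroup X] [Module k X] [AddCommGroup Y] [Module k Y]

/-- The hypotheses say that (d, x) ↦ (α d, e⁻¹ x, β d) is a multiplicative map from g(m) to T(X, Y),
surjective by `hsurj`. The Lie identities therefore pass from g(m) to T(X, Y) and need no separate
verification. Injectivity on D(m, m) is not required. -/
lemma isInsideTits_of (L : LieYamaguti k m) (A : TitsIngredient k ε X) (B : TitsIngredient k ε Y)
    (e : (A.Zero ⊗[k] B.Zero) ≃ₗ[k] m) (α : L.innerDer →ₗ⁅k⁆ A.inner) (β : L.innerDer →ₗ⁅k⁆ B.inner)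
    (hsurj : ∀ a b, ∃ d, α d = a ∧ β d = b)
    (hact : ∀ d x y, d.1 (e (x ⊗ₜ y)) = e (A.act (α d) x ⊗ₜ y + x ⊗ₜ B.act (β d) y))
    (hα : ∀ x y x' y', α (L.der (e (x ⊗ₜ y)) (e (x' ⊗ₜ y'))) = B.form y y' • A.DInner x x')
    (hβ : ∀ x y x' y', β (L.der (e (x ⊗ₜ y)) (e (x' ⊗ₜ y'))) = A.form x x' • B.DInner y y')
    (hmul : ∀ x y x' y', L.mul (e (x ⊗ₜ y)) (e (x' ⊗ₜ y')) = e (A.star x x' ⊗ₜ B.star y y')) :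
    L.IsInsideTits A B := by
  let derₗ : m →ₗ[k] m →ₗ[k] L.innerDer := LinearMap.mk₂ k L.der
    (fun x x' y => Subtype.ext (by simp [der])) (fun c x y => Subtype.ext (by simp [der]))
    (fun x y y' => Subtype.ext (by simp [der])) (fun c x y => Subtype.ext (by simp [der]))
  have hact' : ∀ d u, d.1 (e u)
      = e ((A.act (α d)).rTensor B.Zero u + (B.act (β d)).lTensor A.Zero u) := by
    intro d u
    induction u with
    | zero => simp
    | tmul x y => simpa using hact d x y
    | add u v hu hv => simp only [map_add, hu, hv]; abel
  have hder : ∀ x y, derₗ x y = L.der x y := fun _ _ => rfl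
  have hα' : ∀ u v, α (L.der (e u) (e v))
      = TensorProduct.rid k A.inner (TensorProduct.map₂ A.DInner B.form u v) := by
    intro u v
    have : (derₗ.compl₁₂ e.toLinearMap e.toLinearMap).compr₂ (α : L.innerDer →ₗ[k] A.inner)
        = (TensorProduct.map₂ A.DInner B.form).compr₂ (TensorProduct.rid k A.inner).toLinearMap := by
      ext x y x' y' : 6
      simpa [hder] using hα x y x' y'
    exact LinearMap.congr_fun₂ this u v
  have hβ' : ∀ u v, β (L.der (e u) (e v))
      = TensorProduct.lid k B.inner (TensorProduct.map₂ A.form B.DInner u v) := by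
    intro u v
    have : (derₗ.compl₁₂ e.toLinearMap e.toLinearMap).compr₂ (β : L.innerDer →ₗ[k] B.inner)
        = (TensorProduct.map₂ A.form B.DInner).compr₂ (TensorProduct.lid k B.inner).toLinearMap := by
      ext x y x' y' : 6
      simpa [hder] using hβ x y x' y'
    exact LinearMap.congr_fun₂ this u v
  have hmul' : ∀ u v, L.mul (e u) (e v) = e (TensorProduct.map₂ A.star B.star u v) := by
    intro u v
    have : L.mul.compl₁₂ e.toLinearMap e.toLinearMap
        = (TensorProduct.map₂ A.star B.star).compr₂ e.toLinearMap := by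
      ext x y x' y' : 6
      simpa using hmul x y x' y'
    exact LinearMap.congr_fun₂ this u v
  let F : L.Envelope → TitsSpace A B := fun z => (α z.1, e.symm z.2, β z.1)
  have hF : Function.Surjective F := by
    rintro ⟨a, u, b⟩
    obtain ⟨d, rfl, rfl⟩ := hsurj a b
    exact ⟨⟨d, e u⟩, by simp [F]⟩
  have hF0 : F 0 = 0 := by
    change (α 0, e.symm 0, β 0) = 0
    simp
  have hFadd : ∀ x y, F (x + y) = F x + F y := by
    intro x y
    change (α (x.1 + y.1), e.symm (x.2 + y.2), β (x.1 + y.1)) = _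
    simp [F]
  have hFlie : ∀ x y, F ⁅x, y⁆ = titsBracket A B (F x) (F y) := by
    rintro ⟨d, x⟩ ⟨d', x'⟩
    obtain ⟨u, rfl⟩ := e.surjective x
    obtain ⟨v, rfl⟩ := e.surjective x'
    change (α (⁅d, d'⁆ + L.der (e u) (e v)), e.symm (d.1 (e v) - d'.1 (e u) + L.mul (e u) (e v)),
      β (⁅d, d'⁆ + L.der (e u) (e v))) = _
    simp only [map_add, map_sub, hact', hmul', hα', hβ', LieHom.map_lie]
    simp [F, titsBracket]
  refine ⟨⟨fun p => ?_, fun p q r => ?_⟩, e, fun u v => ?_, fun u v w => ?_⟩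
  · obtain ⟨z, rfl⟩ := hF p
    rw [← hFlie, lie_self, hF0]
  · obtain ⟨x, rfl⟩ := hF p
    obtain ⟨y, rfl⟩ := hF q
    obtain ⟨z, rfl⟩ := hF r
    simp only [← hFlie, ← hFadd]
    rw [leibniz_lie]
  · rw [hmul']
    simp [titsMul, titsBracket, TitsIngredient.act_zero]
  · have : L.tri (e u) (e v) (e w) = (L.der (e u) (e v)).1 (e w) := rfl
    rw [this, hact', hα', hβ']
    simp [titsTri, titsBracket, TitsIngredient.act_zero]

end LieYamaguti

/-! ### LY-algebras given by a pair of forms -/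

section OffDiagonal

variable {k : Type*} [Field k] {V₁ V₂ : Type*} [AddCommGroup V₁] [Module k V₁]
  [AddCommGroup V₂] [Module k V₂] {ε : k}
  {φ₁ : LinearMap.BilinForm k V₁} {φ₂ : LinearMap.BilinForm k V₂}

@[simp] lemma orthSum_apply (v w : V₁ × V₂) :
    orthSum φ₁ φ₂ v w = φ₁ v.1 w.1 + φ₂ v.2 w.2 := rfl

lemma orthSum_isEpsSymm (h₁ : IsEpsSymm ε φ₁) (h₂ : IsEpsSymm ε φ₂) :
    IsEpsSymm ε (orthSum φ₁ φ₂) := by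
  intro v w
  rw [orthSum_apply, orthSum_apply, h₁ v.1, h₂ v.2, mul_add]

lemma orthSum_nondegenerate (h₁ : IsEpsSymm ε φ₁) (h₂ : IsEpsSymm ε φ₂)
    (hn₁ : φ₁.Nondegenerate) (hn₂ : φ₂.Nondegenerate) : (orthSum φ₁ φ₂).Nondegenerate := by
  refine nondegenerate_of_left (orthSum_isEpsSymm h₁ h₂) fun v hv => Prod.ext ?_ ?_
  · exact eq_zero_of_nondegenerate hn₁ fun w => by simpa using hv (w, 0)
  · exact eq_zero_of_nondegenerate hn₂ fun w => by simpa using hv (0, w)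

lemma prodMap_mem {a : Module.End k V₁} {b : Module.End k V₂}
    (ha : a ∈ skewAdjointLieSubalgebra φ₁) (hb : b ∈ skewAdjointLieSubalgebra φ₂) :
    LinearMap.prodMap a b ∈ skewAdjointLieSubalgebra (orthSum φ₁ φ₂) := by
  rw [mem_skewAdjoint_iff] at *
  intro v w
  simp [ha, hb]
  ring

lemma phiMap_orthSum_apply (v : V₁) (w : V₂) (z : V₁ × V₂) :
    phiMap ε (orthSum φ₁ φ₂) (v, 0) (0, w) z = (-(ε * φ₂ w z.2) • v, φ₁ v z.1 • w) := by
  rw [phiMap_apply]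
  ext <;> simp

/-- `v ⊗ w ↦ φ_{v,w}` for `φ = φ₁ ⊥ φ₂`. -/
noncomputable def offDiag (ε : k) (φ₁ : LinearMap.BilinForm k V₁) (φ₂ : LinearMap.BilinForm k V₂) :
    V₁ ⊗[k] V₂ →ₗ[k] Module.End k (V₁ × V₂) :=
  TensorProduct.lift ((phiMapₗ ε (orthSum φ₁ φ₂)).compl₁₂ (LinearMap.inl k V₁ V₂)
    (LinearMap.inr k V₁ V₂))

@[simp] lemma offDiag_tmul (v : V₁) (w : V₂) :
    offDiag ε φ₁ φ₂ (v ⊗ₜ w) = phiMap ε (orthSum φ₁ φ₂) (v, 0) (0, w) := rfl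

lemma offDiag_mem (hε : ε * ε = 1) (h₁ : IsEpsSymm ε φ₁) (h₂ : IsEpsSymm ε φ₂) (u : V₁ ⊗[k] V₂) :
    offDiag ε φ₁ φ₂ u ∈ skewAdjointLieSubalgebra (orthSum φ₁ φ₂) := by
  induction u with
  | zero => rw [map_zero]; exact zero_mem _
  | tmul v w => exact phiMap_mem hε (orthSum_isEpsSymm h₁ h₂) _ _
  | add u v hu hv => rw [map_add]; exact add_mem hu hv

lemma lie_prodMap_offDiag {a : Module.End k V₁} {b : Module.End k V₂}
    (ha : a ∈ skewAdjointLieSubalgebra φ₁) (hb : b ∈ skewAdjointLieSubalgebra φ₂)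
    (u : V₁ ⊗[k] V₂) :
    ⁅LinearMap.prodMap a b, offDiag ε φ₁ φ₂ u⁆ = offDiag ε φ₁ φ₂ (kronSum k V₁ V₂ (a, b) u) := by
  induction u with
  | zero => simp
  | tmul v w =>
    rw [offDiag_tmul, lie_phiMap (prodMap_mem ha hb), kronSum_tmul, map_add, offDiag_tmul,
      offDiag_tmul]
    simp
  | add u v hu hv => rw [map_add, lie_add, hu, hv, map_add, map_add]

/-- Two off-diagonal maps have a block diagonal commutator. This is the reason for the zero binary
product, and the two blocks are the two terms of the triple product. -/
lemma lie_offDiag_offDiag (h₁ : IsEpsSymm ε φ₁) (h₂ : IsEpsSymm ε φ₂) (v w : V₁) (v' w' : V₂) :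
    ⁅offDiag ε φ₁ φ₂ (v ⊗ₜ v'), offDiag ε φ₁ φ₂ (w ⊗ₜ w')⁆
      = LinearMap.prodMap (φ₂ v' w' • phiMap ε φ₁ v w) (φ₁ v w • phiMap ε φ₂ v' w') := by
  refine LinearMap.ext fun z => Prod.ext ?_ ?_
  · simp only [Ring.lie_def, LinearMap.sub_apply, Module.End.mul_apply, offDiag_tmul,
      phiMap_orthSum_apply, LinearMap.prodMap_apply, LinearMap.smul_apply,
      Prod.fst_sub, map_smul, smul_eq_mul]
    rw [phiMap_apply]
    rw [h₂ v' w']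
    module
  · simp only [Ring.lie_def, LinearMap.sub_apply, Module.End.mul_apply, offDiag_tmul,
      phiMap_orthSum_apply, LinearMap.prodMap_apply, LinearMap.smul_apply,
      Prod.snd_sub, map_smul, smul_eq_mul]
    rw [phiMap_apply]
    rw [h₁ v w]
    module

variable [FiniteDimensional k V₁] [FiniteDimensional k V₂] [CharZero k]

lemma exists_eq_prodMap_add_offDiag (hε : ε * ε = 1) (h₁ : IsEpsSymm ε φ₁) (h₂ : IsEpsSymm ε φ₂)
    (hn₁ : φ₁.Nondegenerate) (hn₂ : φ₂.Nondegenerate) {f : Module.End k (V₁ × V₂)}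
    (hf : f ∈ skewAdjointLieSubalgebra (orthSum φ₁ φ₂)) :
    ∃ a ∈ skewAdjointLieSubalgebra φ₁, ∃ b ∈ skewAdjointLieSubalgebra φ₂, ∃ u,
      f = LinearMap.prodMap a b + offDiag ε φ₁ φ₂ u := by
  have := mem_span_phiMap hε (orthSum_isEpsSymm h₁ h₂) (orthSum_nondegenerate h₁ h₂ hn₁ hn₂) hf
  clear hf
  induction this using Submodule.span_induction with
  | zero => exact ⟨0, zero_mem _, 0, zero_mem _, 0, by ext <;> simp⟩
  | add f g _ _ hf hg =>
    obtain ⟨a, ha, b, hb, u, rfl⟩ := hf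
    obtain ⟨a', ha', b', hb', u', rfl⟩ := hg
    refine ⟨a + a', add_mem ha ha', b + b', add_mem hb hb', u + u', ?_⟩
    rw [map_add]
    have : LinearMap.prodMap (a + a') (b + b')
      = LinearMap.prodMap a b + LinearMap.prodMap a' b' := by ext <;> simp
    rw [this]; abel
  | smul c f _ hf =>
    obtain ⟨a, ha, b, hb, u, rfl⟩ := hf
    refine ⟨c • a, (skewAdjointLieSubalgebra φ₁).smul_mem c ha, c • b,
      (skewAdjointLieSubalgebra φ₂).smul_mem c hb, c • u, ?_⟩
    rw [map_smul, smul_add]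
    congr 1
  | mem f hf =>
    obtain ⟨v, w, rfl⟩ := hf
    -- Expand φ_{v,w} along the two summands. The mixed term with its first vector in V₂ is put in
    -- the standard order by φ_{y,x} = -ε φ_{x,y}, which accounts for the coefficient -ε.
    refine ⟨phiMap ε φ₁ v.1 w.1, phiMap_mem hε h₁ _ _, phiMap ε φ₂ v.2 w.2, phiMap_mem hε h₂ _ _,
      v.1 ⊗ₜ w.2 - ε • (w.1 ⊗ₜ v.2), LinearMap.ext fun z => ?_⟩
    rw [map_sub, map_smul]
    simp only [LinearMap.add_apply, LinearMap.sub_apply, LinearMap.smul_apply, offDiag_tmul,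
      phiMap_orthSum_apply, LinearMap.prodMap_apply]
    simp only [phiMap_apply, orthSum_apply]
    ext
    · simp only [Prod.fst_sub, Prod.fst_add, Prod.smul_fst]
      linear_combination (norm := module) (-hε) • (φ₂ v.2 z.2 • w.1)
    · simp only [Prod.snd_sub, Prod.snd_add, Prod.smul_snd]
      module

end OffDiagonal

/-! ### The inner derivations of the LY-algebra of two forms -/

namespace LieYamaguti

variable {k : Type*} [Field k] {m : Type*} [AddCommGroup m] [Module k m]
  {V₁ V₂ : Type*} [AddCommGroup V₁] [Module k V₁] [AddCommGroup V₂] [Module k V₂]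
  {ε : k} {φ₁ : LinearMap.BilinForm k V₁} {φ₂ : LinearMap.BilinForm k V₂}

lemma HasProductsForms.tri_eq {L : LieYamaguti k m} {e : (V₁ ⊗[k] V₂) ≃ₗ[k] m}
    (h : L.HasProductsForms ε φ₁ φ₂ e) (x₁ y₁ : V₁) (x₂ y₂ : V₂) :
    L.tri (e (x₁ ⊗ₜ x₂)) (e (y₁ ⊗ₜ y₂))
      = e.conj (kronSum k V₁ V₂ (φ₂ x₂ y₂ • phiMap ε φ₁ x₁ y₁, φ₁ x₁ y₁ • phiMap ε φ₂ x₂ y₂)) := by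
  refine LinearMap.ext fun z => ?_
  obtain ⟨u, rfl⟩ := e.surjective z
  induction u with
  | zero => simp
  | tmul z₁ z₂ =>
    rw [h.2, LinearEquiv.conj_apply_apply, LinearEquiv.symm_apply_apply, kronSum_tmul]
    simp [TensorProduct.smul_tmul']
  | add u v hu hv => rw [map_add, map_add, map_add, hu, hv]

lemma HasProductsForms.exists_eq_conj {L : LieYamaguti k m} {e : (V₁ ⊗[k] V₂) ≃ₗ[k] m}
    (h : L.HasProductsForms ε φ₁ φ₂ e) (hε : ε * ε = 1) (h₁ : IsEpsSymm ε φ₁)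
    (h₂ : IsEpsSymm ε φ₂) (d : L.innerDer) :
    ∃ a ∈ skewAdjointLieSubalgebra φ₁, ∃ b ∈ skewAdjointLieSubalgebra φ₂,
      e.conj (kronSum k V₁ V₂ (a, b)) = d.1 := by
  let S : Submodule k (Module.End k m) :=
    ((skewAdjointLieSubalgebra φ₁).toSubmodule.prod (skewAdjointLieSubalgebra φ₂).toSubmodule).map
      (e.conj.toLinearMap ∘ₗ kronSum k V₁ V₂)
  have hS : ∀ u v, L.tri (e u) (e v) ∈ S := by
    intro u v
    induction u with
    | zero => simp
    | add u u' hu hu' => rw [map_add, map_add, LinearMap.add_apply]; exact add_mem hu hu'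
    | tmul x₁ x₂ =>
      induction v with
      | zero => simp
      | add u u' hu hu' => rw [map_add, map_add]; exact add_mem hu hu'
      | tmul y₁ y₂ =>
        rw [h.tri_eq]
        exact Submodule.mem_map_of_mem (f := e.conj.toLinearMap ∘ₗ kronSum k V₁ V₂)
          ⟨Submodule.smul_mem _ _ (phiMap_mem hε h₁ x₁ y₁),
            Submodule.smul_mem _ _ (phiMap_mem hε h₂ x₂ y₂)⟩
  have hd : d.1 ∈ S := by
    refine L.innerDer_induction (p := fun d => d.1 ∈ S) (zero_mem _)
      (fun _ _ ha hb => add_mem ha hb) (fun c _ ha => S.smul_mem c ha) (fun x y => ?_) d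
    obtain ⟨u, rfl⟩ := e.surjective x
    obtain ⟨v, rfl⟩ := e.surjective y
    exact hS u v
  obtain ⟨⟨a, b⟩, ⟨ha, hb⟩, hab⟩ := hd
  exact ⟨a, ha, b, hb, hab⟩

variable [CharZero k] [FiniteDimensional k V₁] [FiniteDimensional k V₂] [Nontrivial V₁]
  [Nontrivial V₂]

/-- The inner derivation algebra of an LY-algebra given by two forms. -/
lemma HasProductsForms.exists_der_equiv {L : LieYamaguti k m} {e : (V₁ ⊗[k] V₂) ≃ₗ[k] m}
    (h : L.HasProductsForms ε φ₁ φ₂ e) (hε : ε * ε = 1) (h₁ : IsEpsSymm ε φ₁)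
    (h₂ : IsEpsSymm ε φ₂) (hn₁ : φ₁.Nondegenerate) (hn₂ : φ₂.Nondegenerate) :
    ∃ Ψ : L.innerDer ≃ₗ⁅k⁆ skewAdjointLieSubalgebra φ₁ × skewAdjointLieSubalgebra φ₂,
      ∀ d : L.innerDer, d.1 = e.conj (kronSum k V₁ V₂ ((Ψ d).1.1, (Ψ d).2.1)) := by
  have hinl : ∀ a ∈ skewAdjointLieSubalgebra φ₁,
      e.conj (kronSum k V₁ V₂ (a, 0)) ∈ L.innerDer := by
    intro a ha
    have := mem_span_phiMap hε h₁ hn₁ ha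
    clear ha
    induction this using Submodule.span_induction with
    | zero => rw [← Prod.zero_eq_mk, map_zero, map_zero]; exact zero_mem _
    | add a b _ _ ha hb =>
      have : ((a + b, 0) : Module.End k V₁ × Module.End k V₂) = (a, 0) + (b, 0) := by simp
      rw [this, map_add, map_add]; exact add_mem ha hb
    | smul c a _ ha =>
      have : ((c • a, 0) : Module.End k V₁ × Module.End k V₂) = c • (a, 0) := by simp
      rw [this, map_smul, map_smul]; exact L.innerDer.smul_mem c ha
    | mem a ha =>
      obtain ⟨v, w, rfl⟩ := ha
      obtain ⟨x, hx⟩ := exists_ne (0 : V₂)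
      obtain ⟨y, hy⟩ := exists_form_eq_one hn₂ hx
      -- Choose φ₂(x, y) = 1 and symmetrize in x, y with the sign ε. The V₂-components cancel since
      -- φ_{y,x} = -ε φ_{x,y}, while the V₁-components agree since ε φ₂(y, x) = 1.
      have : e.conj (kronSum k V₁ V₂ (phiMap ε φ₁ v w, 0))
          = (1 / 2 : k) • (L.tri (e (v ⊗ₜ x)) (e (w ⊗ₜ y))
            + ε • L.tri (e (v ⊗ₜ y)) (e (w ⊗ₜ x))) := by
        rw [h.tri_eq, h.tri_eq, ← map_smul, ← map_smul, ← map_add, ← map_add, ← map_smul,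
          ← map_smul]
        congr 2
        have hyx : ε * φ₂ y x = 1 := by rw [← h₂, hy]
        ext1
        · simp only [Prod.smul_mk, Prod.mk_add_mk, smul_smul, hyx, hy]
          module
        · simp only [Prod.smul_mk, Prod.mk_add_mk, phiMap_swap hε x y, smul_smul]
          linear_combination (norm := module) (1 / 2 : k) • (hε • (φ₁ v w • phiMap ε φ₂ x y))
      rw [this]
      exact L.innerDer.smul_mem _ (add_mem (L.der _ _).2 (L.innerDer.smul_mem _ (L.der _ _).2))
  have hinr : ∀ a ∈ skewAdjointLieSubalgebra φ₂,
      e.conj (kronSum k V₁ V₂ (0, a)) ∈ L.innerDer := by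
    intro a ha
    have := mem_span_phiMap hε h₂ hn₂ ha
    clear ha
    induction this using Submodule.span_induction with
    | zero => rw [← Prod.zero_eq_mk, map_zero, map_zero]; exact zero_mem _
    | add a b _ _ ha hb =>
      have : ((0, a + b) : Module.End k V₁ × Module.End k V₂) = (0, a) + (0, b) := by simp
      rw [this, map_add, map_add]; exact add_mem ha hb
    | smul c a _ ha =>
      have : ((0, c • a) : Module.End k V₁ × Module.End k V₂) = c • (0, a) := by simp
      rw [this, map_smul, map_smul]; exact L.innerDer.smul_mem c ha
    | mem a ha =>
      obtain ⟨v, w, rfl⟩ := ha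
      obtain ⟨x, hx⟩ := exists_ne (0 : V₁)
      obtain ⟨y, hy⟩ := exists_form_eq_one hn₁ hx
      have : e.conj (kronSum k V₁ V₂ (0, phiMap ε φ₂ v w))
          = (1 / 2 : k) • (L.tri (e (x ⊗ₜ v)) (e (y ⊗ₜ w))
            + ε • L.tri (e (y ⊗ₜ v)) (e (x ⊗ₜ w))) := by
        rw [h.tri_eq, h.tri_eq, ← map_smul, ← map_smul, ← map_add, ← map_add, ← map_smul,
          ← map_smul]
        congr 2
        have hyx : ε * φ₁ y x = 1 := by rw [← h₁, hy]
        ext1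
        · simp only [Prod.smul_mk, Prod.mk_add_mk, phiMap_swap hε x y, smul_smul]
          linear_combination (norm := module) (1 / 2 : k) • (hε • (φ₂ v w • phiMap ε φ₁ x y))
        · simp only [Prod.smul_mk, Prod.mk_add_mk, smul_smul, hyx, hy]
          module
      rw [this]
      exact L.innerDer.smul_mem _ (add_mem (L.der _ _).2 (L.innerDer.smul_mem _ (L.der _ _).2))
  have hmem : ∀ p : skewAdjointLieSubalgebra φ₁ × skewAdjointLieSubalgebra φ₂,
      e.conj (kronSum k V₁ V₂ (p.1.1, p.2.1)) ∈ L.innerDer := by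
    intro p
    have : ((p.1.1, p.2.1) : Module.End k V₁ × Module.End k V₂) = (p.1.1, 0) + (0, p.2.1) := by
      simp
    rw [this, map_add, map_add]
    exact add_mem (hinl _ p.1.2) (hinr _ p.2.2)
  let A : (skewAdjointLieSubalgebra φ₁ × skewAdjointLieSubalgebra φ₂) →ₗ⁅k⁆ L.innerDer :=
    { toFun := fun p => ⟨e.conj (kronSum k V₁ V₂ (p.1.1, p.2.1)), hmem p⟩
      map_add' := fun p q => Subtype.ext (by
        change e.conj (kronSum k V₁ V₂ ((p.1.1, p.2.1) + (q.1.1, q.2.1))) = _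
        rw [map_add, map_add]; rfl)
      map_smul' := fun c p => Subtype.ext (by
        change e.conj (kronSum k V₁ V₂ (c • (p.1.1, p.2.1))) = _
        rw [map_smul, map_smul]; rfl)
      map_lie' := fun {p q} => Subtype.ext (by
        change e.conj (kronSum k V₁ V₂ (⁅p.1.1, q.1.1⁆, ⁅p.2.1, q.2.1⁆))
          = ⁅e.conj (kronSum k V₁ V₂ (p.1.1, p.2.1)), e.conj (kronSum k V₁ V₂ (q.1.1, q.2.1))⁆
        rw [← lie_kronSum_kronSum]
        exact (e.lieConj).map_lie _ _) }
  have hA : Function.Bijective A := by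
    constructor
    · refine (injective_iff_map_eq_zero A).mpr fun p hp => ?_
      have hp' : e.conj (kronSum k V₁ V₂ (p.1.1, p.2.1)) = 0 := congrArg Subtype.val hp
      have := kronSum_eq_zero (trace_eq_zero_of_skew hε h₁ hn₁ p.1.2)
        (trace_eq_zero_of_skew hε h₂ hn₂ p.2.2) ((LinearEquiv.map_eq_zero_iff _).mp hp')
      exact Prod.ext (Subtype.ext this.1) (Subtype.ext this.2)
    · intro d
      obtain ⟨a, ha, b, hb, hab⟩ := h.exists_eq_conj hε h₁ h₂ d
      exact ⟨(⟨a, ha⟩, ⟨b, hb⟩), Subtype.ext hab⟩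
  refine ⟨(LieEquiv.ofBijective A hA).symm, fun d => ?_⟩
  exact congrArg Subtype.val ((LieEquiv.ofBijective A hA).apply_symm_apply d).symm

end LieYamaguti

/-! ### The enveloping algebra and the Tits model of the LY-algebra of two forms -/

namespace LieYamaguti

variable {k : Type*} [Field k] {m : Type*} [AddCommGroup m] [Module k m]
  {V₁ V₂ : Type*} [AddCommGroup V₁] [Module k V₁] [AddCommGroup V₂] [Module k V₂]
  {ε : k} {φ₁ : LinearMap.BilinForm k V₁} {φ₂ : LinearMap.BilinForm k V₂}

/-- Exchange of the two forms. -/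
lemma HasProductsForms.swap {L : LieYamaguti k m} {e : (V₁ ⊗[k] V₂) ≃ₗ[k] m}
    (h : L.HasProductsForms ε φ₁ φ₂ e) :
    L.HasProductsForms ε φ₂ φ₁ ((TensorProduct.comm k V₂ V₁).trans e) := by
  refine ⟨h.1, fun x₁ y₁ z₁ x₂ y₂ z₂ => ?_⟩
  simp only [LinearEquiv.trans_apply, TensorProduct.comm_tmul, map_add, map_smul, h.2]
  exact add_comm _ _

/-- Transport along linear isomorphisms of the two spaces. -/
lemma HasProductsForms.transport {L : LieYamaguti k m} {e : (V₁ ⊗[k] V₂) ≃ₗ[k] m}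
    (h : L.HasProductsForms ε φ₁ φ₂ e) {W₁ W₂ : Type*} [AddCommGroup W₁] [Module k W₁]
    [AddCommGroup W₂] [Module k W₂] (f₁ : W₁ ≃ₗ[k] V₁) (f₂ : W₂ ≃ₗ[k] V₂) :
    L.HasProductsForms ε (φ₁.compl₁₂ f₁.toLinearMap f₁.toLinearMap)
      (φ₂.compl₁₂ f₂.toLinearMap f₂.toLinearMap) ((TensorProduct.congr f₁ f₂).trans e) := by
  refine ⟨h.1, fun x₁ y₁ z₁ x₂ y₂ z₂ => ?_⟩
  simp only [LinearEquiv.trans_apply, TensorProduct.congr_tmul, map_add, map_smul, h.2,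
    phiMap_apply, TensorProduct.sub_tmul, TensorProduct.tmul_sub, map_sub]
  simp

lemma nondegenerate_compl₁₂ {W : Type*} [AddCommGroup W] [Module k W] (f : W ≃ₗ[k] V₁)
    (h : φ₁.Nondegenerate) :
    LinearMap.BilinForm.Nondegenerate (φ₁.compl₁₂ f.toLinearMap f.toLinearMap) := by
  refine ⟨fun v hv => ?_, fun v hv => ?_⟩
  · exact (LinearEquiv.map_eq_zero_iff f).mp (h.1 (f v) fun w => by
      simpa using hv (f.symm w))
  · exact (LinearEquiv.map_eq_zero_iff f).mp (h.2 (f v) fun w => by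
      simpa using hv (f.symm w))

variable [CharZero k] [FiniteDimensional k V₁] [FiniteDimensional k V₂]

/-- Derivations go to block diagonal maps and vectors to off-diagonal ones; the three kinds of
brackets match. Surjectivity is the block decomposition of skew maps. Injectivity follows from
simplicity of g(m), since the map is nonzero. -/
lemma HasProductsForms.exists_envelope_equiv {L : LieYamaguti k m} {e : (V₁ ⊗[k] V₂) ≃ₗ[k] m}
    [Nontrivial V₁] [Nontrivial V₂]
    (h : L.HasProductsForms ε φ₁ φ₂ e) (hε : ε * ε = 1) (h₁ : IsEpsSymm ε φ₁)
    (h₂ : IsEpsSymm ε φ₂) (hn₁ : φ₁.Nondegenerate) (hn₂ : φ₂.Nondegenerate)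
    (hsimple : LieAlgebra.IsSimple k L.Envelope)
    (Ψ : L.innerDer ≃ₗ⁅k⁆ skewAdjointLieSubalgebra φ₁ × skewAdjointLieSubalgebra φ₂)
    (hΨ : ∀ d : L.innerDer, d.1 = e.conj (kronSum k V₁ V₂ ((Ψ d).1.1, (Ψ d).2.1))) :
    ∃ Φ : L.Envelope ≃ₗ⁅k⁆ skewAdjointLieSubalgebra (orthSum φ₁ φ₂),
      (∀ v w, (Φ (L.ofVec (e (v ⊗ₜ w)))).1 = phiMap ε (orthSum φ₁ φ₂) (v, 0) (0, w)) ∧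
      (∀ d, (Φ (L.ofDer d)).1 = LinearMap.prodMap (Ψ d).1.1 (Ψ d).2.1) := by
  have hΨd : ∀ x₁ y₁ x₂ y₂, Ψ (L.der (e (x₁ ⊗ₜ x₂)) (e (y₁ ⊗ₜ y₂)))
      = (φ₂ x₂ y₂ • ⟨_, phiMap_mem hε h₁ x₁ y₁⟩, φ₁ x₁ y₁ • ⟨_, phiMap_mem hε h₂ x₂ y₂⟩) := by
    intro x₁ y₁ x₂ y₂
    rw [← LieEquiv.eq_symm_apply]
    refine Subtype.ext ?_
    rw [hΨ (Ψ.symm _), LieEquiv.apply_symm_apply]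
    exact h.tri_eq x₁ y₁ x₂ y₂
  let D : L.innerDer → Module.End k (V₁ × V₂) := fun d => LinearMap.prodMap (Ψ d).1.1 (Ψ d).2.1
  have hDadd : ∀ a b, D (a + b) = D a + D b := by
    intro a b
    refine LinearMap.ext fun z => ?_
    simp [D]
  have hDsmul : ∀ (c : k) a, D (c • a) = c • D a := by
    intro c a
    refine LinearMap.ext fun z => ?_
    simp [D]
  have hDlie : ∀ a b, D ⁅a, b⁆ = ⁅D a, D b⁆ := by
    intro a b
    have e1 : (Ψ ⁅a, b⁆).1.1 = ⁅(Ψ a).1.1, (Ψ b).1.1⁆ := by rw [LieEquiv.map_lie]; rfl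
    have e2 : (Ψ ⁅a, b⁆).2.1 = ⁅(Ψ a).2.1, (Ψ b).2.1⁆ := by rw [LieEquiv.map_lie]; rfl
    refine LinearMap.ext fun z => ?_
    simp [D, e1, e2, Ring.lie_def]
  have hDJ : ∀ d u, ⁅D d, offDiag ε φ₁ φ₂ u⁆ = offDiag ε φ₁ φ₂ (e.symm (d.1 (e u))) := by
    intro d u
    rw [lie_prodMap_offDiag (Ψ d).1.2 (Ψ d).2.2, hΨ d]
    simp [LinearEquiv.conj_apply_apply]
  have hJJ : ∀ u v, ⁅offDiag ε φ₁ φ₂ u, offDiag ε φ₁ φ₂ v⁆ = D (L.der (e u) (e v)) := by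
    have hD0 : D 0 = 0 := by simpa using hDsmul 0 0
    intro u v
    induction u with
    | zero =>
      have : L.der (e 0) (e v) = 0 := Subtype.ext (by simp [der])
      rw [this, map_zero, zero_lie, hD0]
    | add u u' hu hu' =>
      have : L.der (e (u + u')) (e v) = L.der (e u) (e v) + L.der (e u') (e v) :=
        Subtype.ext (by simp [der])
      rw [this, map_add, add_lie, hDadd, hu, hu']
    | tmul x₁ x₂ =>
      induction v with
      | zero =>
        have : L.der (e (x₁ ⊗ₜ x₂)) (e 0) = 0 := Subtype.ext (by simp [der])
        rw [this, map_zero, lie_zero, hD0]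
      | add u u' hu hu' =>
        have : L.der (e (x₁ ⊗ₜ x₂)) (e (u + u'))
            = L.der (e (x₁ ⊗ₜ x₂)) (e u) + L.der (e (x₁ ⊗ₜ x₂)) (e u') :=
          Subtype.ext (by simp [der])
        rw [this, map_add, lie_add, hDadd, hu, hu']
      | tmul y₁ y₂ =>
        rw [lie_offDiag_offDiag h₁ h₂]
        simp [D, hΨd]
  let F : L.Envelope →ₗ⁅k⁆ skewAdjointLieSubalgebra (orthSum φ₁ φ₂) :=
    { toFun := fun z => ⟨D z.1 + offDiag ε φ₁ φ₂ (e.symm z.2),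
        add_mem (prodMap_mem (Ψ z.1).1.2 (Ψ z.1).2.2) (offDiag_mem hε h₁ h₂ _)⟩
      map_add' := fun x y => Subtype.ext (by
        change D (x.1 + y.1) + offDiag ε φ₁ φ₂ (e.symm (x.2 + y.2))
          = (D x.1 + offDiag ε φ₁ φ₂ (e.symm x.2)) + (D y.1 + offDiag ε φ₁ φ₂ (e.symm y.2))
        rw [hDadd, map_add, map_add]; abel)
      map_smul' := fun c x => Subtype.ext (by
        change D (c • x.1) + offDiag ε φ₁ φ₂ (e.symm (c • x.2))
          = c • (D x.1 + offDiag ε φ₁ φ₂ (e.symm x.2))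
        rw [hDsmul, map_smul, map_smul, smul_add])
      map_lie' := fun {x y} => Subtype.ext (by
        obtain ⟨d, x⟩ := x
        obtain ⟨d', y⟩ := y
        obtain ⟨u, rfl⟩ := e.surjective x
        obtain ⟨v, rfl⟩ := e.surjective y
        change D (⁅d, d'⁆ + L.der (e u) (e v))
            + offDiag ε φ₁ φ₂ (e.symm (d.1 (e v) - d'.1 (e u) + L.mul (e u) (e v)))
          = ⁅D d + offDiag ε φ₁ φ₂ (e.symm (e u)), D d' + offDiag ε φ₁ φ₂ (e.symm (e v))⁆
        rw [h.1, add_zero, map_sub, map_sub, add_lie, lie_add, lie_add, e.symm_apply_apply,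
          e.symm_apply_apply, hDadd, hDlie, ← hDJ, ← hDJ, ← hJJ,
          ← lie_skew (D d') (offDiag ε φ₁ φ₂ u)]
        abel) }
  have hF0 : ∀ v w, (F (L.ofVec (e (v ⊗ₜ w)))).1 = phiMap ε (orthSum φ₁ φ₂) (v, 0) (0, w) := by
    intro v w
    change D 0 + offDiag ε φ₁ φ₂ (e.symm (e (v ⊗ₜ w))) = _
    rw [e.symm_apply_apply, offDiag_tmul]
    simp [D]
  have hF1 : ∀ d, (F (L.ofDer d)).1 = D d := by
    intro d
    change D d + offDiag ε φ₁ φ₂ (e.symm 0) = _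
    simp
  have hF : Function.Bijective F := by
    constructor
    · rw [← LieHom.ker_eq_bot]
      refine (hsimple.eq_bot_or_eq_top F.ker).resolve_right fun hker => ?_
      obtain ⟨v, hv⟩ := exists_ne (0 : V₁)
      obtain ⟨w, hw⟩ := exists_ne (0 : V₂)
      obtain ⟨v', hv'⟩ := exists_form_eq_one hn₁ hv
      have hmem : L.ofVec (e (v ⊗ₜ w)) ∈ F.ker := by rw [hker]; trivial
      have h0 : (F (L.ofVec (e (v ⊗ₜ w)))).1 = 0 := by
        rw [LieHom.mem_ker] at hmem
        rw [hmem]; rfl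
      rw [hF0] at h0
      have := congrArg Prod.snd (LinearMap.congr_fun h0 (v', 0))
      rw [phiMap_orthSum_apply] at this
      exact hw (by simpa [hv'] using this)
    · rintro ⟨f, hf⟩
      obtain ⟨a, ha, b, hb, u, rfl⟩ := exists_eq_prodMap_add_offDiag hε h₁ h₂ hn₁ hn₂ hf
      refine ⟨⟨Ψ.symm (⟨a, ha⟩, ⟨b, hb⟩), e u⟩, Subtype.ext ?_⟩
      change D _ + offDiag ε φ₁ φ₂ (e.symm (e u)) = _
      rw [e.symm_apply_apply]
      simp only [D, LieEquiv.apply_symm_apply]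
  exact ⟨LieEquiv.ofBijective F hF, hF0, hF1⟩

/-- `X₀ = V` for `X = J(V)`. -/
def jordanOfFormZero {V : Type*} [AddCommGroup V] [Module k V] (ε : k) (hε : ε * ε = 1)
    (φ : LinearMap.BilinForm k V) (hφ : IsEpsSymm ε φ) :
    (jordanOfForm ε hε φ hφ).Zero ≃ₗ[k] V where
  toFun x := x.1.2
  map_add' _ _ := rfl
  map_smul' _ _ := rfl
  invFun v := ⟨(0, v), rfl⟩
  left_inv x := by
    obtain ⟨⟨a, v⟩, h⟩ := x
    have : a = 0 := h
    subst this
    rfl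
  right_inv _ := rfl

/-- The action of `so(V)` or `sp(V)` on `J(V)`. -/
def jordanOfFormInner {V : Type*} [AddCommGroup V] [Module k V] [FiniteDimensional k V] (ε : k)
    (hε : ε * ε = 1) (φ : LinearMap.BilinForm k V) (hφ : IsEpsSymm ε φ) (hn : φ.Nondegenerate) :
    skewAdjointLieSubalgebra φ →ₗ⁅k⁆ (jordanOfForm ε hε φ hφ).inner where
  toFun f := ⟨LinearMap.inr k k V ∘ₗ f.1 ∘ₗ LinearMap.snd k k V, by
    obtain ⟨f, hf⟩ := f
    have := mem_span_phiMap hε hφ hn hf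
    change LinearMap.inr k k V ∘ₗ f ∘ₗ LinearMap.snd k k V ∈ _
    clear hf
    induction this using Submodule.span_induction with
    | zero => simp
    | add f g _ _ hf hg =>
      convert add_mem hf hg using 1
      ext <;> simp
    | smul c f _ hf =>
      convert (jordanOfForm ε hε φ hφ).inner.smul_mem c hf using 1
      ext <;> simp
    | mem f hf =>
      obtain ⟨v, w, rfl⟩ := hf
      exact Submodule.subset_span ⟨⟨(0, v), rfl⟩, ⟨(0, w), rfl⟩, rfl⟩⟩
  map_add' f g := by ext <;> simp
  map_smul' c f := by ext <;> simp
  map_lie' {f g} := by ext <;> simp [Ring.lie_def]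

lemma jordanOfFormInner_surjective {V : Type*} [AddCommGroup V] [Module k V]
    [FiniteDimensional k V] (ε : k) (hε : ε * ε = 1) (φ : LinearMap.BilinForm k V)
    (hφ : IsEpsSymm ε φ) (hn : φ.Nondegenerate) :
    Function.Surjective (jordanOfFormInner ε hε φ hφ hn) := by
  rintro ⟨d, hd⟩
  have hd' : d ∈ Submodule.span k {d | ∃ x y, d = (jordanOfForm ε hε φ hφ).D x y} := hd
  suffices ∃ f, (jordanOfFormInner ε hε φ hφ hn f).1 = d by
    obtain ⟨f, hf⟩ := this
    exact ⟨f, Subtype.ext hf⟩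
  clear hd
  induction hd' using Submodule.span_induction with
  | zero => exact ⟨0, by rw [map_zero]; rfl⟩
  | add f g _ _ hf hg =>
    obtain ⟨a, rfl⟩ := hf
    obtain ⟨b, rfl⟩ := hg
    exact ⟨a + b, by rw [map_add]; rfl⟩
  | smul c f _ hf =>
    obtain ⟨a, rfl⟩ := hf
    exact ⟨c • a, by rw [map_smul]; rfl⟩
  | mem f hf =>
    obtain ⟨x, y, rfl⟩ := hf
    exact ⟨⟨_, phiMap_mem hε hφ x.1.2 y.1.2⟩, rfl⟩

lemma HasProductsForms.isInsideTits {L : LieYamaguti k m} {e : (V₁ ⊗[k] V₂) ≃ₗ[k] m}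
    (h : L.HasProductsForms ε φ₁ φ₂ e) (hε : ε * ε = 1) (h₁ : IsEpsSymm ε φ₁)
    (h₂ : IsEpsSymm ε φ₂) (hn₁ : φ₁.Nondegenerate) (hn₂ : φ₂.Nondegenerate)
    (Ψ : L.innerDer ≃ₗ⁅k⁆ skewAdjointLieSubalgebra φ₁ × skewAdjointLieSubalgebra φ₂)
    (hΨ : ∀ d : L.innerDer, d.1 = e.conj (kronSum k V₁ V₂ ((Ψ d).1.1, (Ψ d).2.1))) :
    L.IsInsideTits (jordanOfForm ε hε φ₁ h₁) (jordanOfForm ε hε φ₂ h₂) := by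
  have hΨd : ∀ x₁ y₁ x₂ y₂, Ψ (L.der (e (x₁ ⊗ₜ x₂)) (e (y₁ ⊗ₜ y₂)))
      = (φ₂ x₂ y₂ • ⟨_, phiMap_mem hε h₁ x₁ y₁⟩, φ₁ x₁ y₁ • ⟨_, phiMap_mem hε h₂ x₂ y₂⟩) := by
    intro x₁ y₁ x₂ y₂
    rw [← LieEquiv.eq_symm_apply]
    refine Subtype.ext ?_
    rw [hΨ (Ψ.symm _), LieEquiv.apply_symm_apply]
    exact h.tri_eq x₁ y₁ x₂ y₂
  let α : L.innerDer →ₗ⁅k⁆ (jordanOfForm ε hε φ₁ h₁).inner :=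
    { toFun := fun d => jordanOfFormInner ε hε φ₁ h₁ hn₁ (Ψ d).1
      map_add' := fun a b => by simp
      map_smul' := fun c a => by simp
      map_lie' := fun {a b} => by
        rw [LieEquiv.map_lie, ← LieHom.map_lie]; rfl }
  let β : L.innerDer →ₗ⁅k⁆ (jordanOfForm ε hε φ₂ h₂).inner :=
    { toFun := fun d => jordanOfFormInner ε hε φ₂ h₂ hn₂ (Ψ d).2
      map_add' := fun a b => by simp
      map_smul' := fun c a => by simp
      map_lie' := fun {a b} => by
        rw [LieEquiv.map_lie, ← LieHom.map_lie]; rfl }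
  have hα : ∀ d, α d = jordanOfFormInner ε hε φ₁ h₁ hn₁ (Ψ d).1 := fun _ => rfl
  have hβ : ∀ d, β d = jordanOfFormInner ε hε φ₂ h₂ hn₂ (Ψ d).2 := fun _ => rfl
  refine L.isInsideTits_of _ _ ((TensorProduct.congr (jordanOfFormZero ε hε φ₁ h₁)
    (jordanOfFormZero ε hε φ₂ h₂)).trans e) α β ?_ ?_ ?_ ?_ ?_
  · intro a b
    obtain ⟨f, rfl⟩ := jordanOfFormInner_surjective ε hε φ₁ h₁ hn₁ a
    obtain ⟨g, rfl⟩ := jordanOfFormInner_surjective ε hε φ₂ h₂ hn₂ b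
    exact ⟨Ψ.symm (f, g), by rw [hα, LieEquiv.apply_symm_apply],
      by rw [hβ, LieEquiv.apply_symm_apply]⟩
  · intro d x y
    rw [hΨ d]
    simp only [LinearEquiv.trans_apply, TensorProduct.congr_tmul, LinearEquiv.conj_apply_apply,
      LinearEquiv.symm_apply_apply, kronSum_tmul, map_add]
    rfl
  · intro x y x' y'
    simp only [LinearEquiv.trans_apply, TensorProduct.congr_tmul, hα, hΨd]
    rw [map_smul]
    congr 1
    change φ₂ y.1.2 y'.1.2 = y.1.1 * y'.1.1 + φ₂ y.1.2 y'.1.2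
    have : y.1.1 = 0 := y.2
    rw [this, zero_mul, zero_add]
  · intro x y x' y'
    simp only [LinearEquiv.trans_apply, TensorProduct.congr_tmul, hβ, hΨd]
    rw [map_smul]
    congr 1
    change φ₁ x.1.2 x'.1.2 = x.1.1 * x'.1.1 + φ₁ x.1.2 x'.1.2
    have : x.1.1 = 0 := x.2
    rw [this, zero_mul, zero_add]
  · intro x y x' y'
    rw [h.1]
    -- In J(V) the product of two vectors of V is a multiple of 1, so its projection to the trace
    -- zero part vanishes, in agreement with the zero binary product.
    have : (jordanOfForm ε hε φ₁ h₁).star x x' = 0 := by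
      refine (jordanOfFormZero ε hε φ₁ h₁).injective ?_
      change x.1.1 • x'.1.2 + x'.1.1 • x.1.2 - (x.1.1 * x'.1.1 + φ₁ x.1.2 x'.1.2) • (0 : V₁) = 0
      have hx : x.1.1 = 0 := x.2
      have hx' : x'.1.1 = 0 := x'.2
      rw [hx, hx']
      simp
    rw [this, TensorProduct.zero_tmul, map_zero]

/-- The common form of the conclusion for orthogonal and for symplectic sums. -/
def FormsConclusion (L : LieYamaguti k m) (ε : k) (hε : ε * ε = 1) (n₀ : ℕ) : Prop :=
  ∃ n₁ n₂ : ℕ, n₀ ≤ n₁ ∧ n₁ ≤ n₂ ∧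
    ∃ (φ₁ : LinearMap.BilinForm k (Fin n₁ → k)) (φ₂ : LinearMap.BilinForm k (Fin n₂ → k))
      (h₁ : IsEpsSymm ε φ₁) (h₂ : IsEpsSymm ε φ₂),
      φ₁.Nondegenerate ∧ φ₂.Nondegenerate ∧
      L.IsInsideTits (jordanOfForm ε hε φ₁ h₁) (jordanOfForm ε hε φ₂ h₂) ∧
      ∃ (e : ((Fin n₁ → k) ⊗[k] (Fin n₂ → k)) ≃ₗ[k] m)
        (Φ : L.Envelope ≃ₗ⁅k⁆ skewAdjointLieSubalgebra (orthSum φ₁ φ₂))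
        (Ψ : L.innerDer ≃ₗ⁅k⁆ skewAdjointLieSubalgebra φ₁ × skewAdjointLieSubalgebra φ₂),
        L.HasProductsForms ε φ₁ φ₂ e ∧
        (∀ v w, (Φ (L.ofVec (e (v ⊗ₜ w)))).1 = phiMap ε (orthSum φ₁ φ₂) (v, 0) (0, w)) ∧
        (∀ d, (Φ (L.ofDer d)).1 = LinearMap.prodMap (Ψ d).1.1 (Ψ d).2.1)

lemma HasProductsForms.formsConclusion_of_le {L : LieYamaguti k m}
    (hsimple : LieAlgebra.IsSimple k L.Envelope) {e : (V₁ ⊗[k] V₂) ≃ₗ[k] m}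
    (h : L.HasProductsForms ε φ₁ φ₂ e) (hε : ε * ε = 1) (h₁ : IsEpsSymm ε φ₁)
    (h₂ : IsEpsSymm ε φ₂) (hn₁ : φ₁.Nondegenerate) (hn₂ : φ₂.Nondegenerate) {n₀ : ℕ}
    (h0 : n₀ ≠ 0) (hd₁ : n₀ ≤ Module.finrank k V₁) (hle : Module.finrank k V₁ ≤ Module.finrank k V₂) :
    L.FormsConclusion ε hε n₀ := by
  let f₁ : (Fin (Module.finrank k V₁) → k) ≃ₗ[k] V₁ := (Module.finBasis k V₁).equivFun.symm
  let f₂ : (Fin (Module.finrank k V₂) → k) ≃ₗ[k] V₂ := (Module.finBasis k V₂).equivFun.symm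
  have h' := h.transport f₁ f₂
  have h₁' : IsEpsSymm ε (φ₁.compl₁₂ f₁.toLinearMap f₁.toLinearMap) := fun v w => h₁ _ _
  have h₂' : IsEpsSymm ε (φ₂.compl₁₂ f₂.toLinearMap f₂.toLinearMap) := fun v w => h₂ _ _
  have hn₁' := nondegenerate_compl₁₂ f₁ hn₁
  have hn₂' := nondegenerate_compl₁₂ f₂ hn₂
  have : NeZero (Module.finrank k V₁) := ⟨by omega⟩
  have : NeZero (Module.finrank k V₂) := ⟨by omega⟩
  obtain ⟨Ψ, hΨ⟩ := h'.exists_der_equiv hε h₁' h₂' hn₁' hn₂'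
  obtain ⟨Φ, hΦ, hΦ'⟩ := h'.exists_envelope_equiv hε h₁' h₂' hn₁' hn₂' hsimple Ψ hΨ
  exact ⟨_, _, hd₁, hle, _, _, h₁', h₂', hn₁', hn₂',
    h'.isInsideTits hε h₁' h₂' hn₁' hn₂' Ψ hΨ, _, Φ, Ψ, h', hΦ, hΦ'⟩

lemma HasProductsForms.formsConclusion {L : LieYamaguti k m}
    (hsimple : LieAlgebra.IsSimple k L.Envelope) {e : (V₁ ⊗[k] V₂) ≃ₗ[k] m}
    (h : L.HasProductsForms ε φ₁ φ₂ e) (hε : ε * ε = 1) (h₁ : IsEpsSymm ε φ₁)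
    (h₂ : IsEpsSymm ε φ₂) (hn₁ : φ₁.Nondegenerate) (hn₂ : φ₂.Nondegenerate) {n₀ : ℕ}
    (h0 : n₀ ≠ 0) (hd₁ : n₀ ≤ Module.finrank k V₁) (hd₂ : n₀ ≤ Module.finrank k V₂) :
    L.FormsConclusion ε hε n₀ := by
  rcases le_total (Module.finrank k V₁) (Module.finrank k V₂) with hle | hle
  · exact h.formsConclusion_of_le hsimple hε h₁ h₂ hn₁ hn₂ h0 hd₁ hle
  · exact h.swap.formsConclusion_of_le hsimple hε h₂ h₁ hn₂ hn₁ h0 hd₂ hle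

end LieYamaguti

/-! ### Irreducible modules of commuting families are tensor products -/

section TensorDecomposition

/-- Burnside's theorem: an algebra acting irreducibly on a finite-dimensional space over an
algebraically closed field acts by all linear maps. -/
lemma exists_smul_eq_of_isSimpleModule {k A S : Type*} [Field k] [IsAlgClosed k] [Ring A]
    [Algebra k A] [AddCommGroup S] [Module k S] [Module A S] [IsScalarTower k A S]
    [FiniteDimensional k S] [IsSimpleModule A S] (g : Module.End k S) :
    ∃ a : A, ∀ s, g s = a • s := by
  classical
  -- By Schur's lemma the endomorphisms of the simple module are the scalars in k, so a k-linear map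
  -- is linear over them and Jacobson density applies, on a finite basis.
  let f : Module.End (Module.End A S) S :=
    { toFun := g
      map_add' := map_add g
      map_smul' := fun c s => by
        obtain ⟨t, rfl⟩ :=
          (IsSimpleModule.algebraMap_end_bijective_of_isAlgClosed (A := A) (V := S) k).2 c
        change g (t • s) = t • g s
        exact map_smul g t s }
  let b := Module.finBasis k S
  obtain ⟨a, ha⟩ := jacobson_density (R := A) f (Finset.univ.image b)
  refine ⟨a, fun s => ?_⟩
  let g' : Module.End k S := Algebra.lsmul k k S a
  have : g = g' := b.ext fun i => ha (b i) (Finset.mem_image_of_mem _ (Finset.mem_univ i))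
  rw [this]
  rfl

variable {k : Type*} [Field k] [IsAlgClosed k] {V : Type*} [AddCommGroup V] [Module k V]
  [FiniteDimensional k V]

/-- A minimal nonzero A-submodule exists by finite dimension, and Burnside's theorem on it gives the
last assertion. -/
lemma exists_irreducible_subspace [Nontrivial V] (A : Subalgebra k (Module.End k V)) :
    ∃ S : Submodule k V, S ≠ ⊥ ∧ (∀ a ∈ A, ∀ s ∈ S, a s ∈ S) ∧
      (∀ N : Submodule k V, (∀ a ∈ A, ∀ s ∈ N, a s ∈ N) → N ≤ S → N = ⊥ ∨ N = S) ∧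
      (∀ g : Module.End k S, ∃ a ∈ A, ∀ s : S, (g s : V) = a s) := by
  have hart : IsArtinian A V := isArtinian_of_tower k inferInstance
  have : Nontrivial (Submodule A V) := (Submodule.nontrivial_iff A).mpr inferInstance
  obtain ⟨S, hS, -⟩ := (eq_bot_or_exists_atom_le (⊤ : Submodule A V)).resolve_left top_ne_bot
  have hSs : IsSimpleModule A S := isSimpleModule_iff_isAtom.mpr hS
  have : FiniteDimensional k S :=
    (inferInstance : FiniteDimensional k (S.restrictScalars k : Submodule k V))
  refine ⟨S.restrictScalars k, ?_, fun a ha s hs => S.smul_mem ⟨a, ha⟩ hs, fun N hN hNS => ?_,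
    fun g => ?_⟩
  · intro h
    refine hS.1 ((Submodule.eq_bot_iff _).mpr fun x hx => ?_)
    exact (Submodule.eq_bot_iff _).mp h x hx
  · let N' : Submodule A V := { N with smul_mem' := fun a x hx => hN a.1 a.2 x hx }
    have hle : N' ≤ S := hNS
    rcases hS.le_iff.mp hle with h | h
    · left
      rw [Submodule.eq_bot_iff]
      exact (Submodule.eq_bot_iff N').mp h
    · right
      rw [← h]
      rfl
  · obtain ⟨⟨a, ha⟩, h⟩ := exists_smul_eq_of_isSimpleModule (k := k) (A := A) (S := S) g
    exact ⟨a, ha, fun s => congrArg Subtype.val (h s)⟩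

/-- Let A be the algebra generated by P, S a minimal A-submodule of V and R = Hom_A(S, V).
Evaluation S ⊗ R → V is an isomorphism: P acts through S, and Q acts through R by composition since
it commutes with A. Irreducibility of the first factor under P is minimality of S. -/
theorem exists_tensor_decomposition [Nontrivial V] (P Q : Submodule k (Module.End k V))
    (hcomm : ∀ p ∈ P, ∀ q ∈ Q, ∀ v, p (q v) = q (p v))
    (hirr : ∀ U : Submodule k V, (∀ p ∈ P, ∀ u ∈ U, p u ∈ U) → (∀ q ∈ Q, ∀ u ∈ U, q u ∈ U) →
      U = ⊥ ∨ U = ⊤) :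
    ∃ (n₁ n₂ : ℕ) (T : ((Fin n₁ → k) ⊗[k] (Fin n₂ → k)) ≃ₗ[k] V),
      (∀ p ∈ P, ∃ a, ∀ u, p (T u) = T (TensorProduct.map a LinearMap.id u)) ∧
      (∀ q ∈ Q, ∃ f, ∀ u, q (T u) = T (TensorProduct.map LinearMap.id f u)) ∧
      (∀ U : Submodule k (Fin n₁ → k),
        (∀ p ∈ P, ∀ a, (∀ u, p (T u) = T (TensorProduct.map a LinearMap.id u)) →
          ∀ u ∈ U, a u ∈ U) → U = ⊥ ∨ U = ⊤) := by
  let A := Algebra.adjoin k (P : Set (Module.End k V))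
  have hPA : ∀ p ∈ P, p ∈ A := fun p hp => Algebra.subset_adjoin hp
  have hA : ∀ (U : Submodule k V), (∀ p ∈ P, ∀ u ∈ U, p u ∈ U) → ∀ a ∈ A, ∀ u ∈ U, a u ∈ U := by
    intro U hU a ha
    induction ha using Algebra.adjoin_induction with
    | mem x hx => exact hU x hx
    | algebraMap r => intro u hu; exact U.smul_mem r hu
    | add x y _ _ hx hy => intro u hu; exact add_mem (hx u hu) (hy u hu)
    | mul x y _ _ hx hy => intro u hu; exact hx _ (hy u hu)
  have hAQ : ∀ a ∈ A, ∀ q ∈ Q, ∀ v, a (q v) = q (a v) := by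
    intro a ha q hq
    induction ha using Algebra.adjoin_induction with
    | mem x hx => exact hcomm x hx q hq
    | algebraMap r => intro v; exact (map_smul q r v).symm
    | add x y _ _ hx hy => intro v; rw [LinearMap.add_apply, LinearMap.add_apply, hx, hy, map_add]
    | mul x y _ _ hx hy => intro v; rw [Module.End.mul_apply, Module.End.mul_apply, hy, hx]
  obtain ⟨S, hS0, hSmem, hSmin, hSburn⟩ := exists_irreducible_subspace A
  let R : Submodule k (S →ₗ[k] V) :=
    { carrier := {f | ∀ a (ha : a ∈ A) (s : S), f ⟨a s.1, hSmem a ha s.1 s.2⟩ = a (f s)}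
      zero_mem' := by intro a ha s; simp
      add_mem' := by intro f g hf hg a ha s; simp [hf a ha s, hg a ha s]
      smul_mem' := by intro c f hf a ha s; simp [hf a ha s] }
  let ev : S ⊗[k] R →ₗ[k] V := TensorProduct.lift R.subtype.flip
  have hev : ∀ s f, ev (s ⊗ₜ f) = f.1 s := fun _ _ => rfl
  -- injectivity
  have hinj : Function.Injective ev := by
    refine (injective_iff_map_eq_zero ev).mpr fun u hu => ?_
    let b := Module.finBasis k S
    obtain ⟨c, rfl⟩ : ∃ c : Fin (Module.finrank k S) → R, u = ∑ i, b i ⊗ₜ c i := by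
      clear hu
      induction u with
      | zero => exact ⟨0, by simp⟩
      | tmul s f =>
        refine ⟨fun i => b.repr s i • f, ?_⟩
        conv_lhs => rw [← b.sum_repr s]
        rw [TensorProduct.sum_tmul]
        exact Finset.sum_congr rfl fun i _ => by rw [TensorProduct.smul_tmul]
      | add u v hu hv =>
        obtain ⟨c, rfl⟩ := hu
        obtain ⟨c', rfl⟩ := hv
        exact ⟨c + c', by simp [TensorProduct.tmul_add, Finset.sum_add_distrib]⟩
    have hc : ∀ i, c i = 0 := by
      intro i
      refine Subtype.ext (LinearMap.ext fun s => ?_)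
      -- By Burnside, some a in A acts on S by bᵢ ↦ s and bⱼ ↦ 0 for j ≠ i. Applied to ∑ cⱼ(bⱼ) = 0,
      -- it leaves cᵢ(s) = 0.
      obtain ⟨a, ha, has⟩ := hSburn ((b.coord i).smulRight s)
      rw [map_sum] at hu
      have h1 := congrArg a hu
      rw [map_sum, map_zero] at h1
      have h2 : ∀ j, a (ev (b j ⊗ₜ c j)) = (c j).1 (b.coord i (b j) • s) := by
        intro j
        rw [hev, ← (c j).2 a ha (b j)]
        congr 1
        exact Subtype.ext (has (b j)).symm
      simp only [h2] at h1
      rw [Finset.sum_eq_single i] at h1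
      · simpa using h1
      · intro j _ hj
        simp [Finsupp.single_eq_of_ne hj.symm]
      · simp
    simp [hc]
  -- surjectivity
  have hsurj : Function.Surjective ev := by
    rw [← LinearMap.range_eq_top]
    -- The image of evaluation is stable under P and Q, and it contains S because the inclusion of S
    -- belongs to R.
    refine (hirr _ ?_ ?_).resolve_left ?_
    · rintro p hp _ ⟨u, rfl⟩
      induction u with
      | zero => simp
      | tmul s f =>
        refine ⟨⟨p s.1, hSmem p (hPA p hp) s.1 s.2⟩ ⊗ₜ f, ?_⟩
        rw [hev, hev, f.2 p (hPA p hp)]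
      | add u v hu hv => rw [map_add, map_add]; exact add_mem hu hv
    · rintro q hq _ ⟨u, rfl⟩
      induction u with
      | zero => simp
      | tmul s f =>
        refine ⟨s ⊗ₜ ⟨q ∘ₗ f.1, fun a ha s => ?_⟩, ?_⟩
        · rw [LinearMap.comp_apply, LinearMap.comp_apply, f.2 a ha, hAQ a ha q hq]
        · rw [hev, hev]; rfl
      | add u v hu hv => rw [map_add, map_add]; exact add_mem hu hv
    · intro hbot
      obtain ⟨s, hs, hs0⟩ := Submodule.exists_mem_ne_zero_of_ne_bot hS0
      have : s ∈ LinearMap.range ev :=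
        ⟨⟨s, hs⟩ ⊗ₜ ⟨S.subtype, fun a ha s => rfl⟩, rfl⟩
      rw [hbot] at this
      exact hs0 (by simpa using this)
  obtain ⟨n₁, b₁⟩ : Σ n, S ≃ₗ[k] (Fin n → k) := ⟨_, (Module.finBasis k S).equivFun⟩
  obtain ⟨n₂, b₂⟩ : Σ n, R ≃ₗ[k] (Fin n → k) := ⟨_, (Module.finBasis k R).equivFun⟩
  obtain ⟨T, hT⟩ : ∃ T : ((Fin n₁ → k) ⊗[k] (Fin n₂ → k)) ≃ₗ[k] V,
      ∀ x y, T (x ⊗ₜ y) = (b₂.symm y).1 (b₁.symm x) :=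
    ⟨(TensorProduct.congr b₁ b₂).symm.trans (LinearEquiv.ofBijective ev ⟨hinj, hsurj⟩),
      fun x y => rfl⟩
  have hP : ∀ p ∈ P, ∃ a : Module.End k (Fin n₁ → k),
      (∀ u, p (T u) = T (TensorProduct.map a LinearMap.id u)) ∧
      ∀ x, (b₁.symm (a x) : V) = p (b₁.symm x) := by
    intro p hp
    have hr : ∀ x, b₁.symm (b₁.conj (p.restrict (hSmem p (hPA p hp))) x)
        = ⟨p (b₁.symm x), hSmem p (hPA p hp) _ (b₁.symm x).2⟩ := by
      intro x
      rw [LinearEquiv.conj_apply_apply, LinearEquiv.symm_apply_apply]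
      rfl
    refine ⟨b₁.conj (p.restrict (hSmem p (hPA p hp))), fun u => ?_, fun x => by rw [hr]⟩
    induction u with
    | zero => simp
    | tmul x y => rw [TensorProduct.map_tmul, hT, hT, hr]; exact ((b₂.symm y).2 p (hPA p hp) _).symm
    | add u v hu hv => rw [map_add, map_add, hu, hv, map_add, map_add]
  have hQ : ∀ q ∈ Q, ∃ f : Module.End k (Fin n₂ → k),
      ∀ u, q (T u) = T (TensorProduct.map LinearMap.id f u) := by
    intro q hq
    let g : Module.End k R :=
      { toFun := fun f => ⟨q ∘ₗ f.1, fun a ha s => by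
          rw [LinearMap.comp_apply, LinearMap.comp_apply, f.2 a ha, hAQ a ha q hq]⟩
        map_add' := fun s t => Subtype.ext (LinearMap.ext fun _ => map_add q _ _)
        map_smul' := fun c s => Subtype.ext (LinearMap.ext fun _ => map_smul q _ _) }
    have hg : ∀ f x, (g f).1 x = q (f.1 x) := fun _ _ => rfl
    clear_value g
    refine ⟨b₂.conj g, fun u => ?_⟩
    induction u with
    | zero => simp
    | tmul x y =>
      rw [TensorProduct.map_tmul, hT, hT, LinearEquiv.conj_apply_apply,
        LinearEquiv.symm_apply_apply, hg]
      rfl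
    | add u v hu hv => rw [map_add, map_add, hu, hv, map_add, map_add]
  refine ⟨n₁, n₂, T, fun p hp => (hP p hp).imp fun _ h => h.1, hQ, fun U hU => ?_⟩
  have hstab : ∀ a ∈ A, ∀ u ∈ (U.comap b₁.toLinearMap).map S.subtype,
      a u ∈ (U.comap b₁.toLinearMap).map S.subtype := by
    refine hA _ ?_
    rintro p hp _ ⟨s, hs, rfl⟩
    obtain ⟨a, ha, ha'⟩ := hP p hp
    refine ⟨b₁.symm (a (b₁ s)), ?_, ?_⟩
    · have := hU p hp a ha _ hs
      simpa using this
    · rw [Submodule.subtype_apply, ha', LinearEquiv.symm_apply_apply]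
      rfl
  have hN : (U.comap b₁.toLinearMap).map S.subtype ≤ S := by
    rintro _ ⟨s, -, rfl⟩
    exact s.2
  rcases hSmin _ hstab hN with h | h
  · left
    rw [Submodule.eq_bot_iff]
    intro u hu
    have : ((b₁.symm u : S) : V) ∈ (U.comap b₁.toLinearMap).map S.subtype :=
      ⟨b₁.symm u, by simpa using hu, rfl⟩
    rw [h] at this
    have h0 : b₁.symm u = 0 := Subtype.ext (by simpa using this)
    simpa using h0
  · right
    rw [Submodule.eq_top_iff']
    intro u
    have : ((b₁.symm u : S) : V) ∈ (U.comap b₁.toLinearMap).map S.subtype := by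
      rw [h]; exact (b₁.symm u).2
    obtain ⟨s, hs, hsu⟩ := this
    have h0 : s = b₁.symm u := Subtype.ext hsu
    rw [h0] at hs
    simpa using hs

end TensorDecomposition

/-! ### Invariant forms on tensor products -/

section TensorForms

variable {k : Type*} [Field k] {V₁ V₂ : Type*} [AddCommGroup V₁] [Module k V₁]
  [AddCommGroup V₂] [Module k V₂]

/-- Schur's lemma for invariant bilinear forms. -/
lemma exists_smul_of_invariant [IsAlgClosed k] [FiniteDimensional k V₁] [Nontrivial V₁]
    (P : Set (Module.End k V₁))
    (hirr : ∀ U : Submodule k V₁, (∀ a ∈ P, ∀ u ∈ U, a u ∈ U) → U = ⊥ ∨ U = ⊤)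
    {β γ : LinearMap.BilinForm k V₁} (hn : β.Nondegenerate)
    (hβ : ∀ a ∈ P, a ∈ skewAdjointLieSubalgebra β) (hγ : ∀ a ∈ P, a ∈ skewAdjointLieSubalgebra γ) :
    ∃ c : k, ∀ v w, γ v w = c * β v w := by
  let T : Module.End k V₁ := (LinearMap.BilinForm.toDual β hn).symm.toLinearMap ∘ₗ γ
  have hT : ∀ v w, β (T v) w = γ v w := fun v w =>
    LinearMap.BilinForm.apply_toDual_symm_apply (hB := hn) (γ v) w
  have hcomm : ∀ a ∈ P, ∀ v, T (a v) = a (T v) := by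
    intro a ha v
    refine eq_of_nondegenerate hn fun w => ?_
    have h1 := mem_skewAdjoint_iff.mp (hβ a ha)
    have h2 := mem_skewAdjoint_iff.mp (hγ a ha)
    rw [hT, h2, h1, hT]
  obtain ⟨c, hc⟩ := Module.End.exists_eigenvalue T
  obtain ⟨v₀, hv₀⟩ := hc.exists_hasEigenvector
  have htop := (hirr (Module.End.eigenspace T c) (fun a ha u hu => by
    rw [Module.End.mem_eigenspace_iff] at hu ⊢
    rw [hcomm a ha, hu, map_smul])).resolve_left (fun h => hv₀.2 (by
      have : v₀ ∈ Module.End.eigenspace T c := hv₀.1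
      rw [h] at this
      simpa using this))
  refine ⟨c, fun v w => ?_⟩
  have hv : v ∈ Module.End.eigenspace T c := by rw [htop]; trivial
  rw [Module.End.mem_eigenspace_iff] at hv
  rw [← hT, hv, map_smul, LinearMap.smul_apply, smul_eq_mul]

/-- The left and the right radical of an invariant form are stable subspaces, and they are proper
when the form is nonzero. -/
lemma nondegenerate_of_invariant
    (P : Set (Module.End k V₁))
    (hirr : ∀ U : Submodule k V₁, (∀ a ∈ P, ∀ u ∈ U, a u ∈ U) → U = ⊥ ∨ U = ⊤)
    {β : LinearMap.BilinForm k V₁} (hβ : ∀ a ∈ P, a ∈ skewAdjointLieSubalgebra β) (h0 : β ≠ 0) :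
    β.Nondegenerate := by
  have key : ∀ γ : LinearMap.BilinForm k V₁, γ ≠ 0 →
      (∀ a ∈ P, a ∈ skewAdjointLieSubalgebra γ) → LinearMap.ker γ = ⊥ := by
    intro γ hγ0 hγ
    refine (hirr _ fun a ha u hu => ?_).resolve_right fun h => hγ0 (LinearMap.ker_eq_top.mp h)
    refine LinearMap.mem_ker.mpr (LinearMap.ext fun w => ?_)
    rw [mem_skewAdjoint_iff.mp (hγ a ha), LinearMap.mem_ker.mp hu]
    simp
  refine ⟨fun v hv => ?_, fun v hv => ?_⟩
  · have : v ∈ LinearMap.ker β := LinearMap.mem_ker.mpr (LinearMap.ext hv)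
    rw [key β h0 hβ] at this
    simpa using this
  · have : v ∈ LinearMap.ker β.flip := LinearMap.mem_ker.mpr (LinearMap.ext hv)
    rw [key β.flip (fun h => h0 (LinearMap.ext₂ fun v w => LinearMap.congr_fun₂ h w v)) (fun a ha => by
      rw [mem_skewAdjoint_iff]
      intro v w
      have := mem_skewAdjoint_iff.mp (hβ a ha) w v
      change β w (a v) = -β (a w) v
      rw [this, neg_neg])] at this
    simpa using this

/-- An invariant form on a tensor product is a tensor product of forms. -/
theorem exists_forms_of_invariant [IsAlgClosed k] [FiniteDimensional k V₁]
    [Nontrivial V₁] [Nontrivial V₂] {ε : k} (hε : ε * ε = 1)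
    {φ : LinearMap.BilinForm k (V₁ ⊗[k] V₂)} (hφ : IsEpsSymm ε φ) (hn : φ.Nondegenerate)
    (P : Set (Module.End k V₁))
    (hirr : ∀ U : Submodule k V₁, (∀ a ∈ P, ∀ u ∈ U, a u ∈ U) → U = ⊥ ∨ U = ⊤)
    (hP : ∀ a ∈ P, TensorProduct.map a LinearMap.id ∈ skewAdjointLieSubalgebra φ) :
    ∃ (φ₁ : LinearMap.BilinForm k V₁) (φ₂ : LinearMap.BilinForm k V₂) (ε₁ ε₂ : k),
      ε₁ * ε₁ = 1 ∧ ε₂ * ε₂ = 1 ∧ ε₁ * ε₂ = ε ∧ IsEpsSymm ε₁ φ₁ ∧ IsEpsSymm ε₂ φ₂ ∧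
      φ₁.Nondegenerate ∧ φ₂.Nondegenerate ∧
      (∀ v v' w w', φ (v ⊗ₜ w) (v' ⊗ₜ w') = φ₁ v v' * φ₂ w w') ∧
      (∀ a, TensorProduct.map a LinearMap.id ∈ skewAdjointLieSubalgebra φ →
        a ∈ skewAdjointLieSubalgebra φ₁) ∧
      (∀ f, TensorProduct.map LinearMap.id f ∈ skewAdjointLieSubalgebra φ →
        f ∈ skewAdjointLieSubalgebra φ₂) := by
  -- Each pair of vectors of V₂ gives a P-invariant form on V₁. By Schur's lemma all of them are
  -- multiples of a single nonzero one, φ₁, and the multiple as a function of the pair is φ₂.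
  let B : V₂ → V₂ → LinearMap.BilinForm k V₁ := fun w w' =>
    φ.compl₁₂ ((TensorProduct.mk k V₁ V₂).flip w) ((TensorProduct.mk k V₁ V₂).flip w')
  have hB : ∀ w w' v v', B w w' v v' = φ (v ⊗ₜ w) (v' ⊗ₜ w') := fun _ _ _ _ => rfl
  have hBinv : ∀ w w', ∀ a ∈ P, a ∈ skewAdjointLieSubalgebra (B w w') := by
    intro w w' a ha
    rw [mem_skewAdjoint_iff]
    intro v v'
    simpa [hB] using mem_skewAdjoint_iff.mp (hP a ha) (v ⊗ₜ w) (v' ⊗ₜ w')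
  obtain ⟨w₀, w₀', hB0⟩ : ∃ w w', B w w' ≠ 0 := by
    by_contra h
    push Not at h
    have : φ = 0 := by
      ext v w v' w'
      exact LinearMap.congr_fun₂ (h w w') v v'
    have hnt : Nontrivial (V₁ ⊗[k] V₂) := inferInstance
    exact hn.ne_zero this
  obtain ⟨φ₁, hφ₁⟩ : ∃ φ₁, φ₁ = B w₀ w₀' := ⟨_, rfl⟩
  have hφ₁inv : ∀ a ∈ P, a ∈ skewAdjointLieSubalgebra φ₁ := hφ₁ ▸ hBinv w₀ w₀'
  have hn₁ : φ₁.Nondegenerate := nondegenerate_of_invariant P hirr hφ₁inv (hφ₁ ▸ hB0)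
  obtain ⟨v₀, hv₀⟩ := exists_ne (0 : V₁)
  obtain ⟨v₀', hv₀'⟩ := exists_form_eq_one hn₁ hv₀
  -- The transposed form is invariant too, so it is ε₁ φ₁ for some scalar, and transposing twice
  -- gives ε₁² = 1.
  obtain ⟨ε₁, hε₁⟩ := exists_smul_of_invariant P hirr hn₁ hφ₁inv (γ := φ₁.flip) (fun a ha => by
      rw [mem_skewAdjoint_iff]
      intro v w
      have := mem_skewAdjoint_iff.mp (hφ₁inv a ha) w v
      change φ₁ w (a v) = -φ₁ (a w) v
      rw [this, neg_neg])
  have h₁ : IsEpsSymm ε₁ φ₁ := fun v w => by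
    exact hε₁ w v
  have hε₁1 : ε₁ * ε₁ = 1 := by
    have e1 := h₁ v₀ v₀'
    rw [h₁ v₀' v₀, hv₀', mul_one] at e1
    exact e1.symm
  -- Since φ₁(v₀, v₀') = 1, evaluation at this pair returns the scalar of Schur's lemma.
  let φ₂ : LinearMap.BilinForm k V₂ :=
    φ.compl₁₂ (TensorProduct.mk k V₁ V₂ v₀) (TensorProduct.mk k V₁ V₂ v₀')
  have hφ₂ : ∀ w w', φ₂ w w' = φ (v₀ ⊗ₜ w) (v₀' ⊗ₜ w') := fun _ _ => rfl
  have hmul : ∀ v v' w w', φ (v ⊗ₜ w) (v' ⊗ₜ w') = φ₁ v v' * φ₂ w w' := by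
    intro v v' w w'
    obtain ⟨c, hc⟩ := exists_smul_of_invariant P hirr hn₁ hφ₁inv (hBinv w w')
    have := hc v₀ v₀'
    rw [hv₀', mul_one, hB, ← hφ₂] at this
    rw [← hB, hc, this, mul_comm]
  have h₂ : IsEpsSymm (ε * ε₁) φ₂ := by
    intro w w'
    rw [hφ₂, hφ, hmul, h₁ v₀' v₀, hv₀']
    ring
  have hn₂ : φ₂.Nondegenerate := by
    refine nondegenerate_of_left h₂ fun w hw => ?_
    have h0 : v₀ ⊗ₜ[k] w = 0 := by
      refine eq_zero_of_nondegenerate hn fun u => ?_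
      induction u with
      | zero => simp
      | tmul v' w' => rw [hmul, hw, mul_zero]
      | add u u' hu hu' => rw [map_add, hu, hu', add_zero]
    have := congrArg ((TensorProduct.lid k V₂).toLinearMap ∘ₗ (LinearMap.flip φ₁ v₀').rTensor V₂) h0
    simpa [hv₀'] using this
  obtain ⟨w₁, hw₁⟩ := exists_ne (0 : V₂)
  obtain ⟨w₁', hw₁'⟩ := exists_form_eq_one hn₂ hw₁
  refine ⟨φ₁, φ₂, ε₁, ε * ε₁, hε₁1, ?_, ?_, h₁, h₂, hn₁, hn₂, hmul, ?_, ?_⟩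
  · linear_combination ε₁ * ε₁ * hε + hε₁1
  · linear_combination ε * hε₁1
  · intro a ha
    rw [mem_skewAdjoint_iff] at ha ⊢
    intro v v'
    simpa [hmul, hw₁'] using ha (v ⊗ₜ w₁) (v' ⊗ₜ w₁')
  · intro f hf
    rw [mem_skewAdjoint_iff] at hf ⊢
    intro w w'
    simpa [hmul, hv₀'] using hf (v₀ ⊗ₜ w) (v₀' ⊗ₜ w')

lemma tmul_form_apply (φ₁ : LinearMap.BilinForm k V₁) (φ₂ : LinearMap.BilinForm k V₂)
    (v v' : V₁) (w w' : V₂) : φ₁.tmul φ₂ (v ⊗ₜ w) (v' ⊗ₜ w') = φ₁ v v' * φ₂ w w' := by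
  rw [LinearMap.BilinForm.tensorDistrib_tmul]
  simp [mul_comm]

lemma eq_tmul_form {φ : LinearMap.BilinForm k (V₁ ⊗[k] V₂)} {φ₁ : LinearMap.BilinForm k V₁}
    {φ₂ : LinearMap.BilinForm k V₂}
    (h : ∀ v v' w w', φ (v ⊗ₜ w) (v' ⊗ₜ w') = φ₁ v v' * φ₂ w w') : φ = φ₁.tmul φ₂ := by
  ext v w v' w'
  have e1 := h v v' w w'
  have e2 := tmul_form_apply φ₁ φ₂ v v' w w'
  exact e1.trans e2.symm

lemma kronSum_mem_skew {φ₁ : LinearMap.BilinForm k V₁} {φ₂ : LinearMap.BilinForm k V₂}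
    {a : Module.End k V₁} {f : Module.End k V₂} (ha : a ∈ skewAdjointLieSubalgebra φ₁)
    (hf : f ∈ skewAdjointLieSubalgebra φ₂) :
    kronSum k V₁ V₂ (a, f) ∈ skewAdjointLieSubalgebra (φ₁.tmul φ₂) := by
  rw [mem_skewAdjoint_iff] at *
  intro u u'
  induction u with
  | zero => simp
  | add u v hu hv => simp only [map_add, LinearMap.add_apply, hu, hv, neg_add]
  | tmul v w =>
    induction u' with
    | zero => simp
    | add u v hu hv => simp only [map_add, hu, hv, neg_add]
    | tmul v' w' =>
      simp only [kronSum_tmul, map_add, LinearMap.add_apply, tmul_form_apply, ha, hf]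
      ring

lemma map_form_apply {φ₁ : LinearMap.BilinForm k V₁} {φ₂ : LinearMap.BilinForm k V₂} {c d : k}
    {a : Module.End k V₁} {f : Module.End k V₂} (ha : ∀ v w, φ₁ (a v) w = c * φ₁ v (a w))
    (hf : ∀ v w, φ₂ (f v) w = d * φ₂ v (f w)) (u u' : V₁ ⊗[k] V₂) :
    φ₁.tmul φ₂ (TensorProduct.map a f u) u' = c * d * φ₁.tmul φ₂ u (TensorProduct.map a f u') := by
  induction u with
  | zero => simp
  | add u v hu hv => simp only [map_add, LinearMap.add_apply, hu, hv, mul_add]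
  | tmul v w =>
    induction u' with
    | zero => simp
    | add u v hu hv => simp only [map_add, hu, hv, mul_add]
    | tmul v' w' =>
      simp only [TensorProduct.map_tmul, tmul_form_apply, ha, hf]
      ring

lemma map_mem_skew {φ₁ : LinearMap.BilinForm k V₁} {φ₂ : LinearMap.BilinForm k V₂}
    {a : Module.End k V₁} {f : Module.End k V₂} (ha : a ∈ skewAdjointLieSubalgebra φ₁)
    (hf : f ∈ symEnd φ₂) : TensorProduct.map a f ∈ skewAdjointLieSubalgebra (φ₁.tmul φ₂) := by
  rw [mem_skewAdjoint_iff] at *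
  intro u u'
  rw [map_form_apply (c := -1) (d := 1) (by simpa using ha) (by simpa using mem_symEnd_iff.mp hf)]
  ring

lemma map_mem_skew' {φ₁ : LinearMap.BilinForm k V₁} {φ₂ : LinearMap.BilinForm k V₂}
    {a : Module.End k V₁} {f : Module.End k V₂} (ha : a ∈ symEnd φ₁)
    (hf : f ∈ skewAdjointLieSubalgebra φ₂) :
    TensorProduct.map a f ∈ skewAdjointLieSubalgebra (φ₁.tmul φ₂) := by
  rw [mem_skewAdjoint_iff] at *
  intro u u'
  rw [map_form_apply (c := 1) (d := -1) (by simpa using mem_symEnd_iff.mp ha) (by simpa using hf)]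
  ring

/-- Every endomorphism is the sum of a symmetric and a skew one. -/
lemma exists_sym_add_skew [CharZero k] [FiniteDimensional k V₁] {ε : k} (hε : ε * ε = 1)
    {φ : LinearMap.BilinForm k V₁} (hφ : IsEpsSymm ε φ) (hn : φ.Nondegenerate)
    (a : Module.End k V₁) :
    ∃ s ∈ symEnd φ, ∃ t ∈ skewAdjointLieSubalgebra φ, a = s + t := by
  let T : Module.End k V₁ := φ.leftAdjointOfNondegenerate hn a
  have h1 : ∀ v w, φ (T v) w = φ v (a w) :=
    LinearMap.BilinForm.isAdjointPairLeftAdjointOfNondegenerate φ hn a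
  have h2 : ∀ v w, φ (a v) w = φ v (T w) := by
    intro v w
    rw [hφ, ← h1, hφ, ← mul_assoc, hε, one_mul]
  refine ⟨(1 / 2 : k) • (a + T), ?_, (1 / 2 : k) • (a - T), ?_, by module⟩
  · rw [mem_symEnd_iff]
    intro v w
    simp [h1, h2]
    ring
  · rw [mem_skewAdjoint_iff]
    intro v w
    simp [h1, h2]
    ring

variable [CharZero k] [FiniteDimensional k V₁] [FiniteDimensional k V₂]
  {φ₁ : LinearMap.BilinForm k V₁} {φ₂ : LinearMap.BilinForm k V₂} {ε₁ ε₂ : k}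

/-- The skew maps of a tensor product of forms. -/
lemma mem_sup_of_mem_skew (hε₁ : ε₁ * ε₁ = 1) (hε₂ : ε₂ * ε₂ = 1) (h₁ : IsEpsSymm ε₁ φ₁)
    (h₂ : IsEpsSymm ε₂ φ₂) (hn₁ : φ₁.Nondegenerate) (hn₂ : φ₂.Nondegenerate)
    (hn : (φ₁.tmul φ₂).Nondegenerate) {x : Module.End k (V₁ ⊗[k] V₂)}
    (hx : x ∈ skewAdjointLieSubalgebra (φ₁.tmul φ₂)) (S : Submodule k (Module.End k (V₁ ⊗[k] V₂)))
    (hS : ∀ t ∈ skewAdjointLieSubalgebra φ₁, ∀ s ∈ symEnd φ₂, TensorProduct.map t s ∈ S)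
    (hS' : ∀ s ∈ symEnd φ₁, ∀ t ∈ skewAdjointLieSubalgebra φ₂, TensorProduct.map s t ∈ S) :
    x ∈ S := by
  -- Split both tensor factors into symmetric and skew parts. Mixed products are skew and lie in S,
  -- while products of equal type are symmetric. For a skew x the symmetric remainder is both
  -- symmetric and skew, hence zero.
  have key : ∀ x : Module.End k (V₁ ⊗[k] V₂),
      ∃ y ∈ S ⊓ (skewAdjointLieSubalgebra (φ₁.tmul φ₂)).toSubmodule,
        ∃ z ∈ symEnd (φ₁.tmul φ₂), x = y + z := by
    intro x
    induction x using endTensor_induction with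
    | h0 => exact ⟨0, zero_mem _, 0, zero_mem _, by simp⟩
    | hadd x x' hx hx' =>
      obtain ⟨y, hy, z, hz, rfl⟩ := hx
      obtain ⟨y', hy', z', hz', rfl⟩ := hx'
      exact ⟨y + y', add_mem hy hy', z + z', add_mem hz hz', by abel⟩
    | hmap a f =>
      obtain ⟨s, hs, t, ht, rfl⟩ := exists_sym_add_skew hε₁ h₁ hn₁ a
      obtain ⟨s', hs', t', ht', rfl⟩ := exists_sym_add_skew hε₂ h₂ hn₂ f
      refine ⟨TensorProduct.map t s' + TensorProduct.map s t',
        add_mem ⟨hS t ht s' hs', map_mem_skew ht hs'⟩ ⟨hS' s hs t' ht', map_mem_skew' hs ht'⟩,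
        TensorProduct.map s s' + TensorProduct.map t t', add_mem ?_ ?_, ?_⟩
      · intro u u'
        rw [map_form_apply (c := 1) (d := 1) (by simpa using mem_symEnd_iff.mp hs)
          (by simpa using mem_symEnd_iff.mp hs')]
        ring
      · rw [mem_skewAdjoint_iff] at ht ht'
        intro u u'
        rw [map_form_apply (c := -1) (d := -1) (by simpa using ht) (by simpa using ht')]
        ring
      · rw [TensorProduct.map_add_left, TensorProduct.map_add_right, TensorProduct.map_add_right]
        abel
  obtain ⟨y, hy, z, hz, rfl⟩ := key x
  have hz0 : z = 0 := by
    have hz1 : z ∈ skewAdjointLieSubalgebra (φ₁.tmul φ₂) := by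
      have := sub_mem hx (show y ∈ skewAdjointLieSubalgebra (φ₁.tmul φ₂) from hy.2)
      rwa [add_sub_cancel_left] at this
    rw [mem_skewAdjoint_iff] at hz1
    refine LinearMap.ext fun v => eq_zero_of_nondegenerate hn fun w => ?_
    have e1 := hz1 v w
    rw [← mem_symEnd_iff.mp hz v w] at e1
    have : (2 : k) * (φ₁.tmul φ₂) (z v) w = 0 := by linear_combination e1
    simpa using this
  rw [hz0, add_zero]
  exact hy.1

/-- If all symmetric maps are scalar, then the form is symplectic of dimension `2`. -/
lemma eq_neg_one_of_symEnd_le {ε : k} (hε : ε * ε = 1) {φ : LinearMap.BilinForm k V₁}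
    (hφ : IsEpsSymm ε φ) (hn : φ.Nondegenerate) (hd : 2 ≤ Module.finrank k V₁)
    (hs : ∀ s ∈ symEnd φ, ∃ c : k, s = c • 1) : ε = -1 ∧ Module.finrank k V₁ = 2 := by
  -- With the opposite sign the rank-two maps φ_{v,w} become symmetric; these are the test elements
  -- for the hypothesis `hs`.
  have hsym : ∀ v w, phiMap (-ε) φ v w ∈ symEnd φ := by
    intro v w x y
    simp only [phiMap_apply, map_sub, map_smul, LinearMap.sub_apply, LinearMap.smul_apply,
      smul_eq_mul]
    rw [hφ x w, hφ x v]
    linear_combination -(φ w y * φ v x) * hε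
  -- a vector outside a given small subspace
  have hbig : ∀ S : Submodule k V₁, Module.finrank k S < Module.finrank k V₁ → ∃ v, v ∉ S := by
    intro S hS
    by_contra h
    push Not at h
    rw [Submodule.eq_top_iff'.mpr h, finrank_top] at hS
    exact lt_irrefl _ hS
  have hpair : ∀ v : V₁, v ≠ 0 → ∃ z, z ≠ 0 ∧ φ v z = 0 := by
    intro v hv
    have h1 := (φ v).finrank_range_add_finrank_ker
    have h2 : Module.finrank k (LinearMap.range (φ v)) ≤ 1 :=
      (Submodule.finrank_le _).trans (Module.finrank_self k).le
    have h3 : LinearMap.ker (φ v) ≠ ⊥ := by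
      intro h; rw [h, finrank_bot] at h1; omega
    obtain ⟨z, hz, hz0⟩ := Submodule.exists_mem_ne_zero_of_ne_bot h3
    exact ⟨z, hz0, hz⟩
  have : Nontrivial V₁ := Module.nontrivial_of_finrank_pos (R := k) (by omega)
  have hε1 : ε = -1 := by
    have : (ε - 1) * (ε + 1) = 0 := by linear_combination hε
    rcases mul_eq_zero.mp this with h | h
    · exfalso
      have hε1 : ε = 1 := sub_eq_zero.mp h
      subst hε1
      -- For ε = 1 the test map x ↦ 2φ(v, x)v is scalar and kills a nonzero z orthogonal to v, so it
      -- is zero and φ(v, v) = 0. A symmetric form with this property vanishes by polarization.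
      have h0 : ∀ v, φ v v = 0 := by
        intro v
        by_contra hv
        have hv0 : v ≠ 0 := by rintro rfl; simp at hv
        obtain ⟨c, hc⟩ := hs _ (hsym v v)
        obtain ⟨z, hz0, hz⟩ := hpair v hv0
        have e1 := LinearMap.congr_fun hc z
        have e2 := LinearMap.congr_fun hc v
        rw [phiMap_apply, hz] at e1
        have hc0 : c = 0 := by simpa [hz0] using e1.symm
        rw [phiMap_apply, hc0] at e2
        have : (2 * φ v v) • v = 0 := by
          rw [LinearMap.smul_apply, zero_smul] at e2
          linear_combination (norm := module) e2
        simp [hv, hv0] at this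
      obtain ⟨v, hv⟩ := exists_ne (0 : V₁)
      obtain ⟨w, hw⟩ := exists_form_eq_one hn hv
      have h1 := h0 (v + w)
      simp only [map_add, LinearMap.add_apply, h0, hφ w v, hw] at h1
      norm_num at h1
    · exact eq_neg_of_add_eq_zero_left h
  refine ⟨hε1, ?_⟩
  subst hε1
  by_contra h2
  obtain ⟨v, hv⟩ := exists_ne (0 : V₁)
  obtain ⟨w, hw⟩ := exists_form_eq_one hn hv
  obtain ⟨c, hc⟩ := hs _ (hsym v w)
  have hvv : φ v v = 0 := by
    have := hφ v v
    have h2 : (2 : k) * φ v v = 0 := by linear_combination this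
    simpa using h2
  have hwv : φ w v = -1 := by rw [hφ, hw]; ring
  -- For ε = -1 and φ(v, w) = 1 the test map fixes v, so the scalar is 1. It also kills the common
  -- orthogonal of v and w, which is nonzero as soon as the dimension exceeds 2.
  have hc' : c = 1 := by
    have e1 := LinearMap.congr_fun hc v
    rw [phiMap_apply, hvv, hwv] at e1
    have : (c - 1) • v = 0 := by
      have e2 : c • v = v := by simpa using e1.symm
      rw [sub_smul, e2]; module
    have := (smul_eq_zero.mp this).resolve_right hv
    exact sub_eq_zero.mp this
  let S : Submodule k V₁ := LinearMap.ker ((φ v).prod (φ w))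
  have hS : S ≠ ⊥ := by
    have h1 := ((φ v).prod (φ w)).finrank_range_add_finrank_ker
    have h3 : Module.finrank k (LinearMap.range ((φ v).prod (φ w))) ≤ 2 :=
      (Submodule.finrank_le _).trans (by simp)
    intro h
    have : Module.finrank k (LinearMap.ker ((φ v).prod (φ w))) = 0 := by
      change Module.finrank k S = 0
      rw [h, finrank_bot]
    omega
  obtain ⟨z, hz, hz0⟩ := Submodule.exists_mem_ne_zero_of_ne_bot hS
  have hz' : φ v z = 0 ∧ φ w z = 0 := by
    have := LinearMap.mem_ker.mp hz
    exact ⟨congrArg Prod.fst this, congrArg Prod.snd this⟩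
  have e1 := LinearMap.congr_fun hc z
  rw [phiMap_apply, hz'.1, hz'.2, hc'] at e1
  exact hz0 (by simpa using e1.symm)

/-- The space of the `a ⊗ 1 + 1 ⊗ f` with `a` and `f` skew. -/
noncomputable def skewKron (φ₁ : LinearMap.BilinForm k V₁) (φ₂ : LinearMap.BilinForm k V₂) :
    Submodule k (Module.End k (V₁ ⊗[k] V₂)) :=
  ((skewAdjointLieSubalgebra φ₁).toSubmodule.prod (skewAdjointLieSubalgebra φ₂).toSubmodule).map
    (kronSum k V₁ V₂)

/-- A linear form that vanishes on the skew maps and on `1`, but not on a given nonscalar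
symmetric map. -/
lemma exists_form_separating {φ : LinearMap.BilinForm k V₁} (hn : φ.Nondegenerate)
    {s : Module.End k V₁} (hs : s ∈ symEnd φ) (hs' : ¬ ∃ c : k, s = c • 1) :
    ∃ l : Module.End k V₁ →ₗ[k] k,
      (∀ t ∈ skewAdjointLieSubalgebra φ, l t = 0) ∧ l LinearMap.id = 0 ∧ l s ≠ 0 := by
  let S : Submodule k (Module.End k V₁) :=
    (skewAdjointLieSubalgebra φ).toSubmodule ⊔ Submodule.span k {1}
  have hsS : s ∉ S := by
    intro h
    obtain ⟨t, ht, y, hy, hty⟩ := Submodule.mem_sup.mp h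
    obtain ⟨c, rfl⟩ := Submodule.mem_span_singleton.mp hy
    refine hs' ⟨c, ?_⟩
    have ht' := mem_skewAdjoint_iff.mp (show t ∈ skewAdjointLieSubalgebra φ from ht)
    have : t = 0 := by
      refine LinearMap.ext fun v => eq_zero_of_nondegenerate hn fun w => ?_
      have e1 := mem_symEnd_iff.mp hs v w
      rw [← hty] at e1
      simp only [LinearMap.add_apply, map_add, LinearMap.smul_apply, map_smul,
        Module.End.one_apply] at e1
      have e2 := ht' v w
      have : (2 : k) * φ (t v) w = 0 := by linear_combination e1 + e2
      simpa using this
    rw [← hty, this, zero_add]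
  obtain ⟨l, hl, hlS⟩ := Submodule.exists_le_ker_of_notMem hsS
  exact ⟨l, fun t ht => hlS (Submodule.mem_sup_left ht),
    hlS (Submodule.mem_sup_right (Submodule.mem_span_singleton_self _)), hl⟩

lemma contractFst_skewKron {l : Module.End k V₁ →ₗ[k] k}
    (hl : ∀ t ∈ skewAdjointLieSubalgebra φ₁, l t = 0) (hl1 : l LinearMap.id = 0)
    {x : Module.End k (V₁ ⊗[k] V₂)} (hx : x ∈ skewKron φ₁ φ₂) : contractFst l x = 0 := by
  obtain ⟨⟨a, f⟩, ⟨ha, hf⟩, rfl⟩ := hx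
  rw [kronSum_apply, map_add, contractFst_map, contractFst_map, hl1, hl a ha]
  simp

lemma contractSnd_skewKron {l : Module.End k V₂ →ₗ[k] k}
    (hl : ∀ t ∈ skewAdjointLieSubalgebra φ₂, l t = 0) (hl1 : l LinearMap.id = 0)
    {x : Module.End k (V₁ ⊗[k] V₂)} (hx : x ∈ skewKron φ₁ φ₂) : contractSnd l x = 0 := by
  obtain ⟨⟨a, f⟩, ⟨ha, hf⟩, rfl⟩ := hx
  rw [kronSum_apply, map_add, contractSnd_map, contractSnd_map, hl1, hl f hf]
  simp

/-- The span of the `t ⊗ s` with `t` skew and `s` symmetric. -/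
def skewSym (φ₁ : LinearMap.BilinForm k V₁) (φ₂ : LinearMap.BilinForm k V₂) :
    Submodule k (Module.End k (V₁ ⊗[k] V₂)) :=
  Submodule.span k {x | ∃ t ∈ skewAdjointLieSubalgebra φ₁, ∃ s ∈ symEnd φ₂,
    x = TensorProduct.map t s}

/-- Contract the first factor with a linear form l that vanishes on the skew maps and on 1. Both
summands of the sup are killed, but s ⊗ t goes to l(s)t; for a nonscalar s one can choose l(s) ≠ 0.
-/
lemma scalar_of_skew_le (hn₁ : φ₁.Nondegenerate) {t : Module.End k V₂} (ht : t ≠ 0)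
    (ht' : t ∈ skewAdjointLieSubalgebra φ₂)
    (h : ∀ x ∈ skewAdjointLieSubalgebra (φ₁.tmul φ₂), x ∈ skewKron φ₁ φ₂ ⊔ skewSym φ₁ φ₂)
    (s : Module.End k V₁) (hs : s ∈ symEnd φ₁) : ∃ c : k, s = c • 1 := by
  by_contra hs'
  obtain ⟨l, hl, hl1, hls⟩ := exists_form_separating hn₁ hs hs'
  obtain ⟨y, hy, z, hz, hyz⟩ := Submodule.mem_sup.mp (h _ (map_mem_skew' hs ht'))
  have e1 := congrArg (contractFst l) hyz
  have e2 : contractFst l z = 0 := by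
    have hz' : z ∈ LinearMap.ker (contractFst (W := V₂) l) := by
      refine (Submodule.span_le.mpr ?_) hz
      rintro _ ⟨t, ht, s, hs, rfl⟩
      exact LinearMap.mem_ker.mpr (by rw [contractFst_map, hl t ht, zero_smul])
    exact hz'
  rw [map_add, contractFst_skewKron hl hl1 hy, e2, contractFst_map, add_zero] at e1
  exact (smul_ne_zero hls ht) e1.symm

/-- The same contraction argument, on the second factor and applied to t ⊗ s. -/
lemma scalar_of_skewSym_le (hn₂ : φ₂.Nondegenerate) {t : Module.End k V₁} (ht : t ≠ 0)
    (ht' : t ∈ skewAdjointLieSubalgebra φ₁)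
    (h : ∀ x ∈ skewSym φ₁ φ₂, x ∈ skewKron φ₁ φ₂)
    (s : Module.End k V₂) (hs : s ∈ symEnd φ₂) : ∃ c : k, s = c • 1 := by
  by_contra hs'
  obtain ⟨l, hl, hl1, hls⟩ := exists_form_separating hn₂ hs hs'
  have hy := h _ (Submodule.subset_span ⟨t, ht', s, hs, rfl⟩)
  have e1 := contractSnd_skewKron hl hl1 hy
  rw [contractSnd_map] at e1
  exact (smul_ne_zero hls ht) e1

end TensorForms


/-! ### Recognizing a Lie-Yamaguti algebra inside the endomorphisms of a tensor product -/

namespace LieYamaguti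

variable {k : Type*} [Field k] {m : Type*} [AddCommGroup m] [Module k m] {L : LieYamaguti k m}
  {V₁ V₂ : Type*} [AddCommGroup V₁] [Module k V₁] [AddCommGroup V₂] [Module k V₂]

section

variable {E : Type*} [LieRing E] [LieAlgebra k E] {G : LieSubalgebra k E}

lemma coe_map_add (Φ : L.Envelope ≃ₗ⁅k⁆ G) (x y : L.Envelope) :
    (Φ (x + y)).1 = (Φ x).1 + (Φ y).1 := by
  rw [map_add]; rfl

lemma coe_map_sub (Φ : L.Envelope ≃ₗ⁅k⁆ G) (x y : L.Envelope) :
    (Φ (x - y)).1 = (Φ x).1 - (Φ y).1 := by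
  rw [map_sub]; rfl

lemma coe_map_smul (Φ : L.Envelope ≃ₗ⁅k⁆ G) (c : k) (x : L.Envelope) :
    (Φ (c • x)).1 = c • (Φ x).1 := by
  rw [map_smul]; rfl

lemma coe_map_zero (Φ : L.Envelope ≃ₗ⁅k⁆ G) : (Φ 0).1 = 0 := by
  rw [map_zero]; rfl

lemma coe_map_lie (Φ : L.Envelope ≃ₗ⁅k⁆ G) (x y : L.Envelope) :
    (Φ ⁅x, y⁆).1 = ⁅(Φ x).1, (Φ y).1⁆ := by
  rw [LieEquiv.map_lie]; rfl

lemma eq_of_coe_map (Φ : L.Envelope ≃ₗ⁅k⁆ G) {x y : L.Envelope} (h : (Φ x).1 = (Φ y).1) : x = y :=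
  Φ.injective (Subtype.ext h)

lemma exists_coe_map_eq (Φ : L.Envelope ≃ₗ⁅k⁆ G) {z : E} (hz : z ∈ G) : ∃ x, (Φ x).1 = z := by
  obtain ⟨x, hx⟩ := Φ.surjective ⟨z, hz⟩
  exact ⟨x, congrArg Subtype.val hx⟩

lemma coe_lie_ofDer_ofVec (Φ : L.Envelope ≃ₗ⁅k⁆ G) (d : L.innerDer) (x : m) :
    (Φ (L.ofVec (d.1 x))).1 = ⁅(Φ (L.ofDer d)).1, (Φ (L.ofVec x)).1⁆ := by
  rw [← lie_ofDer_ofVec, coe_map_lie]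

/-- The action of `D(m, m)` through a realization of the enveloping algebra. -/
def derRep (Φ : L.Envelope ≃ₗ⁅k⁆ G) : L.innerDer →ₗ⁅k⁆ E where
  toFun d := (Φ (L.ofDer d)).1
  map_add' d d' := (congrArg (fun x => (Φ x).1) (map_add L.ofDerₗ d d')).trans (coe_map_add Φ _ _)
  map_smul' c d := (congrArg (fun x => (Φ x).1) (map_smul L.ofDerₗ c d)).trans (coe_map_smul Φ _ _)
  map_lie' {d d'} := by rw [← coe_map_lie, lie_ofDer_ofDer]

lemma derRep_apply (Φ : L.Envelope ≃ₗ⁅k⁆ G) (d : L.innerDer) :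
    derRep Φ d = (Φ (L.ofDer d)).1 := rfl

lemma eq_zero_of_derRep (Φ : L.Envelope ≃ₗ⁅k⁆ G) {d : L.innerDer} (h : derRep Φ d = 0) : d = 0 := by
  apply L.ofDer_inj
  apply eq_of_coe_map Φ
  rw [← derRep_apply, ← derRep_apply, h, map_zero]

/-- An `ad D(m, m)`-stable complement `j(X)` of `D(m, m)` in the enveloping algebra is `m`. -/
lemma exists_vec_equiv [IsAlgClosed k] [CharZero k] [FiniteDimensional k m]
    (hirr : L.IsIrreducible) (hns : L.IsNonSimpleType)
    (hsimple : LieAlgebra.IsSimple k L.Envelope) (Φ : L.Envelope ≃ₗ⁅k⁆ G) {X : Type*}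
    [AddCommGroup X] [Module k X] {j : X →ₗ[k] E} (hjinj : Function.Injective j)
    (hjG : ∀ u, j u ∈ G) (hjlie : ∀ d u, ⁅derRep Φ d, j u⁆ ∈ LinearMap.range j)
    (hjdisj : ∀ d, derRep Φ d ∈ LinearMap.range j → derRep Φ d = 0)
    (hjsup : ∀ z ∈ G, ∃ d, z - derRep Φ d ∈ LinearMap.range j) :
    ∃ e : X ≃ₗ[k] m, ∀ u, (Φ (L.ofVec (e u))).1 = j u := by
  let M : Submodule k L.Envelope :=
    (LinearMap.range j).comap (G.toSubmodule.subtype ∘ₗ Φ.toLinearEquiv.toLinearMap)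
  have hM : ∀ x, x ∈ M ↔ (Φ x).1 ∈ LinearMap.range j := fun x => Iff.rfl
  have hdisj : ∀ d, L.ofDer d ∈ M → d = 0 := fun d hd => eq_zero_of_derRep Φ (hjdisj d hd)
  have hvec : ∀ x, L.ofVec x ∈ M := by
    refine ofVec_mem_of_complement L hirr hns hsimple M ?_ hdisj ?_
    · intro d x hx
      obtain ⟨u, hu⟩ := (hM x).mp hx
      rw [hM, coe_map_lie, ← hu]
      exact hjlie d u
    · intro x
      obtain ⟨d, hd⟩ := hjsup _ (Φ (L.ofVec x)).2
      refine ⟨d, (hM _).mpr ?_⟩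
      rw [coe_map_sub]
      exact hd
  -- If j(u) is the image of d + x with d in D and x in m, then both j(u) and x belong to the
  -- complement, hence so does d, and d = 0.
  have hpre : ∀ u, ∃ x, (Φ (L.ofVec x)).1 = j u := by
    intro u
    obtain ⟨y, hy⟩ := exists_coe_map_eq Φ (hjG u)
    refine ⟨y.2, ?_⟩
    have h1 : L.ofDer y.1 ∈ M := by
      have hyM : y ∈ M := (hM y).mpr ⟨u, hy.symm⟩
      have := sub_mem hyM (hvec y.2)
      nth_rewrite 1 [← L.ofDer_add_ofVec y] at this
      rwa [add_sub_cancel_right] at this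
    have h2 := hdisj _ h1
    have : L.ofVec y.2 = y := by
      conv_rhs => rw [← L.ofDer_add_ofVec y, h2]
      exact (zero_add (L.ofVec y.2)).symm
    rw [this, hy]
  let r : m →ₗ[k] E :=
    G.toSubmodule.subtype ∘ₗ Φ.toLinearEquiv.toLinearMap ∘ₗ L.ofVecₗ
  have hr : ∀ x, r x = (Φ (L.ofVec x)).1 := fun _ => rfl
  have hrinj : Function.Injective r := by
    intro x y h
    rw [hr, hr] at h
    exact L.ofVec_inj (Φ.injective (Subtype.ext h))
  have hrange : LinearMap.range j = LinearMap.range r := by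
    apply le_antisymm
    · rintro _ ⟨u, rfl⟩
      obtain ⟨x, hx⟩ := hpre u
      exact ⟨x, hx⟩
    · rintro _ ⟨x, rfl⟩
      exact hvec x
  refine ⟨(LinearEquiv.ofInjective j hjinj).trans ((LinearEquiv.ofEq _ _ hrange).trans
    (LinearEquiv.ofInjective r hrinj).symm), fun u => ?_⟩
  rw [← hr]
  have := LinearEquiv.apply_symm_apply (LinearEquiv.ofInjective r hrinj)
    ((LinearEquiv.ofEq _ _ hrange) ((LinearEquiv.ofInjective j hjinj) u))
  exact congrArg Subtype.val this

lemma mul_and_der_of_lie (Φ : L.Envelope ≃ₗ⁅k⁆ G) {x y w : m} {d : L.innerDer}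
    (h : ⁅(Φ (L.ofVec x)).1, (Φ (L.ofVec y)).1⁆ = (Φ (L.ofDer d)).1 + (Φ (L.ofVec w)).1) :
    L.der x y = d ∧ L.mul x y = w := by
  have h1 : ⁅L.ofVec x, L.ofVec y⁆ = L.ofDer d + L.ofVec w := by
    apply eq_of_coe_map Φ
    rw [coe_map_lie, coe_map_add, h]
  have h2 := (lie_ofVec_ofVec L x y).symm.trans h1
  constructor
  · have h3 := congrArg Envelope.fst h2
    change L.der x y + 0 = d + 0 at h3
    simpa using h3
  · have h3 := congrArg Envelope.snd h2
    change 0 + L.mul x y = 0 + w at h3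
    simpa using h3

end

variable {G : LieSubalgebra k (Module.End k (V₁ ⊗[k] V₂))} (Φ : L.Envelope ≃ₗ⁅k⁆ G)
  [CharZero k] [FiniteDimensional k V₁] [FiniteDimensional k V₂] [Nontrivial V₁] [Nontrivial V₂]

/-- Otherwise the elements acting as a ⊗ 1 would form an ideal of g(m), nonzero by `hI` and proper
by `hJ`. -/
lemma not_forall_kronSum (hsimple : LieAlgebra.IsSimple k L.Envelope)
    (hI : ∃ x, x ≠ 0 ∧ ∃ a, LinearMap.trace k V₁ a = 0 ∧ (Φ x).1 = kronSum k V₁ V₂ (a, 0))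
    (hJ : ∃ x, x ≠ 0 ∧ ∃ f, LinearMap.trace k V₂ f = 0 ∧ (Φ x).1 = kronSum k V₁ V₂ (0, f)) :
    ¬ ∀ x, ∃ a f, LinearMap.trace k V₁ a = 0 ∧ LinearMap.trace k V₂ f = 0 ∧
      (Φ x).1 = kronSum k V₁ V₂ (a, f) := by
  intro hall
  let N : LieIdeal k L.Envelope :=
    { carrier := {x | ∃ a, LinearMap.trace k V₁ a = 0 ∧ (Φ x).1 = kronSum k V₁ V₂ (a, 0)}
      zero_mem' := ⟨0, map_zero _, by
        rw [coe_map_zero, show ((0 : Module.End k V₁), (0 : Module.End k V₂)) = 0 from rfl, map_zero]⟩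
      add_mem' := by
        rintro x y ⟨a, ha, hx⟩ ⟨b, hb, hy⟩
        refine ⟨a + b, by rw [map_add, ha, hb, add_zero], ?_⟩
        rw [coe_map_add, hx, hy, ← map_add, Prod.mk_add_mk, add_zero]
      smul_mem' := by
        rintro c x ⟨a, ha, hx⟩
        refine ⟨c • a, by rw [map_smul, ha, smul_zero], ?_⟩
        rw [coe_map_smul, hx, ← map_smul, Prod.smul_mk, smul_zero]
      lie_mem := by
        rintro x y ⟨a, ha, hy⟩
        obtain ⟨b, f, hb, hf, hx⟩ := hall x
        refine ⟨⁅b, a⁆, LinearMap.trace_lie _ _, ?_⟩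
        rw [coe_map_lie, hx, hy, lie_kronSum_kronSum, lie_zero] }
  obtain ⟨x, hx0, a, ha, hx⟩ := hI
  obtain ⟨y, hy0, f, hf, hy⟩ := hJ
  rcases hsimple.eq_bot_or_eq_top N with h | h
  · have : x ∈ N := ⟨a, ha, hx⟩
    rw [h] at this
    exact hx0 (by simpa using this)
  · have : y ∈ N := by rw [h]; trivial
    obtain ⟨b, hb, hy'⟩ := this
    have h1 : kronSum k V₁ V₂ (b, -f) = 0 := by
      have : ((b, -f) : Module.End k V₁ × Module.End k V₂) = (b, 0) - (0, f) := by simp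
      rw [this, map_sub, ← hy, ← hy', sub_self]
    have h2 := (kronSum_eq_zero hb (by rw [map_neg, hf, neg_zero]) h1).2
    apply hy0
    apply eq_of_coe_map Φ
    rw [hy, neg_eq_zero.mp h2, show ((0 : Module.End k V₁), (0 : Module.End k V₂)) = 0 from rfl,
      map_zero, coe_map_zero]

variable {s₁ : LieSubalgebra k (Module.End k V₁)} {s₂ : LieSubalgebra k (Module.End k V₂)}

/-- The elements of g(m) realized by s₁ ⊕ s₂ form a D-stable subspace containing D. It cannot
contain m by `not_forall_kronSum`, so it meets m trivially and is equal to D. -/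
lemma exists_der_of_kronSum [IsAlgClosed k] (hirr : L.IsIrreducible)
    (hsimple : LieAlgebra.IsSimple k L.Envelope)
    (ht₁ : ∀ a ∈ s₁, LinearMap.trace k V₁ a = 0) (ht₂ : ∀ f ∈ s₂, LinearMap.trace k V₂ f = 0)
    (hder : ∀ d, ∃ a ∈ s₁, ∃ f ∈ s₂, (Φ (L.ofDer d)).1 = kronSum k V₁ V₂ (a, f))
    (hI : ∃ x, x ≠ 0 ∧ ∃ a, LinearMap.trace k V₁ a = 0 ∧ (Φ x).1 = kronSum k V₁ V₂ (a, 0))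
    (hJ : ∃ x, x ≠ 0 ∧ ∃ f, LinearMap.trace k V₂ f = 0 ∧ (Φ x).1 = kronSum k V₁ V₂ (0, f))
    (hG : ∀ a ∈ s₁, ∀ f ∈ s₂, kronSum k V₁ V₂ (a, f) ∈ G) :
    ∀ a ∈ s₁, ∀ f ∈ s₂, ∃ d, (Φ (L.ofDer d)).1 = kronSum k V₁ V₂ (a, f) := by
  let S : Submodule k L.Envelope := ((s₁.toSubmodule.prod s₂.toSubmodule).map
    (kronSum k V₁ V₂)).comap (G.toSubmodule.subtype ∘ₗ Φ.toLinearEquiv.toLinearMap)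
  have hS : ∀ x, x ∈ S ↔ ∃ a ∈ s₁, ∃ f ∈ s₂, (Φ x).1 = kronSum k V₁ V₂ (a, f) := by
    intro x
    constructor
    · rintro ⟨⟨a, f⟩, ⟨ha, hf⟩, h⟩
      exact ⟨a, ha, f, hf, h.symm⟩
    · rintro ⟨a, ha, f, hf, h⟩
      exact ⟨⟨a, f⟩, ⟨ha, hf⟩, h.symm⟩
  have hdS : ∀ d, L.ofDer d ∈ S := fun d => (hS _).mpr (hder d)
  rcases vec_dichotomy L hirr S (by
    intro d x hx
    obtain ⟨a, ha, f, hf, hd⟩ := hder d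
    obtain ⟨b, hb, g, hg, hx⟩ := (hS x).mp hx
    refine (hS _).mpr ⟨_, s₁.lie_mem ha hb, _, s₂.lie_mem hf hg, ?_⟩
    rw [coe_map_lie, hd, hx, lie_kronSum_kronSum]) with h | h
  · refine absurd (fun x => ?_) (not_forall_kronSum Φ hsimple hI hJ)
    have hx : x ∈ S := by
      rw [← L.ofDer_add_ofVec x]
      exact add_mem (hdS _) (h _)
    obtain ⟨a, ha, f, hf, hx⟩ := (hS x).mp hx
    exact ⟨a, f, ht₁ a ha, ht₂ f hf, hx⟩
  · intro a ha f hf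
    obtain ⟨x, hx⟩ := exists_coe_map_eq Φ (hG a ha f hf)
    have hxS : x ∈ S := (hS x).mpr ⟨a, ha, f, hf, hx⟩
    have hx2 : x.2 = 0 := h _ (by
      have := sub_mem hxS (hdS x.1)
      nth_rewrite 1 [← L.ofDer_add_ofVec x] at this
      rwa [add_sub_cancel_left] at this)
    refine ⟨x.1, ?_⟩
    have : L.ofDer x.1 = x := by
      conv_rhs => rw [← L.ofDer_add_ofVec x, hx2]
      exact (add_zero (L.ofDer x.1)).symm
    rw [this, hx]

lemma exists_der_equiv_of_kronSum
    (ht₁ : ∀ a ∈ s₁, LinearMap.trace k V₁ a = 0) (ht₂ : ∀ f ∈ s₂, LinearMap.trace k V₂ f = 0)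
    (hder : ∀ d, ∃ a ∈ s₁, ∃ f ∈ s₂, (Φ (L.ofDer d)).1 = kronSum k V₁ V₂ (a, f))
    (hsurj : ∀ a ∈ s₁, ∀ f ∈ s₂, ∃ d, (Φ (L.ofDer d)).1 = kronSum k V₁ V₂ (a, f)) :
    ∃ Ψ : L.innerDer ≃ₗ⁅k⁆ s₁ × s₂,
      ∀ d, (Φ (L.ofDer d)).1 = kronSum k V₁ V₂ ((Ψ d).1.1, (Ψ d).2.1) := by
  choose a ha f hf hd using hder
  have huniq : ∀ p q : s₁ × s₂, kronSum k V₁ V₂ (p.1.1, p.2.1) = kronSum k V₁ V₂ (q.1.1, q.2.1) →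
      p = q := by
    intro p q h
    have h1 : kronSum k V₁ V₂ (p.1.1 - q.1.1, p.2.1 - q.2.1) = 0 := by
      rw [← Prod.mk_sub_mk, map_sub, h, sub_self]
    obtain ⟨h2, h3⟩ := kronSum_eq_zero (by rw [map_sub, ht₁ _ p.1.2, ht₁ _ q.1.2, sub_zero])
      (by rw [map_sub, ht₂ _ p.2.2, ht₂ _ q.2.2, sub_zero]) h1
    exact Prod.ext (Subtype.ext (sub_eq_zero.mp h2)) (Subtype.ext (sub_eq_zero.mp h3))
  let ψ : L.innerDer → s₁ × s₂ := fun d => (⟨a d, ha d⟩, ⟨f d, hf d⟩)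
  have hψ : ∀ d, (Φ (L.ofDer d)).1 = kronSum k V₁ V₂ ((ψ d).1.1, (ψ d).2.1) := hd
  have hinj : Function.Injective ψ := by
    intro d d' h
    have : (Φ (L.ofDer d)).1 = (Φ (L.ofDer d')).1 := by rw [hψ, hψ, h]
    exact L.ofDer_inj (Φ.injective (Subtype.ext this))
  have hsur : Function.Surjective ψ := by
    intro p
    obtain ⟨d, hd⟩ := hsurj _ p.1.2 _ p.2.2
    exact ⟨d, huniq _ _ (by rw [← hψ, hd])⟩
  let Ψ : L.innerDer →ₗ⁅k⁆ s₁ × s₂ :=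
    { toFun := ψ
      map_add' := fun d d' => huniq _ _ (by
        change kronSum k V₁ V₂ _ = kronSum k V₁ V₂ ((ψ d).1.1 + (ψ d').1.1, (ψ d).2.1 + (ψ d').2.1)
        rw [← hψ, ← Prod.mk_add_mk, map_add, ← hψ, ← hψ, ← coe_map_add]
        exact congrArg (fun x => (Φ x).1) (map_add L.ofDerₗ d d'))
      map_smul' := fun c d => huniq _ _ (by
        change kronSum k V₁ V₂ _ = kronSum k V₁ V₂ (c • (ψ d).1.1, c • (ψ d).2.1)
        rw [← hψ, ← Prod.smul_mk, map_smul, ← hψ, ← coe_map_smul]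
        exact congrArg (fun x => (Φ x).1) (map_smul L.ofDerₗ c d))
      map_lie' := fun {d d'} => huniq _ _ (by
        change kronSum k V₁ V₂ _ =
          kronSum k V₁ V₂ (⁅(ψ d).1.1, (ψ d').1.1⁆, ⁅(ψ d).2.1, (ψ d').2.1⁆)
        rw [← hψ, ← lie_kronSum_kronSum, ← hψ, ← hψ, ← lie_ofDer_ofDer, coe_map_lie]) }
  exact ⟨LieEquiv.ofBijective Ψ ⟨hinj, hsur⟩, hd⟩

variable {X₁ X₂ : Type*} [AddCommGroup X₁] [Module k X₁] [AddCommGroup X₂] [Module k X₂]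

/-- The image of X₁ ⊗ X₂ is stable under D, and by `hG` it spans G together with D. It meets D
trivially because both partial traces vanish on it, whereas they recover a and f from a ⊗ 1 + 1 ⊗ f.
By uniqueness of the complement it is m. -/
lemma exists_vec_equiv_of_map [IsAlgClosed k] [FiniteDimensional k m] (hirr : L.IsIrreducible)
    (hns : L.IsNonSimpleType) (hsimple : LieAlgebra.IsSimple k L.Envelope)
    (ht₁ : ∀ a ∈ s₁, LinearMap.trace k V₁ a = 0) (ht₂ : ∀ f ∈ s₂, LinearMap.trace k V₂ f = 0)
    (hder : ∀ d, ∃ a ∈ s₁, ∃ f ∈ s₂, (Φ (L.ofDer d)).1 = kronSum k V₁ V₂ (a, f))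
    (hsurj : ∀ a ∈ s₁, ∀ f ∈ s₂, ∃ d, (Φ (L.ofDer d)).1 = kronSum k V₁ V₂ (a, f))
    {ι₁ : X₁ →ₗ[k] Module.End k V₁} {ι₂ : X₂ →ₗ[k] Module.End k V₂}
    (hι₁ : Function.Injective ι₁) (hι₂ : Function.Injective ι₂)
    (htX₁ : ∀ x, LinearMap.trace k V₁ (ι₁ x) = 0) (htX₂ : ∀ x, LinearMap.trace k V₂ (ι₂ x) = 0)
    (hs₁ : ∀ a ∈ s₁, ∀ x, ∃ y, ⁅a, ι₁ x⁆ = ι₁ y) (hs₂ : ∀ f ∈ s₂, ∀ x, ∃ y, ⁅f, ι₂ x⁆ = ι₂ y)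
    (hmem : ∀ x y, TensorProduct.map (ι₁ x) (ι₂ y) ∈ G)
    (hG : ∀ z ∈ G, ∃ a ∈ s₁, ∃ f ∈ s₂,
      z - kronSum k V₁ V₂ (a, f) ∈ Submodule.span k {z | ∃ x y, z = TensorProduct.map (ι₁ x) (ι₂ y)}) :
    ∃ e : (X₁ ⊗[k] X₂) ≃ₗ[k] m,
      ∀ x y, (Φ (L.ofVec (e (x ⊗ₜ y)))).1 = TensorProduct.map (ι₁ x) (ι₂ y) := by
  let j : X₁ ⊗[k] X₂ →ₗ[k] Module.End k (V₁ ⊗[k] V₂) :=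
    (endTensor k V₁ V₂).toLinearMap ∘ₗ TensorProduct.map ι₁ ι₂
  have hj : ∀ x y, j (x ⊗ₜ y) = TensorProduct.map (ι₁ x) (ι₂ y) := fun x y => endTensor_tmul _ _
  have hjinj : Function.Injective j :=
    (endTensor k V₁ V₂).injective.comp (TensorProduct.map_injective_of_flat_flat _ _ hι₁ hι₂)
  have hjr : ∀ z ∈ Submodule.span k {z | ∃ x y, z = TensorProduct.map (ι₁ x) (ι₂ y)},
      z ∈ LinearMap.range j := by
    intro z hz
    refine (Submodule.span_le.mpr ?_) hz
    rintro _ ⟨x, y, rfl⟩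
    exact ⟨x ⊗ₜ y, hj x y⟩
  have hjG : ∀ u, j u ∈ G := by
    intro u
    induction u with
    | zero => rw [map_zero]; exact zero_mem _
    | tmul x y => rw [hj]; exact hmem x y
    | add u v hu hv => rw [map_add]; exact add_mem hu hv
  have hjlie : ∀ a ∈ s₁, ∀ f ∈ s₂, ∀ u, ⁅kronSum k V₁ V₂ (a, f), j u⁆ ∈ LinearMap.range j := by
    intro a ha f hf u
    induction u with
    | zero => rw [map_zero, lie_zero]; exact zero_mem _
    | add u v hu hv => rw [map_add, lie_add]; exact add_mem hu hv
    | tmul x y =>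
      obtain ⟨x', hx'⟩ := hs₁ a ha x
      obtain ⟨y', hy'⟩ := hs₂ f hf y
      refine ⟨x' ⊗ₜ y + x ⊗ₜ y', ?_⟩
      rw [hj, lie_kronSum_map, map_add, hj, hj, hx', hy']
  have hj0 : ∀ u, contractSnd (LinearMap.trace k V₂) (j u) = 0 ∧
      contractFst (LinearMap.trace k V₁) (j u) = 0 := by
    intro u
    induction u with
    | zero => simp
    | add u v hu hv => simp only [map_add, hu.1, hu.2, hv.1, hv.2, add_zero, and_self]
    | tmul x y =>
      rw [hj, contractSnd_map, contractFst_map, htX₁, htX₂, zero_smul, zero_smul]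
      exact ⟨rfl, rfl⟩
  have hjdisj : ∀ d, derRep Φ d ∈ LinearMap.range j → derRep Φ d = 0 := by
    rintro d ⟨u, hu⟩
    obtain ⟨a, ha, f, hf, h⟩ := hder d
    rw [derRep_apply, h] at hu ⊢
    have h1 := (hj0 u).1
    have h2 := (hj0 u).2
    rw [hu, kronSum_apply, map_add, contractSnd_map, contractSnd_map, trace_one', ht₂ f hf,
      zero_smul, add_zero] at h1
    rw [hu, kronSum_apply, map_add, contractFst_map, contractFst_map, trace_one', ht₁ a ha,
      zero_smul, zero_add] at h2
    have n1 : (Module.finrank k V₁ : k) ≠ 0 := Nat.cast_ne_zero.mpr Module.finrank_pos.ne'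
    have n2 : (Module.finrank k V₂ : k) ≠ 0 := Nat.cast_ne_zero.mpr Module.finrank_pos.ne'
    rw [(smul_eq_zero.mp h1).resolve_left n2, (smul_eq_zero.mp h2).resolve_left n1,
      show ((0 : Module.End k V₁), (0 : Module.End k V₂)) = 0 from rfl, map_zero]
  obtain ⟨e, he⟩ := exists_vec_equiv hirr hns hsimple Φ hjinj hjG (fun d u => by
    obtain ⟨a, ha, f, hf, h⟩ := hder d
    rw [derRep_apply, h]
    exact hjlie a ha f hf u) hjdisj (fun z hz => by
    obtain ⟨a, ha, f, hf, h⟩ := hG z hz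
    obtain ⟨d, hd⟩ := hsurj a ha f hf
    refine ⟨d, ?_⟩
    rw [derRep_apply, hd]
    exact hjr _ h)
  exact ⟨e, fun x y => by rw [he, hj]⟩

omit [CharZero k] [FiniteDimensional k V₁] [FiniteDimensional k V₂] [Nontrivial V₁]
  [Nontrivial V₂] in
-- Turns commutators computed in End(V₁ ⊗ V₂) into the action of D(m, m) and into the two components
-- of a bracket of vectors.
lemma der_mul_tri_of_map (Ψ : L.innerDer ≃ₗ⁅k⁆ s₁ × s₂)
    (hΨ : ∀ d, (Φ (L.ofDer d)).1 = kronSum k V₁ V₂ ((Ψ d).1.1, (Ψ d).2.1))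
    {ι₁ : X₁ →ₗ[k] Module.End k V₁} {ι₂ : X₂ →ₗ[k] Module.End k V₂}
    (e : (X₁ ⊗[k] X₂) ≃ₗ[k] m)
    (he : ∀ x y, (Φ (L.ofVec (e (x ⊗ₜ y)))).1 = TensorProduct.map (ι₁ x) (ι₂ y)) :
    (∀ d x y x' y', ⁅(Ψ d).1.1, ι₁ x⁆ = ι₁ x' → ⁅(Ψ d).2.1, ι₂ y⁆ = ι₂ y' →
      d.1 (e (x ⊗ₜ y)) = e (x' ⊗ₜ y + x ⊗ₜ y')) ∧
    (∀ (x x' : X₁) (y y' : X₂) (p : s₁ × s₂) (w : X₁ ⊗[k] X₂),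
      ⁅TensorProduct.map (ι₁ x) (ι₂ y), TensorProduct.map (ι₁ x') (ι₂ y')⁆
        = kronSum k V₁ V₂ (p.1.1, p.2.1) + (Φ (L.ofVec (e w))).1 →
      Ψ (L.der (e (x ⊗ₜ y)) (e (x' ⊗ₜ y'))) = p ∧ L.mul (e (x ⊗ₜ y)) (e (x' ⊗ₜ y')) = e w) := by
  constructor
  · intro d x y x' y' h1 h2
    apply L.ofVec_inj
    apply eq_of_coe_map Φ
    rw [coe_lie_ofDer_ofVec, hΨ, he, lie_kronSum_map, h1, h2, map_add, ← he, ← he,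
      ← coe_map_add]
    exact congrArg (fun x => (Φ x).1) (map_add L.ofVecₗ _ _).symm
  · intro x x' y y' p w h
    obtain ⟨h1, h2⟩ := mul_and_der_of_lie Φ (x := e (x ⊗ₜ y)) (y := e (x' ⊗ₜ y')) (w := e w)
      (d := Ψ.symm p) (by rw [he, he, h, hΨ, LieEquiv.apply_symm_apply])
    exact ⟨by rw [h1, LieEquiv.apply_symm_apply], h2⟩

/-- The bracket of two pure tensors of endomorphisms. -/
lemma lie_map_map {a b : Module.End k V₁} {f g : Module.End k V₂} :
    ⁅TensorProduct.map a f, TensorProduct.map b g⁆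
      = kronSum k V₁ V₂ ((1 / (Module.finrank k V₂ : k) * LinearMap.trace k V₂ (f * g)) • ⁅a, b⁆,
          (1 / (Module.finrank k V₁ : k) * LinearMap.trace k V₁ (a * b)) • ⁅f, g⁆)
        + (TensorProduct.map ((1 / 2 : k) • ⁅a, b⁆) (jordanTraceless f g)
          + TensorProduct.map (jordanTraceless a b) ((1 / 2 : k) • ⁅f, g⁆)) := by
  -- The identity is ab ⊗ fg - ba ⊗ gf = ½[a,b] ⊗ (fg + gf) + (ab + ba) ⊗ ½[f,g], with the trace
  -- parts of the anticommutators moved to the terms [a,b] ⊗ 1 and 1 ⊗ [f,g].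
  apply TensorProduct.ext'
  intro v w
  have n1 : (Module.finrank k V₁ : k) ≠ 0 := Nat.cast_ne_zero.mpr Module.finrank_pos.ne'
  have n2 : (Module.finrank k V₂ : k) ≠ 0 := Nat.cast_ne_zero.mpr Module.finrank_pos.ne'
  simp only [Ring.lie_def, LinearMap.sub_apply, Module.End.mul_apply, TensorProduct.map_tmul,
    LinearMap.add_apply, kronSum_tmul, LinearMap.smul_apply, jordanTraceless,
    Module.End.one_apply, ← TensorProduct.smul_tmul', TensorProduct.tmul_smul,
    TensorProduct.sub_tmul, TensorProduct.tmul_sub, TensorProduct.add_tmul, TensorProduct.tmul_add]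
  module

end LieYamaguti


/-! ### Conjugation by linear isomorphisms, and dimension bounds from traceless maps -/

section ConjEquiv

variable {k : Type*} [Field k] {V W : Type*} [AddCommGroup V] [Module k V] [AddCommGroup W]
  [Module k W]

lemma exists_lieEquiv_conj (T : V ≃ₗ[k] W) (G : LieSubalgebra k (Module.End k V))
    (G' : LieSubalgebra k (Module.End k W)) (h : ∀ x, x ∈ G ↔ T.conj x ∈ G') :
    ∃ Θ : G ≃ₗ⁅k⁆ G', ∀ x, (Θ x).1 = T.conj x.1 := by
  refine ⟨LieEquiv.ofSubalgebras G G' T.lieConj ?_, fun x => rfl⟩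
  ext y
  rw [LieSubalgebra.mem_map]
  constructor
  · rintro ⟨x, hx, rfl⟩
    exact (h x).mp hx
  · intro hy
    refine ⟨T.symm.conj y, (h _).mpr ?_, ?_⟩
    · have : T.conj (T.symm.conj y) = y := by
        ext v; simp [LinearEquiv.conj_apply]
      rwa [this]
    · ext v
      change T.conj (T.symm.conj y) v = y v
      simp [LinearEquiv.conj_apply]

lemma conj_mem_slEnd (T : V ≃ₗ[k] W) (x : Module.End k V) :
    x ∈ slEnd k V ↔ T.conj x ∈ slEnd k W := by
  change LinearMap.trace k V x = 0 ↔ LinearMap.trace k W (T.conj x) = 0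
  rw [LinearMap.trace_conj']

lemma conj_mem_skew (T : V ≃ₗ[k] W) (φ : LinearMap.BilinForm k W) (x : Module.End k V) :
    x ∈ skewAdjointLieSubalgebra (φ.compl₁₂ T.toLinearMap T.toLinearMap) ↔
      T.conj x ∈ skewAdjointLieSubalgebra φ := by
  rw [mem_skewAdjoint_iff, mem_skewAdjoint_iff]
  constructor
  · intro h v w
    simpa [LinearEquiv.conj_apply] using h (T.symm v) (T.symm w)
  · intro h v w
    simpa [LinearEquiv.conj_apply] using h (T v) (T w)

lemma eq_zero_of_trace_eq_zero [FiniteDimensional k V] (h : Module.finrank k V = 1)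
    {a : Module.End k V} (ha : LinearMap.trace k V a = 0) : a = 0 := by
  obtain ⟨v, hv, hspan⟩ := finrank_eq_one_iff'.mp h
  obtain ⟨c, hc⟩ := hspan (a v)
  have ha' : a = c • 1 := by
    ext w
    obtain ⟨b, rfl⟩ := hspan w
    rw [map_smul, ← hc, LinearMap.smul_apply, Module.End.one_apply, smul_comm]
  rw [ha', map_smul, LinearMap.trace_one, h] at ha
  have : c = 0 := by simpa using ha
  rw [ha', this, zero_smul]

lemma two_le_finrank [FiniteDimensional k V] {a : Module.End k V} (h0 : a ≠ 0)
    (ha : LinearMap.trace k V a = 0) : 2 ≤ Module.finrank k V := by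
  by_contra h
  have : Module.finrank k V = 0 ∨ Module.finrank k V = 1 := by omega
  rcases this with h | h
  · have := Module.finrank_zero_iff.mp h
    exact h0 (LinearMap.ext fun v => Subsingleton.elim _ _)
  · exact h0 (eq_zero_of_trace_eq_zero h ha)

lemma trace_kronSum [FiniteDimensional k V] [FiniteDimensional k W] (a : Module.End k V)
    (f : Module.End k W) : LinearMap.trace k (V ⊗[k] W) (kronSum k V W (a, f))
      = LinearMap.trace k V a * (Module.finrank k W : k)
        + (Module.finrank k V : k) * LinearMap.trace k W f := by
  rw [kronSum_apply, map_add, LinearMap.trace_tensorProduct', LinearMap.trace_tensorProduct',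
    trace_one', trace_one']

lemma nontrivial_of_tensor {V₁ V₂ V : Type*} [AddCommGroup V₁] [Module k V₁] [AddCommGroup V₂]
    [Module k V₂] [AddCommGroup V] [Module k V] [Nontrivial V] (T : (V₁ ⊗[k] V₂) ≃ₗ[k] V) :
    Nontrivial V₁ ∧ Nontrivial V₂ := by
  have hne : Nontrivial (V₁ ⊗[k] V₂) := T.toEquiv.nontrivial
  constructor
  · by_contra h
    rw [not_nontrivial_iff_subsingleton] at h
    exact not_subsingleton _ (inferInstance : Subsingleton (V₁ ⊗[k] V₂))
  · by_contra h
    rw [not_nontrivial_iff_subsingleton] at h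
    exact not_subsingleton _ (inferInstance : Subsingleton (V₁ ⊗[k] V₂))

end ConjEquiv

/-! ### The action of D(m, m) on an irreducible module -/

namespace LieYamaguti

variable {k : Type*} [Field k] {m : Type*} [AddCommGroup m] [Module k m]
  [IsAlgClosed k] [CharZero k] [FiniteDimensional k m] {V : Type*} [AddCommGroup V] [Module k V]
  [FiniteDimensional k V] [Nontrivial V]

/-- If `D(m, m)` acts irreducibly on `V`, then `V` is a tensor product and `D(m, m)` consists of
maps `a ⊗ 1 + 1 ⊗ f`. -/
theorem exists_kron_decomposition (L : LieYamaguti k m) (hirr : L.IsIrreducible)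
    (hns : L.IsNonSimpleType) (hsimple : LieAlgebra.IsSimple k L.Envelope)
    (ρ : L.innerDer →ₗ⁅k⁆ Module.End k V)
    (hV : ∀ U : Submodule k V, (∀ d, ∀ u ∈ U, ρ d u ∈ U) → U = ⊥ ∨ U = ⊤) :
    ∃ (n₁ n₂ : ℕ) (T : ((Fin n₁ → k) ⊗[k] (Fin n₂ → k)) ≃ₗ[k] V),
      (∀ d, ∃ a f, T.symm.conj (ρ d) = kronSum k _ _ (a, f)) ∧
      (∃ d, d ≠ 0 ∧ ∃ a, T.symm.conj (ρ d) = kronSum k _ _ (a, 0)) ∧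
      (∃ d, d ≠ 0 ∧ ∃ f, T.symm.conj (ρ d) = kronSum k _ _ (0, f)) ∧
      (∀ U : Submodule k (Fin n₁ → k),
        (∀ a, (∃ d, T.symm.conj (ρ d) = kronSum k _ _ (a, 0)) → ∀ u ∈ U, a u ∈ U) →
          U = ⊥ ∨ U = ⊤) := by
  obtain ⟨I, J, ⟨a₀, ha₀, ha₀'⟩, ⟨b₀, hb₀, hb₀'⟩, hcomm, hdisj, hsum⟩ :=
    exists_ideals L hirr hns hsimple
  -- The commuting families are the images of the two ideals I and J. They generate the image of D,
  -- so joint stability under them is stability under D.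
  obtain ⟨n₁, n₂, T, hP, hQ, hirr₁⟩ := exists_tensor_decomposition
    (I.toSubmodule.map (ρ : L.innerDer →ₗ[k] Module.End k V))
    (J.toSubmodule.map (ρ : L.innerDer →ₗ[k] Module.End k V)) (by
      rintro _ ⟨a, ha, rfl⟩ _ ⟨b, hb, rfl⟩ v
      have h1 : ⁅ρ a, ρ b⁆ = 0 := by rw [← LieHom.map_lie, hcomm a ha b hb, map_zero]
      have h2 := LinearMap.congr_fun h1 v
      rw [Ring.lie_def] at h2
      exact sub_eq_zero.mp h2) (by
      intro U h1 h2
      refine hV U fun d u hu => ?_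
      obtain ⟨a, ha, b, hb, rfl⟩ := hsum d
      rw [map_add]
      exact add_mem (h1 _ ⟨a, ha, rfl⟩ u hu) (h2 _ ⟨b, hb, rfl⟩ u hu))
  have hconj : ∀ d x, (∀ u, ρ d (T u) = T (x u)) → T.symm.conj (ρ d) = x := by
    intro d x h
    refine LinearMap.ext fun u => ?_
    rw [LinearEquiv.conj_apply_apply, LinearEquiv.symm_symm, h, LinearEquiv.symm_apply_apply]
  have hIa : ∀ d ∈ I, ∃ a, T.symm.conj (ρ d) = kronSum k _ _ (a, 0) := by
    intro d hd
    obtain ⟨a, ha⟩ := hP _ ⟨d, hd, rfl⟩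
    refine ⟨a, hconj d _ fun u => ?_⟩
    rw [kronSum_apply, TensorProduct.map_zero_right, add_zero]
    exact ha u
  have hJf : ∀ d ∈ J, ∃ f, T.symm.conj (ρ d) = kronSum k _ _ (0, f) := by
    intro d hd
    obtain ⟨f, hf⟩ := hQ _ ⟨d, hd, rfl⟩
    refine ⟨f, hconj d _ fun u => ?_⟩
    rw [kronSum_apply, TensorProduct.map_zero_left, zero_add]
    exact hf u
  refine ⟨n₁, n₂, T, fun d => ?_, ⟨a₀, ha₀', hIa a₀ ha₀⟩, ⟨b₀, hb₀', hJf b₀ hb₀⟩, fun U hU => ?_⟩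
  · obtain ⟨x, hx, y, hy, rfl⟩ := hsum d
    obtain ⟨a, ha⟩ := hIa x hx
    obtain ⟨f, hf⟩ := hJf y hy
    refine ⟨a, f, ?_⟩
    rw [map_add, map_add, ha, hf, ← map_add, Prod.mk_add_mk, add_zero, zero_add]
  · refine hirr₁ U ?_
    rintro _ ⟨d, hd, rfl⟩ a ha
    refine hU a ⟨d, hconj d _ fun u => ?_⟩
    rw [kronSum_apply, TensorProduct.map_zero_right, add_zero]
    exact ha u

end LieYamaguti


/-! ### Forms on planes -/

section DimTwo

variable {k : Type*} [Field k] [CharZero k] {V : Type*} [AddCommGroup V] [Module k V]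
  [FiniteDimensional k V] {φ : LinearMap.BilinForm k V}

lemma IsEpsSymm.self_eq_zero (hφ : IsEpsSymm (-1) φ) (v : V) : φ v v = 0 := by
  have := hφ v v
  have h2 : (2 : k) * φ v v = 0 := by linear_combination this
  simpa using h2

/-- In dimension `2`, `φ(x, y) z + φ(y, z) x + φ(z, x) y = 0` for `φ` skew-symmetric. -/
lemma smul_eq_of_finrank_two (hφ : IsEpsSymm (-1) φ) (h : Module.finrank k V = 2) (x y z : V) :
    φ x y • z = φ x z • y - φ y z • x := by
  let b := Module.finBasisOfFinrankEq k V h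
  have h10 : φ (b 1) (b 0) = -φ (b 0) (b 1) := by rw [hφ]; ring
  rw [← b.sum_repr x, ← b.sum_repr y, ← b.sum_repr z]
  simp only [Fin.sum_univ_two, map_add, map_smul, LinearMap.add_apply, LinearMap.smul_apply,
    hφ.self_eq_zero, h10, smul_eq_mul]
  module

/-- In dimension `2`, the skew maps of a symmetric form are the multiples of one map. -/
lemma exists_skew_generator (hφ : IsEpsSymm 1 φ) (hn : φ.Nondegenerate)
    (h : Module.finrank k V = 2) :
    ∃ s ∈ skewAdjointLieSubalgebra φ, s ≠ 0 ∧
      ∀ t ∈ skewAdjointLieSubalgebra φ, ∃ c : k, t = c • s := by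
  let b := Module.finBasisOfFinrankEq k V h
  have hgen : ∀ v w, ∃ c : k, phiMap 1 φ v w = c • phiMap 1 φ (b 0) (b 1) := by
    intro v w
    -- For a symmetric form φ_{v,w} is alternating in (v, w), so in a plane it depends only on the
    -- determinant of the coordinates.
    refine ⟨b.repr v 0 * b.repr w 1 - b.repr v 1 * b.repr w 0, LinearMap.ext fun z => ?_⟩
    conv_lhs => rw [← b.sum_repr v, ← b.sum_repr w]
    simp only [Fin.sum_univ_two, phiMap_apply, LinearMap.smul_apply, map_add, map_smul,
      LinearMap.add_apply, smul_eq_mul]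
    module
  refine ⟨phiMap 1 φ (b 0) (b 1), phiMap_mem (by ring) hφ _ _, fun h0 => ?_, fun t ht => ?_⟩
  · have : b 0 = 0 := by
      refine eq_zero_of_nondegenerate hn fun z => ?_
      have h1 := LinearMap.congr_fun h0 z
      rw [phiMap_apply] at h1
      have h2 := congrArg (fun v => b.repr v 1) h1
      simpa using h2
    exact b.ne_zero 0 this
  · have hle : Submodule.span k {d | ∃ v w, d = phiMap 1 φ v w}
        ≤ Submodule.span k {phiMap 1 φ (b 0) (b 1)} := by
      refine Submodule.span_le.mpr ?_
      rintro _ ⟨v, w, rfl⟩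
      obtain ⟨c, hc⟩ := hgen v w
      exact Submodule.mem_span_singleton.mpr ⟨c, hc.symm⟩
    obtain ⟨c, hc⟩ := Submodule.mem_span_singleton.mp
      (hle (mem_span_phiMap (by ring) hφ hn ht))
    exact ⟨c, hc.symm⟩

end DimTwo

/-! ### Skew maps of the form a ⊗ 1 + 1 ⊗ f -/

section KronSkew

variable {k : Type*} [Field k] [CharZero k] {V₁ V₂ : Type*} [AddCommGroup V₁] [Module k V₁]
  [AddCommGroup V₂] [Module k V₂] [FiniteDimensional k V₁] [FiniteDimensional k V₂]
  {φ₁ : LinearMap.BilinForm k V₁} {φ₂ : LinearMap.BilinForm k V₂} {ε₁ ε₂ : k}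

/-- If s and s' are the symmetric parts of a and f, then s ⊗ 1 + 1 ⊗ s' is both symmetric and skew,
hence zero. The parts s and s' themselves may be opposite scalars, which is why a and f have to be
replaced. -/
lemma exists_skew_of_kronSum_mem_skew (hε₁ : ε₁ * ε₁ = 1) (hε₂ : ε₂ * ε₂ = 1)
    (h₁ : IsEpsSymm ε₁ φ₁) (h₂ : IsEpsSymm ε₂ φ₂) (hn₁ : φ₁.Nondegenerate)
    (hn₂ : φ₂.Nondegenerate) (hn : (φ₁.tmul φ₂).Nondegenerate) {a : Module.End k V₁}
    {f : Module.End k V₂} (h : kronSum k V₁ V₂ (a, f) ∈ skewAdjointLieSubalgebra (φ₁.tmul φ₂)) :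
    ∃ t ∈ skewAdjointLieSubalgebra φ₁, ∃ t' ∈ skewAdjointLieSubalgebra φ₂,
      kronSum k V₁ V₂ (a, f) = kronSum k V₁ V₂ (t, t') := by
  obtain ⟨s, hs, t, ht, rfl⟩ := exists_sym_add_skew hε₁ h₁ hn₁ a
  obtain ⟨s', hs', t', ht', rfl⟩ := exists_sym_add_skew hε₂ h₂ hn₂ f
  have hsum : kronSum k V₁ V₂ (s + t, s' + t')
      = kronSum k V₁ V₂ (s, s') + kronSum k V₁ V₂ (t, t') := by
    rw [← map_add, Prod.mk_add_mk]
  have hskew : kronSum k V₁ V₂ (s, s') ∈ skewAdjointLieSubalgebra (φ₁.tmul φ₂) := by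
    have := sub_mem h (kronSum_mem_skew ht ht')
    rwa [hsum, add_sub_cancel_right] at this
  have hsym : ∀ u u', φ₁.tmul φ₂ (kronSum k V₁ V₂ (s, s') u) u'
      = φ₁.tmul φ₂ u (kronSum k V₁ V₂ (s, s') u') := by
    intro u u'
    rw [kronSum_apply, LinearMap.add_apply, LinearMap.add_apply, map_add, map_add,
      LinearMap.add_apply,
      map_form_apply (c := 1) (d := 1) (a := s) (f := LinearMap.id)
        (by simpa using mem_symEnd_iff.mp hs) (by simp),
      map_form_apply (c := 1) (d := 1) (a := LinearMap.id) (f := s') (by simp)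
        (by simpa using mem_symEnd_iff.mp hs')]
    ring
  have h0 : kronSum k V₁ V₂ (s, s') = 0 := by
    rw [mem_skewAdjoint_iff] at hskew
    refine LinearMap.ext fun v => eq_zero_of_nondegenerate hn fun w => ?_
    have e1 := hskew v w
    rw [← hsym v w] at e1
    have : (2 : k) * (φ₁.tmul φ₂) (kronSum k V₁ V₂ (s, s') v) w = 0 := by linear_combination e1
    simpa using this
  exact ⟨t, ht, t', ht', by rw [hsum, h0, zero_add]⟩

end KronSkew

/-! ### Orthogonal sums with a summand of small dimension -/

namespace LieYamaguti

variable {k : Type*} [Field k] {m : Type*} [AddCommGroup m] [Module k m]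
  [IsAlgClosed k] [CharZero k] [FiniteDimensional k m]

lemma eq_zero_of_central_fst (L : LieYamaguti k m) (hirr : L.IsIrreducible) {S₁ S₂ : Type*}
    [LieRing S₁] [LieAlgebra k S₁] [LieRing S₂] [LieAlgebra k S₂] (Ψ : L.innerDer ≃ₗ⁅k⁆ S₁ × S₂)
    (s : S₁) (hs : ∀ t : S₁, ⁅t, s⁆ = 0) : s = 0 := by
  have h0 := eq_zero_of_central L hirr (Ψ.symm (s, 0)) (fun d => by
    obtain ⟨p, rfl⟩ := Ψ.symm.surjective d
    have h1 : ⁅p, ((s, 0) : S₁ × S₂)⁆ = 0 := Prod.ext (hs p.1) (lie_zero p.2)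
    have h2 : Ψ.symm ⁅p, ((s, 0) : S₁ × S₂)⁆ = ⁅Ψ.symm p, Ψ.symm (s, 0)⁆ := LieEquiv.map_lie _ _ _
    exact h2.symm.trans (by rw [h1, map_zero]))
  have h1 : Ψ (Ψ.symm (s, 0)) = Ψ 0 := congrArg Ψ h0
  rw [LieEquiv.apply_symm_apply, map_zero] at h1
  exact congrArg Prod.fst h1

section Quadric

variable {V : Type*} [AddCommGroup V] [Module k V] [FiniteDimensional k V]
  {ψ : LinearMap.BilinForm k V}

/-- If the triple product is `ψ(x, z) y - ψ(y, z) x` for a symmetric form `ψ`, then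
`dim m = 4` and the triple product comes from two skew-symmetric forms in dimension `2`. -/
lemma formsConclusion_of_quadric (L : LieYamaguti k m) (hirr : L.IsIrreducible)
    (hns : L.IsNonSimpleType) (hsimple : LieAlgebra.IsSimple k L.Envelope) (g : V ≃ₗ[k] m)
    (hψ : IsEpsSymm 1 ψ) (hn : ψ.Nondegenerate) (hmul : ∀ x y, L.mul x y = 0)
    (htri : ∀ x y z, L.tri (g x) (g y) (g z) = g (phiMap 1 ψ x y z)) :
    L.FormsConclusion (-1) (by norm_num) 2 := by
  have hm := nontrivial_of_isIrreducible L hirr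
  have hVn : Nontrivial V := g.toEquiv.nontrivial
  let ρ : L.innerDer →ₗ⁅k⁆ Module.End k V := (g.symm.lieConj : Module.End k m →ₗ⁅k⁆ _).comp L.innerDer.incl
  have hρ : ∀ d v, g (ρ d v) = d.1 (g v) := by
    intro d v
    change g (g.symm.conj d.1 v) = _
    simp [LinearEquiv.conj_apply]
  have hρinj : ∀ d, ρ d = 0 → d = 0 := by
    intro d h
    refine Subtype.ext (LinearMap.ext fun x => ?_)
    have := hρ d (g.symm x)
    rw [h] at this
    simpa using this.symm
  have hρder : ∀ x y, ρ (L.der (g x) (g y)) = phiMap 1 ψ x y := fun x y => LinearMap.ext fun v => by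
    apply g.injective
    rw [hρ, ← htri]
    rfl
  have hρmem : ∀ d, ρ d ∈ skewAdjointLieSubalgebra ψ := by
    intro d
    induction d using innerDer_induction with
    | h0 => rw [map_zero]; exact zero_mem _
    | hadd a b ha hb => rw [map_add]; exact add_mem ha hb
    | hsmul c a ha => rw [map_smul]; exact SMulMemClass.smul_mem c ha
    | hder x y =>
      obtain ⟨x, rfl⟩ := g.surjective x
      obtain ⟨y, rfl⟩ := g.surjective y
      rw [hρder]
      exact phiMap_mem (by ring) hψ _ _
  have hρsurj : ∀ f ∈ skewAdjointLieSubalgebra ψ, ∃ d, ρ d = f := by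
    intro f hf
    have h1 := mem_span_phiMap (by ring) hψ hn hf
    have h2 : Submodule.span k {d | ∃ v w, d = phiMap 1 ψ v w}
        ≤ LinearMap.range (ρ : L.innerDer →ₗ[k] Module.End k V) := by
      refine Submodule.span_le.mpr ?_
      rintro _ ⟨v, w, rfl⟩
      exact ⟨_, hρder v w⟩
    exact h2 h1
  -- At this point D is identified with so(V, ψ) acting irreducibly on V ≅ m. Non-simplicity of D
  -- now makes V a tensor product.
  obtain ⟨n₁, n₂, T, hder, ⟨d₁, hd₁, a, hda⟩, ⟨d₂, hd₂, f, hdf⟩, hirr₁⟩ :=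
    exists_kron_decomposition L hirr hns hsimple ρ (by
      intro U hU
      by_cases h : U = ⊥
      · exact Or.inl h
      · right
        obtain ⟨u, hu, hu0⟩ := Submodule.exists_mem_ne_zero_of_ne_bot h
        have := eq_top_of_stable L hirr (U.map g.toLinearMap) (by
          rintro d _ ⟨v, hv, rfl⟩
          exact ⟨_, hU d v hv, hρ d v⟩) ⟨u, hu, rfl⟩ (by simpa using hu0)
        rw [Submodule.eq_top_iff'] at this ⊢
        intro v
        obtain ⟨w, hw, hwv⟩ := this (g v)
        rwa [← g.injective hwv])
  have hconj : ∀ x, T.conj (T.symm.conj x) = x := fun x => by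
    ext v; simp [LinearEquiv.conj_apply]
  have hconj' : ∀ x, T.symm.conj (T.conj x) = x := fun x => LinearMap.ext fun v => by
    simp [LinearEquiv.conj_apply]
  obtain ⟨hne₁, hne₂⟩ := nontrivial_of_tensor T
  let φ : LinearMap.BilinForm k ((Fin n₁ → k) ⊗[k] (Fin n₂ → k)) :=
    ψ.compl₁₂ T.toLinearMap T.toLinearMap
  have hnφ : φ.Nondegenerate := nondegenerate_compl₁₂ T hn
  have hskew : ∀ d, T.symm.conj (ρ d) ∈ skewAdjointLieSubalgebra φ := fun d =>
    (conj_mem_skew T ψ _).mpr (by rw [hconj]; exact hρmem d)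
  obtain ⟨φ₁, φ₂, ε₁, ε₂, hε₁, hε₂, hε, h₁, h₂, hn₁, hn₂, hφ, ha₁, hf₂⟩ :=
    exists_forms_of_invariant (ε := 1) (by ring) (φ := φ) (fun v w => hψ (T v) (T w)) hnφ
      {a | ∃ d, T.symm.conj (ρ d) = kronSum k _ _ (a, 0)} (fun U hU => hirr₁ U hU) (by
        rintro a ⟨d, hd⟩
        have := hskew d
        rwa [hd, kronSum_apply, TensorProduct.map_zero_right, add_zero] at this)
  have hφt : φ = φ₁.tmul φ₂ := eq_tmul_form hφ
  rw [kronSum_apply, TensorProduct.map_zero_right, add_zero] at hda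
  rw [kronSum_apply, TensorProduct.map_zero_left, zero_add] at hdf
  have ha : a ∈ skewAdjointLieSubalgebra φ₁ := ha₁ a (hda ▸ hskew d₁)
  have hf : f ∈ skewAdjointLieSubalgebra φ₂ := hf₂ f (hdf ▸ hskew d₂)
  have ha0 : a ≠ 0 := by
    rintro rfl
    apply hd₁
    apply hρinj
    rw [← hconj (ρ d₁), hda, TensorProduct.map_zero_left, map_zero]
  have hf0 : f ≠ 0 := by
    rintro rfl
    apply hd₂
    apply hρinj
    rw [← hconj (ρ d₂), hdf, TensorProduct.map_zero_right, map_zero]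
  -- As D is all of so(V, ψ), every skew map is a sum a ⊗ 1 + 1 ⊗ f. This leaves no room for
  -- products of a skew map with a nonscalar symmetric one, so both factors are symplectic planes.
  have hle : ∀ x ∈ skewAdjointLieSubalgebra (φ₁.tmul φ₂), x ∈ skewKron φ₁ φ₂ := by
    intro x hx
    obtain ⟨d, hd⟩ := hρsurj _ ((conj_mem_skew T ψ x).mp (by rw [← hφt] at hx; exact hx))
    obtain ⟨b, c, hbc⟩ := hder d
    rw [hd, hconj'] at hbc
    rw [hbc] at hx ⊢
    obtain ⟨t, ht, t', ht', htt⟩ :=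
      exists_skew_of_kronSum_mem_skew hε₁ hε₂ h₁ h₂ hn₁ hn₂ (hφt ▸ hnφ) hx
    exact ⟨(t, t'), ⟨ht, ht'⟩, htt.symm⟩
  have hsc₁ := scalar_of_skew_le hn₁ hf0 hf (fun x hx => Submodule.mem_sup_left (hle x hx))
  have hsc₂ := scalar_of_skewSym_le hn₂ ha0 ha (fun x hx => hle x (by
    refine (Submodule.span_le (p := (skewAdjointLieSubalgebra (φ₁.tmul φ₂)).toSubmodule)).mpr ?_ hx
    rintro _ ⟨t, ht, s, hs, rfl⟩
    exact map_mem_skew ht hs))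
  obtain ⟨rfl, hr₁⟩ := eq_neg_one_of_symEnd_le hε₁ h₁ hn₁
    (two_le_finrank ha0 (trace_eq_zero_of_skew hε₁ h₁ hn₁ ha)) hsc₁
  obtain ⟨rfl, hr₂⟩ := eq_neg_one_of_symEnd_le hε₂ h₂ hn₂
    (two_le_finrank hf0 (trace_eq_zero_of_skew hε₂ h₂ hn₂ hf)) hsc₂
  -- The factor ½ comes from (A+B) ⊗ (A'-B') + (A-B) ⊗ (A'+B') = 2(A ⊗ A' - B ⊗ B'), where A =
  -- φ₁(x₁,z₁)y₁, B = φ₁(y₁,z₁)x₁ and A', B' are the analogues in V₂. The planar identity rewrites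
  -- φ₁(x₁,y₁)z₁ as A - B, and A ⊗ A' - B ⊗ B' is the given triple product.
  have h₁' : IsEpsSymm (-1) ((1 / 2 : k) • φ₁) := fun v w => by
    simp only [LinearMap.smul_apply, smul_eq_mul]
    rw [h₁]; ring
  have hn₁' : LinearMap.BilinForm.Nondegenerate ((1 / 2 : k) • φ₁) :=
    nondegenerate_of_left h₁' fun v hv => eq_zero_of_nondegenerate hn₁ fun w => by
      simpa using hv w
  have hprod : L.HasProductsForms (-1) ((1 / 2 : k) • φ₁) φ₂ (T.trans g) := by
    refine ⟨hmul, fun x₁ y₁ z₁ x₂ y₂ z₂ => ?_⟩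
    simp only [LinearEquiv.trans_apply]
    rw [htri]
    congr 1
    have e1 : ∀ v v' w w', ψ (T (v ⊗ₜ w)) (T (v' ⊗ₜ w')) = φ₁ v v' * φ₂ w w' := hφ
    have e2 := smul_eq_of_finrank_two h₁ hr₁ x₁ y₁ z₁
    have e3 := smul_eq_of_finrank_two h₂ hr₂ x₂ y₂ z₂
    rw [phiMap_apply, e1, e1, ← map_smul, ← map_smul, ← map_sub]
    congr 1
    have e4 : φ₂ x₂ y₂ • (phiMap (-1) ((1 / 2 : k) • φ₁) x₁ y₁ z₁ ⊗ₜ[k] z₂)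
        = phiMap (-1) ((1 / 2 : k) • φ₁) x₁ y₁ z₁ ⊗ₜ[k] (φ₂ x₂ y₂ • z₂) := by
      rw [TensorProduct.tmul_smul]
    have e5 : ((1 / 2 : k) • φ₁) x₁ y₁ • (z₁ ⊗ₜ[k] phiMap (-1) φ₂ x₂ y₂ z₂)
        = (1 / 2 : k) • ((φ₁ x₁ y₁ • z₁) ⊗ₜ[k] phiMap (-1) φ₂ x₂ y₂ z₂) := by
      rw [← TensorProduct.smul_tmul', smul_smul]; rfl
    rw [e4, e5, e2, e3]
    simp only [phiMap_apply, LinearMap.smul_apply, TensorProduct.sub_tmul, TensorProduct.tmul_sub,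
      ← TensorProduct.smul_tmul', TensorProduct.tmul_smul, smul_eq_mul]
    module
  exact hprod.formsConclusion hsimple (by norm_num) h₁' h₂ hn₁' hn₂ (by norm_num) hr₁.ge hr₂.ge

end Quadric

variable {V₁ V₂ : Type*} [AddCommGroup V₁] [Module k V₁] [AddCommGroup V₂] [Module k V₂]
  [FiniteDimensional k V₁] [FiniteDimensional k V₂] {φ₁ : LinearMap.BilinForm k V₁}
  {φ₂ : LinearMap.BilinForm k V₂}

/-- If V₁ is a line, then m ≅ V₂ with the triple product of a quadratic space, and
`formsConclusion_of_quadric` applies. If V₁ is a plane, so(V₁) is a one-dimensional central ideal of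
D, which is impossible. -/
lemma HasProductsForms.formsConclusion_of_finrank_le {L : LieYamaguti k m}
    (hirr : L.IsIrreducible) (hns : L.IsNonSimpleType)
    (hsimple : LieAlgebra.IsSimple k L.Envelope) {e : (V₁ ⊗[k] V₂) ≃ₗ[k] m}
    (h : L.HasProductsForms 1 φ₁ φ₂ e) (h₁ : IsEpsSymm 1 φ₁) (h₂ : IsEpsSymm 1 φ₂)
    (hn₁ : φ₁.Nondegenerate) (hn₂ : φ₂.Nondegenerate) [Nontrivial V₁] [Nontrivial V₂]
    (hd : Module.finrank k V₁ ≤ 2) : L.FormsConclusion (-1) (by norm_num) 2 := by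
  have hpos : 0 < Module.finrank k V₁ := Module.finrank_pos
  rcases (by omega : Module.finrank k V₁ = 1 ∨ Module.finrank k V₁ = 2) with hd | hd
  · obtain ⟨v, hv, hspan⟩ := finrank_eq_one_iff'.mp hd
    obtain ⟨w, hw⟩ := exists_form_eq_one hn₁ hv
    have hc : φ₁ v v ≠ 0 := by
      intro h0
      obtain ⟨c, rfl⟩ := hspan w
      rw [map_smul, h0, smul_zero] at hw
      exact zero_ne_one hw
    let g₀ : V₂ →ₗ[k] V₁ ⊗[k] V₂ := TensorProduct.mk k V₁ V₂ v
    have hg₀ : Function.Bijective g₀ := by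
      constructor
      · intro x y hxy
        have := congrArg ((TensorProduct.lid k V₂).toLinearMap ∘ₗ (φ₁ v).rTensor V₂) hxy
        simpa [g₀, hc] using this
      · intro u
        induction u with
        | zero => exact ⟨0, map_zero _⟩
        | add x y hx hy =>
          obtain ⟨x, rfl⟩ := hx
          obtain ⟨y, rfl⟩ := hy
          exact ⟨x + y, map_add _ _ _⟩
        | tmul x y =>
          obtain ⟨c, rfl⟩ := hspan x
          exact ⟨c • y, by simp [g₀, ← TensorProduct.smul_tmul']⟩
    have hψ : IsEpsSymm 1 (φ₁ v v • φ₂) := fun x y => by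
      simp only [LinearMap.smul_apply, smul_eq_mul]
      rw [h₂]; ring
    refine formsConclusion_of_quadric L hirr hns hsimple ((LinearEquiv.ofBijective g₀ hg₀).trans e)
      (ψ := φ₁ v v • φ₂) hψ (nondegenerate_of_left hψ fun x hx =>
        eq_zero_of_nondegenerate hn₂ fun y => by simpa [hc] using hx y) h.1 fun x y z => ?_
    refine (h.2 v v v x y z).trans (congrArg e ?_)
    change _ = v ⊗ₜ[k] phiMap 1 (φ₁ v v • φ₂) x y z
    have e1 : phiMap 1 φ₁ v v v = 0 := by rw [phiMap_apply]; module
    have e2 : phiMap 1 (φ₁ v v • φ₂) x y z = φ₁ v v • phiMap 1 φ₂ x y z := by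
      simp only [phiMap_apply, LinearMap.smul_apply, smul_eq_mul]; module
    rw [e1, e2, TensorProduct.zero_tmul, smul_zero, zero_add, TensorProduct.tmul_smul]
  · exfalso
    obtain ⟨Ψ, hΨ⟩ := h.exists_der_equiv (by ring) h₁ h₂ hn₁ hn₂
    obtain ⟨s, hs, hs0, hgen⟩ := exists_skew_generator h₁ hn₁ hd
    have h0 := eq_zero_of_central_fst L hirr Ψ ⟨s, hs⟩ (fun t => by
      obtain ⟨c, hc⟩ := hgen _ t.2
      apply Subtype.ext
      change ⁅t.1, s⁆ = 0
      rw [hc, smul_lie, lie_self, smul_zero])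
    exact hs0 (congrArg Subtype.val h0)

/-- No lower bound on the dimensions is assumed: a summand of dimension at most 2 leads to the
symplectic alternative. -/
theorem HasProductsForms.formsConclusion_of_symm {L : LieYamaguti k m}
    (hirr : L.IsIrreducible) (hns : L.IsNonSimpleType)
    (hsimple : LieAlgebra.IsSimple k L.Envelope) {e : (V₁ ⊗[k] V₂) ≃ₗ[k] m}
    (h : L.HasProductsForms 1 φ₁ φ₂ e) (h₁ : IsEpsSymm 1 φ₁) (h₂ : IsEpsSymm 1 φ₂)
    (hn₁ : φ₁.Nondegenerate) (hn₂ : φ₂.Nondegenerate) :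
    L.FormsConclusion 1 (by norm_num) 3 ∨ L.FormsConclusion (-1) (by norm_num) 2 := by
  have hm := nontrivial_of_isIrreducible L hirr
  obtain ⟨hne₁, hne₂⟩ := nontrivial_of_tensor e
  by_cases hd₁ : Module.finrank k V₁ ≤ 2
  · exact Or.inr (h.formsConclusion_of_finrank_le hirr hns hsimple h₁ h₂ hn₁ hn₂ hd₁)
  by_cases hd₂ : Module.finrank k V₂ ≤ 2
  · exact Or.inr (h.swap.formsConclusion_of_finrank_le hirr hns hsimple h₂ h₁ hn₂ hn₁ hd₂)
  exact Or.inl (h.formsConclusion hsimple (by norm_num) h₁ h₂ hn₁ hn₂ (by norm_num) (by omega)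
    (by omega))

end LieYamaguti


/-! ### Scalar anticommutators, and trace forms on spaces of endomorphisms -/

section SlTwo

variable {k : Type*} [Field k] [CharZero k] {V W : Type*} [AddCommGroup V] [Module k V]
  [FiniteDimensional k V] [AddCommGroup W] [Module k W] [FiniteDimensional k W]

/-- The double commutator of elements with scalar anticommutators. -/
lemma lie_lie_of_anticomm {A : Type*} [Ring A] [Algebra k A] {f g h : A} {x y z : k}
    (hfg : f * g + g * f = x • 1) (hfh : f * h + h * f = y • 1) (hgh : g * h + h * g = z • 1) :
    ⁅⁅f, g⁆, h⁆ = (2 * z) • f - (2 * y) • g := by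
  have e1 : f * (g * h + h * g) = z • f := by rw [hgh, mul_smul_comm, mul_one]
  have e2 : (g * h + h * g) * f = z • f := by rw [hgh, smul_mul_assoc, one_mul]
  have e3 : g * (f * h + h * f) = y • g := by rw [hfh, mul_smul_comm, mul_one]
  have e4 : (f * h + h * f) * g = y • g := by rw [hfh, smul_mul_assoc, one_mul]
  have e5 : ⁅⁅f, g⁆, h⁆ = f * (g * h + h * g) + (g * h + h * g) * f
      - (g * (f * h + h * f) + (f * h + h * f) * g) := by
    simp only [Ring.lie_def]
    noncomm_ring
  rw [e5, e1, e2, e3, e4]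
  module

/-- This is the polarized Cayley–Hamilton identity for traceless 2 × 2 matrices. -/
lemma anticomm_of_finrank_two (h : Module.finrank k V = 2) {a b : Module.End k V}
    (ha : LinearMap.trace k V a = 0) (hb : LinearMap.trace k V b = 0) :
    a * b + b * a = LinearMap.trace k V (a * b) • 1 := by
  let B := Module.finBasisOfFinrankEq k V h
  apply (LinearMap.toMatrix B B).injective
  rw [LinearMap.trace_eq_matrix_trace k B] at ha hb ⊢
  rw [map_add, map_smul, LinearMap.toMatrix_mul, LinearMap.toMatrix_mul, LinearMap.toMatrix_one]
  generalize LinearMap.toMatrix B B a = A at *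
  generalize LinearMap.toMatrix B B b = C at *
  rw [Matrix.trace_fin_two] at ha hb
  have ha' : A 1 1 = -A 0 0 := by linear_combination ha
  have hb' : C 1 1 = -C 0 0 := by linear_combination hb
  ext i j
  fin_cases i <;> fin_cases j <;>
    simp [Matrix.mul_apply, Fin.sum_univ_two, Matrix.trace_fin_two, ha', hb'] <;> ring

lemma jordanTraceless_eq_zero (h : Module.finrank k V = 2) {a b : Module.End k V}
    (ha : LinearMap.trace k V a = 0) (hb : LinearMap.trace k V b = 0) :
    jordanTraceless a b = 0 := by
  rw [jordanTraceless, anticomm_of_finrank_two h ha hb, h]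
  norm_num

/-- The form `tr(ab)`. -/
noncomputable def traceMulForm (k V : Type*) [Field k] [AddCommGroup V] [Module k V] :
    LinearMap.BilinForm k (Module.End k V) :=
  (LinearMap.mul k (Module.End k V)).compr₂ (LinearMap.trace k V)

lemma eq_zero_of_trace_mul {a : Module.End k V}
    (h : ∀ b, LinearMap.trace k V (a * b) = 0) : a = 0 := by
  refine LinearMap.ext fun v => (Module.forall_dual_apply_eq_zero_iff k (a v)).mp fun l => ?_
  rw [← trace_smulRight, ← h (l.smulRight v), LinearMap.trace_mul_comm]
  have : l.smulRight v * a = (l ∘ₗ a).smulRight v := LinearMap.ext fun w => rfl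
  rw [this, trace_smulRight, trace_smulRight]
  rfl

/-- The form `c tr(xy)` on a space of endomorphisms. -/
noncomputable def traceFormOf {X : Type*} [AddCommGroup X] [Module k X] (c : k)
    (ι : X →ₗ[k] Module.End k V) : LinearMap.BilinForm k X :=
  c • (traceMulForm k V).compl₁₂ ι ι

lemma traceFormOf_apply {X : Type*} [AddCommGroup X] [Module k X] (c : k)
    (ι : X →ₗ[k] Module.End k V) (x y : X) :
    traceFormOf c ι x y = c * LinearMap.trace k V (ι x * ι y) := rfl

lemma traceFormOf_isEpsSymm {X : Type*} [AddCommGroup X] [Module k X] (c : k)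
    (ι : X →ₗ[k] Module.End k V) : IsEpsSymm 1 (traceFormOf c ι) := fun x y => by
  rw [traceFormOf_apply, traceFormOf_apply, LinearMap.trace_mul_comm, one_mul]

/-- The trace form on all of End V is nondegenerate. Hypothesis `h` says that testing against any b
amounts to testing against some element of the subspace, so nondegeneracy is inherited. -/
lemma traceFormOf_nondegenerate {X : Type*} [AddCommGroup X] [Module k X] {c : k} (hc : c ≠ 0)
    {ι : X →ₗ[k] Module.End k V} (hι : Function.Injective ι)
    (h : ∀ b, ∃ y, ∀ x, LinearMap.trace k V (ι x * b) = LinearMap.trace k V (ι x * ι y)) :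
    (traceFormOf c ι).Nondegenerate := by
  refine nondegenerate_of_left (traceFormOf_isEpsSymm c ι) fun x hx => ?_
  apply hι
  rw [map_zero]
  refine eq_zero_of_trace_mul fun b => ?_
  obtain ⟨y, hy⟩ := h b
  have := hx y
  rw [traceFormOf_apply] at this
  rw [hy]
  exact (mul_eq_zero.mp this).resolve_left hc

lemma exists_trace_zero_sub [Nontrivial V] (a : Module.End k V) :
    ∃ (c : k), LinearMap.trace k V (a - c • 1) = 0 := by
  refine ⟨LinearMap.trace k V a / Module.finrank k V, ?_⟩
  have h : (Module.finrank k V : k) ≠ 0 := Nat.cast_ne_zero.mpr Module.finrank_pos.ne'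
  rw [map_sub, map_smul, LinearMap.trace_one, smul_eq_mul, div_mul_cancel₀ _ h, sub_self]

lemma comm_conj_kronSum (a : Module.End k V) (f : Module.End k W) :
    (TensorProduct.comm k V W).conj (kronSum k V W (a, f)) = kronSum k W V (f, a) := by
  refine TensorProduct.ext' fun w v => ?_
  rw [LinearEquiv.conj_apply_apply]
  simp [kronSum_tmul, add_comm]

end SlTwo

/-! ### The LY-algebra sl(V₁) ⊗ sl(V₂) -/

namespace LieYamaguti

variable {k : Type*} [Field k] {m : Type*} [AddCommGroup m] [Module k m]
  [IsAlgClosed k] [CharZero k] [FiniteDimensional k m]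

variable {V₁ V₂ : Type*} [AddCommGroup V₁] [Module k V₁] [AddCommGroup V₂] [Module k V₂]
  [FiniteDimensional k V₁] [FiniteDimensional k V₂]

/-- Clifford-type relations xy + yx = 2ν tr(xy) give [[x,y],z] = -4ν φ_{x,y}(z) for the trace form
φ. Rescaling the second form by -4ν₁ν₂ absorbs all the constants. In the applications ν is the
inverse of the dimension of the space acted on. -/
lemma hasProductsForms_of_anticomm {L : LieYamaguti k m} {X₁ X₂ : Type*} [AddCommGroup X₁]
    [Module k X₁] [AddCommGroup X₂] [Module k X₂] (e : (X₁ ⊗[k] X₂) ≃ₗ[k] m)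
    (ι₁ : X₁ →ₗ[k] Module.End k V₁) (ι₂ : X₂ →ₗ[k] Module.End k V₂) (ν₁ ν₂ : k)
    (hι₁ : ∀ x y, ι₁ x * ι₁ y + ι₁ y * ι₁ x = (2 * ν₁ * LinearMap.trace k V₁ (ι₁ x * ι₁ y)) • 1)
    (hι₂ : ∀ x y, ι₂ x * ι₂ y + ι₂ y * ι₂ x = (2 * ν₂ * LinearMap.trace k V₂ (ι₂ x * ι₂ y)) • 1)
    (hmul : ∀ x y, L.mul x y = 0)
    (htri : ∀ x y z u x' y' z' u', ι₁ u = ⁅⁅ι₁ x, ι₁ y⁆, ι₁ z⁆ → ι₂ u' = ⁅⁅ι₂ x', ι₂ y'⁆, ι₂ z'⁆ →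
      L.tri (e (x ⊗ₜ x')) (e (y ⊗ₜ y')) (e (z ⊗ₜ z'))
        = e ((ν₂ * LinearMap.trace k V₂ (ι₂ x' * ι₂ y')) • (u ⊗ₜ z')
          + (ν₁ * LinearMap.trace k V₁ (ι₁ x * ι₁ y)) • (z ⊗ₜ u'))) :
    L.HasProductsForms 1 (traceFormOf 1 ι₁) (traceFormOf (-4 * ν₁ * ν₂) ι₂) e := by
  refine ⟨hmul, fun x y z x' y' z' => ?_⟩
  rw [htri x y z ((-4 * ν₁) • phiMap 1 (traceFormOf 1 ι₁) x y z) x' y' z'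
    ((-4 * ν₂) • phiMap 1 (traceFormOf 1 ι₂) x' y' z')]
  · congr 1
    simp only [phiMap_apply, traceFormOf_apply, TensorProduct.sub_tmul, TensorProduct.tmul_sub,
      ← TensorProduct.smul_tmul', TensorProduct.tmul_smul]
    module
  · rw [lie_lie_of_anticomm (hι₁ _ _) (hι₁ _ _) (hι₁ _ _)]
    simp only [phiMap_apply, traceFormOf_apply, map_sub, map_smul]
    module
  · rw [lie_lie_of_anticomm (hι₂ _ _) (hι₂ _ _) (hι₂ _ _)]
    simp only [phiMap_apply, traceFormOf_apply, map_sub, map_smul]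
    module

omit [IsAlgClosed k] in
lemma exists_trace_mul_slEnd [Nontrivial V₁]
    (b : Module.End k V₁) : ∃ y : slEnd k V₁, ∀ x : slEnd k V₁,
      LinearMap.trace k V₁ (x.1 * b) = LinearMap.trace k V₁ (x.1 * y.1) := by
  obtain ⟨c, hc⟩ := exists_trace_zero_sub b
  refine ⟨⟨b - c • 1, hc⟩, fun x => ?_⟩
  rw [mul_sub, map_sub, mul_smul_comm, mul_one, map_smul,
    show LinearMap.trace k V₁ x.1 = 0 from x.2, smul_zero, sub_zero]

/-- The exceptional pair (2, 2): traceless maps of a plane anticommute up to scalars, so the binary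
product vanishes and each sl(Vᵢ) is a three-dimensional quadratic space. This is the isomorphism of
sl₄ with so₆. -/
lemma HasProductsSl.formsConclusion {L : LieYamaguti k m}
    (hirr : L.IsIrreducible) (hns : L.IsNonSimpleType)
    (hsimple : LieAlgebra.IsSimple k L.Envelope) {e : (slEnd k V₁ ⊗[k] slEnd k V₂) ≃ₗ[k] m}
    (h : L.HasProductsSl e) (h₁ : Module.finrank k V₁ = 2) (h₂ : Module.finrank k V₂ = 2) :
    L.FormsConclusion 1 (by norm_num) 3 ∨ L.FormsConclusion (-1) (by norm_num) 2 := by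
  have hne₁ : Nontrivial V₁ := Module.nontrivial_of_finrank_pos (R := k) (by omega)
  have hne₂ : Nontrivial V₂ := Module.nontrivial_of_finrank_pos (R := k) (by omega)
  have hprod := hasProductsForms_of_anticomm (L := L) e
    ((slEnd k V₁).incl : slEnd k V₁ →ₗ[k] Module.End k V₁)
    ((slEnd k V₂).incl : slEnd k V₂ →ₗ[k] Module.End k V₂) (1 / 2) (1 / 2)
    (fun x y => by
      change x.1 * y.1 + y.1 * x.1 = (2 * (1 / 2) * LinearMap.trace k V₁ (x.1 * y.1)) • 1
      rw [anticomm_of_finrank_two h₁ x.2 y.2]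
      norm_num)
    (fun x y => by
      change x.1 * y.1 + y.1 * x.1 = (2 * (1 / 2) * LinearMap.trace k V₂ (x.1 * y.1)) • 1
      rw [anticomm_of_finrank_two h₂ x.2 y.2]
      norm_num) (by
      have h0₁ : ∀ a b : slEnd k V₁, slJordan a b = 0 := fun a b =>
        Subtype.ext (jordanTraceless_eq_zero h₁ a.2 b.2)
      have h0₂ : ∀ a b : slEnd k V₂, slJordan a b = 0 := fun a b =>
        Subtype.ext (jordanTraceless_eq_zero h₂ a.2 b.2)
      intro x y
      obtain ⟨x, rfl⟩ := e.surjective x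
      obtain ⟨y, rfl⟩ := e.surjective y
      induction x with
      | zero => simp
      | add u v hu hv => rw [map_add, map_add, LinearMap.add_apply, hu, hv, add_zero]
      | tmul a f =>
        induction y with
        | zero => simp
        | add u v hu hv => rw [map_add, map_add, hu, hv, add_zero]
        | tmul b g => rw [h.1, h0₁, h0₂, TensorProduct.tmul_zero, TensorProduct.zero_tmul,
            add_zero, map_zero]) (by
      intro x y z u x' y' z' u' hu hu'
      rw [h.2]
      obtain rfl : u = ⁅⁅x, y⁆, z⁆ := Subtype.ext hu
      obtain rfl : u' = ⁅⁅x', y'⁆, z'⁆ := Subtype.ext hu'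
      rw [TensorProduct.tmul_smul, ← TensorProduct.smul_tmul', h₁, h₂]
      rfl)
  refine hprod.formsConclusion_of_symm hirr hns hsimple (traceFormOf_isEpsSymm _ _)
    (traceFormOf_isEpsSymm _ _)
    (traceFormOf_nondegenerate one_ne_zero Subtype.val_injective exists_trace_mul_slEnd)
    (traceFormOf_nondegenerate (by norm_num) Subtype.val_injective exists_trace_mul_slEnd)

/-- End(V₁ ⊗ V₂) = k1 ⊕ (sl(V₁) ⊗ 1 + 1 ⊗ sl(V₂)) ⊕ sl(V₁) ⊗ sl(V₂). The middle part is D by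
`exists_der_of_kronSum`, so the last part is m, and the products come from `lie_map_map`. -/
theorem exists_sl_equiv {L : LieYamaguti k m} (hirr : L.IsIrreducible) (hns : L.IsNonSimpleType)
    (hsimple : LieAlgebra.IsSimple k L.Envelope) [Nontrivial V₁] [Nontrivial V₂]
    (Φ : L.Envelope ≃ₗ⁅k⁆ slEnd k (V₁ ⊗[k] V₂))
    (hder : ∀ d, ∃ a f, (Φ (L.ofDer d)).1 = kronSum k V₁ V₂ (a, f))
    (hI : ∃ x, x ≠ 0 ∧ ∃ a, (Φ x).1 = kronSum k V₁ V₂ (a, 0))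
    (hJ : ∃ x, x ≠ 0 ∧ ∃ f, (Φ x).1 = kronSum k V₁ V₂ (0, f)) :
    2 ≤ Module.finrank k V₁ ∧ 2 ≤ Module.finrank k V₂ ∧
    ∃ (e : (slEnd k V₁ ⊗[k] slEnd k V₂) ≃ₗ[k] m) (Ψ : L.innerDer ≃ₗ⁅k⁆ slEnd k V₁ × slEnd k V₂),
      L.HasProductsSl e ∧
      (∀ a f, (Φ (L.ofVec (e (a ⊗ₜ f)))).1 = TensorProduct.map a.1 f.1) ∧
      (∀ d, (Φ (L.ofDer d)).1 = TensorProduct.map (Ψ d).1.1 LinearMap.id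
        + TensorProduct.map LinearMap.id (Ψ d).2.1) := by
  have n1 : (Module.finrank k V₁ : k) ≠ 0 := Nat.cast_ne_zero.mpr Module.finrank_pos.ne'
  have n2 : (Module.finrank k V₂ : k) ≠ 0 := Nat.cast_ne_zero.mpr Module.finrank_pos.ne'
  have htr : ∀ x, LinearMap.trace k _ (Φ x).1 = 0 := fun x => (Φ x).2
  have htr₁ : ∀ x a, (Φ x).1 = kronSum k V₁ V₂ (a, 0) → LinearMap.trace k V₁ a = 0 := by
    intro x a h
    have := htr x
    rw [h, trace_kronSum, map_zero, mul_zero, add_zero] at this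
    exact (mul_eq_zero.mp this).resolve_right n2
  have htr₂ : ∀ x f, (Φ x).1 = kronSum k V₁ V₂ (0, f) → LinearMap.trace k V₂ f = 0 := by
    intro x f h
    have := htr x
    rw [h, trace_kronSum, map_zero, zero_mul, zero_add] at this
    exact (mul_eq_zero.mp this).resolve_left n1
  have hI' : ∃ x, x ≠ 0 ∧ ∃ a, LinearMap.trace k V₁ a = 0 ∧ (Φ x).1 = kronSum k V₁ V₂ (a, 0) := by
    obtain ⟨x, hx, a, ha⟩ := hI
    exact ⟨x, hx, a, htr₁ x a ha, ha⟩
  have hJ' : ∃ x, x ≠ 0 ∧ ∃ f, LinearMap.trace k V₂ f = 0 ∧ (Φ x).1 = kronSum k V₁ V₂ (0, f) := by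
    obtain ⟨x, hx, a, ha⟩ := hJ
    exact ⟨x, hx, a, htr₂ x a ha, ha⟩
  have hder' : ∀ d, ∃ a ∈ slEnd k V₁, ∃ f ∈ slEnd k V₂,
      (Φ (L.ofDer d)).1 = kronSum k V₁ V₂ (a, f) := by
    intro d
    obtain ⟨a, f, h⟩ := hder d
    obtain ⟨c, hc⟩ := exists_trace_zero_sub a
    -- A scalar can be moved from one factor to the other. Once a is traceless, the total trace
    -- being zero makes the second map traceless as well.
    have h2 : kronSum k V₁ V₂ (a, f) = kronSum k V₁ V₂ (a - c • 1, f + c • 1) := by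
      refine TensorProduct.ext' fun v w => ?_
      simp only [kronSum_tmul, LinearMap.sub_apply, LinearMap.add_apply, LinearMap.smul_apply,
        Module.End.one_apply, TensorProduct.sub_tmul, TensorProduct.tmul_add,
        ← TensorProduct.smul_tmul', TensorProduct.tmul_smul]
      module
    refine ⟨a - c • 1, hc, f + c • 1, ?_, h.trans h2⟩
    have := htr (L.ofDer d)
    rw [h, h2, trace_kronSum, hc, zero_mul, zero_add] at this
    exact (mul_eq_zero.mp this).resolve_left n1
  have hsl : ∀ a ∈ slEnd k V₁, ∀ f ∈ slEnd k V₂,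
      kronSum k V₁ V₂ (a, f) ∈ slEnd k (V₁ ⊗[k] V₂) := by
    intro a ha f hf
    change LinearMap.trace k _ _ = 0
    rw [trace_kronSum, show LinearMap.trace k V₁ a = 0 from ha,
      show LinearMap.trace k V₂ f = 0 from hf, zero_mul, mul_zero, add_zero]
  have hsurj := exists_der_of_kronSum Φ hirr hsimple (fun a ha => ha) (fun f hf => hf) hder'
    hI' hJ' hsl
  obtain ⟨Ψ, hΨ⟩ := exists_der_equiv_of_kronSum Φ (fun a ha => ha) (fun f hf => hf) hder' hsurj
  have hdec : ∀ z : Module.End k (V₁ ⊗[k] V₂), ∃ c : k, ∃ a ∈ slEnd k V₁, ∃ f ∈ slEnd k V₂,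
      z - c • 1 - kronSum k V₁ V₂ (a, f) ∈ Submodule.span k {z | ∃ (x : slEnd k V₁)
        (y : slEnd k V₂), z = TensorProduct.map ((slEnd k V₁).incl x) ((slEnd k V₂).incl y)} := by
    intro z
    induction z using endTensor_induction with
    | h0 => exact ⟨0, 0, zero_mem _, 0, zero_mem _, by
        rw [show ((0 : Module.End k V₁), (0 : Module.End k V₂)) = 0 from rfl, map_zero]; simp⟩
    | hadd x y hx hy =>
      obtain ⟨c, a, ha, f, hf, h⟩ := hx
      obtain ⟨c', a', ha', f', hf', h'⟩ := hy
      refine ⟨c + c', a + a', add_mem ha ha', f + f', add_mem hf hf', ?_⟩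
      have := add_mem h h'
      rw [← Prod.mk_add_mk, map_add]
      convert this using 1
      module
    | hmap a f =>
      obtain ⟨c, hc⟩ := exists_trace_zero_sub a
      obtain ⟨c', hc'⟩ := exists_trace_zero_sub f
      refine ⟨c * c', c' • (a - c • 1), Submodule.smul_mem _ _ hc, c • (f - c' • 1),
        Submodule.smul_mem _ _ hc', Submodule.subset_span ⟨⟨_, hc⟩, ⟨_, hc'⟩, ?_⟩⟩
      refine TensorProduct.ext' fun v w => ?_
      change _ = (a - c • 1) v ⊗ₜ[k] (f - c' • 1) w
      simp only [kronSum_tmul, LinearMap.sub_apply, LinearMap.smul_apply,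
        Module.End.one_apply, TensorProduct.sub_tmul, TensorProduct.tmul_sub,
        ← TensorProduct.smul_tmul', TensorProduct.tmul_smul, TensorProduct.map_tmul]
      module
  have hmem : ∀ (x : slEnd k V₁) (y : slEnd k V₂),
      TensorProduct.map ((slEnd k V₁).incl x) ((slEnd k V₂).incl y) ∈ slEnd k (V₁ ⊗[k] V₂) := by
    intro x y
    change LinearMap.trace k _ _ = 0
    rw [LinearMap.trace_tensorProduct', show LinearMap.trace k V₁ ((slEnd k V₁).incl x) = 0 from x.2,
      zero_mul]
  obtain ⟨e, he⟩ := exists_vec_equiv_of_map Φ hirr hns hsimple (fun a ha => ha) (fun f hf => hf)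
    hder' hsurj (ι₁ := ((slEnd k V₁).incl : slEnd k V₁ →ₗ[k] Module.End k V₁))
    (ι₂ := ((slEnd k V₂).incl : slEnd k V₂ →ₗ[k] Module.End k V₂)) Subtype.val_injective
    Subtype.val_injective (fun x => x.2) (fun x => x.2)
    (fun a ha x => ⟨⁅(⟨a, ha⟩ : slEnd k V₁), x⁆, rfl⟩)
    (fun a ha x => ⟨⁅(⟨a, ha⟩ : slEnd k V₂), x⁆, rfl⟩) hmem (by
      intro z hz
      obtain ⟨c, a, ha, f, hf, h⟩ := hdec z
      -- All the other terms of the decomposition are traceless, and the trace of 1 is dim V₁ · dim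
      -- V₂ ≠ 0.
      have hc : c = 0 := by
        have h1 : Submodule.span k {z | ∃ (x : slEnd k V₁) (y : slEnd k V₂),
            z = TensorProduct.map ((slEnd k V₁).incl x) ((slEnd k V₂).incl y)}
            ≤ (slEnd k (V₁ ⊗[k] V₂)).toSubmodule := by
          refine Submodule.span_le.mpr ?_
          rintro _ ⟨x, y, rfl⟩
          exact hmem x y
        have h2 : LinearMap.trace k _ (z - c • 1 - kronSum k V₁ V₂ (a, f)) = 0 := h1 h
        rw [map_sub, map_sub, show LinearMap.trace k _ z = 0 from hz,
          show LinearMap.trace k _ (kronSum k V₁ V₂ (a, f)) = 0 from hsl a ha f hf, map_smul,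
          LinearMap.trace_one, Module.finrank_tensorProduct, Nat.cast_mul] at h2
        simpa [n1, n2] using h2
      rw [hc, zero_smul, sub_zero] at h
      exact ⟨a, ha, f, hf, h⟩)
  obtain ⟨hact, hprod⟩ := der_mul_tri_of_map Φ Ψ hΨ e he
  refine ⟨?_, ?_, e, Ψ, ⟨?_, ?_⟩, he, hΨ⟩
  · obtain ⟨x, hx, a, ha, h⟩ := hI'
    refine two_le_finrank (a := a) ?_ ha
    rintro rfl
    exact hx (eq_of_coe_map Φ (by
      rw [h, coe_map_zero, show ((0 : Module.End k V₁), (0 : Module.End k V₂)) = 0 from rfl,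
        map_zero]))
  · obtain ⟨x, hx, a, ha, h⟩ := hJ'
    refine two_le_finrank (a := a) ?_ ha
    rintro rfl
    exact hx (eq_of_coe_map Φ (by
      rw [h, coe_map_zero, show ((0 : Module.End k V₁), (0 : Module.End k V₂)) = 0 from rfl,
        map_zero]))
  · intro a b f g
    refine (hprod a b f g (⟨(1 / (Module.finrank k V₂ : k) * LinearMap.trace k V₂ (f.1 * g.1)) • ⁅a.1, b.1⁆,
      (slEnd k V₁).smul_mem _ ((slEnd k V₁).lie_mem a.2 b.2)⟩,
      ⟨(1 / (Module.finrank k V₁ : k) * LinearMap.trace k V₁ (a.1 * b.1)) • ⁅f.1, g.1⁆,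
      (slEnd k V₂).smul_mem _ ((slEnd k V₂).lie_mem f.2 g.2)⟩) _ ?_).2
    rw [map_add, ← ofVecₗ_apply, map_add, ofVecₗ_apply, ofVecₗ_apply, coe_map_add, he, he]
    exact lie_map_map
  · intro a b c f g h
    have h1 := (hprod a b f g (⟨(1 / (Module.finrank k V₂ : k) * LinearMap.trace k V₂ (f.1 * g.1)) • ⁅a.1, b.1⁆,
      (slEnd k V₁).smul_mem _ ((slEnd k V₁).lie_mem a.2 b.2)⟩,
      ⟨(1 / (Module.finrank k V₁ : k) * LinearMap.trace k V₁ (a.1 * b.1)) • ⁅f.1, g.1⁆,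
      (slEnd k V₂).smul_mem _ ((slEnd k V₂).lie_mem f.2 g.2)⟩)
      (((1 / 2 : k) • ⁅a, b⁆) ⊗ₜ slJordan f g + slJordan a b ⊗ₜ ((1 / 2 : k) • ⁅f, g⁆)) (by
      rw [map_add, ← ofVecₗ_apply, map_add, ofVecₗ_apply, ofVecₗ_apply, coe_map_add, he, he]
      exact lie_map_map)).1
    refine (hact (L.der (e (a ⊗ₜ f)) (e (b ⊗ₜ g))) c h
      ((1 / (Module.finrank k V₂ : k) * LinearMap.trace k V₂ (f.1 * g.1)) • ⁅⁅a, b⁆, c⁆)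
      ((1 / (Module.finrank k V₁ : k) * LinearMap.trace k V₁ (a.1 * b.1)) • ⁅⁅f, g⁆, h⁆)
      ?_ ?_).trans ?_
    · rw [h1]; exact smul_lie _ _ _
    · rw [h1]; exact smul_lie _ _ _
    · rw [TensorProduct.tmul_smul, ← TensorProduct.smul_tmul', TensorProduct.tmul_smul,
        ← TensorProduct.smul_tmul']

end LieYamaguti


/-! ### Special linear enveloping algebras, and stabilizers of subspaces -/

namespace LieYamaguti

variable {k : Type*} [Field k] {m : Type*} [AddCommGroup m] [Module k m]
  [IsAlgClosed k] [CharZero k] [FiniteDimensional k m]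

/-- The products, the enveloping algebra and the inner derivation algebra of `m` are those of
`sl(V₁) ⊗ sl(V₂)` inside `sl(V₁ ⊗ V₂)`. -/
def SlConclusion (L : LieYamaguti k m) : Prop :=
  ∃ n₁ n₂ : ℕ, 2 ≤ n₁ ∧ n₁ ≤ n₂ ∧ (n₁, n₂) ≠ (2, 2) ∧
    ∃ (e : (slEnd k (Fin n₁ → k) ⊗[k] slEnd k (Fin n₂ → k)) ≃ₗ[k] m)
      (Φ : L.Envelope ≃ₗ⁅k⁆ slEnd k ((Fin n₁ → k) ⊗[k] (Fin n₂ → k)))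
      (Ψ : L.innerDer ≃ₗ⁅k⁆ slEnd k (Fin n₁ → k) × slEnd k (Fin n₂ → k)),
      L.HasProductsSl e ∧
      (∀ a f, (Φ (L.ofVec (e (a ⊗ₜ f)))).1 = TensorProduct.map a.1 f.1) ∧
      (∀ d, (Φ (L.ofDer d)).1
        = TensorProduct.map (Ψ d).1.1 LinearMap.id
          + TensorProduct.map LinearMap.id (Ψ d).2.1)

lemma slConclusion_of_le {L : LieYamaguti k m} (hirr : L.IsIrreducible) (hns : L.IsNonSimpleType)
    (hsimple : LieAlgebra.IsSimple k L.Envelope) {n₁ n₂ : ℕ} (hle : n₁ ≤ n₂)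
    [Nontrivial (Fin n₁ → k)] [Nontrivial (Fin n₂ → k)]
    (Φ : L.Envelope ≃ₗ⁅k⁆ slEnd k ((Fin n₁ → k) ⊗[k] (Fin n₂ → k)))
    (hder : ∀ d, ∃ a f, (Φ (L.ofDer d)).1 = kronSum k _ _ (a, f))
    (hI : ∃ x, x ≠ 0 ∧ ∃ a, (Φ x).1 = kronSum k _ _ (a, 0))
    (hJ : ∃ x, x ≠ 0 ∧ ∃ f, (Φ x).1 = kronSum k _ _ (0, f)) :
    L.SlConclusion ∨ L.FormsConclusion 1 (by norm_num) 3 ∨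
      L.FormsConclusion (-1) (by norm_num) 2 := by
  obtain ⟨h₁, h₂, e, Ψ, hprod, he, hΨ⟩ := exists_sl_equiv hirr hns hsimple Φ hder hI hJ
  rw [Module.finrank_fin_fun] at h₁ h₂
  by_cases h : (n₁, n₂) = (2, 2)
  · obtain ⟨rfl, rfl⟩ := Prod.mk.inj h
    exact Or.inr (hprod.formsConclusion hirr hns hsimple (Module.finrank_fin_fun k)
      (Module.finrank_fin_fun k))
  · exact Or.inl ⟨n₁, n₂, h₁, hle, h, e, Φ, Ψ, hprod, he, hΨ⟩

lemma ofDer_ne_zero {L : LieYamaguti k m} {d : L.innerDer} (h : d ≠ 0) : L.ofDer d ≠ 0 :=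
  fun h0 => h (L.ofDer_inj (h0.trans (map_zero L.ofDerₗ).symm))

variable {V : Type*} [AddCommGroup V] [Module k V] [FiniteDimensional k V] [Nontrivial V]

theorem conclusion_of_sl_irreducible {L : LieYamaguti k m} (hirr : L.IsIrreducible)
    (hns : L.IsNonSimpleType) (hsimple : LieAlgebra.IsSimple k L.Envelope)
    (Φ : L.Envelope ≃ₗ⁅k⁆ slEnd k V)
    (hV : ∀ U : Submodule k V, (∀ d, ∀ u ∈ U, derRep Φ d u ∈ U) → U = ⊥ ∨ U = ⊤) :
    L.SlConclusion ∨ L.FormsConclusion 1 (by norm_num) 3 ∨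
      L.FormsConclusion (-1) (by norm_num) 2 := by
  obtain ⟨n₁, n₂, T, hder, ⟨d₁, hd₁, a, ha⟩, ⟨d₂, hd₂, f, hf⟩, -⟩ :=
    exists_kron_decomposition L hirr hns hsimple (derRep Φ) hV
  obtain ⟨hne₁, hne₂⟩ := nontrivial_of_tensor T
  -- The decomposition of V does not order the factors; if n₁ > n₂, the flip of the tensor product
  -- exchanges them.
  rcases le_total n₁ n₂ with hle | hle
  · obtain ⟨Θ, hΘ⟩ := exists_lieEquiv_conj T.symm (slEnd k V) (slEnd k _)
      (conj_mem_slEnd T.symm)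
    have hΘ' : ∀ d, ((Φ.trans Θ) (L.ofDer d)).1 = T.symm.conj (derRep Φ d) :=
      fun d => hΘ (Φ (L.ofDer d))
    exact slConclusion_of_le hirr hns hsimple hle (Φ.trans Θ)
      (fun d => by rw [hΘ']; exact hder d)
      ⟨_, ofDer_ne_zero hd₁, a, by rw [hΘ']; exact ha⟩
      ⟨_, ofDer_ne_zero hd₂, f, by rw [hΘ']; exact hf⟩
  · let T' := T.symm.trans (TensorProduct.comm k _ _)
    obtain ⟨Θ, hΘ⟩ := exists_lieEquiv_conj T' (slEnd k V) (slEnd k _) (conj_mem_slEnd T')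
    have hΘ' : ∀ d a f, T.symm.conj (derRep Φ d) = kronSum k _ _ (a, f) →
        ((Φ.trans Θ) (L.ofDer d)).1 = kronSum k _ _ (f, a) := by
      intro d a f h
      rw [← comm_conj_kronSum, ← h]
      exact hΘ (Φ (L.ofDer d))
    exact slConclusion_of_le hirr hns hsimple hle (Φ.trans Θ)
      (fun d => by obtain ⟨a, f, h⟩ := hder d; exact ⟨f, a, hΘ' d a f h⟩)
      ⟨_, ofDer_ne_zero hd₂, f, hΘ' _ _ _ hf⟩
      ⟨_, ofDer_ne_zero hd₁, a, hΘ' _ _ _ ha⟩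

omit [FiniteDimensional k V] [Nontrivial V] in
/-- A proper stabilizer that contains `D(m, m)` is equal to `D(m, m)`. -/
lemma exists_derRep_of_stable {L : LieYamaguti k m} (hirr : L.IsIrreducible)
    {G : LieSubalgebra k (Module.End k V)} (Φ : L.Envelope ≃ₗ⁅k⁆ G) {W : Submodule k V}
    (hW : ∀ d, ∀ u ∈ W, derRep Φ d u ∈ W) (hG : ∃ z ∈ G, ∃ u ∈ W, z u ∉ W)
    {z : Module.End k V} (hz : z ∈ G) (hzW : ∀ u ∈ W, z u ∈ W) : ∃ d, derRep Φ d = z := by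
  let S : Submodule k L.Envelope :=
    { carrier := {x | ∀ u ∈ W, (Φ x).1 u ∈ W}
      zero_mem' := fun u hu => by rw [coe_map_zero]; exact zero_mem _
      add_mem' := fun hx hy u hu => by rw [coe_map_add]; exact add_mem (hx u hu) (hy u hu)
      smul_mem' := fun c x hx u hu => by rw [coe_map_smul]; exact W.smul_mem c (hx u hu) }
  have hS : ∀ x, x ∈ S ↔ ∀ u ∈ W, (Φ x).1 u ∈ W := fun x => Iff.rfl
  have hdS : ∀ d, L.ofDer d ∈ S := hW
  rcases vec_dichotomy L hirr S (by
    intro d x hx u hu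
    rw [coe_map_lie]
    exact sub_mem (hW d _ (hx u hu)) (hx _ (hW d u hu))) with h | h
  · exfalso
    obtain ⟨z, hz, u, hu, hzu⟩ := hG
    obtain ⟨x, rfl⟩ := exists_coe_map_eq Φ hz
    have hx : x ∈ S := by
      rw [← L.ofDer_add_ofVec x]
      exact add_mem (hdS _) (h _)
    exact hzu (hx u hu)
  · obtain ⟨x, rfl⟩ := exists_coe_map_eq Φ hz
    have hx2 : x.2 = 0 := h _ (by
      have := sub_mem ((hS x).mpr hzW) (hdS x.1)
      nth_rewrite 1 [← L.ofDer_add_ofVec x] at this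
      rwa [add_sub_cancel_left] at this)
    refine ⟨x.1, ?_⟩
    have : L.ofDer x.1 = x := by
      conv_rhs => rw [← L.ofDer_add_ofVec x, hx2]
      exact (add_zero (L.ofDer x.1)).symm
    rw [derRep_apply, this]

omit [FiniteDimensional k V] [Nontrivial V] in
lemma eq_zero_of_mem_abelian {L : LieYamaguti k m} (hirr : L.IsIrreducible)
    {G : LieSubalgebra k (Module.End k V)} (Φ : L.Envelope ≃ₗ⁅k⁆ G)
    (N : Submodule k (Module.End k V)) (hNd : ∀ z ∈ N, ∃ d, derRep Φ d = z)
    (hN : ∀ d, ∀ z ∈ N, ⁅derRep Φ d, z⁆ ∈ N) (hab : ∀ z ∈ N, ∀ z' ∈ N, ⁅z, z'⁆ = 0)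
    {z : Module.End k V} (hz : z ∈ N) : z = 0 := by
  obtain ⟨d, rfl⟩ := hNd z hz
  have := eq_zero_of_mem_abelian_ideal L hirr (N.comap (derRep Φ : L.innerDer →ₗ[k] Module.End k V))
    (fun d a ha => by
      change derRep Φ ⁅d, a⁆ ∈ N
      rw [LieHom.map_lie]
      exact hN d _ ha)
    (fun a ha b hb => eq_zero_of_derRep Φ (by rw [LieHom.map_lie]; exact hab _ ha _ hb)) d hz
  rw [this, map_zero]

omit [Nontrivial V] in
-- If W is proper, nonzero and stable, then D is the whole stabilizer of W in sl(V). The maps V → W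
-- that vanish on W form a nonzero abelian ideal of it, and D has no such ideal.
lemma irreducible_of_sl {L : LieYamaguti k m} (hirr : L.IsIrreducible)
    (Φ : L.Envelope ≃ₗ⁅k⁆ slEnd k V) (W : Submodule k V)
    (hW : ∀ d, ∀ u ∈ W, derRep Φ d u ∈ W) : W = ⊥ ∨ W = ⊤ := by
  by_contra hcon
  push Not at hcon
  obtain ⟨u, hu, hu0⟩ := Submodule.exists_mem_ne_zero_of_ne_bot hcon.1
  obtain ⟨v, hv⟩ : ∃ v, v ∉ W := by
    by_contra h
    push Not at h
    exact hcon.2 (Submodule.eq_top_iff'.mpr h)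
  -- A rank-one map l ⊗ v with l(u) ≠ 0 and l(v) = 0 is traceless and moves u out of W. Such l
  -- exists because u, unlike the multiples of v outside 0, lies in W.
  have hG : ∃ z ∈ slEnd k V, ∃ u ∈ W, z u ∉ W := by
    obtain ⟨l, hl, hlv⟩ := Submodule.exists_le_ker_of_notMem (p := Submodule.span k {v}) (v := u) (by
      intro h
      obtain ⟨c, hc⟩ := Submodule.mem_span_singleton.mp h
      have hc0 : c ≠ 0 := by rintro rfl; rw [zero_smul] at hc; exact hu0 hc.symm
      apply hv
      rw [← inv_smul_smul₀ hc0 v, hc]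
      exact W.smul_mem _ hu)
    refine ⟨l.smulRight v, ?_, u, hu, ?_⟩
    · exact (trace_smulRight l v).trans (hlv (Submodule.mem_span_singleton_self v))
    · rw [LinearMap.smulRight_apply]
      intro h
      exact hv ((W.smul_mem_iff hl).mp h)
  let N : Submodule k (Module.End k V) :=
    { carrier := {z | z ∈ slEnd k V ∧ (∀ w ∈ W, z w = 0) ∧ ∀ w, z w ∈ W}
      zero_mem' := ⟨zero_mem _, fun w _ => rfl, fun w => zero_mem _⟩
      add_mem' := fun hx hy => ⟨add_mem hx.1 hy.1, fun w hw => by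
        rw [LinearMap.add_apply, hx.2.1 w hw, hy.2.1 w hw, add_zero],
        fun w => add_mem (hx.2.2 w) (hy.2.2 w)⟩
      smul_mem' := fun c x hx => ⟨(slEnd k V).smul_mem c hx.1, fun w hw => by
        rw [LinearMap.smul_apply, hx.2.1 w hw, smul_zero], fun w => W.smul_mem c (hx.2.2 w)⟩ }
  -- A form l vanishing on W with l(v) ≠ 0 gives the nonzero element l ⊗ u of the abelian ideal.
  obtain ⟨l, hl, hlW⟩ := Submodule.exists_le_ker_of_notMem hv
  have hz : l.smulRight u ∈ N := by
    refine ⟨(trace_smulRight l u).trans (hlW hu), fun w hw => ?_, fun w => W.smul_mem _ hu⟩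
    rw [LinearMap.smulRight_apply, show l w = 0 from hlW hw, zero_smul]
  have h0 := eq_zero_of_mem_abelian hirr Φ N
    (fun z hz => exists_derRep_of_stable hirr Φ hW hG hz.1 (fun w _ => hz.2.2 w))
    (fun d z hz => ⟨(slEnd k V).lie_mem (Φ (L.ofDer d)).2 hz.1, fun w hw => by
      rw [Ring.lie_def, LinearMap.sub_apply, Module.End.mul_apply, Module.End.mul_apply,
        hz.2.1 w hw, hz.2.1 _ (hW d w hw), map_zero, sub_zero],
      fun w => sub_mem (hW d _ (hz.2.2 w)) (hz.2.2 _)⟩)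
    (fun z hz z' hz' => LinearMap.ext fun w => by
      rw [Ring.lie_def, LinearMap.sub_apply, Module.End.mul_apply, Module.End.mul_apply,
        hz.2.1 _ (hz'.2.2 w), hz'.2.1 _ (hz.2.2 w), sub_zero]
      rfl) hz
  have h1 := LinearMap.congr_fun h0 v
  rw [LinearMap.smulRight_apply] at h1
  exact smul_ne_zero hl hu0 h1

end LieYamaguti


/-! ### Invariant isotropic subspaces -/

namespace LieYamaguti

variable {k : Type*} [Field k] {m : Type*} [AddCommGroup m] [Module k m]
  [IsAlgClosed k] [CharZero k] [FiniteDimensional k m] {V : Type*} [AddCommGroup V] [Module k V]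
  [FiniteDimensional k V] {ε : k} {φ : LinearMap.BilinForm k V}

/-- `D(m, m)` stabilizes no totally isotropic subspace. -/
lemma eq_bot_of_isotropic {L : LieYamaguti k m} (hirr : L.IsIrreducible) (hε : ε = 1 ∨ ε = -1)
    (hφ : IsEpsSymm ε φ) (hn : φ.Nondegenerate) (hd : ε = 1 → 3 ≤ Module.finrank k V)
    (Φ : L.Envelope ≃ₗ⁅k⁆ skewAdjointLieSubalgebra φ) (U : Submodule k V)
    (hU : ∀ d, ∀ u ∈ U, derRep Φ d u ∈ U) (hiso : ∀ u ∈ U, ∀ u' ∈ U, φ u u' = 0) : U = ⊥ := by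
  have hεε : ε * ε = 1 := by rcases hε with rfl | rfl <;> ring
  by_contra hbot
  obtain ⟨u, hu, hu0⟩ := Submodule.exists_mem_ne_zero_of_ne_bot hbot
  obtain ⟨v, hv⟩ := exists_form_eq_one' hn hu0
  have huv : φ u v = ε := by rw [hφ, hv, mul_one]
  -- If the hyperplane orthogonal to u were contained in the line of u, the dimension would be at
  -- most 2; this is where dimension 3 is needed for symmetric forms.
  have hbig : ε = 1 → ∀ p : Submodule k V, LinearMap.ker (φ u) ≤ p → (∀ w ∈ p, ∃ c : k, w = c • u) →
      False := by
    intro h1 p hp hpu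
    have e1 := (φ u).finrank_range_add_finrank_ker
    have e2 : Module.finrank k (LinearMap.range (φ u)) ≤ 1 :=
      (Submodule.finrank_le _).trans (Module.finrank_self k).le
    have e3 : Module.finrank k (LinearMap.ker (φ u)) ≤ Module.finrank k (Submodule.span k {u}) :=
      Submodule.finrank_mono fun w hw => by
        obtain ⟨c, rfl⟩ := hpu w (hp hw)
        exact Submodule.smul_mem _ _ (Submodule.mem_span_singleton_self u)
    rw [finrank_span_singleton hu0] at e3
    have := hd h1
    omega
  -- Otherwise φ_{v,w}(u) = w - εφ(w,u)v lies in U for every w. For ε = -1 and w = v this puts 2v in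
  -- U, although φ(v,u) = 1. For ε = 1, U contains the hyperplane orthogonal to u, and isotropy
  -- against these vectors gives w = φ(w,v)u for every w in U.
  have hG : ∃ z ∈ skewAdjointLieSubalgebra φ, ∃ u ∈ U, z u ∉ U := by
    by_contra hcon
    push Not at hcon
    have key : ∀ w, w - (ε * φ w u) • v ∈ U := fun w => by
      have := hcon _ (phiMap_mem hεε hφ v w) u hu
      rwa [phiMap_apply, hv, one_smul] at this
    rcases hε with rfl | rfl
    · refine hbig rfl U (fun w hw => ?_) (fun w hw => ?_)
      · have := key w
        rwa [hφ w u, LinearMap.mem_ker.mp hw, mul_zero, mul_zero, zero_smul, sub_zero] at this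
      · refine ⟨φ w v, eq_of_nondegenerate hn fun z => ?_⟩
        have := hiso w hw _ (key z)
        rw [map_sub, map_smul, smul_eq_mul, hφ z u] at this
        rw [map_smul, LinearMap.smul_apply, smul_eq_mul]
        linear_combination this
    · have h1 := key v
      rw [hv] at h1
      have h2 := hiso _ h1 u hu
      rw [map_sub, map_smul, LinearMap.sub_apply, LinearMap.smul_apply, hv] at h2
      norm_num at h2
  have hstab := fun z => exists_derRep_of_stable hirr Φ hU hG (z := z)
  let U' : Submodule k V :=
    { carrier := {v | ∀ u ∈ U, φ u v = 0}
      zero_mem' := fun u _ => map_zero _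
      add_mem' := fun hx hy u hu => by rw [map_add, hx u hu, hy u hu, add_zero]
      smul_mem' := fun c x hx u hu => by rw [map_smul, hx u hu, smul_zero] }
  have hUU' : ∀ u ∈ U, u ∈ U' := fun u hu u' hu' => hiso u' hu' u hu
  have hU' : ∀ d, ∀ v ∈ U', derRep Φ d v ∈ U' := by
    intro d v hv u hu
    have := mem_skewAdjoint_iff.mp (Φ (L.ofDer d)).2 u v
    rw [derRep_apply]
    have h2 := hv _ (hU d u hu)
    rw [derRep_apply, this] at h2
    exact neg_eq_zero.mp h2
  -- D is the stabilizer of U, where U' is the orthogonal of U. The skew maps V → U vanishing on U'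
  -- form an abelian ideal of it, because U ⊆ U'; so they are all zero.
  have hN₂ : ∀ z ∈ skewAdjointLieSubalgebra φ, (∀ v, z v ∈ U) → (∀ v ∈ U', z v = 0) → z = 0 := by
    intro z hz h1 h2
    let N : Submodule k (Module.End k V) :=
      { carrier := {z | z ∈ skewAdjointLieSubalgebra φ ∧ (∀ v, z v ∈ U) ∧ (∀ v ∈ U', z v = 0)}
        zero_mem' := ⟨zero_mem _, fun w => zero_mem _, fun w _ => rfl⟩
        add_mem' := fun hx hy => ⟨add_mem hx.1 hy.1, fun w => add_mem (hx.2.1 w) (hy.2.1 w),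
          fun w hw => by rw [LinearMap.add_apply, hx.2.2 w hw, hy.2.2 w hw, add_zero]⟩
        smul_mem' := fun c x hx => ⟨(skewAdjointLieSubalgebra φ).smul_mem c hx.1,
          fun w => U.smul_mem c (hx.2.1 w), fun w hw => by
          rw [LinearMap.smul_apply, hx.2.2 w hw, smul_zero]⟩ }
    refine eq_zero_of_mem_abelian hirr Φ N (fun z hz => hstab z hz.1 fun w _ => hz.2.1 w)
      (fun d z hz => ⟨(skewAdjointLieSubalgebra φ).lie_mem (Φ (L.ofDer d)).2 hz.1,
        fun w => sub_mem (hU d _ (hz.2.1 w)) (hz.2.1 _), fun w hw => ?_⟩)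
      (fun z hz z' hz' => LinearMap.ext fun w => ?_) ⟨hz, h1, h2⟩
    · rw [Ring.lie_def, LinearMap.sub_apply, Module.End.mul_apply, Module.End.mul_apply,
        hz.2.2 w hw, hz.2.2 _ (hU' d w hw), map_zero, sub_zero]
    · rw [Ring.lie_def, LinearMap.sub_apply, Module.End.mul_apply, Module.End.mul_apply,
        hz.2.2 _ (hUU' _ (hz'.2.1 w)), hz'.2.2 _ (hUU' _ (hz.2.1 w)), sub_zero]
      rfl
  -- The skew maps with V → U' → U → 0. Commutators of two of them are of the kind already shown to
  -- be zero, so this larger ideal is abelian too, and vanishes in turn.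
  let N : Submodule k (Module.End k V) :=
    { carrier := {z | z ∈ skewAdjointLieSubalgebra φ ∧ (∀ v, z v ∈ U') ∧ (∀ v ∈ U', z v ∈ U) ∧
        ∀ v ∈ U, z v = 0}
      zero_mem' := ⟨zero_mem _, fun w => zero_mem _, fun w _ => zero_mem _, fun w _ => rfl⟩
      add_mem' := fun hx hy => ⟨add_mem hx.1 hy.1, fun w => add_mem (hx.2.1 w) (hy.2.1 w),
        fun w hw => add_mem (hx.2.2.1 w hw) (hy.2.2.1 w hw),
        fun w hw => by rw [LinearMap.add_apply, hx.2.2.2 w hw, hy.2.2.2 w hw, add_zero]⟩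
      smul_mem' := fun c x hx => ⟨(skewAdjointLieSubalgebra φ).smul_mem c hx.1,
        fun w => U'.smul_mem c (hx.2.1 w), fun w hw => U.smul_mem c (hx.2.2.1 w hw), fun w hw => by
        rw [LinearMap.smul_apply, hx.2.2.2 w hw, smul_zero]⟩ }
  have hN : ∀ z ∈ N, z = 0 := by
    intro z hz
    refine eq_zero_of_mem_abelian hirr Φ N
      (fun z hz => hstab z hz.1 fun w hw => by rw [hz.2.2.2 w hw]; exact zero_mem _)
      (fun d z hz => ⟨(skewAdjointLieSubalgebra φ).lie_mem (Φ (L.ofDer d)).2 hz.1,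
        fun w => sub_mem (hU' d _ (hz.2.1 w)) (hz.2.1 _),
        fun w hw => sub_mem (hU d _ (hz.2.2.1 w hw)) (hz.2.2.1 _ (hU' d w hw)), fun w hw => ?_⟩)
      (fun z hz z' hz' => ?_) hz
    · rw [Ring.lie_def, LinearMap.sub_apply, Module.End.mul_apply, Module.End.mul_apply,
        hz.2.2.2 w hw, hz.2.2.2 _ (hU d w hw), map_zero, sub_zero]
    · refine hN₂ _ ((skewAdjointLieSubalgebra φ).lie_mem hz.1 hz'.1)
        (fun w => sub_mem (hz.2.2.1 _ (hz'.2.1 w)) (hz'.2.2.1 _ (hz.2.1 w))) (fun w hw => ?_)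
      rw [Ring.lie_def, LinearMap.sub_apply, Module.End.mul_apply, Module.End.mul_apply,
        hz.2.2.2 _ (hz'.2.2.1 w hw), hz'.2.2.2 _ (hz.2.2.1 w hw), sub_zero]
  -- These φ_{u,w} belong to N. Evaluating at v with φ(v,u) = 1 gives w = φ(w,v)u for every w in U'.
  -- For ε = 1 this contradicts the dimension bound; for ε = -1, taking w = u gives 2u = 0.
  have hphi : ∀ w ∈ U', phiMap ε φ u w = 0 := by
    intro w hw
    refine hN _ ⟨phiMap_mem hεε hφ u w, fun z => ?_, fun z hz => ?_, fun z hz => ?_⟩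
    · rw [phiMap_apply]
      exact sub_mem (U'.smul_mem _ hw) (U'.smul_mem _ (hUU' u hu))
    · rw [phiMap_apply, hz u hu, zero_smul, zero_sub]
      exact U.neg_mem (U.smul_mem _ hu)
    · rw [phiMap_apply, hiso u hu z hz, hφ w z, hw z hz, mul_zero, mul_zero, zero_smul, zero_smul,
        sub_zero]
  have hval : ∀ w ∈ U', ε • w = (ε * φ w v) • u := by
    intro w hw
    have := LinearMap.congr_fun (hphi w hw) v
    rw [phiMap_apply, huv] at this
    exact sub_eq_zero.mp this
  rcases hε with rfl | rfl
  · have hspan : ∀ w ∈ U', ∃ c : k, w = c • u := fun w hw => ⟨φ w v, by simpa using hval w hw⟩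
    refine hbig rfl U' (fun w hw u' hu' => ?_) hspan
    obtain ⟨c, rfl⟩ := hspan u' (hUU' u' hu')
    rw [map_smul, LinearMap.smul_apply, LinearMap.mem_ker.mp hw, smul_zero]
  · have := hval u (hUU' u hu)
    rw [huv] at this
    have h2 : (2 : k) • u = 0 := by linear_combination (norm := module) -this
    exact hu0 ((smul_eq_zero.mp h2).resolve_left two_ne_zero)

end LieYamaguti


/-! ### Blocks of maps of an orthogonal sum -/

section OffDiagonalInjective

variable {k : Type*} [Field k] {V₁ V₂ : Type*} [AddCommGroup V₁] [Module k V₁]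
  [AddCommGroup V₂] [Module k V₂] {ε : k}
  {φ₁ : LinearMap.BilinForm k V₁} {φ₂ : LinearMap.BilinForm k V₂}

/-- The block V₁ → V₂ of the image of v ⊗ w is φ₁(v, -)w. It is obtained through V₁ ⊗ V₂ → V₁* ⊗ V₂
→ Hom(V₁, V₂), a composite of injective maps. -/
lemma offDiag_injective [FiniteDimensional k V₁] (hn₁ : φ₁.Nondegenerate) :
    Function.Injective (offDiag ε φ₁ φ₂) := by
  have h1 : Function.Injective φ₁ := by
    intro v w h
    exact eq_of_nondegenerate hn₁ fun z => LinearMap.congr_fun h z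
  have h2 : Function.Injective ((dualTensorHom k V₁ V₂) ∘ₗ LinearMap.rTensor V₂ φ₁) :=
    dualTensorHom_bijective.1.comp (Module.Flat.rTensor_preserves_injective_linearMap _ h1)
  have h3 : ∀ u z, ((dualTensorHom k V₁ V₂) ∘ₗ LinearMap.rTensor V₂ φ₁) u z
      = (offDiag ε φ₁ φ₂ u (z, 0)).2 := by
    intro u z
    induction u with
    | zero => simp
    | tmul v w => rw [offDiag_tmul, phiMap_orthSum_apply]; simp
    | add u v hu hv => simp only [map_add, LinearMap.add_apply, hu, hv, Prod.snd_add]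
  intro u v h
  apply h2
  ext z
  rw [h3, h3, h]

lemma offDiag_apply_inl_fst (u : V₁ ⊗[k] V₂) (z : V₁) : (offDiag ε φ₁ φ₂ u (z, 0)).1 = 0 := by
  induction u with
  | zero => simp
  | tmul v w => rw [offDiag_tmul, phiMap_orthSum_apply]; simp
  | add u v hu hv => simp only [map_add, LinearMap.add_apply, hu, hv, Prod.fst_add, add_zero]

lemma offDiag_apply_inr_snd (u : V₁ ⊗[k] V₂) (z : V₂) : (offDiag ε φ₁ φ₂ u (0, z)).2 = 0 := by
  induction u with
  | zero => simp
  | tmul v w => rw [offDiag_tmul, phiMap_orthSum_apply]; simp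
  | add u v hu hv => simp only [map_add, LinearMap.add_apply, hu, hv, Prod.snd_add, add_zero]

lemma mem_of_prodMap_mem {a : Module.End k V₁} {b : Module.End k V₂}
    (h : LinearMap.prodMap a b ∈ skewAdjointLieSubalgebra (orthSum φ₁ φ₂)) :
    a ∈ skewAdjointLieSubalgebra φ₁ ∧ b ∈ skewAdjointLieSubalgebra φ₂ := by
  simp only [mem_skewAdjoint_iff] at h ⊢
  exact ⟨fun v w => by simpa [orthSum] using h (v, 0) (w, 0),
    fun v w => by simpa [orthSum] using h (0, v) (0, w)⟩

end OffDiagonalInjective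

/-! ### Reducible natural modules of orthogonal and symplectic algebras -/

namespace LieYamaguti

variable {k : Type*} [Field k] {m : Type*} [AddCommGroup m] [Module k m]
  [IsAlgClosed k] [CharZero k] [FiniteDimensional k m] {ε : k}

section

variable {V₁ V₂ : Type*} [AddCommGroup V₁] [Module k V₁]
  [AddCommGroup V₂] [Module k V₂] [FiniteDimensional k V₁] [FiniteDimensional k V₂]
  [Nontrivial V₁] [Nontrivial V₂]
  {φ₁ : LinearMap.BilinForm k V₁} {φ₂ : LinearMap.BilinForm k V₂}

/-- D stabilizes V₁, and some off-diagonal skew map does not, so D contains every skew map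
stabilizing V₁ and is the full block diagonal subalgebra. The off-diagonal maps are an invariant
complement, hence they are m. -/
lemma exists_hasProductsForms {L : LieYamaguti k m} (hirr : L.IsIrreducible)
    (hns : L.IsNonSimpleType) (hsimple : LieAlgebra.IsSimple k L.Envelope) (hε : ε * ε = 1)
    (h₁ : IsEpsSymm ε φ₁) (h₂ : IsEpsSymm ε φ₂) (hn₁ : φ₁.Nondegenerate) (hn₂ : φ₂.Nondegenerate)
    (Φ : L.Envelope ≃ₗ⁅k⁆ skewAdjointLieSubalgebra (orthSum φ₁ φ₂))
    (hder : ∀ d, ∃ a b, derRep Φ d = LinearMap.prodMap a b) :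
    ∃ e : (V₁ ⊗[k] V₂) ≃ₗ[k] m, L.HasProductsForms ε φ₁ φ₂ e := by
  have hder' : ∀ d, ∃ a ∈ skewAdjointLieSubalgebra φ₁, ∃ b ∈ skewAdjointLieSubalgebra φ₂,
      derRep Φ d = LinearMap.prodMap a b := by
    intro d
    obtain ⟨a, b, h⟩ := hder d
    have := (Φ (L.ofDer d)).2
    rw [← derRep_apply, h] at this
    exact ⟨a, (mem_of_prodMap_mem this).1, b, (mem_of_prodMap_mem this).2, h⟩
  have hsurj : ∀ a ∈ skewAdjointLieSubalgebra φ₁, ∀ b ∈ skewAdjointLieSubalgebra φ₂,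
      ∃ d, derRep Φ d = LinearMap.prodMap a b := by
    intro a ha b hb
    refine exists_derRep_of_stable hirr Φ (W := LinearMap.ker (LinearMap.snd k V₁ V₂)) ?_ ?_
      (prodMap_mem ha hb) ?_
    · intro d u hu
      obtain ⟨a, b, h⟩ := hder d
      rw [h, LinearMap.mem_ker] at *
      exact (congrArg b hu).trans (map_zero b)
    · obtain ⟨v, hv⟩ := exists_ne (0 : V₁)
      obtain ⟨w, hw⟩ := exists_ne (0 : V₂)
      obtain ⟨z, hz⟩ := exists_form_eq_one hn₁ hv
      refine ⟨_, offDiag_mem hε h₁ h₂ (v ⊗ₜ w), (z, 0), LinearMap.mem_ker.mpr rfl, fun h => ?_⟩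
      rw [offDiag_tmul, phiMap_orthSum_apply, LinearMap.mem_ker] at h
      simp [hz, hw] at h
    · intro u hu
      rw [LinearMap.mem_ker] at *
      exact (congrArg b hu).trans (map_zero b)
  obtain ⟨e, he⟩ := exists_vec_equiv hirr hns hsimple Φ (offDiag_injective (ε := ε) hn₁)
    (offDiag_mem (φ₂ := φ₂) hε h₁ h₂) (fun d u => by
      obtain ⟨a, ha, b, hb, h⟩ := hder' d
      rw [h, lie_prodMap_offDiag ha hb]
      exact ⟨_, rfl⟩) (by
      rintro d ⟨u, hu⟩
      obtain ⟨a, b, h⟩ := hder d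
      rw [h] at hu ⊢
      have ha : a = 0 := LinearMap.ext fun z => by
        have := offDiag_apply_inl_fst (ε := ε) (φ₁ := φ₁) (φ₂ := φ₂) u z
        rwa [hu] at this
      have hb : b = 0 := LinearMap.ext fun z => by
        have := offDiag_apply_inr_snd (ε := ε) (φ₁ := φ₁) (φ₂ := φ₂) u z
        rwa [hu] at this
      rw [ha, hb, LinearMap.prodMap_zero]) (by
      intro z hz
      obtain ⟨a, ha, b, hb, u, rfl⟩ := exists_eq_prodMap_add_offDiag hε h₁ h₂ hn₁ hn₂ hz
      obtain ⟨d, hd⟩ := hsurj a ha b hb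
      refine ⟨d, ?_⟩
      rw [hd, add_sub_cancel_left]
      exact ⟨u, rfl⟩)
  have hprod : ∀ x₁ y₁ x₂ y₂, ∃ d, derRep Φ d
      = LinearMap.prodMap (φ₂ x₂ y₂ • phiMap ε φ₁ x₁ y₁) (φ₁ x₁ y₁ • phiMap ε φ₂ x₂ y₂) ∧
      L.der (e (x₁ ⊗ₜ x₂)) (e (y₁ ⊗ₜ y₂)) = d ∧ L.mul (e (x₁ ⊗ₜ x₂)) (e (y₁ ⊗ₜ y₂)) = 0 := by
    intro x₁ y₁ x₂ y₂
    obtain ⟨d, hd⟩ := hsurj _ ((skewAdjointLieSubalgebra φ₁).smul_mem (φ₂ x₂ y₂)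
      (phiMap_mem hε h₁ x₁ y₁)) _ ((skewAdjointLieSubalgebra φ₂).smul_mem (φ₁ x₁ y₁)
      (phiMap_mem hε h₂ x₂ y₂))
    refine ⟨d, hd, mul_and_der_of_lie Φ ?_⟩
    rw [he, he, lie_offDiag_offDiag h₁ h₂, ← hd, derRep_apply]
    have : (Φ (L.ofVec 0)).1 = 0 := by
      rw [show L.ofVec 0 = 0 from map_zero L.ofVecₗ, coe_map_zero]
    rw [this, add_zero]
  refine ⟨e, ⟨fun x y => ?_, fun x₁ y₁ z₁ x₂ y₂ z₂ => ?_⟩⟩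
  · obtain ⟨x, rfl⟩ := e.surjective x
    obtain ⟨y, rfl⟩ := e.surjective y
    induction x with
    | zero => simp
    | add u v hu hv => rw [map_add, map_add, LinearMap.add_apply, hu, hv, add_zero]
    | tmul x₁ x₂ =>
      induction y with
      | zero => simp
      | add u v hu hv => rw [map_add, map_add, hu, hv, add_zero]
      | tmul y₁ y₂ => exact (hprod x₁ y₁ x₂ y₂).choose_spec.2.2
  · obtain ⟨d, hd, hd', -⟩ := hprod x₁ y₁ x₂ y₂
    change (L.der (e (x₁ ⊗ₜ x₂)) (e (y₁ ⊗ₜ y₂))).1 (e (z₁ ⊗ₜ z₂)) = _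
    rw [hd']
    apply L.ofVec_inj
    apply eq_of_coe_map Φ
    rw [coe_lie_ofDer_ofVec, ← derRep_apply, hd, he, he, lie_prodMap_offDiag
      ((skewAdjointLieSubalgebra φ₁).smul_mem _ (phiMap_mem hε h₁ x₁ y₁))
      ((skewAdjointLieSubalgebra φ₂).smul_mem _ (phiMap_mem hε h₂ x₂ y₂)), kronSum_tmul]
    simp only [LinearMap.smul_apply, ← TensorProduct.smul_tmul', TensorProduct.tmul_smul]

end

variable {V : Type*} [AddCommGroup V] [Module k V] [FiniteDimensional k V]
  {φ : LinearMap.BilinForm k V}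

omit [IsAlgClosed k] in
lemma two_le_finrank_of_skew [Nontrivial V] (hφ : IsEpsSymm (-1) φ) (hn : φ.Nondegenerate) :
    2 ≤ Module.finrank k V := by
  obtain ⟨v, hv⟩ := exists_ne (0 : V)
  -- For v ≠ 0 the map φ_{v,v} = 2φ(v, -)v is nonzero and traceless, which cannot happen in
  -- dimension less than 2.
  refine two_le_finrank (a := phiMap (-1) φ v v) (fun h => ?_) (trace_phiMap hφ v v)
  obtain ⟨w, hw⟩ := exists_form_eq_one hn hv
  have := LinearMap.congr_fun h w
  rw [phiMap_apply, hw] at this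
  have h2 : (2 : k) • v = 0 := by
    rw [LinearMap.zero_apply] at this
    linear_combination (norm := module) this
  exact hv ((smul_eq_zero.mp h2).resolve_left two_ne_zero)

/-- The intersection of W with its orthogonal is stable and totally isotropic, hence zero. So V is
the orthogonal sum of W and W^⊥, both stable, and D is block diagonal. -/
theorem conclusion_of_reducible {L : LieYamaguti k m} (hirr : L.IsIrreducible)
    (hns : L.IsNonSimpleType) (hsimple : LieAlgebra.IsSimple k L.Envelope)
    (hε : ε = 1 ∨ ε = -1) (hφ : IsEpsSymm ε φ) (hn : φ.Nondegenerate)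
    (hd : ε = 1 → 3 ≤ Module.finrank k V)
    (Φ : L.Envelope ≃ₗ⁅k⁆ skewAdjointLieSubalgebra φ) (W : Submodule k V)
    (hW : ∀ d, ∀ u ∈ W, derRep Φ d u ∈ W) (hbot : W ≠ ⊥) (htop : W ≠ ⊤) :
    L.FormsConclusion 1 (by norm_num) 3 ∨ L.FormsConclusion (-1) (by norm_num) 2 := by
  have hεε : ε * ε = 1 := by rcases hε with rfl | rfl <;> ring
  let W' : Submodule k V := LinearMap.BilinForm.orthogonal φ W
  have hW' : ∀ d, ∀ v ∈ W', derRep Φ d v ∈ W' := by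
    intro d v hv u hu
    have := mem_skewAdjoint_iff.mp (Φ (L.ofDer d)).2 u v
    rw [derRep_apply]
    have h2 := hv _ (hW d u hu)
    change φ _ _ = 0 at h2
    rw [derRep_apply, this] at h2
    exact neg_eq_zero.mp h2
  have hdisj : Disjoint W W' := by
    rw [disjoint_iff]
    refine eq_bot_of_isotropic hirr hε hφ hn hd Φ _ (fun d u hu => ⟨hW d u hu.1, hW' d u hu.2⟩)
      (fun u hu u' hu' => hu'.2 u hu.1)
  have hcompl : IsCompl W W' :=
    (LinearMap.BilinForm.isCompl_orthogonal_iff_disjoint hφ.isRefl).mpr hdisj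
  let T : (W × W') ≃ₗ[k] V := Submodule.prodEquivOfIsCompl W W' hcompl
  have hT : ∀ x, T x = x.1 + x.2 := fun x => rfl
  let φ₁ : LinearMap.BilinForm k W := φ.compl₁₂ W.subtype W.subtype
  let φ₂ : LinearMap.BilinForm k W' := φ.compl₁₂ W'.subtype W'.subtype
  have hφ₁ : ∀ v w, φ₁ v w = φ v w := fun _ _ => rfl
  have hφ₂ : ∀ v w, φ₂ v w = φ v w := fun _ _ => rfl
  have hort : ∀ (w : W) (w' : W'), φ w w' = 0 := fun w w' => w'.2 w.1 w.2
  have hort' : ∀ (w' : W') (w : W), φ w' w = 0 := fun w' w => by rw [hφ, hort, mul_zero]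
  have hTφ : orthSum φ₁ φ₂ = φ.compl₁₂ T.toLinearMap T.toLinearMap := by
    refine LinearMap.ext₂ fun x y => ?_
    change φ x.1 y.1 + φ x.2 y.2 = φ (x.1 + x.2) (y.1 + y.2)
    simp only [map_add, LinearMap.add_apply, hort, hort', add_zero, zero_add]
  have h₁ : IsEpsSymm ε φ₁ := fun v w => hφ v w
  have h₂ : IsEpsSymm ε φ₂ := fun v w => hφ v w
  have hn₁ : φ₁.Nondegenerate := nondegenerate_of_left h₁ fun v hv => by
    refine Subtype.ext (eq_zero_of_nondegenerate hn fun z => ?_)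
    obtain ⟨x, rfl⟩ := T.surjective z
    rw [hT, map_add, hort, add_zero]
    exact hv x.1
  have hn₂ : φ₂.Nondegenerate := nondegenerate_of_left h₂ fun v hv => by
    refine Subtype.ext (eq_zero_of_nondegenerate hn fun z => ?_)
    obtain ⟨x, rfl⟩ := T.surjective z
    rw [hT, map_add, hort', zero_add]
    exact hv x.2
  have hne₁ : Nontrivial W := Submodule.nontrivial_iff_ne_bot.mpr hbot
  have hne₂ : Nontrivial W' := by
    rw [Submodule.nontrivial_iff_ne_bot]
    intro h
    have := hcompl.sup_eq_top
    rw [h, sup_bot_eq] at this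
    exact htop this
  have hconj : ∀ x, T.conj (T.symm.conj x) = x := fun x => by
    ext v; simp [LinearEquiv.conj_apply]
  obtain ⟨Θ, hΘ⟩ := exists_lieEquiv_conj T.symm (skewAdjointLieSubalgebra φ)
    (skewAdjointLieSubalgebra (orthSum φ₁ φ₂)) (fun x => by rw [hTφ, conj_mem_skew, hconj])
  obtain ⟨e, he⟩ := exists_hasProductsForms hirr hns hsimple hεε h₁ h₂ hn₁ hn₂ (Φ.trans Θ) (by
    intro d
    refine ⟨(derRep Φ d).restrict (hW d), (derRep Φ d).restrict (hW' d), ?_⟩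
    refine (hΘ (Φ (L.ofDer d))).trans (LinearMap.ext fun x => ?_)
    apply T.injective
    rw [LinearEquiv.conj_apply_apply, LinearEquiv.apply_symm_apply, LinearEquiv.symm_symm, hT, hT,
      map_add]
    rfl)
  rcases hε with rfl | rfl
  · exact he.formsConclusion_of_symm hirr hns hsimple h₁ h₂ hn₁ hn₂
  · exact Or.inr (he.formsConclusion hsimple (by norm_num) h₁ h₂ hn₁ hn₂ (by norm_num)
      (two_le_finrank_of_skew h₁ hn₁) (two_le_finrank_of_skew h₂ hn₂))

end LieYamaguti


/-! ### Irreducible natural modules of orthogonal and symplectic algebras -/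

namespace LieYamaguti

variable {k : Type*} [Field k] {m : Type*} [AddCommGroup m] [Module k m]

lemma lie_mem_symZero {V₂ : Type*} [AddCommGroup V₂] [Module k V₂]
    {φ₂ : LinearMap.BilinForm k V₂} {f s : Module.End k V₂} (hf : f ∈ skewAdjointLieSubalgebra φ₂)
    (hs : s ∈ symEnd φ₂) : ⁅f, s⁆ ∈ symZero φ₂ := by
  refine ⟨fun v w => ?_, LinearMap.trace_lie _ _⟩
  rw [mem_skewAdjoint_iff] at hf
  rw [mem_symEnd_iff] at hs
  simp only [Ring.lie_def, LinearMap.sub_apply, Module.End.mul_apply, map_sub, hf, hs]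
  ring

lemma lie_mem_skew_of_symZero {V₂ : Type*} [AddCommGroup V₂] [Module k V₂]
    {φ₂ : LinearMap.BilinForm k V₂} {f g : Module.End k V₂} (hf : f ∈ symEnd φ₂) (hg : g ∈ symEnd φ₂) :
    ⁅f, g⁆ ∈ skewAdjointLieSubalgebra φ₂ := by
  rw [mem_skewAdjoint_iff]
  intro v w
  rw [mem_symEnd_iff] at hf hg
  simp only [Ring.lie_def, LinearMap.sub_apply, Module.End.mul_apply, map_sub, hf, hg]
  ring

/-- The products, the enveloping algebra and the inner derivation algebra of `m` are those of
`skew(φ₁) ⊗ sym₀(φ₂)` inside `skew(φ₁ ⊗ φ₂)`. -/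
def IsSpSym [CharZero k] {V₁ V₂ : Type*} [AddCommGroup V₁] [Module k V₁] [AddCommGroup V₂]
    [Module k V₂] [FiniteDimensional k V₂] (L : LieYamaguti k m) (φ₁ : LinearMap.BilinForm k V₁)
    (φ₂ : LinearMap.BilinForm k V₂) : Prop :=
  ∃ (e : (skewAdjointLieSubalgebra φ₁ ⊗[k] symZero φ₂) ≃ₗ[k] m)
    (Φ : L.Envelope ≃ₗ⁅k⁆ skewAdjointLieSubalgebra (φ₁.tmul φ₂))
    (Ψ : L.innerDer ≃ₗ⁅k⁆ skewAdjointLieSubalgebra φ₁ × skewAdjointLieSubalgebra φ₂),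
    L.HasProductsSpSym φ₁ φ₂ e ∧
    (∀ a f, (Φ (L.ofVec (e (a ⊗ₜ f)))).1 = TensorProduct.map a.1 f.1) ∧
    (∀ d, (Φ (L.ofDer d)).1
      = TensorProduct.map (Ψ d).1.1 LinearMap.id + TensorProduct.map LinearMap.id (Ψ d).2.1)

variable [IsAlgClosed k] [CharZero k] [FiniteDimensional k m]

section

variable {V₁ V₂ : Type*} [AddCommGroup V₁] [Module k V₁]
  [AddCommGroup V₂] [Module k V₂] [FiniteDimensional k V₁] [FiniteDimensional k V₂]
  [Nontrivial V₁] [Nontrivial V₂] {ε₁ ε₂ : k}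
  {φ₁ : LinearMap.BilinForm k V₁} {φ₂ : LinearMap.BilinForm k V₂}

/-- The span of skew ⊗ 1, 1 ⊗ skew and skew ⊗ sym is D-stable and contains D. If it contains m, it
is everything, which leaves no room for nonscalar maps in sym(V₁). If it meets m trivially, it is D,
which leaves no room for nonscalar maps in sym(V₂). -/
lemma scalar_or_scalar {L : LieYamaguti k m} (hirr : L.IsIrreducible) (hn₁ : φ₁.Nondegenerate)
    (hn₂ : φ₂.Nondegenerate)
    (Φ : L.Envelope ≃ₗ⁅k⁆ skewAdjointLieSubalgebra (φ₁.tmul φ₂))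
    (hder : ∀ d, ∃ a ∈ skewAdjointLieSubalgebra φ₁, ∃ f ∈ skewAdjointLieSubalgebra φ₂,
      (Φ (L.ofDer d)).1 = kronSum k V₁ V₂ (a, f))
    {a : Module.End k V₁} (ha : a ∈ skewAdjointLieSubalgebra φ₁) (ha0 : a ≠ 0)
    {f : Module.End k V₂} (hf : f ∈ skewAdjointLieSubalgebra φ₂) (hf0 : f ≠ 0) :
    (∀ s ∈ symEnd φ₁, ∃ c : k, s = c • 1) ∨ (∀ s ∈ symEnd φ₂, ∃ c : k, s = c • 1) := by
  let S : Submodule k L.Envelope := (skewKron φ₁ φ₂ ⊔ skewSym φ₁ φ₂).comap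
    ((skewAdjointLieSubalgebra (φ₁.tmul φ₂)).toSubmodule.subtype ∘ₗ Φ.toLinearEquiv.toLinearMap)
  have hS : ∀ x, x ∈ S ↔ (Φ x).1 ∈ skewKron φ₁ φ₂ ⊔ skewSym φ₁ φ₂ := fun x => Iff.rfl
  have hdK : ∀ d, (Φ (L.ofDer d)).1 ∈ skewKron φ₁ φ₂ := by
    intro d
    obtain ⟨a, ha, f, hf, h⟩ := hder d
    exact ⟨(a, f), ⟨ha, hf⟩, h.symm⟩
  have hdS : ∀ d, L.ofDer d ∈ S := fun d => Submodule.mem_sup_left (hdK d)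
  rcases vec_dichotomy L hirr S (by
    intro d x hx
    rw [hS, coe_map_lie]
    obtain ⟨y, hy, z, hz, hyz⟩ := Submodule.mem_sup.mp ((hS x).mp hx)
    obtain ⟨a, ha, f, hf, h⟩ := hder d
    rw [← hyz, lie_add]
    refine Submodule.add_mem_sup ?_ ?_
    · obtain ⟨⟨b, g⟩, ⟨hb, hg⟩, rfl⟩ := hy
      rw [h, lie_kronSum_kronSum]
      exact ⟨_, ⟨(skewAdjointLieSubalgebra φ₁).lie_mem ha hb,
        (skewAdjointLieSubalgebra φ₂).lie_mem hf hg⟩, rfl⟩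
    · rw [h]
      clear hyz
      unfold skewSym at hz
      induction hz using Submodule.span_induction with
      | zero => rw [lie_zero]; exact zero_mem _
      | add x y _ _ hx hy => rw [lie_add]; exact add_mem hx hy
      | smul c x _ hx => rw [lie_smul]; exact Submodule.smul_mem _ c hx
      | mem x hx =>
        obtain ⟨t, ht, s, hs, rfl⟩ := hx
        rw [lie_kronSum_map]
        exact add_mem (Submodule.subset_span
            ⟨_, (skewAdjointLieSubalgebra φ₁).lie_mem ha ht, s, hs, rfl⟩)
          (Submodule.subset_span ⟨t, ht, _, (lie_mem_symZero hf hs).1, rfl⟩)) with h | h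
  · left
    refine scalar_of_skew_le hn₁ hf0 hf fun z hz => ?_
    obtain ⟨x, rfl⟩ := exists_coe_map_eq Φ hz
    rw [← hS, ← L.ofDer_add_ofVec x]
    exact add_mem (hdS _) (h _)
  · right
    refine scalar_of_skewSym_le hn₂ ha0 ha fun z hz => ?_
    have hzG : z ∈ skewAdjointLieSubalgebra (φ₁.tmul φ₂) := by
      refine (Submodule.span_le (p := (skewAdjointLieSubalgebra
        (φ₁.tmul φ₂)).toSubmodule)).mpr ?_ hz
      rintro _ ⟨t, ht, s, hs, rfl⟩
      exact map_mem_skew ht hs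
    obtain ⟨x, rfl⟩ := exists_coe_map_eq Φ hzG
    have hx2 : x.2 = 0 := h _ (by
      have := sub_mem ((hS x).mpr (Submodule.mem_sup_right hz)) (hdS x.1)
      nth_rewrite 1 [← L.ofDer_add_ofVec x] at this
      rwa [add_sub_cancel_left] at this)
    have : L.ofDer x.1 = x := by
      conv_rhs => rw [← L.ofDer_add_ofVec x, hx2]
      exact (add_zero (L.ofDer x.1)).symm
    rw [← this]
    exact hdK _

/-- In dimension 2 the traceless Jordan product on the first factor is zero, so only one of the two
product terms of `lie_map_map` survives. -/
lemma der_mul_of_spSym {L : LieYamaguti k m}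
    (ht₁ : ∀ a ∈ skewAdjointLieSubalgebra φ₁, LinearMap.trace k V₁ a = 0)
    (hd : Module.finrank k V₁ = 2)
    (Φ : L.Envelope ≃ₗ⁅k⁆ skewAdjointLieSubalgebra (φ₁.tmul φ₂))
    (Ψ : L.innerDer ≃ₗ⁅k⁆ skewAdjointLieSubalgebra φ₁ × skewAdjointLieSubalgebra φ₂)
    (hΨ : ∀ d, (Φ (L.ofDer d)).1 = kronSum k V₁ V₂ ((Ψ d).1.1, (Ψ d).2.1))
    (e : (skewAdjointLieSubalgebra φ₁ ⊗[k] symZero φ₂) ≃ₗ[k] m)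
    (he : ∀ a f, (Φ (L.ofVec (e (a ⊗ₜ f)))).1 = TensorProduct.map a.1 f.1)
    (a b : skewAdjointLieSubalgebra φ₁) (f g : symZero φ₂) :
    Ψ (L.der (e (a ⊗ₜ f)) (e (b ⊗ₜ g)))
      = ((1 / (Module.finrank k V₂ : k) * LinearMap.trace k V₂ (f.1 * g.1)) • ⁅a, b⁆,
        (1 / 2 * LinearMap.trace k V₁ (a.1 * b.1)) •
          ⟨⁅f.1, g.1⁆, lie_mem_skew_of_symZero f.2.1 g.2.1⟩) ∧
    L.mul (e (a ⊗ₜ f)) (e (b ⊗ₜ g)) = e (((1 / 2 : k) • ⁅a, b⁆) ⊗ₜ symJordan f g) := by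
  obtain ⟨-, hprod⟩ := der_mul_tri_of_map Φ Ψ hΨ
    (ι₁ := ((skewAdjointLieSubalgebra φ₁).incl : skewAdjointLieSubalgebra φ₁ →ₗ[k] Module.End k V₁))
    (ι₂ := (symZero φ₂).subtype) e he
  refine hprod a b f g _ _ ?_
  refine lie_map_map.trans ?_
  rw [LieHom.coe_toLinearMap, LieSubalgebra.coe_incl,
    jordanTraceless_eq_zero hd (ht₁ _ a.2) (ht₁ _ b.2), TensorProduct.map_zero_left,
    add_zero, hd, he]
  rfl

/-- Since sym(V₁) = k1, the skew maps of V₁ ⊗ V₂ are sp(V₁) ⊗ sym(V₂) + 1 ⊗ skew(V₂). Splitting the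
scalars off sym(V₂) gives D plus the complement sp(V₁) ⊗ sym₀(V₂). -/
theorem isSpSym_of_scalar {L : LieYamaguti k m} (hirr : L.IsIrreducible)
    (hns : L.IsNonSimpleType) (hsimple : LieAlgebra.IsSimple k L.Envelope)
    (h₁ : IsEpsSymm (-1) φ₁) (hε₂ : ε₂ * ε₂ = 1) (h₂ : IsEpsSymm ε₂ φ₂)
    (hn₁ : φ₁.Nondegenerate) (hn₂ : φ₂.Nondegenerate) (hn : (φ₁.tmul φ₂).Nondegenerate)
    (hd : Module.finrank k V₁ = 2) (hsc : ∀ s ∈ symEnd φ₁, ∃ c : k, s = c • 1)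
    (Φ : L.Envelope ≃ₗ⁅k⁆ skewAdjointLieSubalgebra (φ₁.tmul φ₂))
    (hder : ∀ d, ∃ a ∈ skewAdjointLieSubalgebra φ₁, ∃ f ∈ skewAdjointLieSubalgebra φ₂,
      (Φ (L.ofDer d)).1 = kronSum k V₁ V₂ (a, f))
    (hI : ∃ x, x ≠ 0 ∧ ∃ a ∈ skewAdjointLieSubalgebra φ₁, (Φ x).1 = kronSum k V₁ V₂ (a, 0))
    (hJ : ∃ x, x ≠ 0 ∧ ∃ f ∈ skewAdjointLieSubalgebra φ₂, (Φ x).1 = kronSum k V₁ V₂ (0, f)) :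
    L.IsSpSym φ₁ φ₂ := by
  have hε₁ : (-1 : k) * -1 = 1 := by ring
  have ht₁ : ∀ a ∈ skewAdjointLieSubalgebra φ₁, LinearMap.trace k V₁ a = 0 :=
    fun a ha => trace_eq_zero_of_skew hε₁ h₁ hn₁ ha
  have ht₂ : ∀ f ∈ skewAdjointLieSubalgebra φ₂, LinearMap.trace k V₂ f = 0 :=
    fun f hf => trace_eq_zero_of_skew hε₂ h₂ hn₂ hf
  have hI' : ∃ x, x ≠ 0 ∧ ∃ a, LinearMap.trace k V₁ a = 0 ∧ (Φ x).1 = kronSum k V₁ V₂ (a, 0) := by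
    obtain ⟨x, hx, a, ha, h⟩ := hI
    exact ⟨x, hx, a, ht₁ a ha, h⟩
  have hJ' : ∃ x, x ≠ 0 ∧ ∃ f, LinearMap.trace k V₂ f = 0 ∧ (Φ x).1 = kronSum k V₁ V₂ (0, f) := by
    obtain ⟨x, hx, a, ha, h⟩ := hJ
    exact ⟨x, hx, a, ht₂ a ha, h⟩
  have hsurj := exists_der_of_kronSum Φ hirr hsimple ht₁ ht₂ hder hI' hJ'
    (fun a ha f hf => kronSum_mem_skew ha hf)
  obtain ⟨Ψ, hΨ⟩ := exists_der_equiv_of_kronSum Φ ht₁ ht₂ hder hsurj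
  let S : Submodule k (Module.End k (V₁ ⊗[k] V₂)) := skewKron φ₁ φ₂ ⊔ Submodule.span k
    {z | ∃ (x : skewAdjointLieSubalgebra φ₁) (y : symZero φ₂),
      z = TensorProduct.map ((skewAdjointLieSubalgebra φ₁).incl x) ((symZero φ₂).subtype y)}
  obtain ⟨e, he⟩ := exists_vec_equiv_of_map Φ hirr hns hsimple ht₁ ht₂
    hder hsurj
    (ι₁ := ((skewAdjointLieSubalgebra φ₁).incl : skewAdjointLieSubalgebra φ₁ →ₗ[k] Module.End k V₁))
    (ι₂ := (symZero φ₂).subtype) Subtype.val_injective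
    Subtype.val_injective (fun x => ht₁ _ x.2) (fun x => x.2.2)
    (fun a ha x => ⟨⁅(⟨a, ha⟩ : skewAdjointLieSubalgebra φ₁), x⁆, rfl⟩)
    (fun a ha x => ⟨⟨_, lie_mem_symZero ha x.2.1⟩, rfl⟩) (fun x y => map_mem_skew x.2 y.2.1) (by
      intro z hz
      have hzS : z ∈ S := by
        refine mem_sup_of_mem_skew hε₁ hε₂ h₁ h₂ hn₁ hn₂ hn hz S (fun t ht s hs => ?_)
          (fun s hs t ht => ?_)
        · obtain ⟨c, hc⟩ := exists_trace_zero_sub s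
          have hs' : s - c • 1 ∈ symZero φ₂ := by
            refine ⟨sub_mem hs (Submodule.smul_mem _ _ fun v w => ?_), hc⟩
            rfl
          -- The trace part c of s contributes ct ⊗ 1, which belongs to D, and the remainder s - c1
          -- lies in sym₀.
          have : TensorProduct.map t s = kronSum k V₁ V₂ (c • t, 0)
              + TensorProduct.map t (s - c • 1) := by
            refine TensorProduct.ext' fun v w => ?_
            simp only [kronSum_tmul, LinearMap.add_apply, LinearMap.smul_apply,
              LinearMap.sub_apply, LinearMap.zero_apply, TensorProduct.map_tmul,
              Module.End.one_apply, TensorProduct.tmul_sub, TensorProduct.tmul_smul,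
              ← TensorProduct.smul_tmul', TensorProduct.tmul_zero]
            module
          rw [this]
          exact Submodule.add_mem_sup ⟨(c • t, 0), ⟨(skewAdjointLieSubalgebra φ₁).smul_mem c ht,
            zero_mem _⟩, rfl⟩ (Submodule.subset_span ⟨⟨t, ht⟩, ⟨_, hs'⟩, rfl⟩)
        · obtain ⟨c, rfl⟩ := hsc s hs
          refine Submodule.mem_sup_left ⟨(0, c • t), ⟨zero_mem _,
            (skewAdjointLieSubalgebra φ₂).smul_mem c ht⟩, ?_⟩
          refine TensorProduct.ext' fun v w => ?_
          simp only [kronSum_tmul, LinearMap.smul_apply, LinearMap.zero_apply,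
            TensorProduct.map_tmul, Module.End.one_apply, TensorProduct.tmul_smul,
            ← TensorProduct.smul_tmul', TensorProduct.zero_tmul, zero_add]
      obtain ⟨_, ⟨⟨a, f⟩, ⟨ha, hf⟩, rfl⟩, y, hy, rfl⟩ := Submodule.mem_sup.mp hzS
      refine ⟨a, ha, f, hf, ?_⟩
      rwa [add_sub_cancel_left])
  have hmd := der_mul_of_spSym ht₁ hd Φ Ψ hΨ e he
  obtain ⟨hact, -⟩ := der_mul_tri_of_map Φ Ψ hΨ e he
  refine ⟨e, Φ, Ψ, ⟨fun a b f g => (hmd a b f g).2, fun a b c f g h => ?_⟩, he, hΨ⟩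
  refine (hact (L.der (e (a ⊗ₜ f)) (e (b ⊗ₜ g))) c h
      ((1 / (Module.finrank k V₂ : k) * LinearMap.trace k V₂ (f.1 * g.1)) • ⁅⁅a, b⁆, c⁆)
      ((1 / 2 * LinearMap.trace k V₁ (a.1 * b.1)) • symTriple f g h) ?_ ?_).trans ?_
  · rw [(hmd a b f g).1]; exact smul_lie _ _ _
  · rw [(hmd a b f g).1]; exact smul_lie _ _ _
  · rw [TensorProduct.tmul_smul, ← TensorProduct.smul_tmul']

end

/-- The first conclusion concerns only the first factor, so that the lemma can be applied again with
the two factors exchanged. -/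
lemma kron_data {L : LieYamaguti k m} (hirr : L.IsIrreducible)
    (hns : L.IsNonSimpleType) (hsimple : LieAlgebra.IsSimple k L.Envelope) {ε₁ ε₂ : k}
    {V V₁ V₂ : Type*} [AddCommGroup V] [Module k V] [FiniteDimensional k V]
    [AddCommGroup V₁] [Module k V₁] [AddCommGroup V₂] [Module k V₂] [FiniteDimensional k V₁]
    [FiniteDimensional k V₂] [Nontrivial V₁] [Nontrivial V₂] {φ : LinearMap.BilinForm k V}
    {φ₁ : LinearMap.BilinForm k V₁} {φ₂ : LinearMap.BilinForm k V₂}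
    (hε₁ : ε₁ * ε₁ = 1) (hε₂ : ε₂ * ε₂ = 1) (h₁ : IsEpsSymm ε₁ φ₁) (h₂ : IsEpsSymm ε₂ φ₂)
    (hn : φ.Nondegenerate) (hn₁ : φ₁.Nondegenerate) (hn₂ : φ₂.Nondegenerate)
    (Φ : L.Envelope ≃ₗ⁅k⁆ skewAdjointLieSubalgebra φ) (T : V₁ ⊗[k] V₂ ≃ₗ[k] V)
    (hT : ∀ v v' w w', φ (T (v ⊗ₜ w)) (T (v' ⊗ₜ w')) = φ₁ v v' * φ₂ w w')
    (hder : ∀ d, ∃ a f, T.symm.conj (derRep Φ d) = kronSum k _ _ (a, f))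
    (hI : ∃ d, d ≠ 0 ∧ ∃ a ∈ skewAdjointLieSubalgebra φ₁,
      T.symm.conj (derRep Φ d) = kronSum k _ _ (a, 0))
    (hJ : ∃ d, d ≠ 0 ∧ ∃ f ∈ skewAdjointLieSubalgebra φ₂,
      T.symm.conj (derRep Φ d) = kronSum k _ _ (0, f))
    (hd : 2 ≤ Module.finrank k V₁) :
    ((∀ s ∈ symEnd φ₁, ∃ c : k, s = c • 1) →
      ε₁ = -1 ∧ Module.finrank k V₁ = 2 ∧ L.IsSpSym φ₁ φ₂) ∧
    ((∀ s ∈ symEnd φ₁, ∃ c : k, s = c • 1) ∨ (∀ s ∈ symEnd φ₂, ∃ c : k, s = c • 1)) := by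
  let φ' : LinearMap.BilinForm k (V₁ ⊗[k] V₂) := φ.compl₁₂ T.toLinearMap T.toLinearMap
  have hφ' : φ' = φ₁.tmul φ₂ := eq_tmul_form hT
  have hn' : (φ₁.tmul φ₂).Nondegenerate := hφ' ▸ nondegenerate_compl₁₂ T hn
  have hconj : ∀ x, T.conj (T.symm.conj x) = x := fun x => by
    ext v; simp [LinearEquiv.conj_apply]
  obtain ⟨Θ, hΘ⟩ := exists_lieEquiv_conj T.symm (skewAdjointLieSubalgebra φ)
    (skewAdjointLieSubalgebra (φ₁.tmul φ₂)) (fun x => by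
      rw [← hφ', conj_mem_skew, hconj])
  have hΘ' : ∀ d, ((Φ.trans Θ) (L.ofDer d)).1 = T.symm.conj (derRep Φ d) :=
    fun d => hΘ (Φ (L.ofDer d))
  have hder' : ∀ d, ∃ a ∈ skewAdjointLieSubalgebra φ₁, ∃ f ∈ skewAdjointLieSubalgebra φ₂,
      ((Φ.trans Θ) (L.ofDer d)).1 = kronSum k V₁ V₂ (a, f) := by
    intro d
    obtain ⟨a, f, h⟩ := hder d
    have hm := ((Φ.trans Θ) (L.ofDer d)).2
    rw [hΘ', h] at hm
    obtain ⟨t, ht, t', ht', htt⟩ := exists_skew_of_kronSum_mem_skew hε₁ hε₂ h₁ h₂ hn₁ hn₂ hn' hm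
    exact ⟨t, ht, t', ht', by rw [hΘ', h, htt]⟩
  obtain ⟨d₁, hd₁, a, ha, hda⟩ := hI
  obtain ⟨d₂, hd₂, f, hf, hdf⟩ := hJ
  have hne : ∀ d, d ≠ 0 → T.symm.conj (derRep Φ d) ≠ 0 := fun d hd h => hd (by
    apply eq_zero_of_derRep Φ
    rw [← hconj (derRep Φ d), h, map_zero])
  have ha0 : a ≠ 0 := by
    rintro rfl
    exact hne d₁ hd₁ (by
      rw [hda, show ((0 : Module.End k V₁), (0 : Module.End k V₂)) = 0 from rfl, map_zero])
  have hf0 : f ≠ 0 := by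
    rintro rfl
    exact hne d₂ hd₂ (by
      rw [hdf, show ((0 : Module.End k V₁), (0 : Module.End k V₂)) = 0 from rfl, map_zero])
  refine ⟨fun hsc => ?_, scalar_or_scalar hirr hn₁ hn₂ (Φ.trans Θ) hder' ha ha0 hf hf0⟩
  obtain ⟨rfl, hd2⟩ := eq_neg_one_of_symEnd_le hε₁ h₁ hn₁ hd hsc
  exact ⟨rfl, hd2, isSpSym_of_scalar hirr hns hsimple h₁ hε₂ h₂ hn₁ hn₂ hn' hd2 hsc
    (Φ.trans Θ) hder' ⟨_, ofDer_ne_zero hd₁, a, ha, by rw [hΘ', hda]⟩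
    ⟨_, ofDer_ne_zero hd₂, f, hf, by rw [hΘ', hdf]⟩⟩

/-- If `D(m, m)` acts irreducibly on `V`, then `V` is the tensor product of a symplectic plane with
a space with an `(-ε)`-symmetric form. -/
theorem exists_isSpSym {L : LieYamaguti k m} (hirr : L.IsIrreducible)
    (hns : L.IsNonSimpleType) (hsimple : LieAlgebra.IsSimple k L.Envelope)
    {V : Type*} [AddCommGroup V] [Module k V] [FiniteDimensional k V] [Nontrivial V]
    {φ : LinearMap.BilinForm k V} {ε : k} (hε : ε * ε = 1) (hφ : IsEpsSymm ε φ)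
    (hn : φ.Nondegenerate) (Φ : L.Envelope ≃ₗ⁅k⁆ skewAdjointLieSubalgebra φ)
    (hV : ∀ U : Submodule k V, (∀ d, ∀ u ∈ U, derRep Φ d u ∈ U) → U = ⊥ ∨ U = ⊤) :
    ∃ (n : ℕ) (φ₁ : LinearMap.BilinForm k (Fin 2 → k)) (φ₂ : LinearMap.BilinForm k (Fin n → k)),
      2 ≤ n ∧ Module.finrank k V = 2 * n ∧ IsEpsSymm (-1) φ₁ ∧ φ₁.Nondegenerate ∧
      IsEpsSymm (-ε) φ₂ ∧ φ₂.Nondegenerate ∧ L.IsSpSym φ₁ φ₂ := by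
  obtain ⟨n₁, n₂, T, hder, ⟨d₁, hd₁, a, ha⟩, ⟨d₂, hd₂, f, hf⟩, hirr₁⟩ :=
    exists_kron_decomposition L hirr hns hsimple (derRep Φ) hV
  obtain ⟨hne₁, hne₂⟩ := nontrivial_of_tensor T
  let φ' : LinearMap.BilinForm k ((Fin n₁ → k) ⊗[k] (Fin n₂ → k)) :=
    φ.compl₁₂ T.toLinearMap T.toLinearMap
  have hn' : φ'.Nondegenerate := nondegenerate_compl₁₂ T hn
  have hconj : ∀ x, T.conj (T.symm.conj x) = x := fun x => by
    ext v; simp [LinearEquiv.conj_apply]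
  have hmem : ∀ d, T.symm.conj (derRep Φ d) ∈ skewAdjointLieSubalgebra φ' := fun d =>
    (conj_mem_skew T φ _).mpr (by rw [hconj]; exact (Φ (L.ofDer d)).2)
  obtain ⟨φ₁, φ₂, ε₁, ε₂, hε₁, hε₂, hεε, h₁, h₂, hn₁, hn₂, hT, ha₁, hf₂⟩ :=
    exists_forms_of_invariant hε (φ := φ') (fun v w => hφ (T v) (T w)) hn'
      {a | ∃ d, T.symm.conj (derRep Φ d) = kronSum k _ _ (a, 0)} (fun U hU => hirr₁ U hU) (by
        rintro a ⟨d, hd⟩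
        have := hmem d
        rwa [hd, kronSum_apply, TensorProduct.map_zero_right, add_zero] at this)
  have haS : a ∈ skewAdjointLieSubalgebra φ₁ := ha₁ a (by
    have := hmem d₁
    rwa [ha, kronSum_apply, TensorProduct.map_zero_right, add_zero] at this)
  have hfS : f ∈ skewAdjointLieSubalgebra φ₂ := hf₂ f (by
    have := hmem d₂
    rwa [hf, kronSum_apply, TensorProduct.map_zero_left, zero_add] at this)
  have hne : ∀ d, d ≠ 0 → T.symm.conj (derRep Φ d) ≠ 0 := fun d hd h => hd (by
    apply eq_zero_of_derRep Φ
    rw [← hconj (derRep Φ d), h, map_zero])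
  have ha2 : 2 ≤ Module.finrank k (Fin n₁ → k) := by
    refine two_le_finrank (a := a) ?_ (trace_eq_zero_of_skew hε₁ h₁ hn₁ haS)
    rintro rfl
    exact hne d₁ hd₁ (by rw [ha]; exact map_zero (kronSum k _ _))
  have hf2 : 2 ≤ Module.finrank k (Fin n₂ → k) := by
    refine two_le_finrank (a := f) ?_ (trace_eq_zero_of_skew hε₂ h₂ hn₂ hfS)
    rintro rfl
    exact hne d₂ hd₂ (by rw [hf]; exact map_zero (kronSum k _ _))
  have hdim := T.finrank_eq
  rw [Module.finrank_tensorProduct] at hdim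
  obtain ⟨hsp, hor⟩ := kron_data hirr hns hsimple hε₁ hε₂ h₁ h₂ hn hn₁ hn₂ Φ T hT hder
    ⟨d₁, hd₁, a, haS, ha⟩ ⟨d₂, hd₂, f, hfS, hf⟩ ha2
  rw [Module.finrank_fin_fun, Module.finrank_fin_fun] at *
  -- Either factor may turn out to be the symplectic plane. In the second case the flip moves it to
  -- the first place, and in both cases ε₁ε₂ = ε determines the sign of the other form.
  rcases hor with hsc | hsc
  · obtain ⟨rfl, rfl, h⟩ := hsp hsc
    refine ⟨n₂, φ₁, φ₂, hf2, hdim.symm, h₁, hn₁, ?_, hn₂, h⟩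
    rwa [← hεε, neg_one_mul, neg_neg]
  · have hdconj : ∀ d a f, T.symm.conj (derRep Φ d) = kronSum k _ _ (a, f) →
        ((TensorProduct.comm k _ _).trans T).symm.conj (derRep Φ d) = kronSum k _ _ (f, a) := by
      intro d a f h
      rw [← comm_conj_kronSum, ← h]
      rfl
    obtain ⟨hsp', -⟩ := kron_data hirr hns hsimple hε₂ hε₁ h₂ h₁ hn hn₂ hn₁ Φ
      ((TensorProduct.comm k _ _).trans T) (fun v v' w w' => (hT w w' v v').trans (mul_comm _ _))
      (fun d => by obtain ⟨a, f, h⟩ := hder d; exact ⟨f, a, hdconj d a f h⟩)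
      ⟨d₂, hd₂, f, hfS, hdconj _ _ _ hf⟩ ⟨d₁, hd₁, a, haS, hdconj _ _ _ ha⟩
      (by rw [Module.finrank_fin_fun]; exact hf2)
    rw [Module.finrank_fin_fun] at hsp'
    obtain ⟨rfl, rfl, h⟩ := hsp' hsc
    refine ⟨n₁, φ₂, φ₁, ha2, by rw [← hdim, mul_comm], h₂, hn₂, ?_, hn₁, h⟩
    rwa [← hεε, mul_neg_one, neg_neg]

end LieYamaguti


/-! ### Tits constructions of linear type -/

namespace TitsIngredient

variable {k : Type*} [Field k] [CharZero k] {X V : Type*} [AddCommGroup X] [Module k X]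
  [AddCommGroup V] [Module k V]

/-- The map `η` realizes the ingredient `A` by endomorphisms of `V` and its derivations by the
commutators with elements of `s`. -/
structure IsLinearModel (A : TitsIngredient k 1 X) (η : X →ₗ[k] Module.End k V)
    (s : LieSubalgebra k (Module.End k V)) : Prop where
  inj : Function.Injective η
  form_eq : ∀ x y : A.Zero,
    A.form x y = 1 / (Module.finrank k V : k) * LinearMap.trace k V (η x * η y)
  D_eq : ∀ (x y : A.Zero) (z : X), η (A.D x y z) = (1 / 4 : k) • ⁅⁅η x, η y⁆, η z⁆
  lie_mem : ∀ x y : A.Zero, ⁅η x, η y⁆ ∈ s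
  exists_lie : ∀ a ∈ s, ∀ x, ∃ y, η y = ⁅a, η x⁆

/-- The commutator action of s preserves the image of η, which is injective, so it pulls back to X.
The factor 4 inverts the ¼ in the definition of the derivations. -/
lemma IsLinearModel.exists_lift {A : TitsIngredient k 1 X} {η : X →ₗ[k] Module.End k V}
    {s : LieSubalgebra k (Module.End k V)} (h : A.IsLinearModel η s) :
    ∃ Γ : s →ₗ⁅k⁆ Module.End k X, (∀ a x, η (Γ a x) = ⁅a.1, η x⁆) ∧
      ∀ x y : A.Zero, Γ ⟨_, h.lie_mem x y⟩ = (4 : k) • A.D x y := by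
  have hc : ∀ (a : s) (x : X), ∃ y, η y = ⁅a.1, η x⁆ := fun a x => h.exists_lie a.1 a.2 x
  choose g hg using hc
  let γ : s → Module.End k X := fun a =>
    { toFun := g a
      map_add' := fun x y => h.inj (by simp only [map_add, hg, lie_add])
      map_smul' := fun c x => h.inj (by simp only [map_smul, hg, lie_smul, RingHom.id_apply]) }
  have hγ : ∀ a x, η (γ a x) = ⁅a.1, η x⁆ := hg
  refine ⟨{ toFun := γ
            map_add' := fun a b => LinearMap.ext fun x => h.inj ?_
            map_smul' := fun c a => LinearMap.ext fun x => h.inj ?_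
            map_lie' := fun {a b} => LinearMap.ext fun x => h.inj ?_ }, hγ, fun x y =>
    LinearMap.ext fun z => h.inj ?_⟩
  · rw [LinearMap.add_apply, map_add]
    simp only [hγ]
    exact add_lie _ _ _
  · rw [RingHom.id_apply, LinearMap.smul_apply, map_smul]
    simp only [hγ]
    exact smul_lie _ _ _
  · rw [Ring.lie_def (γ a), LinearMap.sub_apply, Module.End.mul_apply, Module.End.mul_apply,
      map_sub]
    simp only [hγ]
    exact lie_lie _ _ _
  · refine (hγ _ z).trans ?_
    rw [LinearMap.smul_apply, map_smul, h.D_eq, smul_smul]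
    norm_num

end TitsIngredient

namespace LieYamaguti

variable {k : Type*} [Field k] {m : Type*} [AddCommGroup m] [Module k m]
variable [IsAlgClosed k] [CharZero k] [FiniteDimensional k m]
variable {V₁ V₂ : Type*} [AddCommGroup V₁] [Module k V₁]
  [AddCommGroup V₂] [Module k V₂] [FiniteDimensional k V₁] [FiniteDimensional k V₂]
  [Nontrivial V₁] [Nontrivial V₂]
  {φ₁ : LinearMap.BilinForm k V₁} {φ₂ : LinearMap.BilinForm k V₂}
  {X Y : Type*} [AddCommGroup X] [Module k X] [AddCommGroup Y] [Module k Y]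

/-- Composing ρ with the lifted action sends the generators D(u, v) to combinations of the
derivations of A, so all of D(m, m) lands in the inner derivations. The last assertion allows two
such maps to be made jointly surjective. -/
lemma exists_inner_lift {A : TitsIngredient k 1 X} {V : Type*} [AddCommGroup V] [Module k V]
    {η : X →ₗ[k] Module.End k V}
    {s : LieSubalgebra k (Module.End k V)} (h : A.IsLinearModel η s) {L : LieYamaguti k m}
    (ρ : L.innerDer →ₗ⁅k⁆ s) {Z W : Type*} [AddCommGroup Z] [Module k Z] [AddCommGroup W]
    [Module k W] (e : (Z ⊗[k] W) ≃ₗ[k] m) (ψ : W → W → k) (g : Z ≃ₗ[k] A.Zero)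
    (hρ : ∀ x y x' y', ρ (L.der (e (x ⊗ₜ y)) (e (x' ⊗ₜ y')))
      = ψ y y' • ⟨_, h.lie_mem (g x) (g x')⟩) :
    ∃ α : L.innerDer →ₗ⁅k⁆ A.inner, (∀ d x, η ((α d).1 x) = ⁅(ρ d).1, η x⁆) ∧
      (∀ x y x' y', α (L.der (e (x ⊗ₜ y)) (e (x' ⊗ₜ y')))
        = (4 * ψ y y') • A.DInner (g x) (g x')) ∧
      (∀ a : A.inner, ∃ b : s, ∀ d, ρ d = b → α d = a) := by
  obtain ⟨Γ, hΓ, hΓ4⟩ := h.exists_lift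
  have key : ∀ x y x' y', Γ (ρ (L.der (e (x ⊗ₜ y)) (e (x' ⊗ₜ y'))))
      = (4 * ψ y y') • A.D (g x) (g x') := by
    intro x y x' y'
    rw [hρ, map_smul, hΓ4, smul_smul, mul_comm]
  have hmem : ∀ d, Γ (ρ d) ∈ A.inner := by
    intro d
    have hzero : ∀ u v, Γ (ρ (L.der u v)) ∈ A.inner := by
      intro u v
      obtain ⟨u, rfl⟩ := e.surjective u
      obtain ⟨v, rfl⟩ := e.surjective v
      have hadd : ∀ u u' v, L.der (u + u') v = L.der u v + L.der u' v := fun u u' v =>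
        Subtype.ext (by simp [der])
      have hadd' : ∀ u v v', L.der u (v + v') = L.der u v + L.der u v' := fun u v v' =>
        Subtype.ext (by simp [der])
      have h0 : ∀ v, L.der 0 v = 0 := fun v => Subtype.ext (by simp [der])
      have h0' : ∀ v, L.der v 0 = 0 := fun v => Subtype.ext (by simp [der])
      induction u with
      | zero => rw [map_zero, h0, map_zero, map_zero]; exact zero_mem _
      | add u u' hu hu' => rw [map_add, hadd, map_add, map_add]; exact add_mem hu hu'
      | tmul x y =>
        induction v with
        | zero => rw [map_zero, h0', map_zero, map_zero]; exact zero_mem _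
        | add u u' hu hu' => rw [map_add, hadd', map_add, map_add]; exact add_mem hu hu'
        | tmul x' y' =>
          rw [key]
          exact SMulMemClass.smul_mem _ (Submodule.subset_span ⟨_, _, rfl⟩)
    induction d using innerDer_induction with
    | h0 => rw [map_zero, map_zero]; exact zero_mem _
    | hadd a b ha hb => rw [map_add, map_add]; exact add_mem ha hb
    | hsmul c a ha => rw [map_smul, map_smul]; exact SMulMemClass.smul_mem c ha
    | hder x y => exact hzero x y
  refine ⟨{ toFun := fun d => ⟨Γ (ρ d), hmem d⟩
            map_add' := fun a b => Subtype.ext (by simp)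
            map_smul' := fun c a => Subtype.ext (by simp)
            map_lie' := fun {a b} => Subtype.ext (by simp) }, fun d x => hΓ _ _,
    fun x y x' y' => Subtype.ext (key x y x' y'), ?_⟩
  have hΓsurj : ∀ a ∈ A.inner, ∃ b, Γ b = a := by
    intro a ha
    change a ∈ Submodule.span k {d | ∃ x y, d = A.D x y} at ha
    induction ha using Submodule.span_induction with
    | zero => exact ⟨0, map_zero _⟩
    | add a b _ _ ha hb =>
      obtain ⟨a, rfl⟩ := ha
      obtain ⟨b, rfl⟩ := hb
      exact ⟨a + b, map_add _ _ _⟩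
    | smul c a _ ha =>
      obtain ⟨a, rfl⟩ := ha
      exact ⟨c • a, map_smul _ _ _⟩
    | mem a ha =>
      obtain ⟨x, y, rfl⟩ := ha
      refine ⟨(1 / 4 : k) • ⟨_, h.lie_mem x y⟩, ?_⟩
      rw [map_smul, hΓ4, smul_smul]
      norm_num
  rintro ⟨a, ha⟩
  obtain ⟨b, hb⟩ := hΓsurj a ha
  exact ⟨b, fun d hd => Subtype.ext ((congrArg Γ hd).trans hb)⟩

/-- Checks the hypotheses of `isInsideTits_of`: both sides are expressed by commutators and
traceless Jordan products of endomorphisms and differ only by a rescaling of m. -/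
theorem isInsideTits_of_isLinearModel {L : LieYamaguti k m}
    (ht₁ : ∀ a ∈ skewAdjointLieSubalgebra φ₁, LinearMap.trace k V₁ a = 0)
    (hd : Module.finrank k V₁ = 2) (hsp : L.IsSpSym φ₁ φ₂)
    {A : TitsIngredient k 1 X} {B : TitsIngredient k 1 Y} {η₁ : X →ₗ[k] Module.End k V₁}
    {η₂ : Y →ₗ[k] Module.End k V₂} (hA : A.IsLinearModel η₁ (skewAdjointLieSubalgebra φ₁))
    (hB : B.IsLinearModel η₂ (skewAdjointLieSubalgebra φ₂))
    (g₁ : A.Zero ≃ₗ[k] skewAdjointLieSubalgebra φ₁) (hg₁ : ∀ x, (g₁ x).1 = η₁ x)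
    (g₂ : B.Zero ≃ₗ[k] symZero φ₂) (hg₂ : ∀ x, (g₂ x).1 = η₂ x)
    (hs₁ : ∀ x y, η₁ (A.star x y) = (1 / 2 : k) • ⁅η₁ x, η₁ y⁆)
    (hs₂ : ∀ x y, η₂ (B.star x y) = (1 / 2 : k) • jordanTraceless (η₂ x) (η₂ y)) :
    L.IsInsideTits A B := by
  obtain ⟨e, Φ, Ψ, hprod, he, hΨ⟩ := hsp
  have hmd := der_mul_of_spSym ht₁ hd Φ Ψ hΨ e he
  obtain ⟨hact, -⟩ := der_mul_tri_of_map Φ Ψ hΨ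
    (ι₁ := ((skewAdjointLieSubalgebra φ₁).incl : skewAdjointLieSubalgebra φ₁ →ₗ[k] Module.End k V₁))
    (ι₂ := (symZero φ₂).subtype) e he
  let ρ₁ : L.innerDer →ₗ⁅k⁆ skewAdjointLieSubalgebra φ₁ :=
    (LieHom.fst k _ _).comp Ψ.toLieHom
  let ρ₂ : L.innerDer →ₗ⁅k⁆ skewAdjointLieSubalgebra φ₂ :=
    (LieHom.snd k _ _).comp Ψ.toLieHom
  have hρ₁ : ∀ d, ρ₁ d = (Ψ d).1 := fun _ => rfl
  have hρ₂ : ∀ d, ρ₂ d = (Ψ d).2 := fun _ => rfl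
  -- The product of m is ½[a,b] ⊗ J(f,g), with J the traceless Jordan product, while the Tits
  -- product is ½[a,b] ⊗ ½J(f,g). Rescaling by c requires c² = c/2, that is c = ½; then c² = ¼ also
  -- matches the derivations.
  let e' : (A.Zero ⊗[k] B.Zero) ≃ₗ[k] m :=
    ((TensorProduct.congr g₁ g₂).trans e).trans (LinearEquiv.smulOfNeZero k m (1 / 2 : k)
      (by norm_num))
  have he' : ∀ x y, e' (x ⊗ₜ y) = (1 / 2 : k) • e (g₁ x ⊗ₜ g₂ y) := fun _ _ => rfl
  have hder : ∀ x y x' y', L.der (e' (x ⊗ₜ y)) (e' (x' ⊗ₜ y'))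
      = (1 / 4 : k) • L.der (e (g₁ x ⊗ₜ g₂ y)) (e (g₁ x' ⊗ₜ g₂ y')) := by
    intro x y x' y'
    refine Subtype.ext ?_
    change L.tri _ _ = (1 / 4 : k) • L.tri _ _
    rw [he', he', map_smul, map_smul, LinearMap.smul_apply, smul_smul]
    norm_num
  obtain ⟨α, hα, hαd, hαs⟩ := exists_inner_lift hA ρ₁ e' (fun y y' => 1 / 4 * B.form y y')
    (LinearEquiv.refl k _) (by
      intro x y x' y'
      rw [hρ₁, hder, map_smul, (hmd _ _ _ _).1, hB.form_eq]
      refine Subtype.ext ?_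
      change (1 / 4 : k) • (1 / (Module.finrank k V₂ : k) *
        LinearMap.trace k V₂ ((g₂ y).1 * (g₂ y').1)) • ⁅(g₁ x).1, (g₁ x').1⁆ = _ • ⁅η₁ x, η₁ x'⁆
      rw [hg₁, hg₁, hg₂, hg₂, smul_smul])
  obtain ⟨β, hβ, hβd, hβs⟩ := exists_inner_lift hB ρ₂ ((TensorProduct.comm k _ _).trans e')
    (fun x x' => 1 / 4 * A.form x x') (LinearEquiv.refl k _) (by
      intro y x y' x'
      rw [hρ₂]
      change (Ψ (L.der (e' (x ⊗ₜ y)) (e' (x' ⊗ₜ y')))).2 = _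
      rw [hder, map_smul, (hmd _ _ _ _).1, hA.form_eq, hd]
      refine Subtype.ext ?_
      change (1 / 4 : k) • (1 / 2 * LinearMap.trace k V₁ ((g₁ x).1 * (g₁ x').1)) •
        ⁅(g₂ y).1, (g₂ y').1⁆ = _ • ⁅η₂ y, η₂ y'⁆
      rw [hg₁, hg₁, hg₂, hg₂, smul_smul]
      rfl)
  refine isInsideTits_of L A B e' α β ?_ ?_ ?_ ?_ ?_
  · intro a b
    obtain ⟨s, hs⟩ := hαs a
    obtain ⟨t, ht⟩ := hβs b
    refine ⟨Ψ.symm (s, t), hs _ ?_, ht _ ?_⟩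
    · rw [hρ₁, LieEquiv.apply_symm_apply]
    · rw [hρ₂, LieEquiv.apply_symm_apply]
  · intro d x y
    rw [he', map_smul, map_add, he', he', ← smul_add, ← map_add]
    congr 1
    refine hact d _ _ _ _ ?_ ?_
    · change ⁅(Ψ d).1.1, (g₁ x).1⁆ = (g₁ _).1
      rw [hg₁, hg₁]
      exact (hα d x).symm
    · change ⁅(Ψ d).2.1, (g₂ y).1⁆ = (g₂ _).1
      rw [hg₂, hg₂]
      exact (hβ d y).symm
  · intro x y x' y'
    rw [hαd]
    congr 1
    ring
  · intro x y x' y'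
    refine (hβd y x y' x').trans ?_
    congr 1
    ring
  · intro x y x' y'
    have h₁ : g₁ (A.star x x') = (1 / 2 : k) • ⁅g₁ x, g₁ x'⁆ := Subtype.ext (by
      rw [hg₁, hs₁, ← hg₁, ← hg₁]; rfl)
    have h₂ : g₂ (B.star y y') = (1 / 2 : k) • symJordan (g₂ y) (g₂ y') := Subtype.ext (by
      rw [hg₂, hs₂, ← hg₂, ← hg₂]; rfl)
    rw [he', he', he', map_smul, map_smul, LinearMap.smul_apply, (hmd _ _ _ _).2, h₁, h₂,
      TensorProduct.tmul_smul, map_smul, smul_smul]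

end LieYamaguti


/-! ### The ingredients as linear models -/

section Models

variable {k : Type*} [Field k] [CharZero k]

/-- On a plane φ is a multiple of the determinant, and φ(av, w) + φ(v, aw) = tr(a) φ(v, w). -/
lemma skew_of_trace_eq_zero {φ : LinearMap.BilinForm k (Fin 2 → k)} (hφ : IsEpsSymm (-1) φ)
    {a : Module.End k (Fin 2 → k)} (ha : LinearMap.trace k _ a = 0) :
    a ∈ skewAdjointLieSubalgebra φ := by
  rw [mem_skewAdjoint_iff]
  obtain ⟨A, rfl⟩ := Matrix.toLin'.surjective a
  rw [Matrix.trace_toLin'_eq, Matrix.trace_fin_two] at ha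
  have h0 : ∀ v, φ v v = 0 := fun v => by
    have h := hφ v v
    have : (2 : k) * φ v v = 0 := by linear_combination h
    simpa using this
  have h10 := hφ (Pi.single 1 1) (Pi.single 0 1)
  intro v w
  have hv : ∀ v : Fin 2 → k, v = v 0 • Pi.single 0 1 + v 1 • Pi.single 1 1 := by
    intro v
    ext i
    fin_cases i <;> simp
  rw [hv v, hv w]
  have hA : ∀ j, Matrix.toLin' A (Pi.single j 1)
      = A 0 j • Pi.single 0 1 + A 1 j • Pi.single 1 1 := by
    intro j
    rw [hv (Matrix.toLin' A (Pi.single j 1))]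
    simp
  simp only [map_add, map_smul, hA, LinearMap.add_apply, LinearMap.smul_apply, smul_eq_mul, h0, h10]
  linear_combination (v 0 * w 1 - v 1 * w 0) * φ (Pi.single 0 1) (Pi.single 1 1) * ha

lemma quaternions_isLinearModel {φ : LinearMap.BilinForm k (Fin 2 → k)} (hφ : IsEpsSymm (-1) φ) :
    (quaternions k).IsLinearModel Matrix.toLin'.toLinearMap (skewAdjointLieSubalgebra φ) where
  inj := Matrix.toLin'.injective
  form_eq x y := by
    change (1 / 2 : k) * Matrix.trace (x.1 * y.1) = 1 / (Module.finrank k (Fin 2 → k) : k) *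
      LinearMap.trace k _ (Matrix.toLin' x.1 * Matrix.toLin' y.1)
    rw [Module.End.mul_eq_comp, ← Matrix.toLin'_mul, Matrix.trace_toLin'_eq,
      Module.finrank_fin_fun]
    norm_num
  D_eq x y z := by
    change Matrix.toLin' ((1 / 4 : k) • ((x.1 * y.1 - y.1 * x.1) * z
      - z * (x.1 * y.1 - y.1 * x.1))) = _
    simp only [map_smul, map_sub, Matrix.toLin'_mul]
    rfl
  lie_mem x y := skew_of_trace_eq_zero hφ (LinearMap.trace_lie _ _)
  exists_lie a _ x := Matrix.toLin'.surjective _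

/-- For traceless 2 × 2 matrices ½tr(xy)1 is half the anticommutator, so subtracting it from xy
leaves half the commutator. -/
lemma quaternions_star (x y : (quaternions k).Zero) :
    Matrix.toLin' ((quaternions k).star x y).1
      = (1 / 2 : k) • ⁅Matrix.toLin' x.1, Matrix.toLin' y.1⁆ := by
  have hx : ∀ x : (quaternions k).Zero, LinearMap.trace k _ (Matrix.toLin' x.1) = 0 := by
    intro x
    have h : (1 / 2 : k) * Matrix.trace x.1 = 0 := x.2
    rw [Matrix.trace_toLin'_eq]
    simpa using h
  have h := anticomm_of_finrank_two (Module.finrank_fin_fun k) (hx x) (hx y)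
  change Matrix.toLin' (x.1 * y.1 - ((1 / 2 : k) * Matrix.trace (x.1 * y.1)) • 1) = _
  rw [Module.End.mul_eq_comp, Module.End.mul_eq_comp, ← Matrix.toLin'_mul, Matrix.trace_toLin'_eq,
    ← Matrix.toLin'_mul] at h
  rw [map_sub, map_smul, Matrix.toLin'_one, Ring.lie_def, Module.End.mul_eq_comp,
    Module.End.mul_eq_comp, ← Matrix.toLin'_mul, ← Matrix.toLin'_mul]
  change _ = _ • (1 : Module.End k (Fin 2 → k)) at h
  change _ - _ • (1 : Module.End k (Fin 2 → k)) = _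
  rw [mul_smul, ← h]
  module

/-- The elements of trace zero of the quaternions as the `φ`-skew maps. -/
noncomputable def quaternionsZeroEquiv {φ : LinearMap.BilinForm k (Fin 2 → k)}
    (hφ : IsEpsSymm (-1) φ) (hn : φ.Nondegenerate) :
    (quaternions k).Zero ≃ₗ[k] skewAdjointLieSubalgebra φ :=
  Matrix.toLin'.submoduleMap _ |>.trans (LinearEquiv.ofEq _
    (skewAdjointLieSubalgebra φ).toSubmodule (by
      ext a
      obtain ⟨A, rfl⟩ := Matrix.toLin'.surjective a
      have h1 : A ∈ (quaternions k).Zero ↔ LinearMap.trace k _ (Matrix.toLin' A) = 0 := by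
        rw [Matrix.trace_toLin'_eq]
        change (1 / 2 : k) * Matrix.trace A = 0 ↔ _
        simp
      constructor
      · rintro ⟨B, hB, h⟩
        obtain rfl := Matrix.toLin'.injective h
        exact skew_of_trace_eq_zero hφ (h1.mp hB)
      · intro h
        exact ⟨A, h1.mpr (trace_eq_zero_of_skew (by ring) hφ hn h), rfl⟩))

section Special

variable {𝒜 : Type*} [Ring 𝒜] [Algebra k 𝒜]
    {S : Submodule k 𝒜} {h1 : (1 : 𝒜) ∈ S} {hS : ∀ x ∈ S, ∀ y ∈ S, x * y + y * x ∈ S}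
    {τ : 𝒜 →ₗ[k] k} {hτ : ∀ x y, τ (x * y) = τ (y * x)} {hτ1 : τ 1 = 1}
    {V : Type*} [AddCommGroup V] [Module k V] [FiniteDimensional k V] [Nontrivial V]
    {φ : LinearMap.BilinForm k V} (θ : 𝒜 ≃ₐ[k] Module.End k V)
    (hθ : ∀ x, x ∈ S ↔ θ x ∈ symEnd φ)
    (hθτ : ∀ x, τ x = 1 / (Module.finrank k V : k) * LinearMap.trace k V (θ x))

lemma coe_specialJordan_D (x y : (specialJordan S h1 hS τ hτ hτ1).Zero) (z : S) :
    ((specialJordan S h1 hS τ hτ hτ1).D x y z : 𝒜) = (1 / 4 : k) •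
      ((x.1.1 * y.1.1 - y.1.1 * x.1.1) * z.1 - z.1 * (x.1.1 * y.1.1 - y.1.1 * x.1.1)) := by
  change (1 / 2 : k) • (((1 / 2 : k) • (z.1 * y.1.1 + y.1.1 * z.1)) * x.1.1
      + x.1.1 * ((1 / 2 : k) • (z.1 * y.1.1 + y.1.1 * z.1)))
    - (1 / 2 : k) • (((1 / 2 : k) • (z.1 * x.1.1 + x.1.1 * z.1)) * y.1.1
      + y.1.1 * ((1 / 2 : k) • (z.1 * x.1.1 + x.1.1 * z.1))) = _
  simp only [smul_mul_assoc, mul_smul_comm, mul_add, add_mul, mul_sub, sub_mul, ← mul_assoc]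
  module

include hθ in
lemma isJordanSym_specialJordan : IsJordanSym (specialJordan S h1 hS τ hτ hτ1) φ := by
  refine ⟨(θ.toLinearEquiv.submoduleMap S).trans (LinearEquiv.ofEq _ _ ?_), fun x y => ?_⟩
  · ext a
    obtain ⟨x, rfl⟩ := θ.surjective a
    rw [← hθ]
    exact ⟨fun ⟨y, hy, h⟩ => θ.injective h ▸ hy, fun h => ⟨x, h, rfl⟩⟩
  · change θ ((1 / 2 : k) • (x.1 * y.1 + y.1 * x.1)) = _
    rw [map_smul, map_add, map_mul, map_mul]
    rfl

variable {θ}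

include hθ hθτ in
lemma isLinearModel_specialJordan : (specialJordan S h1 hS τ hτ hτ1).IsLinearModel
    (θ.toLinearMap ∘ₗ S.subtype) (skewAdjointLieSubalgebra φ) where
  inj := θ.injective.comp Subtype.val_injective
  form_eq x y := by
    change τ ((1 / 2 : k) • (x.1.1 * y.1.1 + y.1.1 * x.1.1)) = _ * LinearMap.trace k V
      (θ x.1.1 * θ y.1.1)
    rw [map_smul, map_add, hτ y.1.1, hθτ, map_mul, smul_eq_mul]
    ring
  D_eq x y z := by
    refine (congrArg θ (coe_specialJordan_D x y z)).trans ?_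
    change _ = (1 / 4 : k) • ⁅⁅θ x.1.1, θ y.1.1⁆, θ z.1⁆
    simp only [map_smul, map_sub, map_mul, Ring.lie_def]
  lie_mem x y := LieYamaguti.lie_mem_skew_of_symZero ((hθ _).mp x.1.2) ((hθ _).mp y.1.2)
  exists_lie a ha x := by
    obtain ⟨y, hy⟩ := θ.surjective ⁅a, θ x.1⁆
    refine ⟨⟨y, (hθ _).mpr ?_⟩, hy⟩
    rw [hy]
    exact (LieYamaguti.lie_mem_symZero ha ((hθ _).mp x.2)).1

include hθτ in
lemma specialJordan_star (x y : (specialJordan S h1 hS τ hτ hτ1).Zero) :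
    θ ((specialJordan S h1 hS τ hτ hτ1).star x y).1.1
      = (1 / 2 : k) • jordanTraceless (θ x.1.1) (θ y.1.1) := by
  change θ ((1 / 2 : k) • (x.1.1 * y.1.1 + y.1.1 * x.1.1)
    - τ ((1 / 2 : k) • (x.1.1 * y.1.1 + y.1.1 * x.1.1)) • 1) = _
  rw [jordanTraceless, map_smul τ, map_add τ, hτ y.1.1, hθτ]
  simp only [map_sub, map_smul, map_add, map_mul, map_one, smul_eq_mul]
  module

lemma exists_specialJordanZeroEquiv (hθ : ∀ x, x ∈ S ↔ θ x ∈ symEnd φ)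
    (hθτ : ∀ x, τ x = 1 / (Module.finrank k V : k) * LinearMap.trace k V (θ x)) :
    ∃ g : (specialJordan S h1 hS τ hτ hτ1).Zero ≃ₗ[k] symZero φ, ∀ x, (g x).1 = θ x.1.1 := by
  have hN : (Module.finrank k V : k) ≠ 0 := Nat.cast_ne_zero.mpr Module.finrank_pos.ne'
  have hzero : ∀ x : S, τ x.1 = 0 ↔ LinearMap.trace k V (θ x.1) = 0 := by
    intro x
    rw [hθτ, mul_eq_zero]
    simp [hN]
  refine ⟨LinearEquiv.ofBijective
    { toFun := fun x => ⟨θ x.1.1, (hθ _).mp x.1.2, (hzero x.1).mp x.2⟩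
      map_add' := fun x y => Subtype.ext (map_add θ _ _)
      map_smul' := fun c x => Subtype.ext (map_smul θ _ _) } ⟨?_, ?_⟩, fun x => rfl⟩
  · intro x y h
    exact Subtype.ext (Subtype.ext (θ.injective (congrArg Subtype.val h)))
  · rintro ⟨a, ha, hat⟩
    obtain ⟨x, rfl⟩ := θ.surjective a
    exact ⟨⟨⟨x, (hθ _).mpr ha⟩, (hzero ⟨x, (hθ _).mpr ha⟩).mpr hat⟩, rfl⟩

end Special

end Models

/-! ### Realization inside T(Q, J) for special Jordan algebras J -/

namespace LieYamaguti

variable {k : Type*} [Field k] {m : Type*} [AddCommGroup m] [Module k m]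
variable [IsAlgClosed k] [CharZero k] [FiniteDimensional k m]

/-- The Jordan algebra enters only through an algebra isomorphism θ onto End V that matches S with
sym(V, φ) and τ with the normalized trace. This covers symmetric matrices and quaternionic hermitian
matrices at once. -/
theorem IsSpSym.isInsideTits {𝒜 : Type*} [Ring 𝒜] [Algebra k 𝒜]
    {S : Submodule k 𝒜} {h1 : (1 : 𝒜) ∈ S} {hS : ∀ x ∈ S, ∀ y ∈ S, x * y + y * x ∈ S}
    {τ : 𝒜 →ₗ[k] k} {hτ : ∀ x y, τ (x * y) = τ (y * x)} {hτ1 : τ 1 = 1}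
    {V : Type*} [AddCommGroup V] [Module k V] [FiniteDimensional k V] [Nontrivial V]
    {φ : LinearMap.BilinForm k V} {φ₁ : LinearMap.BilinForm k (Fin 2 → k)} {L : LieYamaguti k m}
    (h : L.IsSpSym φ₁ φ) (hφ₁ : IsEpsSymm (-1) φ₁) (hn₁ : φ₁.Nondegenerate)
    {θ : 𝒜 ≃ₐ[k] Module.End k V} (hθ : ∀ x, x ∈ S ↔ θ x ∈ symEnd φ)
    (hθτ : ∀ x, τ x = 1 / (Module.finrank k V : k) * LinearMap.trace k V (θ x)) :
    L.IsInsideTits (quaternions k) (specialJordan S h1 hS τ hτ hτ1) := by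
  obtain ⟨g, hg⟩ := exists_specialJordanZeroEquiv (h1 := h1) (hS := hS) (hτ := hτ) (hτ1 := hτ1)
    hθ hθτ
  exact isInsideTits_of_isLinearModel (fun a ha => trace_eq_zero_of_skew (by ring) hφ₁ hn₁ ha)
    (Module.finrank_fin_fun k) h (quaternions_isLinearModel hφ₁)
    (isLinearModel_specialJordan hθ hθτ) (quaternionsZeroEquiv hφ₁ hn₁) (fun x => rfl) g hg
    quaternions_star (specialJordan_star hθτ)

end LieYamaguti


/-! ### Normal forms of nondegenerate forms and matrix models of `sym(V, φ)` -/

section NormalForms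

variable {k : Type*} [Field k] [CharZero k]

lemma mem_symEnd_iff_basis {V ι : Type*} [AddCommGroup V] [Module k V]
    {φ : LinearMap.BilinForm k V} (b : Module.Basis ι k V) {f : Module.End k V} :
    f ∈ symEnd φ ↔ ∀ i j, φ (f (b i)) (b j) = φ (b i) (f (b j)) := by
  refine ⟨fun h i j => h _ _, fun h => ?_⟩
  have : φ.compl₁₂ f LinearMap.id = φ.compl₁₂ LinearMap.id f :=
    LinearMap.ext_basis b b fun i j => h i j
  exact fun v w => LinearMap.congr_fun₂ this v w

/-- Take an orthogonal basis; its vectors are not isotropic by nondegeneracy, and each is divided by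
a square root of its norm. -/
lemma exists_orthonormal_basis [IsAlgClosed k] {V : Type*} [AddCommGroup V] [Module k V]
    [FiniteDimensional k V] {φ : LinearMap.BilinForm k V} (hφ : IsEpsSymm 1 φ)
    (hn : φ.Nondegenerate) :
    ∃ b : Module.Basis (Fin (Module.finrank k V)) k V,
      ∀ i j, φ (b i) (b j) = if i = j then 1 else 0 := by
  have : Invertible (2 : k) := invertibleOfNonzero two_ne_zero
  obtain ⟨v, hv⟩ := LinearMap.BilinForm.exists_orthogonal_basis (B := φ)
    ⟨fun x y => by rw [RingHom.id_apply, hφ x y, one_mul]⟩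
  have hv' : ∀ i j, i ≠ j → φ (v i) (v j) = 0 := fun i j h => hv h
  have hne : ∀ i, φ (v i) (v i) ≠ 0 := by
    intro i h
    refine v.ne_zero i (eq_zero_of_nondegenerate hn fun w => ?_)
    have : φ (v i) = 0 := v.ext fun j => by
      by_cases hij : i = j
      · subst hij; exact h
      · exact hv' i j hij
    rw [this, LinearMap.zero_apply]
  have hsq : ∀ i, ∃ c : k, c * c = φ (v i) (v i) := fun i => by
    obtain ⟨c, hc⟩ := IsAlgClosed.exists_eq_mul_self (φ (v i) (v i))
    exact ⟨c, hc.symm⟩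
  choose c hc using hsq
  have hc0 : ∀ i, c i ≠ 0 := fun i h => hne i (by rw [← hc, h, mul_zero])
  refine ⟨v.isUnitSMul (w := fun i => (c i)⁻¹) fun i => (inv_ne_zero (hc0 i)).isUnit, fun i j => ?_⟩
  rw [Module.Basis.isUnitSMul_apply, Module.Basis.isUnitSMul_apply]
  simp only [map_smul, LinearMap.smul_apply, smul_eq_mul]
  split_ifs with h
  · subst h
    rw [← hc]
    have := hc0 i
    field_simp
  · rw [hv' i j h, mul_zero, mul_zero]

/-- Split off a hyperbolic plane and continue in its orthogonal. The space varies in the induction,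
hence the bound N in front. Only spanning is asserted; independence follows later from the Gram
matrix. -/
lemma exists_symplectic_family (N : ℕ) : ∀ {V : Type*} [AddCommGroup V] [Module k V]
    [FiniteDimensional k V] {φ : LinearMap.BilinForm k V} (hφ : IsEpsSymm (-1) φ)
    (hn : φ.Nondegenerate) (hN : Module.finrank k V ≤ N),
    ∃ (n : ℕ) (v : Fin n → Fin 2 → V), Submodule.span k {x | ∃ i p, x = v i p} = ⊤ ∧
      ∀ i j p q, φ (v i p) (v j q)
        = if i = j then (!![0, 1; -1, 0] : Matrix (Fin 2) (Fin 2) k) p q else 0 := by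
  induction N with
  | zero =>
    intro V _ _ _ φ hφ hn hN
    have := Module.finrank_zero_iff.mp (Nat.le_zero.mp hN)
    exact ⟨0, fun i => i.elim0, Subsingleton.elim _ _, fun i => i.elim0⟩
  | succ N ih =>
    intro V _ _ _ φ hφ hn hN
    rcases subsingleton_or_nontrivial V with hs | hs
    · exact ⟨0, fun i => i.elim0, Subsingleton.elim _ _, fun i => i.elim0⟩
    obtain ⟨x, hx⟩ := exists_ne (0 : V)
    obtain ⟨y, hxy⟩ := exists_form_eq_one hn hx
    have hyx : φ y x = -1 := by rw [hφ, hxy, mul_one]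
    have h0 : ∀ v, φ v v = 0 := fun v => by
      have h := hφ v v
      have : (2 : k) * φ v v = 0 := by linear_combination h
      simpa using this
    let U : Submodule k V := LinearMap.ker (φ x) ⊓ LinearMap.ker (φ y)
    have hU : ∀ v, v - φ x v • y + φ y v • x ∈ U := by
      intro v
      constructor
      · rw [SetLike.mem_coe, LinearMap.mem_ker]
        simp [hxy, h0]
      · rw [SetLike.mem_coe, LinearMap.mem_ker]
        simp [hyx, h0]
    have hxU : ∀ u ∈ U, φ x u = 0 := fun u hu => hu.1
    have hyU : ∀ u ∈ U, φ y u = 0 := fun u hu => hu.2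
    have hUx : ∀ u ∈ U, φ u x = 0 := fun u hu => by rw [hφ, hxU u hu, mul_zero]
    have hUy : ∀ u ∈ U, φ u y = 0 := fun u hu => by rw [hφ, hyU u hu, mul_zero]
    let ψ : LinearMap.BilinForm k U := φ.compl₁₂ U.subtype U.subtype
    have hψ : IsEpsSymm (-1) ψ := fun v w => hφ v w
    obtain ⟨n, v, hv, hvg⟩ := ih (V := U) (φ := ψ) hψ
      (nondegenerate_of_left hψ fun u hu => by
        refine Subtype.ext (eq_zero_of_nondegenerate hn fun w => ?_)
        have h1 := hu ⟨_, hU w⟩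
        change φ u.1 (w - φ x w • y + φ y w • x) = 0 at h1
        rwa [map_add, map_sub, map_smul, map_smul, hUx _ u.2, hUy _ u.2, smul_zero, smul_zero,
          sub_zero, add_zero] at h1) (by
        have hlt : U ≠ ⊤ := fun h => by
          have := hxU y (h ▸ Submodule.mem_top)
          rw [hxy] at this
          exact one_ne_zero this
        have := Submodule.finrank_lt hlt
        omega)
    refine ⟨n + 1, Fin.cons ![x, y] fun i p => (v i p).1, ?_, ?_⟩
    · rw [eq_top_iff]
      intro w _
      set S := Submodule.span k {z | ∃ i p, z = (Fin.cons ![x, y] fun i p => (v i p).1 :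
        Fin (n + 1) → Fin 2 → V) i p} with hS
      have hxS : x ∈ S := Submodule.subset_span ⟨0, 0, rfl⟩
      have hyS : y ∈ S := Submodule.subset_span ⟨0, 1, rfl⟩
      have hUS : ∀ u : U, u.1 ∈ S := by
        intro u
        have hu : u ∈ Submodule.span k {x | ∃ i p, x = v i p} := hv ▸ Submodule.mem_top
        induction hu using Submodule.span_induction with
        | zero => exact zero_mem _
        | add a b _ _ ha hb => exact add_mem ha hb
        | smul c a _ ha => exact Submodule.smul_mem _ c ha
        | mem u hu =>
          obtain ⟨i, p, rfl⟩ := hu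
          exact Submodule.subset_span ⟨i.succ, p, rfl⟩
      have : w = (w - φ x w • y + φ y w • x) + φ x w • y - φ y w • x := by module
      rw [this]
      exact sub_mem (add_mem (hUS ⟨_, hU w⟩) (Submodule.smul_mem _ _ hyS))
        (Submodule.smul_mem _ _ hxS)
    · intro i j p q
      refine Fin.cases ?_ (fun i => ?_) i <;> refine Fin.cases ?_ (fun j => ?_) j
      · fin_cases p <;> fin_cases q <;> simp [h0, hxy, hyx]
      · rw [Fin.cons_zero, Fin.cons_succ, if_neg (Fin.succ_ne_zero j).symm]
        fin_cases p
        · exact hxU _ (v j q).2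
        · exact hyU _ (v j q).2
      · rw [Fin.cons_zero, Fin.cons_succ, if_neg (Fin.succ_ne_zero i)]
        fin_cases q
        · exact hUx _ (v i p).2
        · exact hUy _ (v i p).2
      · rw [Fin.cons_succ, Fin.cons_succ]
        simp only [Fin.succ_inj]
        exact hvg i j p q

lemma exists_symplectic_basis {V : Type*} [AddCommGroup V] [Module k V] [FiniteDimensional k V]
    {φ : LinearMap.BilinForm k V} (hφ : IsEpsSymm (-1) φ) (hn : φ.Nondegenerate) :
    ∃ (n : ℕ) (b : Module.Basis (Fin n × Fin 2) k V), ∀ i j p q, φ (b (i, p)) (b (j, q))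
      = if i = j then (!![0, 1; -1, 0] : Matrix (Fin 2) (Fin 2) k) p q else 0 := by
  obtain ⟨n, v, hv, hvg⟩ := exists_symplectic_family (Module.finrank k V) hφ hn le_rfl
  refine ⟨n, Module.Basis.mk (v := fun ip : Fin n × Fin 2 => v ip.1 ip.2) ?_ ?_, fun i j p q => ?_⟩
  · rw [Fintype.linearIndependent_iff]
    intro g hg
    -- Pairing a linear relation with the family isolates one hyperbolic plane, whose Gram matrix is
    -- invertible.
    have h : ∀ j q, ∑ p, g (j, p) * (!![0, 1; -1, 0] : Matrix (Fin 2) (Fin 2) k) p q = 0 := by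
      intro j q
      have := congrArg (fun w => φ w (v j q)) hg
      simp only [map_sum, map_smul, LinearMap.sum_apply, LinearMap.smul_apply, smul_eq_mul,
        map_zero, LinearMap.zero_apply, Fintype.sum_prod_type, hvg, mul_ite, mul_zero] at this
      rw [Finset.sum_comm] at this
      simpa using this
    rintro ⟨j, p⟩
    have h0 := h j 0
    have h1 := h j 1
    simp [Fin.sum_univ_two] at h0 h1
    fin_cases p
    · exact h1
    · exact h0
  · rw [← hv]
    refine Submodule.span_mono ?_
    rintro _ ⟨i, p, rfl⟩
    exact ⟨(i, p), rfl⟩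
  · rw [Module.Basis.mk_apply, Module.Basis.mk_apply]
    exact hvg i j p q

lemma mem_symMatrices_iff {n : ℕ} {V : Type*} [AddCommGroup V] [Module k V]
    {φ : LinearMap.BilinForm k V} (b : Module.Basis (Fin n) k V)
    (hb : ∀ i j, φ (b i) (b j) = if i = j then 1 else 0) (x : Matrix (Fin n) (Fin n) k) :
    x ∈ symMatrices k n ↔ Matrix.toLinAlgEquiv b x ∈ symEnd φ := by
  rw [mem_symEnd_iff_basis b]
  have h : ∀ i j, φ (Matrix.toLinAlgEquiv b x (b i)) (b j) = x j i := by
    intro i j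
    simp [Matrix.toLinAlgEquiv_self, hb]
  have h' : ∀ i j, φ (b i) (Matrix.toLinAlgEquiv b x (b j)) = x i j := by
    intro i j
    simp [Matrix.toLinAlgEquiv_self, hb]
  simp only [h, h']
  rfl

/-- For the standard symplectic form on k² the adjoint of a 2 × 2 matrix is its adjugate, which is
the quaternion conjugate. Read block by block, φ-symmetry is therefore hermitian symmetry over Q. -/
lemma mem_hermMatricesQ_iff {n : ℕ} {V : Type*} [AddCommGroup V] [Module k V]
    {φ : LinearMap.BilinForm k V} (b : Module.Basis (Fin n × Fin 2) k V)
    (hb : ∀ i j p q, φ (b (i, p)) (b (j, q))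
      = if i = j then (!![0, 1; -1, 0] : Matrix (Fin 2) (Fin 2) k) p q else 0)
    (x : Matrix (Fin n) (Fin n) (Matrix (Fin 2) (Fin 2) k)) :
    x ∈ hermMatricesQ k n ↔
      ((Matrix.compAlgEquiv (Fin n) (Fin 2) k k).trans (Matrix.toLinAlgEquiv b)) x ∈ symEnd φ := by
  rw [mem_symEnd_iff_basis b]
  have h : ∀ i j p q, φ (((Matrix.compAlgEquiv (Fin n) (Fin 2) k k).trans
      (Matrix.toLinAlgEquiv b)) x (b (i, p))) (b (j, q))
      = ∑ r, x j i r p * (!![0, 1; -1, 0] : Matrix (Fin 2) (Fin 2) k) r q := by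
    intro i j p q
    rw [AlgEquiv.trans_apply, Matrix.toLinAlgEquiv_self]
    simp only [map_sum, map_smul, LinearMap.sum_apply, LinearMap.smul_apply, smul_eq_mul,
      Fintype.sum_prod_type, hb, mul_ite, mul_zero, Matrix.compAlgEquiv_apply, Matrix.comp_apply]
    rw [Finset.sum_comm]
    simp
  have h' : ∀ i j p q, φ (b (i, p)) (((Matrix.compAlgEquiv (Fin n) (Fin 2) k k).trans
      (Matrix.toLinAlgEquiv b)) x (b (j, q)))
      = ∑ r, x i j r q * (!![0, 1; -1, 0] : Matrix (Fin 2) (Fin 2) k) p r := by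
    intro i j p q
    rw [AlgEquiv.trans_apply, Matrix.toLinAlgEquiv_self]
    simp only [map_sum, map_smul, smul_eq_mul,
      Fintype.sum_prod_type, hb, mul_ite, mul_zero, Matrix.compAlgEquiv_apply, Matrix.comp_apply]
    rw [Finset.sum_comm]
    simp
  have key : ∀ A B : Matrix (Fin 2) (Fin 2) k, A = quatConj B ↔
      ∀ p q, ∑ r, A r p * (!![0, 1; -1, 0] : Matrix (Fin 2) (Fin 2) k) r q
        = ∑ r, B r q * (!![0, 1; -1, 0] : Matrix (Fin 2) (Fin 2) k) p r := by
    intro A B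
    rw [quatConj_eq_adjugate, Matrix.adjugate_fin_two]
    constructor
    · rintro rfl p q
      fin_cases p <;> fin_cases q <;> simp [Fin.sum_univ_two]
    · intro h
      have h00 := h 0 0
      have h01 := h 0 1
      have h10 := h 1 0
      have h11 := h 1 1
      simp [Fin.sum_univ_two] at h00 h01 h10 h11
      ext i j
      fin_cases i <;> fin_cases j <;> simp [h01, h10, ← h11, ← h00]
  constructor
  · rintro hx ⟨i, p⟩ ⟨j, q⟩
    rw [h, h']
    exact (key _ _).mp (hx i j) p q
  · intro hx i j
    refine (key _ _).mpr fun p q => ?_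
    rw [← h, ← h']
    exact hx (i, p) (j, q)

lemma trace_toLinAlgEquiv_comp {n : ℕ} {V : Type*} [AddCommGroup V] [Module k V]
    (b : Module.Basis (Fin n × Fin 2) k V)
    (x : Matrix (Fin n) (Fin n) (Matrix (Fin 2) (Fin 2) k)) :
    LinearMap.trace k V (((Matrix.compAlgEquiv (Fin n) (Fin 2) k k).trans
      (Matrix.toLinAlgEquiv b)) x) = ∑ i, Matrix.trace (x i i) := by
  have : LinearMap.trace k V (Matrix.toLin b b (Matrix.comp _ _ _ _ _ x)) = _ :=
    Matrix.trace_toLin_eq _ b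
  refine this.trans ?_
  simp [Matrix.trace, Fintype.sum_prod_type]

end NormalForms


/-! ### The case of an irreducible natural module -/

section SkewSym

variable {k : Type*} [Field k] [CharZero k] {V : Type*} [AddCommGroup V] [Module k V]
  [FiniteDimensional k V] {φ : LinearMap.BilinForm k V} {ε : k}

/-- The anticommutator of a skew and a symmetric map is skew, so it has trace zero. -/
lemma trace_skew_mul_sym (hε : ε * ε = 1) (hφ : IsEpsSymm ε φ) (hn : φ.Nondegenerate)
    {t s : Module.End k V} (ht : t ∈ skewAdjointLieSubalgebra φ) (hs : s ∈ symEnd φ) :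
    LinearMap.trace k V (t * s) = 0 := by
  have h : t * s + s * t ∈ skewAdjointLieSubalgebra φ := by
    rw [mem_skewAdjoint_iff] at ht ⊢
    rw [mem_symEnd_iff] at hs
    intro v w
    simp only [LinearMap.add_apply, Module.End.mul_apply, map_add, ht, hs]
    ring
  have h0 := trace_eq_zero_of_skew hε hφ hn h
  rw [map_add, LinearMap.trace_mul_comm k s t, ← two_mul] at h0
  simpa using h0

/-- The skew part of b serves as y, since symmetric maps are trace-orthogonal to skew ones. This is
the input for `traceFormOf_nondegenerate`. -/
lemma exists_trace_mul_skew (hε : ε * ε = 1) (hφ : IsEpsSymm ε φ) (hn : φ.Nondegenerate)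
    (b : Module.End k V) : ∃ y : skewAdjointLieSubalgebra φ, ∀ x : skewAdjointLieSubalgebra φ,
      LinearMap.trace k V (x.1 * b) = LinearMap.trace k V (x.1 * y.1) := by
  obtain ⟨s, hs, t, ht, rfl⟩ := exists_sym_add_skew hε hφ hn b
  refine ⟨⟨t, ht⟩, fun x => ?_⟩
  rw [mul_add, map_add, trace_skew_mul_sym hε hφ hn x.2 hs, zero_add]

lemma exists_trace_mul_symZero [Nontrivial V] (hε : ε * ε = 1) (hφ : IsEpsSymm ε φ)
    (hn : φ.Nondegenerate) (b : Module.End k V) : ∃ y : symZero φ, ∀ x : symZero φ,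
      LinearMap.trace k V (x.1 * b) = LinearMap.trace k V (x.1 * y.1) := by
  obtain ⟨s, hs, t, ht, rfl⟩ := exists_sym_add_skew hε hφ hn b
  obtain ⟨c, hc⟩ := exists_trace_zero_sub s
  refine ⟨⟨s - c • 1, sub_mem hs (Submodule.smul_mem _ _ fun v w => rfl), hc⟩, fun x => ?_⟩
  rw [mul_add, map_add, LinearMap.trace_mul_comm k _ t, trace_skew_mul_sym hε hφ hn ht x.2.1,
    add_zero, mul_sub, map_sub, mul_smul_comm, mul_one, map_smul,
    show LinearMap.trace k V x.1 = 0 from x.2.2, smul_zero, sub_zero]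

/-- In a four-dimensional symplectic space, the traceless symmetric maps anticommute up to
scalars. -/
lemma anticomm_of_mem_symZero {b : Module.Basis (Fin 2 × Fin 2) k V}
    (hb : ∀ i j p q, φ (b (i, p)) (b (j, q))
      = if i = j then (!![0, 1; -1, 0] : Matrix (Fin 2) (Fin 2) k) p q else 0)
    {f g : Module.End k V} (hf : f ∈ symZero φ) (hg : g ∈ symZero φ) :
    f * g + g * f = (1 / 2 * LinearMap.trace k V (f * g)) • 1 := by
  have hN : Module.finrank k V = 4 := by
    rw [Module.finrank_eq_card_basis b]; simp
  -- It suffices that squares are scalars, the general case being the polarization. The scalar is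
  -- then fixed by the trace, as the dimension is 4.
  have hsq : ∀ f ∈ symZero φ, f * f = (1 / 4 * LinearMap.trace k V (f * f)) • 1 := by
    intro f hf
    suffices ∃ c : k, f * f = c • 1 by
      obtain ⟨c, hc⟩ := this
      rw [hc, map_smul, LinearMap.trace_one, hN, smul_eq_mul]
      congr 1
      push_cast
      ring
    let θ := (Matrix.compAlgEquiv (Fin 2) (Fin 2) k k).trans (Matrix.toLinAlgEquiv b)
    obtain ⟨x, rfl⟩ := θ.surjective f
    have hx : ∀ i j, x j i = quatConj (x i j) := (mem_hermMatricesQ_iff b hb x).mpr hf.1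
    have hd : ∀ i, x i i 0 1 = 0 ∧ x i i 1 0 = 0 ∧ x i i 1 1 = x i i 0 0 := by
      intro i
      have h := hx i i
      rw [quatConj_eq_adjugate, Matrix.adjugate_fin_two] at h
      have h01 := congrFun (congrFun h 0) 1
      have h10 := congrFun (congrFun h 1) 0
      have h11 := congrFun (congrFun h 1) 1
      simp only [Matrix.of_apply, Matrix.cons_val', Matrix.cons_val_zero, Matrix.cons_val_one,
        Matrix.cons_val_fin_one] at h01 h10 h11
      exact ⟨self_eq_neg.mp h01, self_eq_neg.mp h10, h11⟩
    have ht : LinearMap.trace k V (θ x) = 0 := hf.2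
    rw [trace_toLinAlgEquiv_comp, Fin.sum_univ_two, Matrix.trace_fin_two, Matrix.trace_fin_two,
      (hd 0).2.2, (hd 1).2.2] at ht
    have ht' : x 1 1 0 0 = - x 0 0 0 0 := by
      have : (2 : k) * (x 1 1 0 0 + x 0 0 0 0) = 0 := by linear_combination ht
      exact eq_neg_of_add_eq_zero_left (by simpa using this)
    have hq := hx 0 1
    rw [quatConj_eq_adjugate, Matrix.adjugate_fin_two] at hq
    -- A traceless hermitian 2 × 2 matrix over Q has diagonal a, -a with a in k and off-diagonal
    -- entries q, q̄. Its square is the scalar a² + q q̄ = a² + det q.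
    have hxx : x * x = (x 0 0 0 0 * x 0 0 0 0 + (x 0 1).det) • 1 := by
      ext i j p q
      rw [Matrix.det_fin_two]
      simp only [Matrix.mul_apply, Fin.sum_univ_two, Matrix.add_apply, Matrix.smul_apply]
      fin_cases i <;> fin_cases j <;> fin_cases p <;> fin_cases q <;>
        simp [hq, hd, ht'] <;> ring
    exact ⟨_, by rw [← map_mul, hxx, map_smul, map_one]⟩
  have h := hsq (f + g) (add_mem hf hg)
  have hf' := hsq f hf
  have hg' := hsq g hg
  have e : f * g + g * f = (f + g) * (f + g) - f * f - g * g := by noncomm_ring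
  rw [e, h, hf', hg', ← sub_smul, ← sub_smul]
  congr 1
  simp only [add_mul, mul_add, map_add, LinearMap.trace_mul_comm k g f]
  ring

/-- In a symplectic plane every traceless map is skew, so a traceless symmetric one is zero. -/
lemma symZero_eq_bot {φ : LinearMap.BilinForm k (Fin 2 → k)} (hφ : IsEpsSymm (-1) φ)
    (hn : φ.Nondegenerate) (f : symZero φ) : f = 0 := by
  have h := mem_skewAdjoint_iff.mp (skew_of_trace_eq_zero hφ f.2.2)
  refine Subtype.ext (LinearMap.ext fun v => eq_zero_of_nondegenerate hn fun w => ?_)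
  have h1 := h v w
  have h2 : φ (f.1 v) w = φ v (f.1 w) := f.2.1 v w
  rw [← h2] at h1
  exact self_eq_neg.mp h1

end SkewSym

/-! ### Small cases of sp(V₁) ⊗ sym₀(V₂) -/

namespace LieYamaguti

variable {k : Type*} [Field k] {m : Type*} [AddCommGroup m] [Module k m]
variable [IsAlgClosed k] [CharZero k] [FiniteDimensional k m]

/-- For n = 2 the algebra so(V₂) is one-dimensional and hence central in D, which has zero centre.
-/
lemma IsSpSym.three_le {L : LieYamaguti k m} (hirr : L.IsIrreducible) {n : ℕ}
    {φ₁ : LinearMap.BilinForm k (Fin 2 → k)} {φ₂ : LinearMap.BilinForm k (Fin n → k)}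
    (hn : 2 ≤ n) (h₂ : IsEpsSymm 1 φ₂) (hn₂ : φ₂.Nondegenerate) (h : L.IsSpSym φ₁ φ₂) : 3 ≤ n := by
  by_contra hlt
  obtain rfl : n = 2 := by omega
  obtain ⟨e, Φ, Ψ, -⟩ := h
  obtain ⟨s, hs, hs0, hgen⟩ := exists_skew_generator h₂ hn₂ (Module.finrank_fin_fun k)
  have := eq_zero_of_central_fst L hirr (Ψ.trans (LieEquiv.prodComm k _ _)) ⟨s, hs⟩ (by
    rintro ⟨t, ht⟩
    obtain ⟨c, rfl⟩ := hgen t ht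
    refine Subtype.ext ?_
    change ⁅c • s, s⁆ = 0
    rw [Ring.lie_def, smul_mul_assoc, mul_smul_comm, sub_self])
  exact hs0 (congrArg Subtype.val this)

/-- Both sp(V₁) and sym₀(V₂) have scalar anticommutators here, so the binary product vanishes and m
is the tensor product of quadratic spaces of dimensions 3 and 5, that is, an orthogonal sum inside
so₈. -/
lemma IsSpSym.formsConclusion_of_four {L : LieYamaguti k m} (hirr : L.IsIrreducible)
    (hns : L.IsNonSimpleType) (hsimple : LieAlgebra.IsSimple k L.Envelope)
    {φ₁ : LinearMap.BilinForm k (Fin 2 → k)} {V : Type*} [AddCommGroup V] [Module k V]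
    [FiniteDimensional k V] [Nontrivial V] {φ₂ : LinearMap.BilinForm k V}
    (h₁ : IsEpsSymm (-1) φ₁) (hn₁ : φ₁.Nondegenerate) (h₂ : IsEpsSymm (-1) φ₂)
    (hn₂ : φ₂.Nondegenerate) {b : Module.Basis (Fin 2 × Fin 2) k V}
    (hb : ∀ i j p q, φ₂ (b (i, p)) (b (j, q))
      = if i = j then (!![0, 1; -1, 0] : Matrix (Fin 2) (Fin 2) k) p q else 0)
    (h : L.IsSpSym φ₁ φ₂) :
    L.FormsConclusion 1 (by norm_num) 3 ∨ L.FormsConclusion (-1) (by norm_num) 2 := by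
  have hN : Module.finrank k V = 4 := by
    rw [Module.finrank_eq_card_basis b]; simp
  obtain ⟨e, Φ, Ψ, ⟨hmul, htri⟩, -⟩ := h
  have hanti := fun f g : symZero φ₂ => anticomm_of_mem_symZero hb f.2 g.2
  have hJ : ∀ f g : symZero φ₂, symJordan f g = 0 := fun f g => Subtype.ext (by
    change jordanTraceless f.1 g.1 = 0
    rw [jordanTraceless, hanti, hN, ← sub_smul]
    push_cast
    ring_nf
    exact zero_smul _ _)
  have ht₁ : ∀ a : skewAdjointLieSubalgebra φ₁, LinearMap.trace k _ a.1 = 0 :=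
    fun a => trace_eq_zero_of_skew (by ring) h₁ hn₁ a.2
  have hprod := hasProductsForms_of_anticomm (L := L) e
    ((skewAdjointLieSubalgebra φ₁).incl : skewAdjointLieSubalgebra φ₁ →ₗ[k]
      Module.End k (Fin 2 → k))
    (symZero φ₂).subtype (1 / 2) (1 / 4)
    (fun x y => by
      change x.1 * y.1 + y.1 * x.1 = (2 * (1 / 2) * LinearMap.trace k _ (x.1 * y.1)) • 1
      rw [anticomm_of_finrank_two (Module.finrank_fin_fun k) (ht₁ x) (ht₁ y)]
      norm_num)
    (fun x y => by
      change x.1 * y.1 + y.1 * x.1 = (2 * (1 / 4) * LinearMap.trace k V (x.1 * y.1)) • 1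
      rw [hanti]
      norm_num) (by
      intro x y
      obtain ⟨x, rfl⟩ := e.surjective x
      obtain ⟨y, rfl⟩ := e.surjective y
      induction x with
      | zero => simp
      | add u v hu hv => rw [map_add, map_add, LinearMap.add_apply, hu, hv, add_zero]
      | tmul a f =>
        induction y with
        | zero => simp
        | add u v hu hv => rw [map_add, map_add, hu, hv, add_zero]
        | tmul b g => rw [hmul, hJ, TensorProduct.tmul_zero, map_zero]) (by
      intro x y z u x' y' z' u' hu hu'
      rw [htri, hN]
      obtain rfl : u = ⁅⁅x, y⁆, z⁆ := Subtype.ext hu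
      obtain rfl : u' = symTriple x' y' z' := Subtype.ext hu'
      norm_num)
  exact hprod.formsConclusion_of_symm hirr hns hsimple (traceFormOf_isEpsSymm _ _)
    (traceFormOf_isEpsSymm _ _)
    (traceFormOf_nondegenerate one_ne_zero Subtype.val_injective
      (exists_trace_mul_skew (by ring) h₁ hn₁))
    (traceFormOf_nondegenerate (by norm_num) Subtype.val_injective
      (exists_trace_mul_symZero (by ring) h₂ hn₂))

end LieYamaguti


/-! ### The matrix forms of the classical Lie algebras -/

section ClassicalMatrix

variable {k ι : Type*} [Field k] [Fintype ι] [DecidableEq ι]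

lemma exists_lieEquiv_of_mem_iff (S : LieSubalgebra k (Matrix ι ι k))
    (T : LieSubalgebra k (Module.End k (ι → k))) (h : ∀ x, x ∈ S ↔ Matrix.toLin' x ∈ T) :
    Nonempty (S ≃ₗ⁅k⁆ T) := by
  refine ⟨(lieEquivMatrix'.symm : Matrix ι ι k ≃ₗ⁅k⁆ Module.End k (ι → k)).ofSubalgebras S T ?_⟩
  ext f
  rw [LieSubalgebra.mem_map]
  constructor
  · rintro ⟨x, hx, rfl⟩
    exact (h x).mp hx
  · intro hf
    obtain ⟨x, rfl⟩ := Matrix.toLin'.surjective f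
    exact ⟨x, (h x).mpr hf, rfl⟩

lemma exists_sl_lieEquiv :
    Nonempty (LieAlgebra.SpecialLinear.sl ι k ≃ₗ⁅k⁆ slEnd k (ι → k)) :=
  exists_lieEquiv_of_mem_iff _ _ fun x => by
    change Matrix.trace x = 0 ↔ LinearMap.trace k _ (Matrix.toLin' x) = 0
    rw [Matrix.trace_toLin'_eq]

lemma exists_skewMatrices_lieEquiv (J : Matrix ι ι k) :
    Nonempty (skewAdjointMatricesLieSubalgebra J ≃ₗ⁅k⁆
      skewAdjointLieSubalgebra (Matrix.toBilin' J)) :=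
  exists_lieEquiv_of_mem_iff _ _ fun x => by
    rw [mem_skewAdjointMatricesLieSubalgebra, mem_skewAdjointMatricesSubmodule,
      Matrix.IsSkewAdjoint, ← isAdjointPair_toLinearMap₂', map_neg]
    exact (LinearMap.mem_skewAdjointSubmodule (B := Matrix.toBilin' J) (Matrix.toLin' x)).symm

lemma isEpsSymm_toBilin' {ε : k} {J : Matrix ι ι k} (h : J.transpose = ε • J) :
    IsEpsSymm ε (Matrix.toBilin' J) := by
  intro v w
  have hε : ∀ i j, J j i = ε * J i j := fun i j => congrFun (congrFun h i) j
  rw [Matrix.toBilin'_apply, Matrix.toBilin'_apply, Finset.sum_comm, Finset.mul_sum]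
  refine Finset.sum_congr rfl fun i _ => ?_
  rw [Finset.mul_sum]
  refine Finset.sum_congr rfl fun j _ => ?_
  rw [hε i j]
  ring

end ClassicalMatrix

/-! ### Assembling the classification -/

namespace LieYamaguti

variable {k : Type*} [Field k] {m : Type*} [AddCommGroup m] [Module k m]
variable [IsAlgClosed k] [CharZero k] [FiniteDimensional k m]

/-- The conclusion in the case of `sp(V₁ ⊗ V₂)`. -/
def SymplecticConclusion (L : LieYamaguti k m) : Prop :=
  ∃ (n : ℕ) (hn : 3 ≤ n),
    ∃ (φ₁ : LinearMap.BilinForm k (Fin 2 → k)) (φ₂ : LinearMap.BilinForm k (Fin n → k)),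
      IsEpsSymm (-1) φ₁ ∧ φ₁ ≠ 0 ∧ IsEpsSymm 1 φ₂ ∧ φ₂.Nondegenerate ∧
      IsJordanSym (hermitianK k n (Nat.zero_lt_of_lt hn).ne') φ₂ ∧
      L.IsInsideTits (quaternions k) (hermitianK k n (Nat.zero_lt_of_lt hn).ne') ∧
      Nonempty (L.Envelope ≃ₗ⁅k⁆ LieAlgebra.Symplectic.sp (Fin n) k) ∧ L.IsSpSym φ₁ φ₂

/-- The conclusion in the case of `so(V₁ ⊗ V₂)`. -/
def OrthogonalConclusion (L : LieYamaguti k m) : Prop :=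
  ∃ (n : ℕ) (hn : 3 ≤ n),
    ∃ (φ₁ : LinearMap.BilinForm k (Fin 2 → k)) (φ₂ : LinearMap.BilinForm k (Fin (2 * n) → k)),
      IsEpsSymm (-1) φ₁ ∧ φ₁ ≠ 0 ∧ IsEpsSymm (-1) φ₂ ∧ φ₂.Nondegenerate ∧
      IsJordanSym (hermitianQ k n (Nat.zero_lt_of_lt hn).ne') φ₂ ∧
      L.IsInsideTits (quaternions k) (hermitianQ k n (Nat.zero_lt_of_lt hn).ne') ∧
      Nonempty (L.Envelope ≃ₗ⁅k⁆ LieAlgebra.Orthogonal.so (Fin (4 * n)) k) ∧ L.IsSpSym φ₁ φ₂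

lemma ne_zero_of_nondegenerate_fin_two {φ : LinearMap.BilinForm k (Fin 2 → k)}
    (hn : φ.Nondegenerate) : φ ≠ 0 := by
  rintro rfl
  exact one_ne_zero (congrFun (eq_zero_of_nondegenerate (v := (1 : Fin 2 → k)) hn
    fun w => rfl) 0)

lemma IsSpSym.symplecticConclusion {L : LieYamaguti k m} (hirr : L.IsIrreducible) {n : ℕ}
    {φ₁ : LinearMap.BilinForm k (Fin 2 → k)} {φ₂ : LinearMap.BilinForm k (Fin n → k)}
    (hn : 2 ≤ n) (h₁ : IsEpsSymm (-1) φ₁) (hn₁ : φ₁.Nondegenerate) (h₂ : IsEpsSymm 1 φ₂)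
    (hn₂ : φ₂.Nondegenerate) (h : L.IsSpSym φ₁ φ₂)
    (hE : Nonempty (L.Envelope ≃ₗ⁅k⁆ LieAlgebra.Symplectic.sp (Fin n) k)) :
    L.SymplecticConclusion := by
  have h3 := h.three_le hirr hn h₂ hn₂
  have : Nontrivial (Fin n → k) := Module.nontrivial_of_finrank_pos (R := k) (by
    rw [Module.finrank_fin_fun]; omega)
  obtain ⟨b, hb⟩ : ∃ b : Module.Basis (Fin n) k (Fin n → k),
      ∀ i j, φ₂ (b i) (b j) = if i = j then 1 else 0 := by
    have := exists_orthonormal_basis h₂ hn₂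
    rwa [Module.finrank_fin_fun] at this
  have hτ : ∀ x, ((1 / (n : k)) • Matrix.traceLinearMap (Fin n) k k) x
      = 1 / (Module.finrank k (Fin n → k) : k) * LinearMap.trace k _ (Matrix.toLinAlgEquiv b x) := by
    intro x
    rw [Module.finrank_fin_fun, show LinearMap.trace k _ (Matrix.toLinAlgEquiv b x) = _ from
      Matrix.trace_toLin_eq x b]
    rfl
  exact ⟨n, h3, φ₁, φ₂, h₁, ne_zero_of_nondegenerate_fin_two hn₁, h₂, hn₂,
    isJordanSym_specialJordan _ (mem_symMatrices_iff b hb),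
    h.isInsideTits h₁ hn₁ (mem_symMatrices_iff b hb) hτ, hE, h⟩

/-- A symplectic space has even dimension 2l. For l = 1 the space sym₀(V₂) is zero, which
contradicts m ≠ 0; for l = 2 the algebra is an orthogonal sum in disguise; for l ≥ 3 a symplectic
basis identifies sym(V₂) with H_l(Q). -/
lemma IsSpSym.orthogonalConclusion {L : LieYamaguti k m} (hirr : L.IsIrreducible)
    (hns : L.IsNonSimpleType) (hsimple : LieAlgebra.IsSimple k L.Envelope) {n : ℕ}
    {φ₁ : LinearMap.BilinForm k (Fin 2 → k)} {φ₂ : LinearMap.BilinForm k (Fin n → k)}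
    (hn : 2 ≤ n) (h₁ : IsEpsSymm (-1) φ₁) (hn₁ : φ₁.Nondegenerate) (h₂ : IsEpsSymm (-1) φ₂)
    (hn₂ : φ₂.Nondegenerate) (h : L.IsSpSym φ₁ φ₂)
    (hE : Nonempty (L.Envelope ≃ₗ⁅k⁆ LieAlgebra.Orthogonal.so (Fin (2 * n)) k)) :
    L.OrthogonalConclusion ∨ L.FormsConclusion 1 (by norm_num) 3 ∨
      L.FormsConclusion (-1) (by norm_num) 2 := by
  obtain ⟨l, b, hb⟩ := exists_symplectic_basis h₂ hn₂
  have hl : n = 2 * l := by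
    rw [← Module.finrank_fin_fun k (n := n), Module.finrank_eq_card_basis b]
    simp [mul_comm]
  subst hl
  have : Nontrivial (Fin (2 * l) → k) := Module.nontrivial_of_finrank_pos (R := k) (by
    rw [Module.finrank_fin_fun]; omega)
  have h4 : 2 * (2 * l) = 4 * l := by ring
  rw [h4] at hE
  obtain rfl | rfl | h3 : l = 1 ∨ l = 2 ∨ 3 ≤ l := by omega
  · obtain ⟨e, -⟩ := h
    have h0 : ∀ x : skewAdjointLieSubalgebra φ₁ ⊗[k] symZero φ₂, x = 0 := fun x => by
      induction x with
      | zero => rfl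
      | add u v hu hv => rw [hu, hv, add_zero]
      | tmul a f => rw [symZero_eq_bot h₂ hn₂ f, TensorProduct.tmul_zero]
    obtain ⟨x, hx⟩ := @exists_ne m (nontrivial_of_isIrreducible L hirr) 0
    exact absurd (e.symm.injective ((h0 _).trans (h0 _).symm)) hx
  · exact Or.inr (h.formsConclusion_of_four hirr hns hsimple h₁ hn₁ h₂ hn₂ hb)
  · left
    have hτ : ∀ x, ((1 / (l : k)) • ∑ i, (1 / 2 : k) •
        (Matrix.traceLinearMap (Fin 2) k k ∘ₗ Matrix.entryLinearMap k _ i i)) x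
        = 1 / (Module.finrank k (Fin (2 * l) → k) : k) * LinearMap.trace k _
          (((Matrix.compAlgEquiv (Fin l) (Fin 2) k k).trans (Matrix.toLinAlgEquiv b)) x) := by
      intro x
      rw [Module.finrank_fin_fun, trace_toLinAlgEquiv_comp]
      simp only [LinearMap.smul_apply, LinearMap.sum_apply, LinearMap.comp_apply,
        Matrix.entryLinearMap_apply, Matrix.traceLinearMap_apply, ← Finset.smul_sum, smul_eq_mul]
      push_cast
      ring
    exact ⟨l, h3, φ₁, φ₂, h₁, ne_zero_of_nondegenerate_fin_two hn₁, h₂, hn₂,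
      isJordanSym_specialJordan _ (mem_hermMatricesQ_iff b hb),
      h.isInsideTits h₁ hn₁ (mem_hermMatricesQ_iff b hb) hτ, hE, h⟩

/-- The classification for a classical standard enveloping Lie algebra. -/
theorem conclusion_of_isClassicalLie {L : LieYamaguti k m} (hirr : L.IsIrreducible)
    (hns : L.IsNonSimpleType) (hsimple : LieAlgebra.IsSimple k L.Envelope)
    (hclass : IsClassicalLie k L.Envelope) :
    L.SlConclusion ∨ L.FormsConclusion 1 (by norm_num) 3 ∨ L.FormsConclusion (-1) (by norm_num) 2 ∨
      L.SymplecticConclusion ∨ L.OrthogonalConclusion := by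
  rcases hclass with ⟨n, hn, ⟨Φ⟩⟩ | ⟨n, hn, ⟨Φ⟩⟩ | ⟨n, hn, ⟨Φ⟩⟩
  · obtain ⟨Θ⟩ := exists_sl_lieEquiv (k := k) (ι := Fin n)
    have : Nontrivial (Fin n → k) := Module.nontrivial_of_finrank_pos (R := k) (by
      rw [Module.finrank_fin_fun]; omega)
    have := conclusion_of_sl_irreducible hirr hns hsimple (Φ.trans Θ)
      (irreducible_of_sl hirr (Φ.trans Θ))
    tauto
  · obtain ⟨Θ⟩ := exists_skewMatrices_lieEquiv (1 : Matrix (Fin n) (Fin n) k)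
    have : Nontrivial (Fin n → k) := Module.nontrivial_of_finrank_pos (R := k) (by
      rw [Module.finrank_fin_fun]; omega)
    have hφ : IsEpsSymm 1 (Matrix.toBilin' (1 : Matrix (Fin n) (Fin n) k)) :=
      isEpsSymm_toBilin' (by rw [Matrix.transpose_one, one_smul])
    have hnd : (Matrix.toBilin' (1 : Matrix (Fin n) (Fin n) k)).Nondegenerate :=
      LinearMap.BilinForm.nondegenerate_toBilin'_of_det_ne_zero' _ (by simp)
    -- An irreducible natural module leads to a tensor product with a symplectic plane, a reducible
    -- one to an orthogonal sum.
    by_cases hV : ∀ U : Submodule k (Fin n → k),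
        (∀ d, ∀ u ∈ U, derRep (Φ.trans Θ) d u ∈ U) → U = ⊥ ∨ U = ⊤
    · obtain ⟨l, φ₁, φ₂, hl, hdim, h₁, hn₁, h₂, hn₂, h⟩ :=
        exists_isSpSym hirr hns hsimple (by ring) hφ hnd (Φ.trans Θ) hV
      rw [Module.finrank_fin_fun] at hdim
      subst hdim
      have := h.orthogonalConclusion hirr hns hsimple hl h₁ hn₁ h₂ hn₂ ⟨Φ⟩
      tauto
    · push Not at hV
      obtain ⟨W, hW, hbot, htop⟩ := hV
      have := conclusion_of_reducible hirr hns hsimple (Or.inl rfl) hφ hnd (fun _ => by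
        rwa [Module.finrank_fin_fun]) (Φ.trans Θ) W hW hbot htop
      tauto
  · obtain ⟨Θ⟩ := exists_skewMatrices_lieEquiv (Matrix.J (Fin n) k)
    have hdim' : Module.finrank k (Fin n ⊕ Fin n → k) = 2 * n := by
      rw [Module.finrank_fintype_fun_eq_card]; simp [two_mul]
    have : Nontrivial (Fin n ⊕ Fin n → k) := Module.nontrivial_of_finrank_pos (R := k) (by
      rw [hdim']; omega)
    have hφ : IsEpsSymm (-1) (Matrix.toBilin' (Matrix.J (Fin n) k)) :=
      isEpsSymm_toBilin' (by rw [Matrix.J_transpose, neg_one_smul])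
    have hnd : (Matrix.toBilin' (Matrix.J (Fin n) k)).Nondegenerate :=
      LinearMap.BilinForm.nondegenerate_toBilin'_of_det_ne_zero' _
        (Matrix.isUnit_det_J (Fin n) k).ne_zero
    by_cases hV : ∀ U : Submodule k (Fin n ⊕ Fin n → k),
        (∀ d, ∀ u ∈ U, derRep (Φ.trans Θ) d u ∈ U) → U = ⊥ ∨ U = ⊤
    · obtain ⟨l, φ₁, φ₂, hl, hdim, h₁, hn₁, h₂, hn₂, h⟩ :=
        exists_isSpSym hirr hns hsimple (by ring) hφ hnd (Φ.trans Θ) hV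
      rw [hdim'] at hdim
      obtain rfl : n = l := by omega
      rw [neg_neg] at h₂
      have := h.symplecticConclusion hirr hl h₁ hn₁ h₂ hn₂ ⟨Φ⟩
      tauto
    · push Not at hV
      obtain ⟨W, hW, hbot, htop⟩ := hV
      have := conclusion_of_reducible hirr hns hsimple (Or.inr rfl) hφ hnd
        (fun h => absurd h (by norm_num)) (Φ.trans Θ) W hW hbot htop
      tauto

end LieYamaguti


theorem mainTheorem2 {k : Type*} [Field k] [IsAlgClosed k] [CharZero k]
    {m : Type*} [AddCommGroup m] [Module k m] [FiniteDimensional k m]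
    (L : LieYamaguti k m) (hirr : L.IsIrreducible) (hns : L.IsNonSimpleType)
    (hsimple : LieAlgebra.IsSimple k L.Envelope) (hclass : IsClassicalLie k L.Envelope) :
    -- (i)
    (∃ n₁ n₂ : ℕ, 2 ≤ n₁ ∧ n₁ ≤ n₂ ∧ (n₁, n₂) ≠ (2, 2) ∧
      ∃ (e : (slEnd k (Fin n₁ → k) ⊗[k] slEnd k (Fin n₂ → k)) ≃ₗ[k] m)
        (Φ : L.Envelope ≃ₗ⁅k⁆ slEnd k ((Fin n₁ → k) ⊗[k] (Fin n₂ → k)))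
        (Ψ : L.innerDer ≃ₗ⁅k⁆ slEnd k (Fin n₁ → k) × slEnd k (Fin n₂ → k)),
        L.HasProductsSl e ∧
        (∀ a f, (Φ (L.ofVec (e (a ⊗ₜ f)))).1 = TensorProduct.map a.1 f.1) ∧
        (∀ d, (Φ (L.ofDer d)).1
          = TensorProduct.map (Ψ d).1.1 LinearMap.id
            + TensorProduct.map LinearMap.id (Ψ d).2.1)) ∨
    -- (ii)
    (∃ n₁ n₂ : ℕ, 3 ≤ n₁ ∧ n₁ ≤ n₂ ∧
      ∃ (φ₁ : LinearMap.BilinForm k (Fin n₁ → k)) (φ₂ : LinearMap.BilinForm k (Fin n₂ → k))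
        (h₁ : IsEpsSymm 1 φ₁) (h₂ : IsEpsSymm 1 φ₂),
        φ₁.Nondegenerate ∧ φ₂.Nondegenerate ∧
        L.IsInsideTits (jordanOfForm 1 (by norm_num) φ₁ h₁) (jordanOfForm 1 (by norm_num) φ₂ h₂) ∧
        ∃ (e : ((Fin n₁ → k) ⊗[k] (Fin n₂ → k)) ≃ₗ[k] m)
          (Φ : L.Envelope ≃ₗ⁅k⁆ skewAdjointLieSubalgebra (orthSum φ₁ φ₂))
          (Ψ : L.innerDer ≃ₗ⁅k⁆ skewAdjointLieSubalgebra φ₁ × skewAdjointLieSubalgebra φ₂),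
          L.HasProductsForms 1 φ₁ φ₂ e ∧
          (∀ v w, (Φ (L.ofVec (e (v ⊗ₜ w)))).1 = phiMap 1 (orthSum φ₁ φ₂) (v, 0) (0, w)) ∧
          (∀ d, (Φ (L.ofDer d)).1 = LinearMap.prodMap (Ψ d).1.1 (Ψ d).2.1)) ∨
    -- (iii)
    (∃ n₁ n₂ : ℕ, 2 ≤ n₁ ∧ n₁ ≤ n₂ ∧
      ∃ (φ₁ : LinearMap.BilinForm k (Fin n₁ → k)) (φ₂ : LinearMap.BilinForm k (Fin n₂ → k))
        (h₁ : IsEpsSymm (-1) φ₁) (h₂ : IsEpsSymm (-1) φ₂),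
        φ₁.Nondegenerate ∧ φ₂.Nondegenerate ∧
        L.IsInsideTits (jordanOfForm (-1) (by norm_num) φ₁ h₁)
          (jordanOfForm (-1) (by norm_num) φ₂ h₂) ∧
        ∃ (e : ((Fin n₁ → k) ⊗[k] (Fin n₂ → k)) ≃ₗ[k] m)
          (Φ : L.Envelope ≃ₗ⁅k⁆ skewAdjointLieSubalgebra (orthSum φ₁ φ₂))
          (Ψ : L.innerDer ≃ₗ⁅k⁆ skewAdjointLieSubalgebra φ₁ × skewAdjointLieSubalgebra φ₂),
          L.HasProductsForms (-1) φ₁ φ₂ e ∧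
          (∀ v w, (Φ (L.ofVec (e (v ⊗ₜ w)))).1 = phiMap (-1) (orthSum φ₁ φ₂) (v, 0) (0, w)) ∧
          (∀ d, (Φ (L.ofDer d)).1 = LinearMap.prodMap (Ψ d).1.1 (Ψ d).2.1)) ∨
    -- (iv)
    (∃ (n : ℕ) (hn : 3 ≤ n),
      ∃ (φ₁ : LinearMap.BilinForm k (Fin 2 → k)) (φ₂ : LinearMap.BilinForm k (Fin n → k)),
        IsEpsSymm (-1) φ₁ ∧ φ₁ ≠ 0 ∧ IsEpsSymm 1 φ₂ ∧ φ₂.Nondegenerate ∧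
        IsJordanSym (hermitianK k n (by omega)) φ₂ ∧
        L.IsInsideTits (quaternions k) (hermitianK k n (by omega)) ∧
        Nonempty (L.Envelope ≃ₗ⁅k⁆ LieAlgebra.Symplectic.sp (Fin n) k) ∧
        ∃ (e : (skewAdjointLieSubalgebra φ₁ ⊗[k] symZero φ₂) ≃ₗ[k] m)
          (Φ : L.Envelope ≃ₗ⁅k⁆ skewAdjointLieSubalgebra (φ₁.tmul φ₂))
          (Ψ : L.innerDer ≃ₗ⁅k⁆ skewAdjointLieSubalgebra φ₁ × skewAdjointLieSubalgebra φ₂),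
          L.HasProductsSpSym φ₁ φ₂ e ∧
          (∀ a f, (Φ (L.ofVec (e (a ⊗ₜ f)))).1 = TensorProduct.map a.1 f.1) ∧
          (∀ d, (Φ (L.ofDer d)).1
            = TensorProduct.map (Ψ d).1.1 LinearMap.id
              + TensorProduct.map LinearMap.id (Ψ d).2.1)) ∨
    -- (v)
    (∃ (n : ℕ) (hn : 3 ≤ n),
      ∃ (φ₁ : LinearMap.BilinForm k (Fin 2 → k)) (φ₂ : LinearMap.BilinForm k (Fin (2 * n) → k)),
        IsEpsSymm (-1) φ₁ ∧ φ₁ ≠ 0 ∧ IsEpsSymm (-1) φ₂ ∧ φ₂.Nondegenerate ∧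
        IsJordanSym (hermitianQ k n (by omega)) φ₂ ∧
        L.IsInsideTits (quaternions k) (hermitianQ k n (by omega)) ∧
        Nonempty (L.Envelope ≃ₗ⁅k⁆ LieAlgebra.Orthogonal.so (Fin (4 * n)) k) ∧
        ∃ (e : (skewAdjointLieSubalgebra φ₁ ⊗[k] symZero φ₂) ≃ₗ[k] m)
          (Φ : L.Envelope ≃ₗ⁅k⁆ skewAdjointLieSubalgebra (φ₁.tmul φ₂))
          (Ψ : L.innerDer ≃ₗ⁅k⁆ skewAdjointLieSubalgebra φ₁ × skewAdjointLieSubalgebra φ₂),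
          L.HasProductsSpSym φ₁ φ₂ e ∧
          (∀ a f, (Φ (L.ofVec (e (a ⊗ₜ f)))).1 = TensorProduct.map a.1 f.1) ∧
          (∀ d, (Φ (L.ofDer d)).1
            = TensorProduct.map (Ψ d).1.1 LinearMap.id
              + TensorProduct.map LinearMap.id (Ψ d).2.1)) := by
  exact LieYamaguti.conclusion_of_isClassicalLie hirr hns hsimple hclass
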